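/- Let $V_R$ be a quaternionic right Banach space, i.e. a right vector space over the quaternions $\mathbb H$, complete for a norm with $\|va\|=\|v\||a|$, and let $T$ be a closed right linear operator with domain $\mathcal D(T)\subset V_R$; $T$ is called bounded if $\mathcal D(T)=V_R$. $\mathcal B(V_R)$ denotes the bounded everywhere defined right linear operators. **Setting.** Let $\mathbb S$ be the set of imaginary units, $\mathbb C_{\mathsf i}=\mathbb R+\mathsf i\mathbb R$ for $\mathsf i\in\mathbb S$, and $[x]=\{x_0+\mathsf i|\underline x|:\mathsf i\in\mathbb S\}$, where $x_0$ and $\underline x$ are the real and the imaginary part of $x$; a set $U$ is axially symmetric if $[x]\subset U$ for all $x\in U$. With $\mathcal Q_s(T)=T^2-2s_0T+|s|^2\mathcal I$ on $\mathcal D(T^2)$, let $\rho_S(T)=\{s\in\mathbb H:\mathcal Q_s(T)^{-1}\in\mathcal B(V_R)\}$, $\sigma_S(T)=\mathbb H\setminus\rho_S(T)$, and $\sigma_{SX}(T)=\sigma_S(T)$ if $T$ is bounded, $\sigma_{SX}(T)=\sigma_S(T)\cup\{\infty\}\subset\mathbb H_\infty=\mathbb H\cup\{\infty\}$ otherwise.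 A function $f$ on an open axially symmetric set $\mathcal D(f)$ is intrinsic slice hyperholomorphic if $f(x_0+\mathsf i x_1)=\alpha(x_0,x_1)+\mathsf i\beta(x_0,x_1)$ for all $\mathsf i \in \mathbb S$ with real-valued, differentiable $\alpha$ (even in $x_1$) and $\beta$ (odd in $x_1$) satisfying the Cauchy-Riemann equations. For $K\subset\mathbb H_\infty$, $\mathcal{SH}(K)$ is the set of all such $f$ with $K\cap\mathbb H\subset\mathcal D(f)$ and, if $\infty\in K$, such that $\mathcal D(f)$ contains the complement of a ball and $f(\infty)=\lim_{x\to\infty}f(x)$ exists. For $f\in\mathcal{SH}(\sigma_{SX}(T))$ put $$f(T)v=v f(\infty)+\int_{\partial(U\cap\mathbb C_{\mathsf i})}\big(\mathcal Q_z(T)^{-1}v\,\overline z-T\mathcal Q_z(T)^{-1}v\big)f(z)\,dz\,\frac{-\mathsf i}{2\pi},\qquad v\in V_R,$$ where $\mathsf i\in\mathbb S$ and $U$ is an axially symmetric open set with $\sigma_S(T)\subset U$ and closure contained in $\mathcal D(f)$ such that each $U\cap\mathbb C_{\mathsf i}$ is a Cauchy domain (finitely many components with disjoint closures, bounded by finitely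 many positively oriented, closed, piecewise continuously differentiable Jordan curves; no curves if $U=\emptyset$ or $U=\mathbb H$). If $T$ is unbounded, $U$ is to be unbounded; if $T$ is bounded, $U$ is to be bounded and the term $vf(\infty)$ is omitted. The slice derivative is $\partial_Sf(x)=\lim_{\mathbb C_{\mathsf i_x}\ni s\to x}(s-x)^{-1}(f(s)-f(x))$, where $x\in\mathbb C_{\mathsf i_x}$. An operator $A\in\mathcal B(V_R)$ commutes with $T$ if $AT\subset TA$. **Claim.** For $f\in\mathcal{SH}(\sigma_{SX}(T))$ admissible $\mathsf i,U$ exist, and $f(T)$ is a well-defined operator in $\mathcal B(V_R)$, independent of their choice. Moreover: 1. $1(T)=\mathcal I$, and $(af+g)(T)=af(T)+g(T)$ and $(fg)(T)=f(T)g(T)$ for all $f,g\in\mathcal{SH}(\sigma_{SX}(T))$, $a\in\mathbb R$. 2. For $f\in\mathcal{SH}(\sigma_{SX}(T))$, $f(T)$ commutes with $T$ and with every $A\in\mathcal B(V_R)$ that commutes with $T$. 3. $f(\sigma_{SX}(T))=\sigma_S(f(T))=\sigma_{SX}(f(T))$ for all $f\in\mathcal{SH}(\sigma_{SX}(T))$,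 and $(g\circ f)(T)=g(f(T))$ for all $g\in\mathcal{SH}(f(\sigma_{SX}(T)))$. 4. Let $\Delta\subset\sigma_{SX}(T)$ be open and closed in $\sigma_{SX}(T)$. There is $\chi_\Delta\in\mathcal{SH}(\sigma_{SX}(T))$ equal to $1$ on a neighborhood of $\Delta$ and to $0$ on a neighborhood of $\sigma_{SX}(T)\setminus\Delta$ in $\mathbb H_\infty$. For every such $\chi_\Delta$, $\chi_\Delta(T)$ is a continuous projection that commutes with $T$, its range $V_\Delta$ is a right linear subspace invariant under $T$ (that is, $Tv\in V_\Delta$ for $v\in V_\Delta\cap\mathcal D(T)$), and $T_\Delta:=T|_{V_\Delta}$ with domain $V_\Delta\cap\mathcal D(T)$ satisfies $\sigma_{SX}(T_\Delta)=\Delta$ and $f(T_\Delta)=f(T)|_{V_\Delta}$ for all $f\in\mathcal{SH}(\sigma_{SX}(T))$. 5. Let $T$ be bounded and let $N\in\mathcal B(V_R)$ commute with $T$, with $\sigma_S(N)\subset\overline{B_\varepsilon(0)}$ (closed ball) for some $\varepsilon>0$. Then $\sigma_S(T+N)$ is contained in the closure $C$ of $\{s\in\mathbb H:\operatorname{dist}(s,\sigma_S(T))<\varepsilon\}$,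 and for every $f\in\mathcal{SH}(C)$ $$f(T+N)=\sum_{n=0}^{\infty}N^n\frac1{n!}(\partial_S^nf)(T)=\sum_{n=0}^{\infty}\frac1{n!}(\partial_S^nf)(T)N^n,$$ with (unconditional) convergence in the operator norm. -/

import Mathlib

open Set Filter Topology MeasureTheory
open scoped Quaternion RightActions

noncomputable section

namespace QuatS

/-! ### Quaternions and slices -/

/-- The opposite ring of the quaternions: a right quaternionic vector space is a module over it,
and `v <• a = MulOpposite.op a • v` is the right multiplication `v a`. -/
abbrev HOp : Type := (ℍ[ℝ])ᵐᵒᵖ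

/-- The sphere of imaginary units. -/
def unitSphere : Set ℍ[ℝ] := {i | i.re = 0 ∧ ‖i‖ = 1}

/-- The point `x₀ + i x₁` of the plane `ℂ_i`, with `(x₀, x₁) ∈ ℝ²` written as a complex number.
For an imaginary unit `i` this is the identification of `ℂ` with `ℂ_i`. -/
def slicePt (i : ℍ[ℝ]) (z : ℂ) : ℍ[ℝ] := (z.re : ℍ[ℝ]) + z.im • i

/-- The plane `ℂ_i`. -/
def slicePlane (i : ℍ[ℝ]) : Set ℍ[ℝ] := range (slicePt i)

/-- The sphere `[x] = {x₀ + i x₁ : i an imaginary unit}`, where `x₁ = |x - x₀|`. -/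
def sphereOf (x : ℍ[ℝ]) : Set ℍ[ℝ] :=
  {y | ∃ i ∈ unitSphere, y = slicePt i ⟨x.re, ‖x.im‖⟩}

def AxiallySymmetric (U : Set ℍ[ℝ]) : Prop := ∀ x ∈ U, sphereOf x ⊆ U

/-- An imaginary unit `i_x` with `x ∈ ℂ_{i_x}`; for real `x` an arbitrary one is fixed. -/
def sliceUnit (x : ℍ[ℝ]) : ℍ[ℝ] :=
  open Classical in if x.im = 0 then ⟨0, 1, 0, 0⟩ else ‖x.im‖⁻¹ • x.im

/-! ### Intrinsic slice hyperholomorphic functions -/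

/-- `f` is an intrinsic slice hyperholomorphic function on the open axially symmetric set `D`:
`f (x₀ + i x₁) = α (x₀, x₁) + i β (x₀, x₁)` with real-valued differentiable `α`, `β`, where `α` is
even and `β` is odd in `x₁`, that satisfy the Cauchy-Riemann equations. -/
def IntrinsicSHOn (f : ℍ[ℝ] → ℍ[ℝ]) (D : Set ℍ[ℝ]) : Prop :=
  IsOpen D ∧ AxiallySymmetric D ∧ ∃ α β : ℂ → ℝ,
    ∀ i ∈ unitSphere, ∀ z : ℂ, slicePt i z ∈ D →
      f (slicePt i z) = (α z : ℍ[ℝ]) + β z • i ∧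
      α (starRingEnd ℂ z) = α z ∧ β (starRingEnd ℂ z) = -β z ∧
      DifferentiableAt ℝ α z ∧ DifferentiableAt ℝ β z ∧
      fderiv ℝ α z 1 = fderiv ℝ β z Complex.I ∧
      fderiv ℝ α z Complex.I = -fderiv ℝ β z 1

/-- The class `SH(K)` for a set `K` of extended quaternions: `f` is intrinsic slice
hyperholomorphic on an open axially symmetric set that contains the finite points of `K`, and if
`∞ ∈ K`, then also at infinity: the domain contains the complement of a ball and `f` has a limit
at infinity. (Values of `f` outside its domain are irrelevant.) -/
def MemSH (f : ℍ[ℝ] → ℍ[ℝ]) (K : Set (OnePoint ℍ[ℝ])) : Prop :=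
  ∃ D : Set ℍ[ℝ], IntrinsicSHOn f D ∧ (∀ x : ℍ[ℝ], (x : OnePoint ℍ[ℝ]) ∈ K → x ∈ D) ∧
    (OnePoint.infty ∈ K →
      (∃ r : ℝ, 0 < r ∧ (Metric.ball 0 r)ᶜ ⊆ D) ∧
      ∃ c, Tendsto f (Bornology.cobounded ℍ[ℝ]) (𝓝 c))

/-- The value `f(∞)`. -/
def valInfty (f : ℍ[ℝ] → ℍ[ℝ]) : ℍ[ℝ] := limUnder (Bornology.cobounded ℍ[ℝ]) f

/-- `f` as a function of extended quaternions. -/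
def extendInfty (f : ℍ[ℝ] → ℍ[ℝ]) (p : OnePoint ℍ[ℝ]) : ℍ[ℝ] := p.elim (valInfty f) f

/-- The slice derivative: the limit of `(s - x)⁻¹ (f s - f x)` for `s → x` in `ℂ_{i_x}`. -/
def sliceDeriv (f : ℍ[ℝ] → ℍ[ℝ]) (x : ℍ[ℝ]) : ℍ[ℝ] :=
  limUnder (𝓝[slicePlane (sliceUnit x) \ {x}] x) (fun s => (s - x)⁻¹ * (f s - f x))

/-! ### Slice Cauchy domains -/

/-- A closed piecewise continuously differentiable Jordan curve, parametrized on `[0, 1]`. -/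
def IsPiecewiseC1Jordan (γ : ℝ → ℂ) : Prop :=
  (∃ (m : ℕ) (t : ℕ → ℝ), Monotone t ∧ t 0 = 0 ∧ t m = 1 ∧
    ∀ k < m, ContDiffOn ℝ 1 γ (Icc (t k) (t (k + 1)))) ∧
  γ 0 = γ 1 ∧ InjOn γ (Ico 0 1)

/-- The total winding number around `z` of finitely many closed curves. -/
def windingNumber {n : ℕ} (γ : Fin n → ℝ → ℂ) (z : ℂ) : ℂ :=
  (2 * Real.pi * Complex.I)⁻¹ * ∑ k, ∫ t in (0 : ℝ)..1, deriv (γ k) t / (γ k t - z)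

/-- The boundary of `W ⊆ ℂ` consists of the closed piecewise continuously differentiable Jordan
curves `γ k`, and these are positively oriented with respect to `W` (`W` lies to their left): if
`W` is bounded, they wind once around the points of `W` and not at all around the exterior points;
if `W` is unbounded, they do not wind around the points of `W` and wind `-1` times around the
exterior points. -/
def IsOrientedBoundary (W : Set ℂ) {n : ℕ} (γ : Fin n → ℝ → ℂ) : Prop :=
  (∀ k, IsPiecewiseC1Jordan (γ k)) ∧
  frontier W = ⋃ k, γ k '' Icc 0 1 ∧
  (Bornology.IsBounded W →
    (∀ z ∈ W, windingNumber γ z = 1) ∧ ∀ z ∉ closure W, windingNumber γ z = 0) ∧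
  (¬ Bornology.IsBounded W →
    (∀ z ∈ W, windingNumber γ z = 0) ∧ ∀ z ∉ closure W, windingNumber γ z = -1)

/-- The components of a set. -/
def components (W : Set ℂ) : Set (Set ℂ) := {C | ∃ z ∈ W, C = connectedComponentIn W z}

/-- Cauchy domains in the plane. Zero boundary curves are allowed, which only adds the
sets `∅` and `ℂ`. -/
def IsCauchyDomain (W : Set ℂ) : Prop :=
  IsOpen W ∧ (components W).Finite ∧
  (components W).Pairwise (fun A B => Disjoint (closure A) (closure B)) ∧
  ∃ (n : ℕ) (γ : Fin n → ℝ → ℂ), IsOrientedBoundary W γ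

def IsSliceCauchyDomain (U : Set ℍ[ℝ]) : Prop :=
  IsOpen U ∧ AxiallySymmetric U ∧ ∀ i ∈ unitSphere, IsCauchyDomain (slicePt i ⁻¹' U)

/-! ### Operators on a quaternionic right Banach space -/

section Helpers

variable {V : Type*} [NormedAddCommGroup V] [Module HOp V]

/-- `T v` for `v` in the domain of `T` (and `0` otherwise). -/
def app (T : V →ₗ.[HOp] V) (v : V) : V :=
  open Classical in if h : v ∈ T.domain then T ⟨v, h⟩ else 0

theorem app_of_mem (T : V →ₗ.[HOp] V) {v : V} (h : v ∈ T.domain) : app T v = T ⟨v, h⟩ := by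
  simp [app, h]

theorem app_add (T : V →ₗ.[HOp] V) {v w : V} (hv : v ∈ T.domain) (hw : w ∈ T.domain) :
    app T (v + w) = app T v + app T w := by
  rw [app_of_mem T hv, app_of_mem T hw, app_of_mem T (T.domain.add_mem hv hw), ← T.map_add]; rfl

theorem app_smul (T : V →ₗ.[HOp] V) (c : HOp) {v : V} (hv : v ∈ T.domain) :
    app T (c • v) = c • app T v := by
  rw [app_of_mem T hv, app_of_mem T (T.domain.smul_mem c hv), ← T.map_smul]; rfl

theorem app_zero (T : V →ₗ.[HOp] V) : app T 0 = 0 := by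
  rw [app_of_mem T T.domain.zero_mem]; exact T.map_zero

end Helpers

variable {V : Type*} [NormedAddCommGroup V] [NormedSpace ℝ V] [Module HOp V]
  [IsScalarTower ℝ HOp V]

/-- An everywhere defined bounded operator as a partially defined operator. -/
def ofBdd (A : V →L[HOp] V) : V →ₗ.[HOp] V := (A : V →ₗ[HOp] V).toPMap ⊤

/-- `v ∈ D(T²)`. -/
def InDomSq (T : V →ₗ.[HOp] V) (v : V) : Prop := v ∈ T.domain ∧ app T v ∈ T.domain

/-- `Q_s(T) v = T² v - 2 s₀ T v + |s|² v` for `v ∈ D(T²)`. -/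
def qOp (T : V →ₗ.[HOp] V) (s : ℍ[ℝ]) (v : V) : V :=
  app T (app T v) - (2 * s.re) • app T v + (‖s‖ ^ 2) • v

/-- The bounded operator `B` is the inverse of `Q_s(T) : D(T²) → V`. -/
def IsPseudoResolvent (T : V →ₗ.[HOp] V) (s : ℍ[ℝ]) (B : V →L[HOp] V) : Prop :=
  (∀ v, InDomSq T (B v) ∧ qOp T s (B v) = v) ∧ ∀ v, InDomSq T v → B (qOp T s v) = v

/-- The `S`-resolvent set. -/
def sResolventSet (T : V →ₗ.[HOp] V) : Set ℍ[ℝ] := {s | ∃ B, IsPseudoResolvent T s B}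

/-- The `S`-spectrum. -/
def sSpectrum (T : V →ₗ.[HOp] V) : Set ℍ[ℝ] := (sResolventSet T)ᶜ

/-- The extended `S`-spectrum: `∞` is added if `T` is not bounded. A closed operator is a bounded
operator on the Banach space `V` if and only if it is everywhere defined. -/
def sSpectrumX (T : V →ₗ.[HOp] V) : Set (OnePoint ℍ[ℝ]) :=
  (fun x : ℍ[ℝ] => (x : OnePoint ℍ[ℝ])) '' sSpectrum T ∪
    {p | p = OnePoint.infty ∧ T.domain ≠ ⊤}

/-- `Q_s(T)⁻¹` for `s` in the `S`-resolvent set (and `0` otherwise). -/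
def pseudoResolvent (T : V →ₗ.[HOp] V) (s : ℍ[ℝ]) : V →L[HOp] V :=
  open Classical in if h : ∃ B, IsPseudoResolvent T s B then h.choose else 0

/-- `R_s(T; v) = Q_s(T)⁻¹ v s̄ - T Q_s(T)⁻¹ v`. -/
def sliceResolvent (T : V →ₗ.[HOp] V) (s : ℍ[ℝ]) (v : V) : V :=
  pseudoResolvent T s v <• star s - app T (pseudoResolvent T s v)

/-- `∫_γ R_z(T; v) f(z) dz (-i / 2π)` over finitely many curves in `ℂ_i`. -/
def cauchyIntegral (T : V →ₗ.[HOp] V) (f : ℍ[ℝ] → ℍ[ℝ]) (i : ℍ[ℝ]) {n : ℕ}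
    (γ : Fin n → ℝ → ℂ) (v : V) : V :=
  (∑ k, ∫ t in (0 : ℝ)..1,
    sliceResolvent T (slicePt i (γ k t)) v <•
      (f (slicePt i (γ k t)) * slicePt i (deriv (γ k) t))) <• ((2 * Real.pi)⁻¹ • (-i))

/-- The data over which the integral defining `f(T)` may be taken: an imaginary unit `i`, a slice
Cauchy domain `U`, bounded if `T` is bounded and unbounded otherwise, with `σ_S(T) ⊆ U` and with
`closure U` contained in the domain of `f`, and the positively oriented boundary `γ` of `U ∩ ℂ_i`. -/
def Admissible (T : V →ₗ.[HOp] V) (f : ℍ[ℝ] → ℍ[ℝ]) (i : ℍ[ℝ]) (U : Set ℍ[ℝ]) {n : ℕ}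
    (γ : Fin n → ℝ → ℂ) : Prop :=
  i ∈ unitSphere ∧ IsSliceCauchyDomain U ∧ (Bornology.IsBounded U ↔ T.domain = ⊤) ∧
  sSpectrum T ⊆ U ∧ (∃ D, IntrinsicSHOn f D ∧ closure U ⊆ D) ∧
  IsOrientedBoundary (slicePt i ⁻¹' U) γ

/-- The bounded operator `A` is `f(T)`: admissible data exist, and for all of them `A` is given by
`A v = v f(∞) + ∫_{∂(U ∩ ℂ_i)} R_z(T; v) f(z) dz (-i / 2π)`, where the term `v f(∞)` is absent if
`T` is bounded. -/
def IsSCalc (T : V →ₗ.[HOp] V) (f : ℍ[ℝ] → ℍ[ℝ]) (A : V →L[HOp] V) : Prop :=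
  (∃ (i : ℍ[ℝ]) (U : Set ℍ[ℝ]) (n : ℕ) (γ : Fin n → ℝ → ℂ), Admissible T f i U γ) ∧
  ∀ (i : ℍ[ℝ]) (U : Set ℍ[ℝ]) (n : ℕ) (γ : Fin n → ℝ → ℂ), Admissible T f i U γ →
    (T.domain = ⊤ → ∀ v, A v = cauchyIntegral T f i γ v) ∧
    (T.domain ≠ ⊤ → ∀ v, A v = v <• valInfty f + cauchyIntegral T f i γ v)

/-- The operator `f(T)` of the intrinsic `S`-functional calculus. -/
def sCalc (T : V →ₗ.[HOp] V) (f : ℍ[ℝ] → ℍ[ℝ]) : V →L[HOp] V :=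
  open Classical in if h : ∃ A, IsSCalc T f A then h.choose else 0

/-- The bounded operator `A` commutes with `T`, that is, `A T ⊆ T A`. -/
def CommutesWith (A : V →L[HOp] V) (T : V →ₗ.[HOp] V) : Prop :=
  ∀ v ∈ T.domain, A v ∈ T.domain ∧ app T (A v) = A (app T v)

/-- The operator induced by `T` on the right linear subspace `W`, with domain
`{w ∈ W ∩ D(T) : T w ∈ W}`. If `W` is invariant under `T`, this is the restriction `T|_W`
with domain `W ∩ D(T)`. -/
def restrictTo (T : V →ₗ.[HOp] V) (W : Submodule HOp V) : W →ₗ.[HOp] W where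
  domain :=
    { carrier := {w | (w : V) ∈ T.domain ∧ app T w ∈ W}
      add_mem' := by
        rintro a b ⟨ha, ha'⟩ ⟨hb, hb'⟩
        refine ⟨T.domain.add_mem ha hb, ?_⟩
        rw [Submodule.coe_add, app_add T ha hb]
        exact W.add_mem ha' hb'
      zero_mem' := by
        refine ⟨T.domain.zero_mem, ?_⟩
        rw [Submodule.coe_zero, app_zero]
        exact W.zero_mem
      smul_mem' := by
        rintro c a ⟨ha, ha'⟩
        refine ⟨T.domain.smul_mem c ha, ?_⟩
        rw [Submodule.coe_smul, app_smul T c ha]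
        exact W.smul_mem c ha' }
  toFun :=
    { toFun := fun w => ⟨app T (w : W), w.2.2⟩
      map_add' := fun a b => Subtype.ext (app_add T a.2.1 b.2.1)
      map_smul' := fun c a => Subtype.ext (app_smul T c a.2.1) }

end QuatS

end

open QuatS

namespace RieszDunford

/-- A parametrized path of integration in the plane: the points `p s`, and a density `d s` that plays
the role of the derivative of `p`. -/
structure Path where
  S : Type
  [mS : MeasurableSpace S]
  μ : Measure S
  [sf : SFinite μ]
  p : S → ℂ
  d : S → ℂ
  supp : Set ℂ
  compact : IsCompact supp
  meas : Measurable p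
  mem : ∀ s, p s ∈ supp
  int : Integrable d μ

attribute [instance] Path.mS Path.sf

namespace Path

variable {E F : Type*} [NormedAddCommGroup E] [NormedSpace ℂ E]
  [NormedAddCommGroup F] [NormedSpace ℂ F]

/-- The path integral. -/
noncomputable def integ (Γ : Path) (f : ℂ → E) : E := ∫ s, Γ.d s • f (Γ.p s) ∂Γ.μ

/-- The winding number around `z`. -/
noncomputable def ind (Γ : Path) (z : ℂ) : ℂ :=
  (2 * Real.pi * Complex.I)⁻¹ * Γ.integ (fun w => (w - z)⁻¹)

omit [NormedSpace ℂ E] in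
theorem stronglyMeasurable_comp (Γ : Path) {f : ℂ → E} (hf : ContinuousOn f Γ.supp) :
    StronglyMeasurable (fun s => f (Γ.p s)) := by
  have h1 : StronglyMeasurable (Γ.supp.domRestrict f) :=
    (continuousOn_iff_continuous_domRestrict.1 hf).stronglyMeasurable
  exact h1.comp_measurable (f := Γ.supp.domRestrict f) (g := fun s => (⟨Γ.p s, Γ.mem s⟩ : Γ.supp))
    (Γ.meas.subtype_mk)

theorem integrable (Γ : Path) {f : ℂ → E} (hf : ContinuousOn f Γ.supp) :
    Integrable (fun s => Γ.d s • f (Γ.p s)) Γ.μ := by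
  obtain ⟨C, hC⟩ := Γ.compact.exists_bound_of_continuousOn hf
  refine Γ.int.smul_bdd C (Γ.stronglyMeasurable_comp hf).aestronglyMeasurable ?_
  exact Eventually.of_forall fun s => hC _ (Γ.mem s)

theorem integ_congr (Γ : Path) {f g : ℂ → E} (h : EqOn f g Γ.supp) : Γ.integ f = Γ.integ g := by
  unfold integ
  congr 1
  funext s
  rw [h (Γ.mem s)]

theorem integ_add (Γ : Path) {f g : ℂ → E} (hf : ContinuousOn f Γ.supp)
    (hg : ContinuousOn g Γ.supp) :
    Γ.integ (fun z => f z + g z) = Γ.integ f + Γ.integ g := by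
  unfold integ
  rw [← integral_add (Γ.integrable hf) (Γ.integrable hg)]
  simp only [smul_add]

theorem integ_sub (Γ : Path) {f g : ℂ → E} (hf : ContinuousOn f Γ.supp)
    (hg : ContinuousOn g Γ.supp) :
    Γ.integ (fun z => f z - g z) = Γ.integ f - Γ.integ g := by
  unfold integ
  rw [← integral_sub (Γ.integrable hf) (Γ.integrable hg)]
  simp only [smul_sub]

theorem integ_smul (Γ : Path) (c : ℂ) (f : ℂ → E) :
    Γ.integ (fun z => c • f z) = c • Γ.integ f := by
  unfold integ
  rw [← integral_smul]
  simp only [smul_comm c]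

theorem integ_zero (Γ : Path) : Γ.integ (fun _ => (0 : E)) = 0 := by
  simp [integ]

theorem integ_finset_sum (Γ : Path) {ι : Type*} (s : Finset ι) {f : ι → ℂ → E}
    (hf : ∀ i ∈ s, ContinuousOn (f i) Γ.supp) :
    Γ.integ (fun z => ∑ i ∈ s, f i z) = ∑ i ∈ s, Γ.integ (f i) := by
  unfold integ
  rw [← integral_finsetSum _ fun i hi => Γ.integrable (hf i hi)]
  simp only [Finset.smul_sum]

theorem integ_clm [CompleteSpace E] [CompleteSpace F] (Γ : Path) (L : E →L[ℂ] F) {f : ℂ → E}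
    (hf : ContinuousOn f Γ.supp) : Γ.integ (fun z => L (f z)) = L (Γ.integ f) := by
  unfold integ
  rw [← L.integral_comp_comm (Γ.integrable hf)]
  simp only [map_smul]

theorem integ_smul_const [CompleteSpace E] (Γ : Path) {f : ℂ → ℂ} (hf : ContinuousOn f Γ.supp)
    (x : E) :
    Γ.integ (fun z => f z • x) = Γ.integ f • x :=
  Γ.integ_clm ((ContinuousLinearMap.id ℂ ℂ).smulRight x) hf

theorem norm_integ_le (Γ : Path) {f : ℂ → E} {C : ℝ} (hC : ∀ z ∈ Γ.supp, ‖f z‖ ≤ C) :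
    ‖Γ.integ f‖ ≤ (∫ s, ‖Γ.d s‖ ∂Γ.μ) * C := by
  unfold integ
  rw [← integral_mul_const]
  refine norm_integral_le_of_norm_le (Γ.int.norm.mul_const C) (Eventually.of_forall fun s => ?_)
  rw [norm_smul]
  exact mul_le_mul_of_nonneg_left (hC _ (Γ.mem s)) (norm_nonneg _)

theorem integ_comm (Γ Δ : Path) {f : ℂ → ℂ → E}
    (hf : ContinuousOn (Function.uncurry f) (Γ.supp ×ˢ Δ.supp)) :
    Γ.integ (fun z => Δ.integ (f z)) = Δ.integ (fun w => Γ.integ (fun z => f z w)) := by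
  unfold integ
  have hm : StronglyMeasurable (fun q : Γ.S × Δ.S => f (Γ.p q.1) (Δ.p q.2)) := by
    have h1 : StronglyMeasurable ((Γ.supp ×ˢ Δ.supp).domRestrict (Function.uncurry f)) :=
      (continuousOn_iff_continuous_domRestrict.1 hf).stronglyMeasurable
    exact h1.comp_measurable
      (g := fun q : Γ.S × Δ.S => (⟨(Γ.p q.1, Δ.p q.2), ⟨Γ.mem q.1, Δ.mem q.2⟩⟩ : ↥(Γ.supp ×ˢ Δ.supp)))
      (Measurable.subtype_mk ((Γ.meas.comp measurable_fst).prodMk (Δ.meas.comp measurable_snd)))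
  obtain ⟨C, hC⟩ := (Γ.compact.prod Δ.compact).exists_bound_of_continuousOn hf
  have hi : Integrable (Function.uncurry
      fun s t => (Γ.d s * Δ.d t) • f (Γ.p s) (Δ.p t)) (Γ.μ.prod Δ.μ) := by
    refine (Γ.int.mul_prod Δ.int).smul_bdd C hm.aestronglyMeasurable ?_
    exact Eventually.of_forall fun q => hC (Γ.p q.1, Δ.p q.2) ⟨Γ.mem q.1, Δ.mem q.2⟩
  have := integral_integral_swap hi
  simp only [mul_smul] at this
  simp only [integral_smul] at this
  rw [this]
  congr 1
  funext t
  rw [← integral_smul]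
  simp only [smul_comm (Δ.d t)]

end Path

/-- A path whose winding number is locally constant off the path and vanishes near infinity. -/
structure Cycle extends Path where
  ind_loc : ∀ z ∉ supp, ∀ᶠ z' in 𝓝 z, toPath.ind z' = toPath.ind z
  ind_far : ∀ᶠ z in Bornology.cobounded ℂ, toPath.ind z = 0

end RieszDunford

namespace Grid

/-- The four unit steps of the square lattice, counterclockwise. -/
def step : Fin 4 → ℤ × ℤ := ![(1, 0), (0, 1), (-1, 0), (0, -1)]

/-- The unit square in the `d`-th quadrant at the lattice point `p`; squares are named by
their lower left corners. -/
def quad (p : ℤ × ℤ) (d : Fin 4) : ℤ × ℤ := p + ![(0, 0), (-1, 0), (-1, -1), (0, -1)] d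

/-- Directed lattice edges with left square in `S` and right square outside `S`. -/
def boundary (S : Set (ℤ × ℤ)) : Set ((ℤ × ℤ) × Fin 4) :=
  {e | quad e.1 e.2 ∈ S ∧ quad e.1 (e.2 + 3) ∉ S}

def head (e : (ℤ × ℤ) × Fin 4) : ℤ × ℤ := e.1 + step e.2

/-- No two squares of `S` touch only diagonally at a lattice point, and no two squares of the
complement do. -/
def NoDiagonal (S : Set (ℤ × ℤ)) : Prop :=
  ∀ p d, ¬ (quad p d ∈ S ∧ quad p (d + 1) ∉ S ∧ quad p (d + 2) ∈ S ∧ quad p (d + 3) ∉ S)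

variable {S : Set (ℤ × ℤ)}

theorem NoDiagonal.compl (h : NoDiagonal S) : NoDiagonal Sᶜ := by
  intro p d hd
  refine h p (d + 1) ⟨?_, ?_, ?_, ?_⟩
  · simpa using hd.2.1
  · have := hd.2.2.1
    rwa [mem_compl_iff, show d + 2 = d + 1 + 1 by fin_cases d <;> rfl] at this
  · have := hd.2.2.2
    rw [mem_compl_iff, not_not] at this
    rwa [show d + 1 + 2 = d + 3 by fin_cases d <;> rfl]
  · have := hd.1
    rwa [mem_compl_iff, show d = d + 1 + 3 by fin_cases d <;> rfl] at this

theorem out_unique (h : NoDiagonal S) {p : ℤ × ℤ} {d d' : Fin 4} (h1 : (p, d) ∈ boundary S)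
    (h2 : (p, d') ∈ boundary S) : d = d' := by
  have a := h p 0
  have b := h p 1
  simp only [boundary, mem_ofPred_eq] at h1 h2
  fin_cases d <;> fin_cases d' <;> simp at h1 h2 a b ⊢ <;> tauto

theorem exists_boundary_of_mem_of_notMem {p : ℤ × ℤ} {d d' : Fin 4} (h1 : quad p d ∈ S)
    (h2 : quad p d' ∉ S) : ∃ d'', (p, d'') ∈ boundary S := by
  by_contra! hc
  have a := hc 0
  have b := hc 1
  have c := hc 2
  have e := hc 3
  simp only [boundary, mem_ofPred_eq] at a b c e
  fin_cases d <;> fin_cases d' <;> simp at h1 h2 a b c e <;> tauto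

theorem quad_head (e : (ℤ × ℤ) × Fin 4) :
    quad (head e) (e.2 + 1) = quad e.1 e.2 ∧ quad (head e) (e.2 + 2) = quad e.1 (e.2 + 3) := by
  obtain ⟨⟨a, b⟩, d⟩ := e
  fin_cases d <;> simp [quad, head, step]

theorem in_unique (h : NoDiagonal S) {e e' : (ℤ × ℤ) × Fin 4} (h1 : e ∈ boundary S)
    (h2 : e' ∈ boundary S) (hh : head e = head e') : e = e' := by
  have q := quad_head e
  have q' := quad_head e'
  simp only [boundary, mem_ofPred_eq] at h1 h2
  rw [← q.1, ← q.2] at h1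
  rw [← q'.1, ← q'.2, ← hh] at h2
  have a := h (head e) 0
  have b := h (head e) 1
  have hd : e.2 = e'.2 := by
    generalize head e = p at *
    generalize e.2 = d at *
    generalize e'.2 = d' at *
    clear q q'
    fin_cases d <;> fin_cases d' <;> simp at h1 h2 a b ⊢ <;> tauto
  refine Prod.ext ?_ hd
  simpa [head, hd] using hh

theorem exists_next {e : (ℤ × ℤ) × Fin 4} (h1 : e ∈ boundary S) :
    ∃ d, (head e, d) ∈ boundary S := by
  have q := quad_head e
  simp only [boundary, mem_ofPred_eq] at h1
  rw [← q.1, ← q.2] at h1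
  exact exists_boundary_of_mem_of_notMem h1.1 h1.2

/-- The boundary edge that follows a given boundary edge. -/
noncomputable def next (e : boundary S) : boundary S :=
  ⟨(head e.1, (exists_next e.2).choose), (exists_next e.2).choose_spec⟩

theorem next_injective (h : NoDiagonal S) : Function.Injective (next (S := S)) := by
  intro e e' hh
  have : head e.1 = head e'.1 := congrArg (fun x : boundary S => x.1.1) hh
  exact Subtype.ext (in_unique h e.2 e'.2 this)

/-- The square across the `d`-th edge of the square `c`. -/
theorem quad_fst_injective (d : Fin 4) : Function.Injective (fun p => quad p d) := by
  intro p p' h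
  simpa [quad] using h

/-- The reversed edge. -/
def rev (e : (ℤ × ℤ) × Fin 4) : (ℤ × ℤ) × Fin 4 := (head e, e.2 + 2)

theorem rev_rev (e : (ℤ × ℤ) × Fin 4) : rev (rev e) = e := by
  obtain ⟨⟨a, b⟩, d⟩ := e
  fin_cases d <;> simp [rev, head, step]

theorem quad_rev (e : (ℤ × ℤ) × Fin 4) :
    quad (rev e).1 (rev e).2 = quad e.1 (e.2 + 3) ∧
    quad (rev e).1 ((rev e).2 + 3) = quad e.1 e.2 := by
  obtain ⟨⟨a, b⟩, d⟩ := e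
  fin_cases d <;> simp [rev, head, step, quad]

theorem rev_mem_boundary_compl {e : (ℤ × ℤ) × Fin 4} :
    rev e ∈ boundary Sᶜ ↔ e ∈ boundary S := by
  simp only [boundary, mem_ofPred_eq, (quad_rev e).1, (quad_rev e).2, mem_compl_iff, not_not]
  tauto

theorem boundary_compl : boundary Sᶜ = rev '' boundary S := by
  ext e
  constructor
  · intro h
    refine ⟨rev e, ?_, rev_rev e⟩
    rwa [← rev_mem_boundary_compl, rev_rev]
  · rintro ⟨e', h, rfl⟩
    exact rev_mem_boundary_compl.2 h

theorem boundary_finite_of_finite (hS : S.Finite) : (boundary S).Finite := by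
  refine ((hS.prod (finite_univ (α := Fin 4))).preimage (f := fun e => (quad e.1 e.2, e.2))
    ?_).subset ?_
  · rintro ⟨p, d⟩ _ ⟨p', d'⟩ _ h
    simp only [Prod.mk.injEq] at h
    obtain ⟨h1, rfl⟩ := h
    rw [quad_fst_injective d h1]
  · intro e he
    exact ⟨he.1, mem_univ _⟩

theorem boundary_finite (hS : S.Finite ∨ Sᶜ.Finite) : (boundary S).Finite := by
  rcases hS with h | h
  · exact boundary_finite_of_finite h
  · rw [← compl_compl S, boundary_compl]
    exact (boundary_finite_of_finite h).image _

/-! ### Geometry -/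

/-- The lattice point `p` in the plane, for mesh size `h`. -/
noncomputable def vtx (h : ℝ) (p : ℤ × ℤ) : ℂ := ⟨h * p.1, h * (p.2 - 1 / 2)⟩

/-- The edge as a complex number. -/
noncomputable def vec (h : ℝ) (d : Fin 4) : ℂ := ⟨h * (step d).1, h * (step d).2⟩

/-- The points of an edge. -/
noncomputable def pt (h : ℝ) (e : (ℤ × ℤ) × Fin 4) (t : ℝ) : ℂ := vtx h e.1 + t * vec h e.2

theorem pt_zero (h : ℝ) (e : (ℤ × ℤ) × Fin 4) : pt h e 0 = vtx h e.1 := by simp [pt]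

theorem pt_one (h : ℝ) (e : (ℤ × ℤ) × Fin 4) : pt h e 1 = vtx h (head e) := by
  apply Complex.ext <;> simp [pt, vtx, vec, head] <;> ring

theorem pt_rev (h : ℝ) (e : (ℤ × ℤ) × Fin 4) (t : ℝ) : pt h (rev e) t = pt h e (1 - t) := by
  obtain ⟨⟨a, b⟩, d⟩ := e
  apply Complex.ext <;> fin_cases d <;> simp [pt, vtx, vec, head, rev, step] <;> ring

theorem vec_rev (h : ℝ) (e : (ℤ × ℤ) × Fin 4) : vec h (rev e).2 = - vec h e.2 := by
  obtain ⟨⟨a, b⟩, d⟩ := e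
  apply Complex.ext <;> fin_cases d <;> simp [vec, rev, step]

theorem int_add_eq {a b : ℤ} {s t : ℝ} (hs : 0 ≤ s) (hs' : s < 1) (ht : 0 ≤ t) (ht' : t < 1)
    (h : (a : ℝ) + s = b + t) : a = b ∧ s = t := by
  have h1 : a < b + 1 := by exact_mod_cast (by linarith : (a : ℝ) < b + 1)
  have h2 : b < a + 1 := by exact_mod_cast (by linarith : (b : ℝ) < a + 1)
  have h3 : a = b := by omega
  subst h3
  exact ⟨rfl, by linarith⟩

theorem int_sub_eq {a b : ℤ} {s t : ℝ} (hs : 0 ≤ s) (hs' : s < 1) (ht : 0 ≤ t) (ht' : t < 1)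
    (h : (a : ℝ) + -s = b + -t) : a = b ∧ s = t := by
  obtain ⟨h1, h2⟩ := int_add_eq (a := a) (b := b) ht ht' hs hs' (by linarith)
  exact ⟨h1, h2.symm⟩

theorem int_add_eq_int {a b : ℤ} {s : ℝ} (hs : 0 ≤ s) (hs' : s < 1)
    (h : (a : ℝ) + s = b) : a = b ∧ s = 0 :=
  int_add_eq hs hs' le_rfl one_pos (by linarith)

theorem int_sub_eq_int {a b : ℤ} {s : ℝ} (hs : 0 ≤ s) (hs' : s < 1)
    (h : (a : ℝ) + -s = b) : a = b ∧ s = 0 :=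
  int_sub_eq hs hs' le_rfl one_pos (by linarith)

theorem int_add_eq_sub {a b : ℤ} {s t : ℝ} (hs : 0 ≤ s) (hs' : s < 1) (ht : 0 ≤ t) (ht' : t < 1)
    (h : (a : ℝ) + s = b + -t) : (a = b ∧ s = 0 ∧ t = 0) ∨ b = a + 1 := by
  have h1 : b < a + 2 := by exact_mod_cast (by linarith : (b : ℝ) < a + 2)
  have h2 : a ≤ b := by exact_mod_cast (by linarith : (a : ℝ) ≤ b)
  rcases (by omega : a = b ∨ b = a + 1) with rfl | h3
  · exact Or.inl ⟨rfl, by linarith, by linarith⟩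
  · exact Or.inr h3

theorem pt_eq_iff {h : ℝ} (hh : 0 < h) (e e' : (ℤ × ℤ) × Fin 4) (t t' : ℝ) :
    pt h e t = pt h e' t' ↔
      (e.1.1 : ℝ) + t * (step e.2).1 = e'.1.1 + t' * (step e'.2).1 ∧
      (e.1.2 : ℝ) + t * (step e.2).2 = e'.1.2 + t' * (step e'.2).2 := by
  rw [Complex.ext_iff]
  simp only [pt, vtx, vec, Complex.add_re, Complex.mul_re, Complex.ofReal_re, Complex.ofReal_im,
    Complex.add_im, Complex.mul_im, zero_mul, sub_zero, add_zero]
  constructor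
  · rintro ⟨h1, h2⟩
    constructor
    · refine mul_left_cancel₀ hh.ne' ?_; linarith
    · refine mul_left_cancel₀ hh.ne' ?_; linarith
  · rintro ⟨h1, h2⟩
    constructor
    · linear_combination h * h1
    · linear_combination h * h2

/-- Half-open boundary edges are disjoint. -/
theorem pt_injective {h : ℝ} (hh : 0 < h) (hS : NoDiagonal S) {e e' : (ℤ × ℤ) × Fin 4}
    (he : e ∈ boundary S) (he' : e' ∈ boundary S) {t t' : ℝ} (ht : 0 ≤ t) (ht1 : t < 1)
    (ht' : 0 ≤ t') (ht1' : t' < 1) (heq : pt h e t = pt h e' t') : e = e' ∧ t = t' := by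
  rw [pt_eq_iff hh] at heq
  have key : (e.1 = e'.1 ∧ (e.2 = e'.2 → t = t') ∧ (e.2 ≠ e'.2 → t = t')) ∨ e' = rev e := by
    obtain ⟨⟨a, b⟩, d⟩ := e
    obtain ⟨⟨a', b'⟩, d'⟩ := e'
    clear he he'
    fin_cases d <;> fin_cases d' <;> simp [step, rev, head] at heq ⊢ <;>
      obtain ⟨h1, h2⟩ := heq
    · obtain ⟨h3, h4⟩ := int_add_eq ht ht1 ht' ht1' h1
      simp [*]
    · obtain ⟨h3, h4⟩ := int_add_eq_int ht ht1 h1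
      obtain ⟨h5, h6⟩ := int_add_eq_int ht' ht1' h2.symm
      simp [*]
    · rcases int_add_eq_sub ht ht1 ht' ht1' h1 with ⟨h3, h4, h5⟩ | h3 <;> simp [*]
    · obtain ⟨h3, h4⟩ := int_add_eq_int ht ht1 h1
      obtain ⟨h5, h6⟩ := int_sub_eq_int ht' ht1' h2.symm
      simp [*]
    · obtain ⟨h3, h4⟩ := int_add_eq_int ht ht1 h2
      obtain ⟨h5, h6⟩ := int_add_eq_int ht' ht1' h1.symm
      simp [*]
    · obtain ⟨h3, h4⟩ := int_add_eq ht ht1 ht' ht1' h2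
      simp [*]
    · obtain ⟨h3, h4⟩ := int_add_eq_int ht ht1 h2
      obtain ⟨h5, h6⟩ := int_sub_eq_int ht' ht1' h1.symm
      simp [*]
    · rcases int_add_eq_sub ht ht1 ht' ht1' h2 with ⟨h3, h4, h5⟩ | h3 <;> simp [*]
    · rcases int_add_eq_sub ht' ht1' ht ht1 h1.symm with ⟨h3, h4, h5⟩ | h3 <;> simp [*]
    · obtain ⟨h3, h4⟩ := int_sub_eq_int ht ht1 h1
      obtain ⟨h5, h6⟩ := int_add_eq_int ht' ht1' h2.symm
      simp [*]
    · obtain ⟨h3, h4⟩ := int_sub_eq ht ht1 ht' ht1' h1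
      simp [*]
    · obtain ⟨h3, h4⟩ := int_sub_eq_int ht ht1 h1
      obtain ⟨h5, h6⟩ := int_sub_eq_int ht' ht1' h2.symm
      simp [*]
    · obtain ⟨h3, h4⟩ := int_sub_eq_int ht ht1 h2
      obtain ⟨h5, h6⟩ := int_add_eq_int ht' ht1' h1.symm
      simp [*]
    · rcases int_add_eq_sub ht' ht1' ht ht1 h2.symm with ⟨h3, h4, h5⟩ | h3 <;> simp [*]
    · obtain ⟨h3, h4⟩ := int_sub_eq_int ht ht1 h2
      obtain ⟨h5, h6⟩ := int_sub_eq_int ht' ht1' h1.symm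
      simp [*]
    · obtain ⟨h3, h4⟩ := int_sub_eq ht ht1 ht' ht1' h2
      simp [*]
  rcases key with ⟨k1, k2, -⟩ | k
  · have hd : e.2 = e'.2 := by
      refine out_unique hS (p := e.1) he ?_
      rw [k1]; exact he'
    exact ⟨Prod.ext k1 hd, k2 hd⟩
  · exfalso
    rw [k] at he'
    have := he'.1
    rw [(quad_rev e).1] at this
    exact he.2 this

end Grid

namespace Grid

variable {S : Set (ℤ × ℤ)}

/-- The iterates of an injective self-map of a finite type decompose the type into cycles. -/
theorem exists_cycle_representatives {α : Type*} [Fintype α] {f : α → α}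
    (hf : Function.Injective f) :
    ∃ (n : ℕ) (r : Fin n → α),
      (∀ φ : α → ℂ, ∑ j, ∑ k ∈ Finset.range (Function.minimalPeriod f (r j)), φ (f^[k] (r j)) =
        ∑ a, φ a) ∧
      ∀ a, ∃ j, ∃ k < Function.minimalPeriod f (r j), f^[k] (r j) = a := by
  classical
  let σ : Equiv.Perm α := Equiv.ofBijective f (Finite.injective_iff_bijective.1 hf)
  have hσ : ∀ (k : ℕ) (a : α), (σ ^ k) a = f^[k] a := by
    intro k a
    rw [Equiv.Perm.iterate_eq_pow σ k |>.symm]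
    rfl
  let Q := Quotient (Equiv.Perm.SameCycle.setoid σ)
  let eq : Q ≃ Fin (Nat.card Q) := Finite.equivFin Q
  let r : Fin (Nat.card Q) → α := fun j => (eq.symm j).out
  have hper : ∀ a, 0 < Function.minimalPeriod f a := fun a =>
    Function.minimalPeriod_pos_of_mem_periodicPts (hf.mem_periodicPts a)
  have hsurj : ∀ a, ∃ j, ∃ k < Function.minimalPeriod f (r j), f^[k] (r j) = a := by
    intro a
    refine ⟨eq (Quotient.mk _ a), ?_⟩
    have h1 : Equiv.Perm.SameCycle σ (r (eq (Quotient.mk _ a))) a := by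
      have : (Equiv.Perm.SameCycle.setoid σ).r (r (eq (Quotient.mk _ a))) a := by
        simp only [r, Equiv.symm_apply_apply]
        exact Quotient.mk_out (s := Equiv.Perm.SameCycle.setoid σ) a
      exact this
    obtain ⟨i, -, hi⟩ := h1.exists_pow_eq'
    refine ⟨i % Function.minimalPeriod f _, Nat.mod_lt _ (hper _), ?_⟩
    rw [Function.iterate_mod_minimalPeriod_eq, ← hσ, hi]
  refine ⟨Nat.card Q, r, fun φ => ?_, hsurj⟩
  have hb : Function.Bijective (fun x : Σ j, Fin (Function.minimalPeriod f (r j)) =>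
      f^[(x.2 : ℕ)] (r x.1)) := by
    constructor
    · rintro ⟨j, k⟩ ⟨j', k'⟩ h
      simp only at h
      have hj : j = j' := by
        apply eq.symm.injective
        have h1 : Equiv.Perm.SameCycle σ (r j) (r j') := by
          have a1 : Equiv.Perm.SameCycle σ (r j) (f^[(k : ℕ)] (r j)) := ⟨(k : ℕ), by
            rw [zpow_natCast, hσ]⟩
          have a2 : Equiv.Perm.SameCycle σ (r j') (f^[(k' : ℕ)] (r j')) := ⟨(k' : ℕ), by
            rw [zpow_natCast, hσ]⟩
          rw [h] at a1
          exact a1.trans a2.symm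
        have h2 : (Quotient.mk (Equiv.Perm.SameCycle.setoid σ) (r j)) =
            Quotient.mk (Equiv.Perm.SameCycle.setoid σ) (r j') := Quotient.sound h1
        simpa only [r, Quotient.out_eq] using h2
      subst hj
      have := Function.iterate_injOn_Iio_minimalPeriod (f := f) (x := r j) k.2 k'.2 h
      rw [Fin.ext this]
    · intro a
      obtain ⟨j, k, hk, h⟩ := hsurj a
      exact ⟨⟨j, ⟨k, hk⟩⟩, h⟩
  rw [← Fintype.sum_bijective _ hb (fun x => φ (f^[(x.2 : ℕ)] (r x.1))) φ (fun _ => rfl),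
    Fintype.sum_sigma]
  simp only [Finset.sum_range]

/-- The integral over an edge. -/
noncomputable def edgeInt (h : ℝ) (f : ℂ → ℂ) (e : (ℤ × ℤ) × Fin 4) : ℂ :=
  ∫ t in (0 : ℝ)..1, vec h e.2 * f (pt h e t)

theorem edgeInt_rev (h : ℝ) (f : ℂ → ℂ) (e : (ℤ × ℤ) × Fin 4) :
    edgeInt h f (rev e) = - edgeInt h f e := by
  unfold edgeInt
  simp only [pt_rev, vec_rev, neg_mul, intervalIntegral.integral_neg]
  rw [intervalIntegral.integral_comp_sub_left (fun t => vec h e.2 * f (pt h e t))]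
  simp

/-- The closed polygon through the cycle of the boundary edge `e`. -/
noncomputable def loop (h : ℝ) (e : boundary S) (t : ℝ) : ℂ :=
  pt h (next^[⌊Function.minimalPeriod next e * t⌋₊] e).1
    (Function.minimalPeriod next e * t - ⌊Function.minimalPeriod next e * t⌋₊)

theorem loop_eq (h : ℝ) (e : boundary S) {t : ℝ} {k : ℕ}
    (h1 : k ≤ Function.minimalPeriod next e * t) (h2 : Function.minimalPeriod next e * t ≤ k + 1) :
    loop h e t = pt h (next^[k] e).1 (Function.minimalPeriod next e * t - k) := by
  unfold loop
  rcases h2.lt_or_eq with h3 | h3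
  · rw [(Nat.floor_eq_iff ((Nat.cast_nonneg k).trans h1)).2 ⟨h1, h3⟩]
  · rw [h3]
    have : ⌊(k : ℝ) + 1⌋₊ = k + 1 := by exact_mod_cast Nat.floor_natCast (R := ℝ) (k + 1)
    rw [this]
    push_cast
    rw [sub_self, add_sub_cancel_left, pt_zero, pt_one, Function.iterate_succ_apply']
    rfl

theorem continuous_pt (h : ℝ) (e : (ℤ × ℤ) × Fin 4) : Continuous (pt h e) := by
  unfold pt; fun_prop

theorem hasDerivAt_pt (h : ℝ) (e : (ℤ × ℤ) × Fin 4) (c d t : ℝ) :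
    HasDerivAt (fun t => pt h e (c * t - d)) (c * vec h e.2) t := by
  unfold pt
  have h1 : HasDerivAt (fun t : ℝ => c * t - d) c t := by
    simpa using ((hasDerivAt_id t).const_mul c).sub_const d
  simpa using (h1.ofReal_comp.mul_const (vec h e.2)).const_add (vtx h e.1)

section

variable {h : ℝ} (hS : NoDiagonal S) [Finite (boundary S)] (e : boundary S)
include hS

theorem minimalPeriod_pos : 0 < Function.minimalPeriod next e :=
  Function.minimalPeriod_pos_of_mem_periodicPts ((next_injective hS).mem_periodicPts e)

theorem mem_piece_iff {t : ℝ} {k : ℕ} :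
    t ∈ Icc ((k : ℝ) / Function.minimalPeriod next e)
        (((k + 1 : ℕ) : ℝ) / Function.minimalPeriod next e) ↔
      k ≤ Function.minimalPeriod next e * t ∧ Function.minimalPeriod next e * t ≤ k + 1 := by
  have hN : (0 : ℝ) < Function.minimalPeriod next e := by exact_mod_cast minimalPeriod_pos hS e
  rw [mem_Icc, div_le_iff₀' hN, le_div_iff₀' hN]
  push_cast
  rfl

theorem isPiecewiseC1Jordan_loop (hh : 0 < h) : IsPiecewiseC1Jordan (loop h e) := by
  have hN : (0 : ℝ) < Function.minimalPeriod next e := by exact_mod_cast minimalPeriod_pos hS e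
  set N := Function.minimalPeriod next e with hNdef
  refine ⟨⟨N, fun k => k / N, ?_, by simp, by field_simp, ?_⟩, ?_, ?_⟩
  · intro a b hab
    simp only
    gcongr
  · intro k hk
    have h1 : ContDiff ℝ 1 (fun t : ℝ => pt h (next^[k] e).1 (N * t - k)) := by
      unfold pt
      have : ContDiff ℝ 1 (fun t : ℝ => ((N * t - k : ℝ) : ℂ)) :=
        Complex.ofRealCLM.contDiff.comp ((contDiff_const.mul contDiff_id).sub contDiff_const)
      fun_prop
    refine h1.contDiffOn.congr fun t ht => ?_
    rw [mem_piece_iff hS e] at ht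
    exact loop_eq h e ht.1 ht.2
  · rw [loop_eq h e (k := 0) (by simp) (by simp), loop_eq h e (k := N) (by simp [N]) (by simp [N])]
    simp [N, Function.iterate_minimalPeriod]
  · rintro t ⟨ht0, ht1⟩ t' ⟨ht0', ht1'⟩ heq
    unfold loop at heq
    have k1 : (0 : ℝ) ≤ N * t := by positivity
    have k1' : (0 : ℝ) ≤ N * t' := by positivity
    obtain ⟨h3, h4⟩ := pt_injective hh hS (Subtype.prop _) (Subtype.prop _)
      (sub_nonneg.2 (Nat.floor_le k1)) (by linarith [Nat.lt_floor_add_one (N * t)])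
      (sub_nonneg.2 (Nat.floor_le k1')) (by linarith [Nat.lt_floor_add_one (N * t')]) heq
    have h5 := Function.iterate_injOn_Iio_minimalPeriod (f := next) (x := e)
      (mem_Iio.2 <| (Nat.floor_lt k1).2 (by nlinarith))
      (mem_Iio.2 <| (Nat.floor_lt k1').2 (by nlinarith)) (Subtype.ext h3)
    rw [h5] at h4
    have h6 : (N : ℝ) * t = N * t' := by linarith
    exact mul_left_cancel₀ hN.ne' h6

theorem image_loop :
    loop h e '' Icc 0 1 =
      ⋃ k : Fin (Function.minimalPeriod next e), pt h (next^[(k : ℕ)] e).1 '' Icc 0 1 := by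
  have hN : (0 : ℝ) < Function.minimalPeriod next e := by exact_mod_cast minimalPeriod_pos hS e
  set N := Function.minimalPeriod next e with hNdef
  ext z
  simp only [mem_iUnion, mem_image]
  constructor
  · rintro ⟨t, ⟨ht0, ht1⟩, rfl⟩
    rcases ht1.lt_or_eq with h1 | rfl
    · have k1 : (0 : ℝ) ≤ N * t := by positivity
      refine ⟨⟨⌊N * t⌋₊, (Nat.floor_lt k1).2 (by nlinarith)⟩, N * t - ⌊N * t⌋₊,
        ⟨sub_nonneg.2 (Nat.floor_le k1), by linarith [Nat.lt_floor_add_one (N * t)]⟩, rfl⟩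
    · refine ⟨⟨0, by exact_mod_cast hN⟩, 0, by simp, ?_⟩
      rw [loop_eq h e (k := N) (by simp [N]) (by simp [N])]
      simp [N, Function.iterate_minimalPeriod]
  · rintro ⟨⟨k, hk⟩, s, ⟨hs0, hs1⟩, rfl⟩
    have hk' : (k : ℝ) + 1 ≤ N := by exact_mod_cast hk
    have e1 : (N : ℝ) * ((k + s) / N) = k + s := by field_simp
    refine ⟨(k + s) / N, ⟨by positivity, (div_le_one hN).2 (by linarith)⟩, ?_⟩
    rw [loop_eq h e (k := k)] <;> rw [← hNdef, e1]
    · simp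
    · linarith
    · linarith

theorem integral_loop {f : ℂ → ℂ} (hf : ∀ e ∈ boundary S, ContinuousOn f (pt h e '' Icc 0 1)) :
    ∫ t in (0 : ℝ)..1, deriv (loop h e) t * f (loop h e t) =
      ∑ k ∈ Finset.range (Function.minimalPeriod next e), edgeInt h f (next^[k] e).1 := by
  have hN : (0 : ℝ) < Function.minimalPeriod next e := by exact_mod_cast minimalPeriod_pos hS e
  set N := Function.minimalPeriod next e with hNdef
  let a : ℕ → ℝ := fun k => k / N
  have haN : ∀ k, N * a k = k := fun k => by simp only [a]; field_simp
  have hle : ∀ k, a k ≤ a (k + 1) := by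
    intro k; simp only [a]; gcongr; simp
  let g : ℕ → ℝ → ℂ := fun k t => (N * vec h (next^[k] e).1.2) * f (pt h (next^[k] e).1 (N * t - k))
  have hg : ∀ k, ContinuousOn (g k) (Icc (a k) (a (k + 1))) := by
    intro k
    refine continuousOn_const.mul ((hf _ (next^[k] e).2).comp
      ((continuous_pt h _).comp (by fun_prop)).continuousOn fun t ht => ?_)
    have ht' : k ≤ N * t ∧ N * t ≤ k + 1 := (mem_piece_iff hS e).1 ht
    exact ⟨_, ⟨by linarith, by linarith⟩, rfl⟩
  have heq : ∀ k, EqOn (fun t => deriv (loop h e) t * f (loop h e t)) (g k)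
      (Ioo (a k) (a (k + 1))) := by
    intro k t ht
    have h1 : loop h e =ᶠ[𝓝 t] fun t => pt h (next^[k] e).1 (N * t - k) := by
      filter_upwards [Icc_mem_nhds ht.1 ht.2] with s hs
      have hs' : k ≤ N * s ∧ N * s ≤ k + 1 := (mem_piece_iff hS e).1 hs
      exact loop_eq h e hs'.1 hs'.2
    simp only [g]
    rw [h1.deriv_eq, h1.self_of_nhds, (hasDerivAt_pt h _ N k t).deriv]
    simp
  have hint : ∀ k < N, IntervalIntegrable (fun t => deriv (loop h e) t * f (loop h e t)) volume
      (a k) (a (k + 1)) := by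
    intro k _
    have h1 : IntervalIntegrable (g k) volume (a k) (a (k + 1)) :=
      ContinuousOn.intervalIntegrable_of_Icc (hle k) (hg k)
    refine h1.congr_uIoo ?_
    rw [uIoo_of_le (hle k)]
    exact (heq k).symm
  have hsum := intervalIntegral.sum_integral_adjacent_intervals (a := a) hint
  have ha0 : a 0 = 0 := by simp [a]
  have haN1 : a N = 1 := by simp only [a]; field_simp
  rw [ha0, haN1] at hsum
  rw [← hsum]
  refine Finset.sum_congr rfl fun k _ => ?_
  rw [intervalIntegral.integral_congr_Ioo_of_le (hle k) (heq k)]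
  simp only [g, mul_assoc]
  rw [intervalIntegral.integral_const_mul,
    intervalIntegral.integral_comp_mul_sub
      (fun t => vec h (next^[k] e).1.2 * f (pt h (next^[k] e).1 t)) hN.ne' (k : ℝ), haN, haN,
      Complex.real_smul]
  push_cast
  rw [sub_self, add_sub_cancel_left, ← mul_assoc, mul_inv_cancel₀ (by exact_mod_cast hN.ne'), one_mul]
  rfl

end

/-- The boundary edges of `S` form finitely many Jordan curves. -/
theorem exists_loops {h : ℝ} (hh : 0 < h) (hS : NoDiagonal S) (hfin : (boundary S).Finite) :
    ∃ (n : ℕ) (γ : Fin n → ℝ → ℂ), (∀ k, IsPiecewiseC1Jordan (γ k)) ∧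
      (⋃ k, γ k '' Icc 0 1) = ⋃ e ∈ boundary S, pt h e '' Icc 0 1 ∧
      ∀ f : ℂ → ℂ, (∀ e ∈ boundary S, ContinuousOn f (pt h e '' Icc 0 1)) →
        ∑ k, ∫ t in (0 : ℝ)..1, deriv (γ k) t * f (γ k t) =
          ∑ e ∈ hfin.toFinset, edgeInt h f e := by
  have := hfin.to_subtype
  have := Fintype.ofFinite (boundary S)
  obtain ⟨n, r, hsum, hsurj⟩ := exists_cycle_representatives (next_injective hS)
  refine ⟨n, fun k => loop h (r k), fun k => isPiecewiseC1Jordan_loop hS _ hh, ?_, ?_⟩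
  · simp only [image_loop hS]
    apply subset_antisymm
    · simp only [iUnion_subset_iff]
      intro j k
      exact subset_biUnion_of_mem (u := fun e => pt h e '' Icc 0 1) (Subtype.prop _)
    · simp only [iUnion_subset_iff]
      intro e he
      obtain ⟨j, k, hk, h2⟩ := hsurj ⟨e, he⟩
      have h3 : e = (next^[k] (r j)).1 := by rw [h2]
      rw [h3]
      exact subset_iUnion₂_of_subset j ⟨k, hk⟩ subset_rfl
  · intro f hf
    simp only [integral_loop hS _ hf]
    rw [hsum fun e => edgeInt h f e.1]
    exact (Finset.sum_subtype _ (by simp) _).symm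

end Grid

namespace Grid

variable {S : Set (ℤ × ℤ)} {h : ℝ}

/-- The closed square with lower left corner `c`. -/
def cell (h : ℝ) (c : ℤ × ℤ) : Set ℂ :=
  {z | ((c.1 : ℝ) ≤ z.re / h ∧ z.re / h ≤ c.1 + 1) ∧
    ((c.2 : ℝ) ≤ z.im / h + 1 / 2 ∧ z.im / h + 1 / 2 ≤ c.2 + 1)}

/-- The open square with lower left corner `c`. -/
def ocell (h : ℝ) (c : ℤ × ℤ) : Set ℂ :=
  {z | ((c.1 : ℝ) < z.re / h ∧ z.re / h < c.1 + 1) ∧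
    ((c.2 : ℝ) < z.im / h + 1 / 2 ∧ z.im / h + 1 / 2 < c.2 + 1)}

noncomputable def center (h : ℝ) (c : ℤ × ℤ) : ℂ := ⟨h * (c.1 + 1 / 2), h * c.2⟩

/-- The union of the closed squares in `S`. -/
def region (h : ℝ) (S : Set (ℤ × ℤ)) : Set ℂ := ⋃ c ∈ S, cell h c

/-- The interior of the union of the closed squares in `S`. -/
def dom (h : ℝ) (S : Set (ℤ × ℤ)) : Set ℂ := (region h Sᶜ)ᶜ

theorem mem_region {z : ℂ} : z ∈ region h S ↔ ∃ c ∈ S, z ∈ cell h c := by simp [region]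

theorem mem_dom {z : ℂ} : z ∈ dom h S ↔ ∀ c, z ∈ cell h c → c ∈ S := by
  simp only [dom, mem_compl_iff, mem_region, not_exists, not_and]
  exact forall_congr' fun c => ⟨fun H hz => by_contra fun hc => H hc hz, fun H hc hz => hc (H hz)⟩

theorem exists_mem_cell (h : ℝ) (z : ℂ) : ∃ c, z ∈ cell h c :=
  ⟨(⌊z.re / h⌋, ⌊z.im / h + 1 / 2⌋), ⟨Int.floor_le _, (Int.lt_floor_add_one _).le⟩,
    Int.floor_le _, (Int.lt_floor_add_one _).le⟩

theorem ocell_subset_cell (c : ℤ × ℤ) : ocell h c ⊆ cell h c := fun _ hz =>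
  ⟨⟨hz.1.1.le, hz.1.2.le⟩, hz.2.1.le, hz.2.2.le⟩

theorem eq_of_mem_ocell_of_mem_cell {c c' : ℤ × ℤ} {z : ℂ} (h1 : z ∈ ocell h c)
    (h2 : z ∈ cell h c') : c = c' := by
  obtain ⟨⟨a1, a2⟩, a3, a4⟩ := h1
  obtain ⟨⟨b1, b2⟩, b3, b4⟩ := h2
  have e1 : c.1 < c'.1 + 1 := by exact_mod_cast a1.trans_le b2
  have e2 : c'.1 < c.1 + 1 := by exact_mod_cast b1.trans_lt a2
  have e3 : c.2 < c'.2 + 1 := by exact_mod_cast a3.trans_le b4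
  have e4 : c'.2 < c.2 + 1 := by exact_mod_cast b3.trans_lt a4
  exact Prod.ext (by omega) (by omega)

theorem center_mem_ocell (hh : 0 < h) (c : ℤ × ℤ) : center h c ∈ ocell h c := by
  simp only [ocell, center, mem_ofPred_eq, mul_div_cancel_left₀ _ hh.ne']
  refine ⟨⟨?_, ?_⟩, ?_, ?_⟩ <;> linarith

theorem isClosed_cell (c : ℤ × ℤ) : IsClosed (cell h c) := by
  unfold cell
  refine IsClosed.inter (IsClosed.inter ?_ ?_) (IsClosed.inter ?_ ?_)
  · exact isClosed_le continuous_const (Complex.continuous_re.div_const _)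
  · exact isClosed_le (Complex.continuous_re.div_const _) continuous_const
  · exact isClosed_le continuous_const ((Complex.continuous_im.div_const _).add continuous_const)
  · exact isClosed_le ((Complex.continuous_im.div_const _).add continuous_const) continuous_const

theorem convex_ocell (c : ℤ × ℤ) : Convex ℝ (ocell h c) := by
  rintro z ⟨⟨a1, a2⟩, a3, a4⟩ w ⟨⟨b1, b2⟩, b3, b4⟩ s t hs ht hst
  have e1 : (s • z + t • w).re / h = s * (z.re / h) + t * (w.re / h) := by simp; ring
  have e2 : (s • z + t • w).im / h + 1 / 2 = s * (z.im / h + 1 / 2) + t * (w.im / h + 1 / 2) := by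
    simp only [Complex.add_im, Complex.real_smul, Complex.im_ofReal_mul]
    linear_combination (-1 / 2) * hst
  have key : ∀ {l u x y : ℝ}, l < x → x < u → l < y → y < u → l < s * x + t * y ∧ s * x + t * y < u := by
    intro l u x y h1 h2 h3 h4
    have := (convex_Ioo l u) ⟨h1, h2⟩ ⟨h3, h4⟩ hs ht hst
    simpa using this
  refine ⟨?_, ?_⟩
  · rw [e1]; exact key a1 a2 b1 b2
  · rw [e2]; exact key a3 a4 b3 b4

theorem cell_subset_closure_ocell (hh : 0 < h) (c : ℤ × ℤ) : cell h c ⊆ closure (ocell h c) := by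
  rintro z ⟨⟨a1, a2⟩, a3, a4⟩
  have hc : Tendsto (fun ε : ℝ => z + ε * (center h c - z)) (𝓝[>] 0) (𝓝 z) := by
    have : Continuous (fun ε : ℝ => z + ε * (center h c - z)) := by fun_prop
    have := (this.tendsto 0).mono_left (nhdsWithin_le_nhds (s := Ioi 0))
    simpa using this
  refine mem_closure_of_tendsto hc ?_
  filter_upwards [Ioo_mem_nhdsGT (one_pos (α := ℝ))] with ε hε
  obtain ⟨h0, h1⟩ := hε
  have e1 : (z + ε * (center h c - z)).re / h = (1 - ε) * (z.re / h) + ε * (c.1 + 1 / 2) := by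
    simp [center]; field_simp; ring
  have e2 : (z + ε * (center h c - z)).im / h + 1 / 2 =
      (1 - ε) * (z.im / h + 1 / 2) + ε * (c.2 + 1 / 2) := by
    simp [center]; field_simp; ring
  simp only [ocell, mem_ofPred_eq]
  rw [e1, e2]
  refine ⟨⟨?_, ?_⟩, ?_, ?_⟩ <;> nlinarith

theorem finite_cells_meeting (hh : 0 < h) (R : ℝ) :
    {c | (cell h c ∩ Metric.closedBall 0 R).Nonempty}.Finite := by
  have hfin : (Icc (-(⌈R / h⌉ + 2)) (⌈R / h⌉ + 2) ×ˢ Icc (-(⌈R / h⌉ + 2)) (⌈R / h⌉ + 2) :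
    Set (ℤ × ℤ)).Finite := (finite_Icc _ _).prod (finite_Icc _ _)
  refine hfin.subset ?_
  rintro c ⟨z, ⟨⟨a1, a2⟩, a3, a4⟩, hz⟩
  rw [mem_closedBall_zero_iff] at hz
  have hre := abs_le.1 ((Complex.abs_re_le_norm z).trans hz)
  have him := abs_le.1 ((Complex.abs_im_le_norm z).trans hz)
  have r1 : z.re / h ≤ R / h := by gcongr; exact hre.2
  have r2 : -(R / h) ≤ z.re / h := by rw [← neg_div]; gcongr; exact hre.1
  have r3 : z.im / h ≤ R / h := by gcongr; exact him.2
  have r4 : -(R / h) ≤ z.im / h := by rw [← neg_div]; gcongr; exact him.1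
  have hc := Int.le_ceil (R / h)
  simp only [mem_prod, mem_Icc]
  refine ⟨⟨?_, ?_⟩, ?_, ?_⟩ <;> rify <;> linarith

theorem locallyFinite_cell (hh : 0 < h) : LocallyFinite (cell h) := fun z =>
  ⟨Metric.closedBall 0 (‖z‖ + 1),
    Filter.mem_of_superset (Metric.ball_mem_nhds z one_pos) (by
      intro w hw
      rw [mem_closedBall_zero_iff]
      rw [mem_ball_iff_norm] at hw
      linarith [norm_sub_norm_le w z]), finite_cells_meeting hh _⟩

theorem isClosed_region (hh : 0 < h) (S : Set (ℤ × ℤ)) : IsClosed (region h S) := by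
  have : region h S = ⋃ c : S, cell h c := by simp [region, iUnion_subtype]
  rw [this]
  exact ((locallyFinite_cell hh).comp_injective Subtype.val_injective).isClosed_iUnion
    fun c => isClosed_cell _

theorem isOpen_dom (hh : 0 < h) (S : Set (ℤ × ℤ)) : IsOpen (dom h S) :=
  (isClosed_region hh _).isOpen_compl

theorem dom_subset_region : dom h S ⊆ region h S := by
  intro z hz
  obtain ⟨c, hc⟩ := exists_mem_cell h z
  exact mem_region.2 ⟨c, mem_dom.1 hz c hc, hc⟩

theorem ocell_subset_dom {c : ℤ × ℤ} (hc : c ∈ S) : ocell h c ⊆ dom h S := by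
  intro z hz
  rw [mem_dom]
  intro c' hc'
  rwa [← eq_of_mem_ocell_of_mem_cell hz hc']

theorem closure_dom (hh : 0 < h) : closure (dom h S) = region h S := by
  apply subset_antisymm
  · exact closure_minimal dom_subset_region (isClosed_region hh S)
  · intro z hz
    obtain ⟨c, hc, hz⟩ := mem_region.1 hz
    exact closure_mono (ocell_subset_dom hc) (cell_subset_closure_ocell hh c hz)

theorem frontier_dom (hh : 0 < h) : frontier (dom h S) = region h S ∩ region h Sᶜ := by
  rw [(isOpen_dom hh S).frontier_eq, closure_dom hh, dom, sdiff_compl]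

theorem exists_quad {p c : ℤ × ℤ} (h1 : c.1 = p.1 ∨ c.1 = p.1 - 1) (h2 : c.2 = p.2 ∨ c.2 = p.2 - 1) :
    ∃ d, c = quad p d := by
  rcases h1 with h1 | h1 <;> rcases h2 with h2 | h2
  · exact ⟨0, Prod.ext (by simp [quad, h1]) (by simp [quad, h2])⟩
  · exact ⟨3, Prod.ext (by simp [quad, h1]) (by simp [quad, h2, sub_eq_add_neg])⟩
  · exact ⟨1, Prod.ext (by simp [quad, h1, sub_eq_add_neg]) (by simp [quad, h2])⟩
  · exact ⟨2, Prod.ext (by simp [quad, h1, sub_eq_add_neg]) (by simp [quad, h2, sub_eq_add_neg])⟩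

/-- Two squares with a common point share a vertex. -/
theorem exists_quad_of_mem_cell {c c' : ℤ × ℤ} {z : ℂ} (h1 : z ∈ cell h c) (h2 : z ∈ cell h c') :
    ∃ p d d', c = quad p d ∧ c' = quad p d' := by
  obtain ⟨⟨a1, a2⟩, a3, a4⟩ := h1
  obtain ⟨⟨b1, b2⟩, b3, b4⟩ := h2
  have e1 : c.1 ≤ c'.1 + 1 := by exact_mod_cast a1.trans b2
  have e2 : c'.1 ≤ c.1 + 1 := by exact_mod_cast b1.trans a2
  have e3 : c.2 ≤ c'.2 + 1 := by exact_mod_cast a3.trans b4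
  have e4 : c'.2 ≤ c.2 + 1 := by exact_mod_cast b3.trans a4
  obtain ⟨d, hd⟩ := exists_quad (p := (max c.1 c'.1, max c.2 c'.2)) (c := c)
    (by simp only; omega) (by simp only; omega)
  obtain ⟨d', hd'⟩ := exists_quad (p := (max c.1 c'.1, max c.2 c'.2)) (c := c')
    (by simp only; omega) (by simp only; omega)
  exact ⟨_, d, d', hd, hd'⟩

theorem pt_re_div (hh : 0 < h) (e : (ℤ × ℤ) × Fin 4) (t : ℝ) :
    (pt h e t).re / h = e.1.1 + t * (step e.2).1 := by
  simp [pt, vtx, vec]; field_simp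

theorem pt_im_div (hh : 0 < h) (e : (ℤ × ℤ) × Fin 4) (t : ℝ) :
    (pt h e t).im / h + 1 / 2 = e.1.2 + t * (step e.2).2 := by
  simp [pt, vtx, vec]; field_simp; ring

theorem mem_cell_iff_pt (hh : 0 < h) (e : (ℤ × ℤ) × Fin 4) (t : ℝ) (c : ℤ × ℤ) :
    pt h e t ∈ cell h c ↔
      ((c.1 : ℝ) ≤ e.1.1 + t * (step e.2).1 ∧ (e.1.1 : ℝ) + t * (step e.2).1 ≤ c.1 + 1) ∧
      ((c.2 : ℝ) ≤ e.1.2 + t * (step e.2).2 ∧ (e.1.2 : ℝ) + t * (step e.2).2 ≤ c.2 + 1) := by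
  simp only [cell, mem_ofPred_eq, pt_re_div hh, pt_im_div hh]

theorem pt_mem_cell_left (hh : 0 < h) (e : (ℤ × ℤ) × Fin 4) {t : ℝ} (ht : t ∈ Icc (0 : ℝ) 1) :
    pt h e t ∈ cell h (quad e.1 e.2) := by
  rw [mem_cell_iff_pt hh]
  obtain ⟨⟨a, b⟩, d⟩ := e
  obtain ⟨h1, h2⟩ := ht
  fin_cases d <;> simp [quad, step] <;> (try constructor) <;> linarith

theorem pt_mem_cell_right (hh : 0 < h) (e : (ℤ × ℤ) × Fin 4) {t : ℝ} (ht : t ∈ Icc (0 : ℝ) 1) :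
    pt h e t ∈ cell h (quad e.1 (e.2 + 3)) := by
  have h1 := pt_mem_cell_left hh (rev e) (t := 1 - t) ⟨by linarith [ht.2], by linarith [ht.1]⟩
  rwa [pt_rev, (quad_rev e).1, sub_sub_cancel] at h1

theorem eq_left_or_right_of_midpoint_mem (hh : 0 < h) {e : (ℤ × ℤ) × Fin 4} {c : ℤ × ℤ}
    (hc : pt h e (1 / 2) ∈ cell h c) : c = quad e.1 e.2 ∨ c = quad e.1 (e.2 + 3) := by
  rw [mem_cell_iff_pt hh] at hc
  obtain ⟨⟨a, b⟩, d⟩ := e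
  obtain ⟨x, y⟩ := c
  obtain ⟨⟨h1, h2⟩, h3, h4⟩ := hc
  fin_cases d <;> simp [quad, step] at h1 h2 h3 h4 ⊢
  · have k1 : x < a + 1 := by rify; linarith
    have k2 : a < x + 1 := by rify; linarith
    have k3 : b ≤ y + 1 := by rify; linarith
    omega
  · have k1 : y < b + 1 := by rify; linarith
    have k2 : b < y + 1 := by rify; linarith
    have k3 : a ≤ x + 1 := by rify; linarith
    omega
  · have k1 : x < a := by rify; linarith
    have k2 : a < x + 2 := by rify; linarith
    have k3 : b ≤ y + 1 := by rify; linarith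
    omega
  · have k1 : y < b := by rify; linarith
    have k2 : b < y + 2 := by rify; linarith
    have k3 : a ≤ x + 1 := by rify; linarith
    omega

theorem exists_pt_of_mem_left_right (hh : 0 < h) {e : (ℤ × ℤ) × Fin 4} {z : ℂ}
    (h1 : z ∈ cell h (quad e.1 e.2)) (h2 : z ∈ cell h (quad e.1 (e.2 + 3))) :
    ∃ t ∈ Icc (0 : ℝ) 1, pt h e t = z := by
  obtain ⟨⟨a, b⟩, d⟩ := e
  obtain ⟨⟨a1, a2⟩, a3, a4⟩ := h1
  obtain ⟨⟨b1, b2⟩, b3, b4⟩ := h2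
  have hz : ∀ {t : ℝ}, (pt h ((a, b), d) t).re / h = z.re / h →
      (pt h ((a, b), d) t).im / h + 1 / 2 = z.im / h + 1 / 2 → pt h ((a, b), d) t = z := by
    intro t e1 e2
    apply Complex.ext
    · rwa [div_left_inj' hh.ne'] at e1
    · rwa [add_left_inj, div_left_inj' hh.ne'] at e2
  simp only [pt_re_div hh, pt_im_div hh] at hz
  generalize z.re / h = u at *
  generalize z.im / h + 1 / 2 = v at *
  fin_cases d <;> simp [quad, step] at a1 a2 a3 a4 b1 b2 b3 b4 hz
  · exact ⟨u - a, ⟨by linarith, by linarith⟩, hz (by linarith) (by linarith)⟩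
  · exact ⟨v - b, ⟨by linarith, by linarith⟩, hz (by linarith) (by linarith)⟩
  · exact ⟨a - u, ⟨by linarith, by linarith⟩, hz (by linarith) (by linarith)⟩
  · exact ⟨b - v, ⟨by linarith, by linarith⟩, hz (by linarith) (by linarith)⟩

theorem eq_vtx_of_mem_diagonal (hh : 0 < h) {p : ℤ × ℤ} {d : Fin 4} {z : ℂ}
    (h1 : z ∈ cell h (quad p d)) (h2 : z ∈ cell h (quad p (d + 2))) : z = vtx h p := by
  obtain ⟨a, b⟩ := p
  obtain ⟨⟨a1, a2⟩, a3, a4⟩ := h1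
  obtain ⟨⟨b1, b2⟩, b3, b4⟩ := h2
  have key : z.re / h = a ∧ z.im / h + 1 / 2 = b := by
    generalize z.re / h = u at *
    generalize z.im / h + 1 / 2 = v at *
    fin_cases d <;> simp [quad] at a1 a2 a3 a4 b1 b2 b3 b4 <;> constructor <;> linarith
  obtain ⟨k1, k2⟩ := key
  rw [div_eq_iff hh.ne'] at k1
  have k3 : z.im / h = b - 1 / 2 := by linarith
  rw [div_eq_iff hh.ne'] at k3
  apply Complex.ext <;> simp [vtx] <;> linarith

theorem fin4_cases (d d' : Fin 4) : d' = d ∨ d' = d + 1 ∨ d' = d + 2 ∨ d' = d + 3 := by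
  fin_cases d <;> fin_cases d' <;> simp

theorem region_inter_region_compl (hh : 0 < h) :
    region h S ∩ region h Sᶜ = ⋃ e ∈ boundary S, pt h e '' Icc 0 1 := by
  ext z
  constructor
  · rintro ⟨h1, h2⟩
    obtain ⟨c, hc, hz⟩ := mem_region.1 h1
    obtain ⟨c', hc', hz'⟩ := mem_region.1 h2
    obtain ⟨p, d, d', rfl, rfl⟩ := exists_quad_of_mem_cell hz hz'
    rcases fin4_cases d d' with rfl | rfl | rfl | rfl
    · exact absurd hc hc'
    · have e1 : d + 1 + 3 = d := by fin_cases d <;> rfl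
      obtain ⟨t, ht, rfl⟩ := exists_pt_of_mem_left_right hh (e := (p, d + 1)) hz' (by
        simp only [e1]; exact hz)
      refine mem_biUnion (x := rev (p, d + 1)) ?_ ⟨1 - t, ⟨by linarith [ht.2], by linarith [ht.1]⟩, ?_⟩
      · refine ⟨?_, ?_⟩
        · rw [(quad_rev _).1]; simp only [e1]; exact hc
        · rw [(quad_rev _).2]; exact hc'
      · rw [pt_rev, sub_sub_cancel]
    · rw [eq_vtx_of_mem_diagonal hh hz hz']
      obtain ⟨d'', hd''⟩ := exists_boundary_of_mem_of_notMem hc hc'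
      exact mem_biUnion hd'' ⟨0, by simp, pt_zero _ _⟩
    · obtain ⟨t, ht, rfl⟩ := exists_pt_of_mem_left_right hh (e := (p, d)) hz hz'
      exact mem_biUnion (x := (p, d)) ⟨hc, hc'⟩ ⟨t, ht, rfl⟩
  · intro hz
    simp only [mem_iUnion] at hz
    obtain ⟨e, he, t, ht, rfl⟩ := hz
    exact ⟨mem_region.2 ⟨_, he.1, pt_mem_cell_left hh e ht⟩,
      mem_region.2 ⟨_, he.2, pt_mem_cell_right hh e ht⟩⟩

/-! ### Components -/

/-- The component of a square. -/
def comp (h : ℝ) (S : Set (ℤ × ℤ)) (c : ℤ × ℤ) : Set ℂ :=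
  connectedComponentIn (dom h S) (center h c)

theorem mem_comp (hh : 0 < h) {c : ℤ × ℤ} (hc : c ∈ S) {z : ℂ} (hz : z ∈ dom h S)
    (hzc : z ∈ cell h c) : z ∈ comp h S c := by
  have h1 : IsPreconnected (ocell h c ∪ {z}) := by
    refine (convex_ocell c).isPreconnected.subset_closure subset_union_left ?_
    exact union_subset subset_closure
      (singleton_subset_iff.2 (cell_subset_closure_ocell hh c hzc))
  exact h1.subset_connectedComponentIn (Or.inl (center_mem_ocell hh c))
    (union_subset (ocell_subset_dom hc) (singleton_subset_iff.2 hz)) (Or.inr rfl)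

theorem comp_eq_of_mem (hh : 0 < h) {c c' : ℤ × ℤ} (hc : c ∈ S) (hc' : c' ∈ S) {z : ℂ}
    (hz : z ∈ dom h S) (h1 : z ∈ cell h c) (h2 : z ∈ cell h c') : comp h S c = comp h S c' :=
  (connectedComponentIn_eq (mem_comp hh hc hz h1)).trans
    (connectedComponentIn_eq (mem_comp hh hc' hz h2)).symm

theorem exists_comp_eq (hh : 0 < h) {z : ℂ} (hz : z ∈ dom h S) :
    ∃ c ∈ S, z ∈ cell h c ∧ connectedComponentIn (dom h S) z = comp h S c := by
  obtain ⟨c, hc⟩ := exists_mem_cell h z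
  have hcS := mem_dom.1 hz c hc
  exact ⟨c, hcS, hc, (connectedComponentIn_eq (mem_comp hh hcS hz hc)).symm⟩

theorem comp_eq_of_adjacent (hh : 0 < h) {p : ℤ × ℤ} {d : Fin 4} (h1 : quad p d ∈ S)
    (h2 : quad p (d + 3) ∈ S) : comp h S (quad p d) = comp h S (quad p (d + 3)) := by
  have ht : (1 / 2 : ℝ) ∈ Icc (0 : ℝ) 1 := by constructor <;> norm_num
  refine comp_eq_of_mem hh h1 h2 (z := pt h (p, d) (1 / 2)) ?_ (pt_mem_cell_left hh (p, d) ht)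
    (pt_mem_cell_right hh (p, d) ht)
  rw [mem_dom]
  intro c hc
  rcases eq_left_or_right_of_midpoint_mem hh hc with rfl | rfl
  · exact h1
  · exact h2

theorem comp_eq_of_touching (hh : 0 < h) (hS : NoDiagonal S) {c c' : ℤ × ℤ} (hc : c ∈ S)
    (hc' : c' ∈ S) {z : ℂ} (h1 : z ∈ cell h c) (h2 : z ∈ cell h c') :
    comp h S c = comp h S c' := by
  obtain ⟨p, d, d', rfl, rfl⟩ := exists_quad_of_mem_cell h1 h2
  have e1 : d + 1 + 3 = d := by fin_cases d <;> rfl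
  have e2 : d + 2 + 3 = d + 1 := by fin_cases d <;> rfl
  have e3 : d + 3 + 3 = d + 2 := by fin_cases d <;> rfl
  have key := fun d => comp_eq_of_adjacent (S := S) hh (p := p) (d := d)
  have k0 := key d
  have k1 := key (d + 1)
  have k2 := key (d + 2)
  have k3 := key (d + 3)
  rw [e1] at k1
  rw [e2] at k2
  rw [e3] at k3
  rcases fin4_cases d d' with rfl | rfl | rfl | rfl
  · rfl
  · exact (k1 hc' hc).symm
  · by_cases q1 : quad p (d + 1) ∈ S
    · exact (k1 q1 hc).symm.trans (k2 hc' q1).symm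
    · by_cases q3 : quad p (d + 3) ∈ S
      · exact (k0 hc q3).trans (k3 q3 hc')
      · exact absurd ⟨hc, q1, hc', q3⟩ (hS p d)
  · exact k0 hc hc'

theorem pairwise_components (hh : 0 < h) (hS : NoDiagonal S) :
    (components (dom h S)).Pairwise (fun A B => Disjoint (closure A) (closure B)) := by
  have key : ∀ z ∈ dom h S, ∀ w ∈ closure (connectedComponentIn (dom h S) z),
      ∃ c ∈ S, w ∈ cell h c ∧ comp h S c = connectedComponentIn (dom h S) z := by
    intro z hz w hw
    have hsub : connectedComponentIn (dom h S) z ⊆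
        region h {c | c ∈ S ∧ comp h S c = connectedComponentIn (dom h S) z} := by
      intro x hx
      have hxW := connectedComponentIn_subset _ _ hx
      obtain ⟨c, hc, hxc, h1⟩ := exists_comp_eq hh hxW
      exact mem_region.2 ⟨c, ⟨hc, by rw [← h1, connectedComponentIn_eq hx]⟩, hxc⟩
    obtain ⟨c, hc, hwc⟩ := mem_region.1 (closure_minimal hsub (isClosed_region hh _) hw)
    exact ⟨c, hc.1, hwc, hc.2⟩
  rintro A ⟨z, hz, rfl⟩ B ⟨z', hz', rfl⟩ hne
  rw [Set.disjoint_left]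
  intro w hw hw'
  obtain ⟨c, hc, hwc, h1⟩ := key z hz w hw
  obtain ⟨c', hc', hwc', h1'⟩ := key z' hz' w hw'
  exact hne (by rw [← h1, ← h1', comp_eq_of_touching hh hS hc hc' hwc hwc'])

theorem isPreconnected_norm_gt {R : ℝ} (hR : 0 < R) : IsPreconnected {z : ℂ | R < ‖z‖} := by
  have h1 : {z : ℂ | R < ‖z‖} = Complex.exp '' {z | Real.log R < z.re} := by
    ext z
    constructor
    · intro hz
      have hz' : R < ‖z‖ := hz
      have hz0 : z ≠ 0 := by
        rintro rfl; simp at hz'; linarith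
      refine ⟨Complex.log z, ?_, Complex.exp_log hz0⟩
      simp only [mem_ofPred_eq, Complex.log_re]
      exact Real.log_lt_log hR hz'
    · rintro ⟨w, hw, rfl⟩
      simp only [mem_ofPred_eq, Complex.norm_exp]
      exact (Real.log_lt_iff_lt_exp hR).1 hw
  rw [h1]
  exact (convex_halfSpace_re_gt _).isPreconnected.image _ Complex.continuous_exp.continuousOn

theorem exists_radius_of_finite (hh : 0 < h) (hS : S.Finite) :
    ∃ R > 0, region h S ⊆ Metric.closedBall 0 R := by
  have hb : Bornology.IsBounded (region h S) := by
    refine (Bornology.isBounded_biUnion hS).2 fun c _ => ?_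
    refine (Metric.isBounded_closedBall (x := (0 : ℂ))
      (r := h * (|(c.1 : ℝ)| + 1) + h * (|(c.2 : ℝ)| + 1))).subset ?_
    rintro z ⟨⟨a1, a2⟩, a3, a4⟩
    rw [mem_closedBall_zero_iff]
    refine (Complex.norm_le_abs_re_add_abs_im z).trans ?_
    have n1 := neg_abs_le (c.1 : ℝ)
    have n2 := le_abs_self (c.1 : ℝ)
    have n3 := neg_abs_le (c.2 : ℝ)
    have n4 := le_abs_self (c.2 : ℝ)
    have f1 : |z.re / h| ≤ |(c.1 : ℝ)| + 1 := abs_le.2 ⟨by linarith, by linarith⟩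
    have f2 : |z.im / h| ≤ |(c.2 : ℝ)| + 1 := abs_le.2 ⟨by linarith, by linarith⟩
    rw [abs_div, abs_of_pos hh, div_le_iff₀' hh] at f1 f2
    exact add_le_add f1 f2
  obtain ⟨R, hR, h1⟩ := hb.exists_pos_norm_le
  exact ⟨R, hR, fun z hz => mem_closedBall_zero_iff.2 (h1 z hz)⟩

theorem finite_components (hh : 0 < h) (hS : S.Finite ∨ Sᶜ.Finite) :
    (components (dom h S)).Finite := by
  have key : components (dom h S) ⊆ comp h S '' S := by
    rintro A ⟨z, hz, rfl⟩
    obtain ⟨c, hc, -, h1⟩ := exists_comp_eq hh hz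
    exact ⟨c, hc, h1.symm⟩
  rcases hS with hS | hS
  · exact (hS.image _).subset key
  · obtain ⟨R, hR, hsub⟩ := exists_radius_of_finite hh hS
    have hE : {z : ℂ | R < ‖z‖} ⊆ dom h S := by
      intro z hz hz'
      have := mem_closedBall_zero_iff.1 (hsub hz')
      exact absurd hz (not_lt.2 this)
    refine (((finite_cells_meeting hh R).image (comp h S)).union
      (finite_singleton (connectedComponentIn (dom h S) ((R + 1 : ℝ) : ℂ)))).subset ?_
    refine key.trans ?_
    rintro A ⟨c, hc, rfl⟩
    by_cases hcR : center h c ∈ Metric.closedBall (0 : ℂ) R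
    · exact Or.inl ⟨c, ⟨_, ocell_subset_cell c (center_mem_ocell hh c), hcR⟩, rfl⟩
    · right
      have h1 : center h c ∈ {z : ℂ | R < ‖z‖} := by
        simpa using hcR
      have h2 : ((R + 1 : ℝ) : ℂ) ∈ {z : ℂ | R < ‖z‖} := by
        rw [mem_ofPred_eq, Complex.norm_real, Real.norm_of_nonneg (by linarith)]
        linarith
      exact connectedComponentIn_eq
        ((isPreconnected_norm_gt hR).subset_connectedComponentIn h1 hE h2)

end Grid

namespace Grid

variable {S : Set (ℤ × ℤ)} {h : ℝ}

/-- The `d`-th edge of the square `c`, counterclockwise. -/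
def edgeOf (c : ℤ × ℤ) (d : Fin 4) : (ℤ × ℤ) × Fin 4 := (c + ![(0, 0), (1, 0), (1, 1), (0, 1)] d, d)

theorem quad_edgeOf (c : ℤ × ℤ) (d : Fin 4) : quad (edgeOf c d).1 (edgeOf c d).2 = c := by
  fin_cases d <;> simp [quad, edgeOf, add_assoc]

theorem edgeOf_quad (e : (ℤ × ℤ) × Fin 4) : edgeOf (quad e.1 e.2) e.2 = e := by
  obtain ⟨p, d⟩ := e
  fin_cases d <;> simp [quad, edgeOf, add_assoc]

/-- The integral over the boundary of a square. -/
noncomputable def cellInt (h : ℝ) (f : ℂ → ℂ) (c : ℤ × ℤ) : ℂ := ∑ d, edgeInt h f (edgeOf c d)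

theorem sum_edgeInt_boundary (hS : S.Finite) (f : ℂ → ℂ) :
    ∑ e ∈ (boundary_finite_of_finite hS).toFinset, edgeInt h f e =
      ∑ c ∈ hS.toFinset, cellInt h f c := by
  classical
  let L : Finset ((ℤ × ℤ) × Fin 4) := (hS.toFinset ×ˢ Finset.univ).image fun x => edgeOf x.1 x.2
  have hL : ∀ e, e ∈ L ↔ quad e.1 e.2 ∈ S := by
    intro e
    simp only [L, Finset.mem_image, Finset.mem_product, Finite.mem_toFinset, Finset.mem_univ,
      and_true]
    constructor
    · rintro ⟨x, hx, rfl⟩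
      rwa [quad_edgeOf]
    · intro he
      exact ⟨(quad e.1 e.2, e.2), he, edgeOf_quad e⟩
  have h1 : ∑ c ∈ hS.toFinset, cellInt h f c = ∑ e ∈ L, edgeInt h f e := by
    rw [Finset.sum_image, Finset.sum_product]
    · rfl
    · rintro ⟨c, d⟩ _ ⟨c', d'⟩ _ heq
      simp only at heq
      have e1 := quad_edgeOf c d
      rw [heq, quad_edgeOf] at e1
      have e2 : (edgeOf c d).2 = (edgeOf c' d').2 := by rw [heq]
      exact Prod.ext e1.symm e2
  have h2 : (boundary_finite_of_finite hS).toFinset = L.filter fun e => quad e.1 (e.2 + 3) ∉ S := by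
    ext e
    simp [hL, boundary]
  rw [h1, h2, ← Finset.sum_filter_add_sum_filter_not L (fun e => quad e.1 (e.2 + 3) ∉ S),
    left_eq_add]
  refine Finset.sum_involution (fun e _ => rev e) ?_ ?_ ?_ ?_
  · intro e _
    rw [edgeInt_rev, add_neg_cancel]
  · intro e _ _ heq
    have : e.2 + 2 = e.2 := congrArg Prod.snd heq
    revert this
    generalize e.2 = d
    fin_cases d <;> simp
  · intro e he
    rw [Finset.mem_filter, hL, not_not] at he ⊢
    rw [(quad_rev e).1, (quad_rev e).2]
    exact he.symm
  · intro e _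
    exact rev_rev e

theorem edgeInt_zero (f : ℂ → ℂ) (p : ℤ × ℤ) : edgeInt h f (p, 0) =
    ∫ x in (vtx h p).re..(vtx h (p + (1, 0))).re, f (x + (vtx h p).im * Complex.I) := by
  have := intervalIntegral.smul_integral_comp_add_mul
    (fun x : ℝ => f (x + (vtx h p).im * Complex.I)) (a := 0) (b := 1) h (vtx h p).re
  have e2 : (vtx h (p + (1, 0))).re = (vtx h p).re + h * 1 := by simp [vtx]; ring
  rw [e2]
  rw [mul_zero, add_zero] at this
  rw [← this, edgeInt, ← intervalIntegral.integral_smul]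
  congr 1
  ext t
  have e1 : vec h ((p, 0) : (ℤ × ℤ) × Fin 4).2 = h := by
    apply Complex.ext <;> simp [vec, step]
  rw [e1, pt, e1, Complex.real_smul]
  congr 2
  apply Complex.ext <;> simp [vtx]; ring

theorem edgeInt_one (f : ℂ → ℂ) (p : ℤ × ℤ) : edgeInt h f (p, 1) =
    Complex.I * ∫ y in (vtx h p).im..(vtx h (p + (0, 1))).im, f ((vtx h p).re + y * Complex.I) := by
  have := intervalIntegral.smul_integral_comp_add_mul
    (fun y : ℝ => f ((vtx h p).re + y * Complex.I)) (a := 0) (b := 1) h (vtx h p).im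
  have e2 : (vtx h (p + (0, 1))).im = (vtx h p).im + h * 1 := by simp [vtx]; ring
  rw [e2]
  rw [mul_zero, add_zero] at this
  rw [← this, edgeInt, ← intervalIntegral.integral_smul, ← intervalIntegral.integral_const_mul]
  congr 1
  ext t
  have e1 : vec h ((p, 1) : (ℤ × ℤ) × Fin 4).2 = h * Complex.I := by
    apply Complex.ext <;> simp [vec, step]
  rw [e1, pt, e1, Complex.real_smul]
  have : vtx h p + t * (h * Complex.I) =
      (vtx h p).re + (((vtx h p).im + h * t : ℝ) : ℂ) * Complex.I := by
    apply Complex.ext <;> simp [vtx]; ring_nf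
  rw [this]
  ring

theorem cellInt_eq (f : ℂ → ℂ) (c : ℤ × ℤ) : cellInt h f c =
    (∫ x in (vtx h c).re..(vtx h (c + (1, 1))).re, f (x + (vtx h c).im * Complex.I)) -
    (∫ x in (vtx h c).re..(vtx h (c + (1, 1))).re, f (x + (vtx h (c + (1, 1))).im * Complex.I)) +
    Complex.I • (∫ y in (vtx h c).im..(vtx h (c + (1, 1))).im,
      f ((vtx h (c + (1, 1))).re + y * Complex.I)) -
    Complex.I • ∫ y in (vtx h c).im..(vtx h (c + (1, 1))).im, f ((vtx h c).re + y * Complex.I) := by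
  have r2 : edgeInt h f (edgeOf c 2) = - edgeInt h f (c + (0, 1), 0) := by
    rw [← edgeInt_rev]
    congr 1
    obtain ⟨a, b⟩ := c
    simp [edgeOf, rev, head, step]
  have r3 : edgeInt h f (edgeOf c 3) = - edgeInt h f (c, 1) := by
    rw [← edgeInt_rev]
    congr 1
  have r0 : edgeOf c 0 = (c, 0) := by simp [edgeOf]
  have r1 : edgeOf c 1 = (c + (1, 0), 1) := by simp [edgeOf]
  rw [cellInt, Fin.sum_univ_four, r0, r1, r2, r3, edgeInt_zero, edgeInt_zero, edgeInt_one,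
    edgeInt_one]
  obtain ⟨a, b⟩ := c
  simp only [vtx, Prod.mk_add_mk, add_zero, smul_eq_mul]
  ring

theorem cellInt_eq_zero (hh : 0 < h) {f : ℂ → ℂ} {c : ℤ × ℤ} (hf : DifferentiableOn ℂ f (cell h c)) :
    cellInt h f c = 0 := by
  rw [cellInt_eq]
  apply Complex.integral_boundary_rect_eq_zero_of_differentiableOn
  refine hf.mono fun z hz => ?_
  rw [Complex.mem_reProdIm] at hz
  have e1 : (vtx h c).re ≤ (vtx h (c + (1, 1))).re := by simp [vtx]; nlinarith
  have e2 : (vtx h c).im ≤ (vtx h (c + (1, 1))).im := by simp [vtx]; nlinarith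
  rw [uIcc_of_le e1, uIcc_of_le e2] at hz
  simp only [vtx, mem_Icc, Prod.fst_add, Prod.snd_add] at hz
  push_cast at hz
  obtain ⟨⟨h1, h2⟩, h3, h4⟩ := hz
  refine ⟨⟨?_, ?_⟩, ?_, ?_⟩
  · rw [le_div_iff₀' hh]; linarith
  · rw [div_le_iff₀' hh]; linarith
  · rw [← sub_le_iff_le_add, le_div_iff₀' hh]; linarith
  · rw [← le_sub_iff_add_le, div_le_iff₀' hh]; linarith

theorem edgeInt_inv (e : (ℤ × ℤ) × Fin 4) (z u : ℂ) (hu : u ≠ 0)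
    (hs : ∀ t ∈ Icc (0 : ℝ) 1, (pt h e t - z) * u ∈ Complex.slitPlane) :
    edgeInt h (fun w => (w - z)⁻¹) e =
      Complex.log ((vtx h (head e) - z) * u) - Complex.log ((vtx h e.1 - z) * u) := by
  have hd : ∀ t ∈ uIcc (0 : ℝ) 1, HasDerivAt (fun t : ℝ => Complex.log ((pt h e t - z) * u))
      (vec h e.2 * (pt h e t - z)⁻¹) t := by
    intro t ht
    rw [uIcc_of_le zero_le_one] at ht
    have h1 : HasDerivAt (fun t : ℝ => (pt h e t - z) * u) (vec h e.2 * u) t := by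
      have := hasDerivAt_pt h e 1 0 t
      simp only [one_mul, sub_zero, Complex.ofReal_one] at this
      exact (this.sub_const z).mul_const u
    have h0 : pt h e t - z ≠ 0 := fun h0 => Complex.slitPlane_ne_zero (hs t ht) (by simp [h0])
    convert h1.clog_real (hs t ht) using 1
    field_simp
  unfold edgeInt
  rw [intervalIntegral.integral_eq_sub_of_hasDerivAt hd, pt_one, pt_zero]
  refine ContinuousOn.intervalIntegrable ?_
  rw [uIcc_of_le zero_le_one]
  refine continuousOn_const.mul (ContinuousOn.inv₀ ?_ ?_)
  · exact ((continuous_pt h e).sub continuous_const).continuousOn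
  · exact fun t ht h0 => Complex.slitPlane_ne_zero (hs t ht) (by simp [h0])

theorem log_neg_sub_log {z : ℂ} (hz : z.im < 0) :
    Complex.log (-z) - Complex.log z = Real.pi * Complex.I := by
  rw [Complex.log, Complex.log, norm_neg, Complex.arg_neg_eq_arg_add_pi_of_im_neg hz]
  push_cast; ring

theorem cellInt_inv (hh : 0 < h) {c : ℤ × ℤ} {z : ℂ} (hz : z ∈ ocell h c) :
    cellInt h (fun w => (w - z)⁻¹) c = 2 * Real.pi * Complex.I := by
  obtain ⟨a, b⟩ := c
  obtain ⟨⟨h1, h2⟩, h3, h4⟩ := hz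
  rw [lt_div_iff₀' hh] at h1
  rw [div_lt_iff₀' hh] at h2
  rw [← sub_lt_iff_lt_add, lt_div_iff₀' hh] at h3
  rw [← lt_sub_iff_add_lt, div_lt_iff₀' hh] at h4
  simp only at h1 h2 h3 h4
  rw [cellInt, Fin.sum_univ_four]
  rw [edgeInt_inv (edgeOf (a, b) 0) z 1 one_ne_zero, edgeInt_inv (edgeOf (a, b) 1) z 1 one_ne_zero,
    edgeInt_inv (edgeOf (a, b) 2) z 1 one_ne_zero,
    edgeInt_inv (edgeOf (a, b) 3) z (-1) (neg_ne_zero.2 one_ne_zero)]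
  · have e1 := log_neg_sub_log (z := vtx h (a, b) - z) (by simp [vtx]; linarith)
    have e2 := log_neg_sub_log (z := -(vtx h (a, b + 1) - z)) (by simp [vtx]; linarith)
    rw [neg_neg] at e2
    simp [edgeOf, head, step] at e1 e2 ⊢
    linear_combination e1 + e2
  all_goals
    rintro t ⟨ht0, ht1⟩
    rw [Complex.mem_slitPlane_iff]
    have : h * t ≤ h := by nlinarith
    have : 0 ≤ h * t := by positivity
    simp [pt, vtx, vec, edgeOf, step]
  · left; linarith
  · right; intro; linarith
  · left; linarith
  · right; intro; linarith

end Grid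

namespace Grid

variable {S : Set (ℤ × ℤ)} {h : ℝ}

theorem sum_boundary_compl (hfin : (boundary S).Finite) (hfin' : (boundary Sᶜ).Finite)
    (f : ℂ → ℂ) :
    ∑ e ∈ hfin'.toFinset, edgeInt h f e = - ∑ e ∈ hfin.toFinset, edgeInt h f e := by
  classical
  have : hfin'.toFinset = hfin.toFinset.image rev := by
    ext e
    rw [Finite.mem_toFinset, boundary_compl]
    simp
  rw [this, Finset.sum_image, ← Finset.sum_neg_distrib]
  · exact Finset.sum_congr rfl fun e _ => edgeInt_rev h f e
  · intro e _ e' _ heq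
    rw [← rev_rev e, ← rev_rev e', heq]

theorem sum_boundary_eq_zero (hh : 0 < h) (hS : S.Finite) {f : ℂ → ℂ}
    (hf : DifferentiableOn ℂ f (region h S)) :
    ∑ e ∈ (boundary_finite_of_finite hS).toFinset, edgeInt h f e = 0 := by
  rw [sum_edgeInt_boundary hS]
  refine Finset.sum_eq_zero fun c hc => cellInt_eq_zero hh (hf.mono ?_)
  exact subset_biUnion_of_mem (u := cell h) (hS.mem_toFinset.1 hc)

theorem differentiableOn_inv_sub {s : Set ℂ} {z : ℂ} (hz : z ∉ s) :
    DifferentiableOn ℂ (fun w => (w - z)⁻¹) s := fun _ hw =>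
  ((differentiableAt_id.sub_const z).inv (sub_ne_zero.2 fun e => hz (e ▸ hw))).differentiableWithinAt

theorem sum_boundary_inv_of_mem_ocell (hh : 0 < h) (hS : S.Finite) {c : ℤ × ℤ} (hc : c ∈ S) {z : ℂ}
    (hz : z ∈ ocell h c) :
    ∑ e ∈ (boundary_finite_of_finite hS).toFinset, edgeInt h (fun w => (w - z)⁻¹) e =
      2 * Real.pi * Complex.I := by
  rw [sum_edgeInt_boundary hS, Finset.sum_eq_single_of_mem c (hS.mem_toFinset.2 hc),
    cellInt_inv hh hz]
  intro c' _ hne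
  refine cellInt_eq_zero hh (differentiableOn_inv_sub fun hz' => hne ?_)
  exact (eq_of_mem_ocell_of_mem_cell hz hz').symm

theorem continuousAt_edgeInt_inv {e : (ℤ × ℤ) × Fin 4} {z : ℂ} (hz : z ∉ pt h e '' Icc 0 1) :
    ContinuousAt (fun z => edgeInt h (fun w => (w - z)⁻¹) e) z := by
  have hcl : IsClosed (pt h e '' Icc 0 1) :=
    (isCompact_Icc.image (continuous_pt h e)).isClosed
  obtain ⟨δ, hδ, hball⟩ := Metric.isOpen_iff.1 hcl.isOpen_compl z hz
  have hb : ∀ z' ∈ Metric.ball z (δ / 2), ∀ t ∈ Icc (0 : ℝ) 1, δ / 2 ≤ ‖pt h e t - z'‖ := by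
    intro z' hz' t ht
    by_contra! hlt
    refine hball (?_ : pt h e t ∈ Metric.ball z δ) ⟨t, ht, rfl⟩
    rw [mem_ball_iff_norm] at hz' ⊢
    calc ‖pt h e t - z‖ = ‖(pt h e t - z') + (z' - z)‖ := by ring_nf
      _ ≤ _ := norm_add_le _ _
      _ < δ := by linarith
  unfold edgeInt
  refine intervalIntegral.continuousAt_of_dominated_interval
    (bound := fun _ => ‖vec h e.2‖ * (δ / 2)⁻¹) ?_ ?_ (by simp) ?_
  · filter_upwards [Metric.ball_mem_nhds z (half_pos hδ)] with z' hz'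
    rw [uIoc_of_le zero_le_one]
    refine ContinuousOn.aestronglyMeasurable ?_ measurableSet_Ioc
    refine continuousOn_const.mul (ContinuousOn.inv₀ ?_ ?_)
    · exact ((continuous_pt h e).sub continuous_const).continuousOn
    · intro t ht h0
      have := hb z' hz' t (Ioc_subset_Icc_self ht)
      rw [h0, norm_zero] at this
      linarith
  · filter_upwards [Metric.ball_mem_nhds z (half_pos hδ)] with z' hz'
    refine Eventually.of_forall fun t ht => ?_
    rw [uIoc_of_le zero_le_one] at ht
    rw [norm_mul, norm_inv]
    gcongr
    exact hb z' hz' t (Ioc_subset_Icc_self ht)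
  · refine Eventually.of_forall fun t ht => ?_
    rw [uIoc_of_le zero_le_one] at ht
    refine continuousAt_const.mul (ContinuousAt.inv₀ (by fun_prop) ?_)
    intro h0
    have := hb z (Metric.mem_ball_self (half_pos hδ)) t (Ioc_subset_Icc_self ht)
    rw [h0, norm_zero] at this
    linarith

theorem sum_boundary_inv_of_mem_dom (hh : 0 < h) (hS : S.Finite) {z : ℂ} (hz : z ∈ dom h S) :
    ∑ e ∈ (boundary_finite_of_finite hS).toFinset, edgeInt h (fun w => (w - z)⁻¹) e =
      2 * Real.pi * Complex.I := by
  obtain ⟨c, hc⟩ := exists_mem_cell h z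
  have hcS := mem_dom.1 hz c hc
  have hcl : z ∈ closure (ocell h c) := cell_subset_closure_ocell hh c hc
  have hcont : ContinuousAt (fun z => ∑ e ∈ (boundary_finite_of_finite hS).toFinset,
      edgeInt h (fun w => (w - z)⁻¹) e) z := by
    refine tendsto_finsetSum _ fun e he => continuousAt_edgeInt_inv fun hze => ?_
    rw [Finite.mem_toFinset] at he
    have : z ∈ region h S ∩ region h Sᶜ := by
      rw [region_inter_region_compl hh]
      exact mem_biUnion he hze
    exact hz this.2
  have : (𝓝[ocell h c] z).NeBot := mem_closure_iff_nhdsWithin_neBot.1 hcl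
  refine tendsto_nhds_unique (l := 𝓝[ocell h c] z) (hcont.tendsto.mono_left nhdsWithin_le_nhds)
    (tendsto_const_nhds.congr' (f₁ := fun _ => 2 * Real.pi * Complex.I) ?_)
  filter_upwards [self_mem_nhdsWithin] with w hw
  exact (sum_boundary_inv_of_mem_ocell hh hS hcS hw).symm

theorem exists_orientedBoundary (hh : 0 < h) (hS : S.Finite) (hN : NoDiagonal S) :
    ∃ (n : ℕ) (γ : Fin n → ℝ → ℂ), IsOrientedBoundary (dom h S) γ ∧
      ∀ f : ℂ → ℂ, DifferentiableOn ℂ f (region h S) →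
        ∑ k, ∫ t in (0 : ℝ)..1, deriv (γ k) t * f (γ k t) = 0 := by
  obtain ⟨n, γ, h1, h2, h3⟩ := exists_loops hh hN (boundary_finite_of_finite hS)
  have hfr : frontier (dom h S) = ⋃ k, γ k '' Icc 0 1 := by
    rw [frontier_dom hh, region_inter_region_compl hh, h2]
  have hedge : ∀ e ∈ boundary S, pt h e '' Icc 0 1 ⊆ region h S ∩ region h Sᶜ := by
    intro e he
    rw [region_inter_region_compl hh]
    exact subset_biUnion_of_mem (u := fun e => pt h e '' Icc 0 1) he
  have hw : ∀ z ∉ region h S ∩ region h Sᶜ, windingNumber γ z = (2 * Real.pi * Complex.I)⁻¹ *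
      ∑ e ∈ (boundary_finite_of_finite hS).toFinset, edgeInt h (fun w => (w - z)⁻¹) e := by
    intro z hz
    rw [← h3]
    · rfl
    · intro e he
      exact (differentiableOn_inv_sub fun hz' => hz (hedge e he hz')).continuousOn
  have hbd : Bornology.IsBounded (dom h S) := by
    obtain ⟨R, -, hR⟩ := exists_radius_of_finite hh hS
    exact Metric.isBounded_closedBall.subset (dom_subset_region.trans hR)
  refine ⟨n, γ, ⟨h1, hfr, fun _ => ⟨?_, ?_⟩, fun hu => absurd hbd hu⟩, ?_⟩
  · intro z hz
    rw [hw z fun h' => hz h'.2, sum_boundary_inv_of_mem_dom hh hS hz]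
    exact inv_mul_cancel₀ Complex.two_pi_I_ne_zero
  · intro z hz
    rw [closure_dom hh] at hz
    rw [hw z fun h' => hz h'.1, sum_boundary_eq_zero hh hS (differentiableOn_inv_sub hz), mul_zero]
  · intro f hf
    rw [h3 f, sum_boundary_eq_zero hh hS hf]
    intro e he
    exact hf.continuousOn.mono ((hedge e he).trans inter_subset_left)

theorem not_isBounded_dom_compl (hh : 0 < h) (hS : S.Finite) :
    ¬ Bornology.IsBounded (dom h Sᶜ) := by
  intro hb
  obtain ⟨R, -, hR⟩ := exists_radius_of_finite hh hS
  have h1 : Bornology.IsBounded (univ : Set ℂ) := by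
    have : dom h Sᶜ ∪ region h S = univ := by rw [dom, compl_compl, compl_union_self]
    rw [← this]
    exact hb.union (Metric.isBounded_closedBall.subset hR)
  exact NormedSpace.unbounded_univ ℂ ℂ h1

theorem exists_orientedBoundary_compl (hh : 0 < h) (hS : S.Finite) (hN : NoDiagonal S) :
    ∃ (n : ℕ) (γ : Fin n → ℝ → ℂ), IsOrientedBoundary (dom h Sᶜ) γ := by
  have hfin := boundary_finite_of_finite hS
  have hfin' : (boundary Sᶜ).Finite := boundary_finite (Or.inr (by rwa [compl_compl]))
  obtain ⟨n, γ, h1, h2, h3⟩ := exists_loops hh hN.compl hfin'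
  have hfr : frontier (dom h Sᶜ) = ⋃ k, γ k '' Icc 0 1 := by
    rw [frontier_dom hh, region_inter_region_compl hh, h2]
  have hedge : ∀ e ∈ boundary Sᶜ, pt h e '' Icc 0 1 ⊆ region h Sᶜ ∩ region h S := by
    intro e he
    have := region_inter_region_compl hh (S := Sᶜ)
    rw [compl_compl] at this
    rw [this]
    exact subset_biUnion_of_mem (u := fun e => pt h e '' Icc 0 1) he
  have hw : ∀ z ∉ region h Sᶜ ∩ region h S, windingNumber γ z = (2 * Real.pi * Complex.I)⁻¹ *
      - ∑ e ∈ hfin.toFinset, edgeInt h (fun w => (w - z)⁻¹) e := by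
    intro z hz
    rw [← sum_boundary_compl hfin hfin', ← h3]
    · rfl
    · intro e he
      exact (differentiableOn_inv_sub fun hz' => hz (hedge e he hz')).continuousOn
  refine ⟨n, γ, h1, hfr, fun hb => absurd hb (not_isBounded_dom_compl hh hS), fun _ => ⟨?_, ?_⟩⟩
  · intro z hz
    have hz' : z ∉ region h S := by rwa [dom, compl_compl] at hz
    rw [hw z fun h' => hz' h'.2, sum_boundary_eq_zero hh hS (differentiableOn_inv_sub hz')]
    simp
  · intro z hz
    rw [closure_dom hh] at hz
    rw [hw z fun h' => hz h'.1, sum_boundary_inv_of_mem_dom hh hS hz, mul_neg,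
      inv_mul_cancel₀ Complex.two_pi_I_ne_zero]

/-- The squares of the bricks that meet `C`; a brick consists of two adjacent squares of a row,
and the rows are shifted against each other. -/
def bricks (h : ℝ) (C : Set ℂ) : Set (ℤ × ℤ) :=
  {c | ∃ c' : ℤ × ℤ, c'.2 = c.2 ∧ (c'.1 - c'.2) / 2 = (c.1 - c.2) / 2 ∧ (cell h c' ∩ C).Nonempty}

theorem noDiagonal_bricks (C : Set ℂ) : NoDiagonal (bricks h C) := by
  have key : ∀ c₁ c₂ : ℤ × ℤ, c₁.2 = c₂.2 → (c₁.1 - c₁.2) / 2 = (c₂.1 - c₂.2) / 2 →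
      c₁ ∈ bricks h C → c₂ ∈ bricks h C := by
    rintro c₁ c₂ h1 h2 ⟨c, h3, h4, h5⟩
    exact ⟨c, h3.trans h1, h4.trans h2, h5⟩
  rintro ⟨a, b⟩ d ⟨h0, h1, h2, h3⟩
  rcases Int.emod_two_eq_zero_or_one (a - b) with hab | hab
  · have k1 := key (quad (a, b) 2) (quad (a, b) 3) (by simp [quad]) (by simp [quad]; omega)
    have k2 := key (quad (a, b) 3) (quad (a, b) 2) (by simp [quad]) (by simp [quad]; omega)
    fin_cases d
    · exact h3 (k1 h2)
    · exact h1 (k2 h2)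
    · exact h1 (k1 h0)
    · exact h3 (k2 h0)
  · have k1 := key (quad (a, b) 0) (quad (a, b) 1) (by simp [quad]) (by simp [quad]; omega)
    have k2 := key (quad (a, b) 1) (quad (a, b) 0) (by simp [quad]) (by simp [quad]; omega)
    fin_cases d
    · exact h1 (k1 h0)
    · exact h3 (k2 h0)
    · exact h3 (k1 h2)
    · exact h1 (k2 h2)

theorem finite_bricks (hh : 0 < h) {C : Set ℂ} (hC : Bornology.IsBounded C) :
    (bricks h C).Finite := by
  obtain ⟨R, hR⟩ := hC.subset_closedBall 0
  refine (((finite_cells_meeting hh R).prod (finite_Icc (-1 : ℤ) 1)).image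
    fun x => x.1 + (x.2, 0)).subset ?_
  rintro ⟨a, b⟩ ⟨⟨a', b'⟩, h1, h2, h3⟩
  simp only at h1 h2
  refine ⟨((a', b'), a - a'), ⟨h3.mono (inter_subset_inter_right _ hR), ?_, ?_⟩, ?_⟩
  · simp only; omega
  · simp only; omega
  · simp [h1]

theorem subset_dom_bricks (C : Set ℂ) : C ⊆ dom h (bricks h C) := by
  intro z hz
  rw [mem_dom]
  exact fun c hc => ⟨c, rfl, rfl, z, hc, hz⟩

theorem region_bricks_subset (hh : 0 < h) {C : Set ℂ} :
    region h (bricks h C) ⊆ Metric.thickening (4 * h) C := by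
  intro z hz
  obtain ⟨⟨a, b⟩, ⟨⟨a', b'⟩, h1, h2, w, hw, hwC⟩, hz⟩ := mem_region.1 hz
  rw [Metric.mem_thickening_iff]
  refine ⟨w, hwC, ?_⟩
  simp only at h1 h2
  subst h1
  obtain ⟨⟨a1, a2⟩, a3, a4⟩ := hz
  obtain ⟨⟨b1, b2⟩, b3, b4⟩ := hw
  simp only at a1 a2 a3 a4 b1 b2 b3 b4
  have k1 : (a : ℝ) ≤ a' + 1 := by exact_mod_cast (by omega : a ≤ a' + 1)
  have k2 : (a' : ℝ) ≤ a + 1 := by exact_mod_cast (by omega : a' ≤ a + 1)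
  have f1 : |(z - w).re / h| ≤ 2 := by
    rw [Complex.sub_re, sub_div, abs_le]; constructor <;> linarith
  have f2 : |(z - w).im / h| ≤ 1 := by
    rw [Complex.sub_im, sub_div, abs_le]; constructor <;> linarith
  rw [abs_div, abs_of_pos hh, div_le_iff₀' hh] at f1 f2
  rw [dist_eq_norm]
  have := Complex.norm_le_abs_re_add_abs_im (z - w)
  linarith

theorem conj_mem_cell {z : ℂ} {a b : ℤ} :
    (starRingEnd ℂ) z ∈ cell h (a, b) ↔ z ∈ cell h (a, -b) := by
  simp only [cell, mem_ofPred_eq, Complex.conj_re, Complex.conj_im, neg_div]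
  push_cast
  refine and_congr_right fun _ => ⟨fun ⟨h1, h2⟩ => ⟨?_, ?_⟩, fun ⟨h1, h2⟩ => ⟨?_, ?_⟩⟩ <;> linarith

theorem neg_mem_bricks {C : Set ℂ} (hC : ∀ z ∈ C, (starRingEnd ℂ) z ∈ C) {a b : ℤ}
    (hab : (a, b) ∈ bricks h C) : (a, -b) ∈ bricks h C := by
  obtain ⟨⟨a', b'⟩, h1, h2, z, hz, hzC⟩ := hab
  simp only at h1 h2
  refine ⟨(a', -b'), by simp only; omega, by simp only; omega, (starRingEnd ℂ) z, ?_, hC z hzC⟩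
  rw [conj_mem_cell, neg_neg]
  exact hz

theorem conj_mem_dom {S : Set (ℤ × ℤ)} (hS : ∀ a b, (a, b) ∈ S → (a, -b) ∈ S) {z : ℂ}
    (hz : z ∈ dom h S) : (starRingEnd ℂ) z ∈ dom h S := by
  rw [mem_dom] at hz ⊢
  rintro ⟨a, b⟩ hc
  have := hS _ _ (hz _ (conj_mem_cell.1 hc))
  rwa [neg_neg] at this

theorem isCauchyDomain_dom (hh : 0 < h) (hS : S.Finite ∨ Sᶜ.Finite) (hN : NoDiagonal S)
    (hγ : ∃ (n : ℕ) (γ : Fin n → ℝ → ℂ), IsOrientedBoundary (dom h S) γ) :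
    IsCauchyDomain (dom h S) :=
  ⟨isOpen_dom hh S, finite_components hh hS, pairwise_components hh hN, hγ⟩

/-- Between a compact set and an open set there is a bounded Cauchy domain. -/
theorem exists_bounded_cauchyDomain {C O : Set ℂ} (hC : IsCompact C) (hO : IsOpen O) (hCO : C ⊆ O) :
    ∃ (W : Set ℂ) (n : ℕ) (γ : Fin n → ℝ → ℂ), IsCauchyDomain W ∧ C ⊆ W ∧ closure W ⊆ O ∧
      Bornology.IsBounded W ∧ IsOrientedBoundary W γ ∧
      (∀ f : ℂ → ℂ, DifferentiableOn ℂ f O →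
        ∑ k, ∫ t in (0 : ℝ)..1, deriv (γ k) t * f (γ k t) = 0) ∧
      ((∀ z ∈ C, (starRingEnd ℂ) z ∈ C) → ∀ z ∈ W, (starRingEnd ℂ) z ∈ W) := by
  obtain ⟨δ, hδ, hsub⟩ := hC.exists_thickening_subset_open hO hCO
  have hh : 0 < δ / 4 := by positivity
  have hS := finite_bricks hh hC.isBounded
  obtain ⟨n, γ, h1, h2⟩ := exists_orientedBoundary hh hS (noDiagonal_bricks C)
  have hreg : region (δ / 4) (bricks (δ / 4) C) ⊆ O := by
    refine (region_bricks_subset hh).trans ?_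
    rwa [mul_div_cancel₀ _ four_ne_zero]
  refine ⟨dom (δ / 4) (bricks (δ / 4) C), n, γ,
    isCauchyDomain_dom hh (Or.inl hS) (noDiagonal_bricks C) ⟨n, γ, h1⟩, subset_dom_bricks C, ?_, ?_,
    h1, fun f hf => h2 f (hf.mono hreg), fun hsym z hz => ?_⟩
  · rwa [closure_dom hh]
  · obtain ⟨R, -, hR⟩ := exists_radius_of_finite hh hS
    exact Metric.isBounded_closedBall.subset (dom_subset_region.trans hR)
  · exact conj_mem_dom (fun a b => neg_mem_bricks hsym) hz

/-- Between the complement of an open set and the complement of a compact set there is an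
unbounded Cauchy domain. -/
theorem exists_unbounded_cauchyDomain {C O : Set ℂ} (hC : IsCompact C) (hO : IsOpen O)
    (hCO : C ⊆ O) :
    ∃ (W : Set ℂ) (n : ℕ) (γ : Fin n → ℝ → ℂ), IsCauchyDomain W ∧ Oᶜ ⊆ W ∧ closure W ⊆ Cᶜ ∧
      ¬ Bornology.IsBounded W ∧ IsOrientedBoundary W γ ∧
      ((∀ z ∈ C, (starRingEnd ℂ) z ∈ C) → ∀ z ∈ W, (starRingEnd ℂ) z ∈ W) := by
  obtain ⟨δ, hδ, hsub⟩ := hC.exists_thickening_subset_open hO hCO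
  have hh : 0 < δ / 4 := by positivity
  have hS := finite_bricks hh hC.isBounded
  obtain ⟨n, γ, h1⟩ := exists_orientedBoundary_compl hh hS (noDiagonal_bricks C)
  have hreg : region (δ / 4) (bricks (δ / 4) C) ⊆ O := by
    refine (region_bricks_subset hh).trans ?_
    rwa [mul_div_cancel₀ _ four_ne_zero]
  refine ⟨dom (δ / 4) (bricks (δ / 4) C)ᶜ, n, γ,
    isCauchyDomain_dom hh (Or.inr (by rwa [compl_compl])) (noDiagonal_bricks C).compl ⟨n, γ, h1⟩,
    ?_, ?_, not_isBounded_dom_compl hh hS, h1, fun hsym z hz => ?_⟩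
  · rw [dom, compl_compl]
    exact compl_subset_compl.2 hreg
  · rw [closure_dom hh]
    have := subset_dom_bricks (h := δ / 4) C
    rw [dom] at this
    exact subset_compl_comm.1 this
  · refine conj_mem_dom (S := (bricks (δ / 4) C)ᶜ) (fun a b hab hab' => hab ?_) hz
    have := neg_mem_bricks hsym hab'
    rwa [neg_neg] at this

end Grid

namespace RieszDunford

theorem continuousOn_of_isPiecewiseC1Jordan {γ : ℝ → ℂ} (h : IsPiecewiseC1Jordan γ) :
    ContinuousOn γ (Icc 0 1) := by
  obtain ⟨⟨m, t, hmono, h0, h1, hd⟩, -, -⟩ := h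
  have key : ∀ k ≤ m, ContinuousOn γ (Icc (t 0) (t k)) := by
    intro k
    induction k with
    | zero => intro _; simp
    | succ k ih =>
      intro hk
      rw [← Icc_union_Icc_eq_Icc (hmono (Nat.zero_le k)) (hmono (Nat.le_succ k))]
      exact (ih (by omega)).union_of_isClosed (hd k (by omega)).continuousOn isClosed_Icc isClosed_Icc
  have := key m le_rfl
  rwa [h0, h1] at this

theorem intervalIntegrable_deriv {γ : ℝ → ℂ} (h : IsPiecewiseC1Jordan γ) :
    IntervalIntegrable (deriv γ) volume 0 1 := by
  obtain ⟨⟨m, t, hmono, h0, h1, hd⟩, -, -⟩ := h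
  rw [← h0, ← h1]
  refine IntervalIntegrable.trans_iterate fun k hk => ?_
  rcases (hmono (Nat.le_succ k)).eq_or_lt with he | hlt
  · rw [← Nat.succ_eq_add_one, ← he]
  · have hc : ContinuousOn (derivWithin γ (Icc (t k) (t (k + 1)))) (Icc (t k) (t (k + 1))) :=
      (hd k hk).continuousOn_derivWithin (uniqueDiffOn_Icc hlt) le_rfl
    refine (hc.intervalIntegrable_of_Icc hlt.le).congr_uIoo fun x hx => ?_
    rw [uIoo_of_le hlt.le] at hx
    exact derivWithin_of_mem_nhds (Icc_mem_nhds hx.1 hx.2)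

/-- Finitely many piecewise continuously differentiable closed curves as a path. -/
noncomputable def ofCurves {n : ℕ} (γ : Fin n → ℝ → ℂ) (h : ∀ k, IsPiecewiseC1Jordan (γ k)) :
    Path where
  S := Fin n × ℝ
  μ := Measure.count.prod (volume.restrict (Ioc 0 1))
  p := fun q => γ q.1 (projIcc 0 1 zero_le_one q.2)
  d := fun q => deriv (γ q.1) q.2
  supp := ⋃ k, γ k '' Icc 0 1
  compact := isCompact_iUnion fun k =>
    isCompact_Icc.image_of_continuousOn (continuousOn_of_isPiecewiseC1Jordan (h k))
  meas := by
    refine measurable_from_prod_countable_right fun k => ?_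
    have : Continuous fun t : ℝ => γ k (projIcc 0 1 zero_le_one t) :=
      (continuousOn_of_isPiecewiseC1Jordan (h k)).comp_continuous
        (continuous_subtype_val.comp continuous_projIcc) fun t => (projIcc 0 1 zero_le_one t).2
    exact this.measurable
  mem := fun q => mem_iUnion.2 ⟨q.1, _, Subtype.prop _, rfl⟩
  int := by
    have hm : Measurable fun q : Fin n × ℝ => deriv (γ q.1) q.2 :=
      measurable_from_prod_countable_right fun k => measurable_deriv (γ k)
    rw [integrable_prod_iff hm.aestronglyMeasurable]
    refine ⟨Eventually.of_forall fun k => ?_, Integrable.of_finite⟩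
    exact (intervalIntegrable_iff_integrableOn_Ioc_of_le zero_le_one).1
      (intervalIntegrable_deriv (h k))

variable {E : Type*} [NormedAddCommGroup E] [NormedSpace ℂ E]
  [CompleteSpace E]

theorem integ_ofCurves {n : ℕ} {γ : Fin n → ℝ → ℂ} (h : ∀ k, IsPiecewiseC1Jordan (γ k))
    {f : ℂ → E} (hf : ContinuousOn f (⋃ k, γ k '' Icc 0 1)) :
    (ofCurves γ h).integ f = ∑ k, ∫ t in (0 : ℝ)..1, deriv (γ k) t • f (γ k t) := by
  have hi : Integrable
      (fun q : Fin n × ℝ => deriv (γ q.1) q.2 • f (γ q.1 (projIcc 0 1 zero_le_one q.2)))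
      (Measure.count.prod (volume.restrict (Ioc 0 1))) := (ofCurves γ h).integrable hf
  have he : (ofCurves γ h).integ f = ∫ q : Fin n × ℝ,
      deriv (γ q.1) q.2 • f (γ q.1 (projIcc 0 1 zero_le_one q.2))
      ∂(Measure.count.prod (volume.restrict (Ioc 0 1))) := rfl
  rw [he, integral_prod _ hi, integral_countable Integrable.of_finite]
  simp only [measureReal_def, Measure.count_singleton, ENNReal.toReal_one, one_smul]
  rw [tsum_fintype]
  refine Finset.sum_congr rfl fun k _ => ?_
  rw [intervalIntegral.integral_of_le zero_le_one]
  refine setIntegral_congr_fun measurableSet_Ioc fun t ht => ?_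
  rw [projIcc_of_mem _ (Ioc_subset_Icc_self ht)]

theorem ind_ofCurves {n : ℕ} {γ : Fin n → ℝ → ℂ} (h : ∀ k, IsPiecewiseC1Jordan (γ k))
    {z : ℂ} (hz : z ∉ ⋃ k, γ k '' Icc 0 1) : (ofCurves γ h).ind z = windingNumber γ z := by
  rw [Path.ind, integ_ofCurves h (Grid.differentiableOn_inv_sub hz).continuousOn]
  simp only [windingNumber, smul_eq_mul, div_eq_mul_inv]

theorem Path.norm_ind_lt_one (Γ : Path) : ∀ᶠ z in Bornology.cobounded ℂ, ‖Γ.ind z‖ < 1 := by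
  obtain ⟨R, hR⟩ := Γ.compact.isBounded.exists_norm_le
  set A := ∫ s, ‖Γ.d s‖ ∂Γ.μ
  have hA : 0 ≤ A := integral_nonneg fun _ => norm_nonneg _
  filter_upwards [tendsto_norm_cobounded_atTop.eventually_gt_atTop (R + (A + 1))] with z hz
  have h1 : ‖Γ.integ (fun w => (w - z)⁻¹)‖ ≤ A * (A + 1)⁻¹ := by
    refine Γ.norm_integ_le fun w hw => ?_
    rw [norm_inv]
    have := norm_sub_norm_le z w
    rw [norm_sub_rev] at this
    gcongr
    linarith [hR w hw]
  have h2 : A * (A + 1)⁻¹ < 1 := by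
    rw [← div_eq_mul_inv, div_lt_one (by linarith)]; linarith
  have h3 : ‖((2 * Real.pi * Complex.I)⁻¹ : ℂ)‖ ≤ 1 := by
    rw [norm_inv]
    apply inv_le_one_of_one_le₀
    simp [abs_of_pos Real.pi_pos]
    linarith [Real.pi_gt_three]
  rw [Path.ind, norm_mul]
  calc _ ≤ 1 * ‖Γ.integ (fun w => (w - z)⁻¹)‖ := by gcongr
    _ < 1 := by linarith

theorem ind_ofCurves_mem {W : Set ℂ} {n : ℕ} {γ : Fin n → ℝ → ℂ}
    (hγ : IsOrientedBoundary W γ) :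
    ∃ κ : ℂ, (κ = 0 ∨ κ = 1) ∧ (κ = 0 ↔ Bornology.IsBounded W) ∧
      (∀ z ∈ W, z ∉ frontier W → (ofCurves γ hγ.1).ind z = 1 - κ) ∧
      ∀ z ∉ closure W, (ofCurves γ hγ.1).ind z = -κ := by
  obtain ⟨h1, h2, h3, h4⟩ := hγ
  by_cases hb : Bornology.IsBounded W
  · refine ⟨0, Or.inl rfl, by simp [hb], fun z hz hz' => ?_, fun z hz => ?_⟩
    · rw [ind_ofCurves h1 (h2 ▸ hz'), (h3 hb).1 z hz, sub_zero]
    · rw [ind_ofCurves h1 (h2 ▸ fun h => hz (frontier_subset_closure h)), (h3 hb).2 z hz, neg_zero]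
  · refine ⟨1, Or.inr rfl, by simp [hb], fun z hz hz' => ?_, fun z hz => ?_⟩
    · rw [ind_ofCurves h1 (h2 ▸ hz'), (h4 hb).1 z hz, sub_self]
    · rw [ind_ofCurves h1 (h2 ▸ fun h => hz (frontier_subset_closure h)), (h4 hb).2 z hz]

/-- The oriented boundary of an open set as a cycle. -/
noncomputable def boundaryCycle {W : Set ℂ} (hW : IsOpen W) {n : ℕ} {γ : Fin n → ℝ → ℂ}
    (hγ : IsOrientedBoundary W γ) : Cycle where
  toPath := ofCurves γ hγ.1
  ind_loc := by
    intro z hz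
    obtain ⟨κ, -, -, h1, h2⟩ := ind_ofCurves_mem hγ
    replace hz : z ∉ frontier W := hγ.2.1 ▸ hz
    have hdis := disjoint_frontier_iff_isOpen.2 hW
    by_cases hzW : z ∈ W
    · filter_upwards [hW.mem_nhds hzW] with w hw
      rw [h1 z hzW hz, h1 w hw (fun h => hdis.le_bot ⟨h, hw⟩)]
    · have hz' : z ∉ closure W := fun h => hz (by rw [hW.frontier_eq]; exact ⟨h, hzW⟩)
      filter_upwards [isClosed_closure.isOpen_compl.mem_nhds hz'] with w hw
      rw [h2 z hz', h2 w hw]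
  ind_far := by
    obtain ⟨κ, hκ, -, h1, h2⟩ := ind_ofCurves_mem hγ
    have hfr : IsCompact (frontier W) := hγ.2.1 ▸ (ofCurves γ hγ.1).compact
    filter_upwards [(ofCurves γ hγ.1).norm_ind_lt_one, Bornology.isBounded_def.1 hfr.isBounded]
      with z hz hzf
    rcases hκ with rfl | rfl <;> by_cases hzW : z ∈ W
    · rw [h1 z hzW hzf] at hz; simp at hz
    · have hz' : z ∉ closure W := fun h => hzf (by rw [hW.frontier_eq]; exact ⟨h, hzW⟩)
      simpa using h2 z hz'
    · simpa using h1 z hzW hzf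
    · have hz' : z ∉ closure W := fun h => hzf (by rw [hW.frontier_eq]; exact ⟨h, hzW⟩)
      rw [h2 z hz'] at hz; simp at hz

theorem boundaryCycle_supp {W : Set ℂ} (hW : IsOpen W) {n : ℕ} {γ : Fin n → ℝ → ℂ}
    (hγ : IsOrientedBoundary W γ) : (boundaryCycle hW hγ).supp = frontier W := hγ.2.1.symm

theorem integ_boundaryCycle {W : Set ℂ} (hW : IsOpen W) {n : ℕ} {γ : Fin n → ℝ → ℂ}
    (hγ : IsOrientedBoundary W γ) {f : ℂ → E} (hf : ContinuousOn f (frontier W)) :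
    (boundaryCycle hW hγ).integ f = ∑ k, ∫ t in (0 : ℝ)..1, deriv (γ k) t • f (γ k t) :=
  integ_ofCurves hγ.1 (hγ.2.1 ▸ hf)

theorem boundaryCycle_ind {W : Set ℂ} (hW : IsOpen W) {n : ℕ} {γ : Fin n → ℝ → ℂ}
    (hγ : IsOrientedBoundary W γ) :
    ∃ κ : ℂ, (κ = 0 ∨ κ = 1) ∧ (κ = 0 ↔ Bornology.IsBounded W) ∧
      (∀ z ∈ W, (boundaryCycle hW hγ).ind z = 1 - κ) ∧
      ∀ z ∉ closure W, (boundaryCycle hW hγ).ind z = -κ := by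
  obtain ⟨κ, h0, h1, h2, h3⟩ := ind_ofCurves_mem hγ
  have hdis := disjoint_frontier_iff_isOpen.2 hW
  exact ⟨κ, h0, h1, fun z hz => h2 z hz fun h => hdis.le_bot ⟨h, hz⟩, h3⟩

/-- The circle as a path. -/
noncomputable def circlePath (c : ℂ) (R : ℝ) : Path where
  S := ℝ
  μ := volume.restrict (Ioc 0 (2 * Real.pi))
  p := circleMap c R
  d := deriv (circleMap c R)
  supp := Metric.sphere c |R|
  compact := isCompact_sphere _ _
  meas := (continuous_circleMap c R).measurable
  mem := fun t => circleMap_mem_sphere' c R t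
  int := by
    have : Continuous (deriv (circleMap c R)) := by
      rw [funext (deriv_circleMap c R)]
      exact (continuous_circleMap 0 R).mul continuous_const
    exact this.continuousOn.integrableOn_Icc.mono_set Ioc_subset_Icc_self

theorem integ_circlePath (c : ℂ) (R : ℝ) (f : ℂ → E) :
    (circlePath c R).integ f = ∮ z in C(c, R), f z := by
  rw [circleIntegral, intervalIntegral.integral_of_le Real.two_pi_pos.le]
  rfl

theorem ind_circlePath_inside {c : ℂ} {R : ℝ} {z : ℂ} (hz : z ∈ Metric.ball c R) :
    (circlePath c R).ind z = 1 := by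
  rw [Path.ind, integ_circlePath, circleIntegral.integral_sub_inv_of_mem_ball hz]
  exact inv_mul_cancel₀ Complex.two_pi_I_ne_zero

theorem ind_circlePath_outside {c : ℂ} {R : ℝ} (hR : 0 < R) {z : ℂ}
    (hz : z ∉ Metric.closedBall c R) : (circlePath c R).ind z = 0 := by
  rw [Path.ind, integ_circlePath, DiffContOnCl.circleIntegral_eq_zero hR.le, mul_zero]
  refine (Grid.differentiableOn_inv_sub ?_).diffContOnCl
  rwa [closure_ball _ hR.ne']

/-- The circle as a cycle. -/
noncomputable def circleCycle (c : ℂ) {R : ℝ} (hR : 0 < R) : Cycle where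
  toPath := circlePath c R
  ind_loc := by
    intro z hz
    have hz' : dist z c ≠ R := by
      rw [← abs_of_pos hR]; exact hz
    rcases hz'.lt_or_gt with h | h
    · filter_upwards [Metric.isOpen_ball.mem_nhds (Metric.mem_ball.2 h)] with w hw
      rw [ind_circlePath_inside hw, ind_circlePath_inside (Metric.mem_ball.2 h)]
    · have h' : z ∉ Metric.closedBall c R := by rwa [Metric.mem_closedBall, not_le]
      filter_upwards [Metric.isClosed_closedBall.isOpen_compl.mem_nhds h'] with w hw
      rw [ind_circlePath_outside hR hw, ind_circlePath_outside hR h']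
  ind_far := by
    filter_upwards [Bornology.isBounded_def.1 (Metric.isBounded_closedBall (x := c) (r := R))] with z hz
    exact ind_circlePath_outside hR hz

/-- **Cauchy's theorem**, homology version, for scalar functions. -/
theorem sum_integ_eq_zero_scalar {ι : Type*} [Fintype ι] (Γ : ι → Cycle) (c : ι → ℂ) {Ω : Set ℂ}
    (hΩ : IsOpen Ω) (hsupp : ∀ j, (Γ j).supp ⊆ Ω) (hind : ∀ z ∉ Ω, ∑ j, c j * (Γ j).ind z = 0)
    {f : ℂ → ℂ} (hf : DifferentiableOn ℂ f Ω) : ∑ j, c j * (Γ j).integ f = 0 := by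
  let K : Set ℂ := (⋃ j, (Γ j).supp) ∪ {z | ∑ j, c j * (Γ j).ind z ≠ 0}
  have hKΩ : K ⊆ Ω := by
    rintro z (hz | hz)
    · exact iUnion_subset hsupp hz
    · by_contra h
      exact hz (hind z h)
  have hKc : IsCompact K := by
    refine Metric.isCompact_of_isClosed_isBounded ?_ ?_
    · rw [← isOpen_compl_iff, isOpen_iff_mem_nhds]
      intro z hz
      simp only [K, mem_compl_iff, mem_union, mem_iUnion, mem_ofPred_eq, not_or, not_exists,
        not_not] at hz
      have h1 : ∀ᶠ w in 𝓝 z, ∀ j, w ∉ (Γ j).supp ∧ (Γ j).ind w = (Γ j).ind z := by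
        rw [eventually_all]
        intro j
        have h2 : ∀ᶠ w in 𝓝 z, w ∉ (Γ j).supp := (Γ j).compact.isClosed.isOpen_compl.mem_nhds (hz.1 j)
        exact h2.and ((Γ j).ind_loc z (hz.1 j))
      filter_upwards [h1] with w hw
      simp only [K, mem_compl_iff, mem_union, mem_iUnion, mem_ofPred_eq, not_or, not_exists,
        not_not]
      refine ⟨fun j => (hw j).1, ?_⟩
      rw [← hz.2]
      exact Finset.sum_congr rfl fun j _ => by rw [(hw j).2]
    · refine Bornology.IsBounded.union ?_ ?_
      · exact (isCompact_iUnion fun j => (Γ j).compact).isBounded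
      · rw [Bornology.isBounded_def]
        have h1 : ∀ᶠ w in Bornology.cobounded ℂ, ∀ j, (Γ j).ind w = 0 :=
          eventually_all.2 fun j => (Γ j).ind_far
        filter_upwards [h1] with w hw
        simp [hw]
  obtain ⟨W, n, γ, hW, hKW, hWΩ, hWb, hγ, hnull, -⟩ :=
    Grid.exists_bounded_cauchyDomain hKc hΩ hKΩ
  let Γ₀ := boundaryCycle hW.1 hγ
  have hs0 : Γ₀.supp = frontier W := boundaryCycle_supp hW.1 hγ
  have hsΩ : Γ₀.supp ⊆ Ω := hs0 ▸ frontier_subset_closure.trans hWΩ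
  have hdis : ∀ w ∈ W, w ∉ Γ₀.supp := fun w hw h =>
    (disjoint_frontier_iff_isOpen.2 hW.1).le_bot ⟨hs0 ▸ h, hw⟩
  obtain ⟨κ, -, hκ, hin, -⟩ := boundaryCycle_ind hW.1 hγ
  have hκ0 := hκ.2 hWb
  subst hκ0
  have hcauchy : ∀ w ∈ K, f w = (2 * Real.pi * Complex.I)⁻¹ *
      Γ₀.integ (fun z => (z - w)⁻¹ * f z) := by
    intro w hw
    have hwW := hKW hw
    have hd : DifferentiableOn ℂ (dslope f w) Ω :=
      (Complex.differentiableOn_dslope (hΩ.mem_nhds (hKΩ hw))).2 hf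
    have hc : ∀ {g : ℂ → ℂ}, ContinuousOn g Ω → ContinuousOn (fun z => (z - w)⁻¹ * g z) Γ₀.supp :=
      fun hg => (Grid.differentiableOn_inv_sub (hdis w hwW)).continuousOn.mul (hg.mono hsΩ)
    have h1 : Γ₀.integ (dslope f w) = 0 := by
      rw [integ_boundaryCycle hW.1 hγ (hs0 ▸ hd.continuousOn.mono hsΩ)]
      exact hnull _ hd
    have h2 : EqOn (dslope f w) (fun z => (z - w)⁻¹ * f z - (z - w)⁻¹ * f w) Γ₀.supp := by
      intro z hz
      have hzw : z ≠ w := fun e => hdis w hwW (e ▸ hz)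
      rw [dslope_of_ne _ hzw, slope_def_field]
      field_simp
    rw [Γ₀.integ_congr h2, Γ₀.integ_sub (hc hf.continuousOn) (hc continuousOn_const), sub_eq_zero]
      at h1
    have h3 : Γ₀.integ (fun z => (z - w)⁻¹ * f w) = Γ₀.integ (fun z => (z - w)⁻¹) * f w :=
      Γ₀.integ_smul_const (Grid.differentiableOn_inv_sub (hdis w hwW)).continuousOn (f w)
    rw [h1, h3, ← mul_assoc]
    have h4 : Γ₀.ind w = 1 := by rw [hin w hwW, sub_zero]
    rw [Path.ind] at h4
    rw [h4, one_mul]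
  have hkc : ∀ j, ContinuousOn (Function.uncurry fun w z : ℂ => (z - w)⁻¹ * f z)
      ((Γ j).supp ×ˢ Γ₀.supp) := by
    intro j
    refine ContinuousOn.mul (ContinuousOn.inv₀ (by fun_prop) ?_) ?_
    · rintro ⟨w, z⟩ ⟨hw, hz⟩ h0
      refine hdis w (hKW (Or.inl (mem_iUnion.2 ⟨j, hw⟩))) ?_
      rw [sub_eq_zero] at h0
      simp only at h0
      exact h0 ▸ hz
    · exact hf.continuousOn.comp continuousOn_snd fun q hq => hsΩ hq.2
  have h1 : ∀ j, (Γ j).integ f = (2 * Real.pi * Complex.I)⁻¹ *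
      Γ₀.integ (fun z => (Γ j).integ fun w => (z - w)⁻¹ * f z) := by
    intro j
    rw [← Path.integ_comm _ _ (hkc j), ← smul_eq_mul, ← Path.integ_smul]
    exact Path.integ_congr _ fun w hw => hcauchy w (Or.inl (mem_iUnion.2 ⟨j, hw⟩))
  have hzK : ∀ z ∈ Γ₀.supp, z ∉ K := fun z hz hzK => hdis z (hKW hzK) hz
  have h2 : ∀ j, EqOn (fun z => (Γ j).integ fun w => (z - w)⁻¹ * f z)
      (fun z => -(2 * Real.pi * Complex.I * (Γ j).ind z * f z)) Γ₀.supp := by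
    intro j z hz
    have hzj : z ∉ (Γ j).supp := fun h => hzK z hz (Or.inl (mem_iUnion.2 ⟨j, h⟩))
    have h3 := (Γ j).integ_smul_const (Grid.differentiableOn_inv_sub hzj).continuousOn (-f z)
    simp only [smul_eq_mul] at h3
    simp only [Path.ind]
    rw [mul_inv_cancel_left₀ Complex.two_pi_I_ne_zero, ← mul_neg, ← h3]
    refine Path.integ_congr _ fun w _ => ?_
    rw [← neg_sub w z, inv_neg]
    ring
  have hcj : ∀ j, ContinuousOn (fun z => (Γ j).ind z) Γ₀.supp := by
    intro j z hz
    have hzj : z ∉ (Γ j).supp := fun h => hzK z hz (Or.inl (mem_iUnion.2 ⟨j, h⟩))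
    exact (continuousAt_const.congr
      (((Γ j).ind_loc z hzj).mono fun w hw => hw.symm)).continuousWithinAt
  have h3 : ∀ j, c j * (Γ j).integ f = Γ₀.integ (fun z => -(c j * (Γ j).ind z * f z)) := by
    intro j
    rw [h1, Path.integ_congr _ (h2 j), ← mul_assoc, ← smul_eq_mul, ← Path.integ_smul]
    refine Path.integ_congr _ fun z _ => ?_
    simp only [smul_eq_mul]
    field_simp
  simp only [h3]
  rw [← Path.integ_finset_sum]
  · rw [← Γ₀.integ_zero]
    refine Path.integ_congr _ fun z hz => ?_
    have : ∑ j, c j * (Γ j).ind z = 0 := by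
      by_contra h
      exact hzK z hz (Or.inr h)
    rw [Finset.sum_neg_distrib, ← Finset.sum_mul, this, zero_mul, neg_zero]
  · intro j _
    exact ((continuousOn_const.mul (hcj j)).mul (hf.continuousOn.mono hsΩ)).neg

/-- **Cauchy's theorem**, homology version. -/
theorem sum_integ_eq_zero {ι : Type*} [Fintype ι] (Γ : ι → Cycle) (c : ι → ℂ) {Ω : Set ℂ}
    (hΩ : IsOpen Ω) (hsupp : ∀ j, (Γ j).supp ⊆ Ω) (hind : ∀ z ∉ Ω, ∑ j, c j * (Γ j).ind z = 0)
    {f : ℂ → E} (hf : DifferentiableOn ℂ f Ω) : ∑ j, c j • (Γ j).integ f = 0 := by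
  refine SeparatingDual.eq_zero_of_forall_dual_eq_zero (R := ℂ) fun L => ?_
  rw [map_sum]
  have := sum_integ_eq_zero_scalar Γ c hΩ hsupp hind (f := fun z => L (f z))
    (L.differentiable.comp_differentiableOn hf)
  rw [← this]
  refine Finset.sum_congr rfl fun j _ => ?_
  rw [map_smul, Path.integ_clm _ L (hf.continuousOn.mono (hsupp j)), smul_eq_mul]

theorem tendsto_circleIntegral {f : ℂ → E} {a : E}
    (ha : Tendsto (fun z => z • f z) (Bornology.cobounded ℂ) (𝓝 a))
    (hf : ∀ᶠ R in atTop, ContinuousOn f (Metric.sphere 0 R)) :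
    Tendsto (fun R => ∮ z in C(0, R), f z) atTop (𝓝 ((2 * Real.pi * Complex.I : ℂ) • a)) := by
  rw [Metric.tendsto_nhds]
  intro ε hε
  have h1 : ∀ᶠ z in Bornology.cobounded ℂ, ‖z • f z - a‖ < ε / (4 * Real.pi) := by
    have := Metric.tendsto_nhds.1 ha (ε / (4 * Real.pi)) (by positivity)
    simpa only [dist_eq_norm] using this
  obtain ⟨r, -, hr⟩ := (Metric.hasBasis_cobounded_compl_closedBall (0 : ℂ)).mem_iff.1 h1
  filter_upwards [eventually_gt_atTop r, eventually_gt_atTop 0, hf] with R hRr hR hfR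
  have h2 : (∮ z in C((0 : ℂ), R), z⁻¹ • a) = (2 * Real.pi * Complex.I : ℂ) • a := by
    have := circleIntegral.integral_sub_inv_of_mem_ball (c := 0) (w := 0) (Metric.mem_ball_self hR)
    rw [circleIntegral.integral_smul_const]
    simpa using congrArg (· • a) this
  have hne : ∀ z ∈ Metric.sphere (0 : ℂ) R, z ≠ 0 := by
    rintro z hz rfl
    simp at hz
    linarith
  rw [dist_eq_norm, ← h2, ← circleIntegral.integral_sub]
  · calc _ ≤ 2 * Real.pi * R * (ε / (4 * Real.pi) / R) := by
          refine circleIntegral.norm_integral_le_of_norm_le_const hR.le fun z hz => ?_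
          have h3 : f z - z⁻¹ • a = z⁻¹ • (z • f z - a) := by
            rw [smul_sub, smul_smul, inv_mul_cancel₀ (hne z hz), one_smul]
          rw [h3, norm_smul, norm_inv, mem_sphere_zero_iff_norm.1 hz, div_eq_inv_mul]
          gcongr
          refine le_of_lt (hr (?_ : z ∈ (Metric.closedBall 0 r)ᶜ))
          rw [mem_compl_iff, mem_closedBall_zero_iff, mem_sphere_zero_iff_norm.1 hz]
          linarith
      _ = ε / 2 := by field_simp; ring
      _ < ε := by linarith
  · exact hfR.circleIntegrable hR.le
  · refine ContinuousOn.circleIntegrable hR.le ?_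
    exact (continuousOn_id.inv₀ hne).smul continuousOn_const

/-- Cauchy's theorem with a contribution of the point at infinity. -/
theorem sum_integ_eq_of_tendsto {ι : Type*} [Fintype ι] (Γ : ι → Cycle) (c : ι → ℂ) {Ω : Set ℂ}
    (hΩ : IsOpen Ω) (hsupp : ∀ j, (Γ j).supp ⊆ Ω) {m : ℂ}
    (hind : ∀ z ∉ Ω, ∑ j, c j * (Γ j).ind z = m)
    {f : ℂ → E} (hf : DifferentiableOn ℂ f Ω) {a : E}
    (hm : m = 0 ∨ Ω ∈ Bornology.cobounded ℂ ∧
      Tendsto (fun z => z • f z) (Bornology.cobounded ℂ) (𝓝 a)) :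
    ∑ j, c j • (Γ j).integ f = (2 * Real.pi * Complex.I * m) • a := by
  rcases hm with rfl | ⟨hcob, ha⟩
  · rw [mul_zero, zero_smul]
    exact sum_integ_eq_zero Γ c hΩ hsupp hind hf
  · obtain ⟨r, -, hr⟩ := (Metric.hasBasis_cobounded_compl_closedBall (0 : ℂ)).mem_iff.1 hcob
    have hsph : ∀ R, r < R → Metric.sphere 0 R ⊆ Ω := by
      intro R hR z hz
      refine hr ?_
      rw [mem_compl_iff, mem_closedBall_zero_iff, mem_sphere_zero_iff_norm.1 hz]
      linarith
    have h1 : ∀ᶠ R in atTop, ∑ j, c j • (Γ j).integ f = m • ∮ z in C(0, R), f z := by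
      filter_upwards [eventually_gt_atTop r, eventually_gt_atTop 0] with R hRr hR
      have := sum_integ_eq_zero (fun o : Option ι => o.elim (circleCycle 0 hR) Γ)
        (fun o : Option ι => o.elim (-m) c) hΩ ?_ ?_ hf
      · simp only [Fintype.sum_option, Option.elim_none, Option.elim_some] at this
        have e : (circleCycle 0 hR).integ f = ∮ z in C(0, R), f z := integ_circlePath 0 R f
        rw [e, neg_smul, neg_add_eq_zero] at this
        exact this.symm
      · rintro (_ | j)
        · have : (circleCycle 0 hR).supp = Metric.sphere 0 |R| := rfl
          simp only [Option.elim_none]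
          rw [this, abs_of_pos hR]
          exact hsph R hRr
        · exact hsupp j
      · intro z hz
        simp only [Fintype.sum_option, Option.elim_none, Option.elim_some]
        rw [hind z hz]
        have : (circleCycle 0 hR).ind z = 1 := by
          refine ind_circlePath_inside ?_
          by_contra h
          refine hz (hr fun h' => h ?_)
          rw [mem_closedBall_zero_iff] at h'
          rw [mem_ball_zero_iff]
          linarith
        rw [this]
        ring
    have h2 : ∀ᶠ R in atTop, ContinuousOn f (Metric.sphere 0 R) := by
      filter_upwards [eventually_gt_atTop r] with R hR
      exact hf.continuousOn.mono (hsph R hR)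
    have h3 := (tendsto_circleIntegral ha h2).const_smul m
    rw [smul_smul, mul_comm] at h3
    exact tendsto_nhds_unique (tendsto_const_nhds.congr' h1) h3

theorem integ_eq_of_tendsto (Γ : Cycle) {Ω : Set ℂ} (hΩ : IsOpen Ω) (hsupp : Γ.supp ⊆ Ω) {m : ℂ}
    (hind : ∀ z ∉ Ω, Γ.ind z = m) {f : ℂ → E} (hf : DifferentiableOn ℂ f Ω) {a : E}
    (hm : m = 0 ∨ Ω ∈ Bornology.cobounded ℂ ∧
      Tendsto (fun z => z • f z) (Bornology.cobounded ℂ) (𝓝 a)) :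
    Γ.integ f = (2 * Real.pi * Complex.I * m) • a := by
  have := sum_integ_eq_of_tendsto (fun _ : Unit => Γ) (fun _ => 1) hΩ (fun _ => hsupp)
    (by simpa using hind) hf hm
  simpa using this

end RieszDunford

namespace RieszDunford

variable {X : Type*} [NormedAddCommGroup X] [NormedSpace ℂ X]

/-! ### Resolvents of closed linear relations -/

/-- `R` is the inverse of `z - G` for the linear relation `G` in `X`. -/
def IsRes (G : Submodule ℂ (X × X)) (z : ℂ) (R : X →L[ℂ] X) : Prop :=
  (∀ x, (R x, z • R x - x) ∈ G) ∧ ∀ p ∈ G, R (z • p.1 - p.2) = p.1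

/-- The resolvent set. -/
def rho (G : Submodule ℂ (X × X)) : Set ℂ := {z | ∃ R, IsRes G z R}

open Classical in
/-- The resolvent. -/
noncomputable def res (G : Submodule ℂ (X × X)) (z : ℂ) : X →L[ℂ] X :=
  if h : ∃ R, IsRes G z R then h.choose else 0

variable {G : Submodule ℂ (X × X)}

theorem IsRes.unique {z : ℂ} {R R' : X →L[ℂ] X} (h : IsRes G z R) (h' : IsRes G z R') : R = R' := by
  ext x
  have := h'.2 _ (h.1 x)
  simpa using this.symm

theorem isRes_res {z : ℂ} (hz : z ∈ rho G) : IsRes G z (res G z) := by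
  have hz' : ∃ R, IsRes G z R := hz
  rw [res, dif_pos hz']
  exact hz'.choose_spec

theorem IsRes.mem_rho {z : ℂ} {R : X →L[ℂ] X} (h : IsRes G z R) : z ∈ rho G := ⟨R, h⟩

theorem IsRes.res_eq {z : ℂ} {R : X →L[ℂ] X} (h : IsRes G z R) : res G z = R :=
  (isRes_res h.mem_rho).unique h

theorem res_sub_res {z w : ℂ} (hz : z ∈ rho G) (hw : w ∈ rho G) :
    res G z - res G w = (w - z) • (res G z * res G w) := by
  ext x
  have := (isRes_res hz).2 _ ((isRes_res hw).1 x)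
  simp only [_root_.sub_apply, _root_.smul_apply,
    mul_apply_eq_comp]
  dsimp only at this
  simp only [map_sub, map_smul] at this
  linear_combination (norm := module) this

theorem res_mul_res {z w : ℂ} (hz : z ∈ rho G) (hw : w ∈ rho G) (hne : w ≠ z) :
    res G z * res G w = (w - z)⁻¹ • (res G z - res G w) := by
  rw [res_sub_res hz hw, smul_smul, inv_mul_cancel₀ (sub_ne_zero.2 hne), one_smul]

theorem res_comm {z w : ℂ} (hz : z ∈ rho G) (hw : w ∈ rho G) :
    res G z * res G w = res G w * res G z := by
  rcases eq_or_ne w z with rfl | hne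
  · rfl
  · rw [res_mul_res hz hw hne, res_mul_res hw hz hne.symm, ← neg_sub w z, inv_neg, neg_smul,
      ← smul_neg, neg_sub]

variable [CompleteSpace X]

theorem isRes_of_isUnit {z w : ℂ} {R : X →L[ℂ] X} (h : IsRes G z R)
    (hu : IsUnit (1 - (z - w) • R)) : IsRes G w (R * Ring.inverse (1 - (z - w) • R)) := by
  obtain ⟨u, hu⟩ := hu
  rw [← hu, Ring.inverse_unit]
  have hc : R * (u⁻¹ : (X →L[ℂ] X)ˣ) = (u⁻¹ : (X →L[ℂ] X)ˣ) * R := by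
    have : Commute R (u : X →L[ℂ] X) := by
      rw [hu]
      exact (Commute.one_right R).sub_right ((Commute.refl R).smul_right _)
    exact this.units_inv_right
  constructor
  · intro x
    set y := (u⁻¹ : (X →L[ℂ] X)ˣ).1 x with hy
    have hx : x = y - (z - w) • R y := by
      have : (u : X →L[ℂ] X) y = x := by
        rw [hy, ← mul_apply_eq_comp, Units.mul_inv, one_apply_eq_self]
      rw [hu] at this
      simpa using this.symm
    have := h.1 y
    rw [mul_apply_eq_comp]
    convert this using 2
    rw [← hy]
    conv_lhs => rw [hx]
    module
  · intro p hp
    have h1 := h.2 p hp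
    rw [hc, mul_apply_eq_comp]
    have h2 : R (w • p.1 - p.2) = (u : X →L[ℂ] X) p.1 := by
      rw [hu]
      simp only [_root_.sub_apply, _root_.smul_apply,
        one_apply_eq_self]
      rw [map_sub, map_smul] at h1 ⊢
      linear_combination (norm := module) h1
    rw [h2, ← mul_apply_eq_comp, Units.inv_mul, one_apply_eq_self]

theorem eventually_isUnit (R : X →L[ℂ] X) (z : ℂ) : ∀ᶠ w in 𝓝 z, IsUnit (1 - (z - w) • R) := by
  have hc : Continuous fun w : ℂ => 1 - (z - w) • R := by fun_prop
  have h0 : IsUnit (1 - (z - z) • R) := by simp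
  exact hc.continuousAt.eventually (Units.isOpen.mem_nhds h0)

theorem isOpen_rho (G : Submodule ℂ (X × X)) : IsOpen (rho G) := by
  rw [isOpen_iff_mem_nhds]
  rintro z ⟨R, hR⟩
  filter_upwards [eventually_isUnit R z] with w hw
  exact (isRes_of_isUnit hR hw).mem_rho

theorem differentiableOn_res (G : Submodule ℂ (X × X)) : DifferentiableOn ℂ (res G) (rho G) := by
  intro z hz
  have h1 : (res G) =ᶠ[𝓝 z] fun w => res G z * Ring.inverse (1 - (z - w) • res G z) := by
    filter_upwards [eventually_isUnit (res G z) z] with w hw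
    exact (isRes_of_isUnit (isRes_res hz) hw).res_eq
  refine (DifferentiableAt.congr_of_eventuallyEq ?_ h1).differentiableWithinAt
  have h2 : DifferentiableAt ℂ (Ring.inverse : (X →L[ℂ] X) → _) (1 - (z - z) • res G z) := by
    rw [sub_self, zero_smul, sub_zero]
    exact differentiableAt_inverse isUnit_one
  have h3 : DifferentiableAt ℂ (fun w : ℂ => 1 - (z - w) • res G z) z := by fun_prop
  have h4 : DifferentiableAt ℂ (fun w => Ring.inverse (1 - (z - w) • res G z)) z :=
    DifferentiableAt.comp z (g := Ring.inverse) h2 h3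
  exact h4.const_mul _

theorem continuousOn_res (G : Submodule ℂ (X × X)) : ContinuousOn (res G) (rho G) :=
  (differentiableOn_res G).continuousOn

/-! ### Cauchy integral formula for cycles -/

variable {E : Type*} [NormedAddCommGroup E] [NormedSpace ℂ E] [CompleteSpace E]

theorem integ_eq_of_ind_eq (Γ Δ : Cycle) {Ω : Set ℂ} (hΩ : IsOpen Ω) (h1 : Γ.supp ⊆ Ω)
    (h2 : Δ.supp ⊆ Ω) (hind : ∀ z ∉ Ω, Γ.ind z = Δ.ind z) {f : ℂ → E}
    (hf : DifferentiableOn ℂ f Ω) : Γ.integ f = Δ.integ f := by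
  have := sum_integ_eq_zero ![Γ, Δ] ![1, -1] hΩ (by simp [Fin.forall_fin_two, h1, h2])
    (by intro z hz; simp [Fin.sum_univ_two, hind z hz]) hf
  simpa [Fin.sum_univ_two, ← sub_eq_add_neg, sub_eq_zero] using this

/-- `f` is holomorphic on `D`, and also at infinity with value `c` if `κ ≠ 0`. -/
def Hol (κ : ℂ) (D : Set ℂ) (f : ℂ → ℂ) (c : ℂ) : Prop :=
  IsOpen D ∧ DifferentiableOn ℂ f D ∧
    (κ = 0 ∨ (D ∈ Bornology.cobounded ℂ ∧ Tendsto f (Bornology.cobounded ℂ) (𝓝 c)))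

/-- The cycle `Γ` separates `K` from the complement of `D`; for `κ = 1`, the point at infinity is
on the side of `K`. -/
def Sep (κ : ℂ) (K D : Set ℂ) (Γ : Cycle) : Prop :=
  Γ.supp ⊆ D \ K ∧ (∀ z ∈ K, Γ.ind z = 1 - κ) ∧ ∀ z ∉ D, Γ.ind z = -κ

theorem eventually_cobounded_ne (z : ℂ) : ∀ᶠ w in Bornology.cobounded ℂ, w ≠ z :=
  Bornology.isBounded_def.1 (Bornology.isBounded_singleton : Bornology.IsBounded ({z} : Set ℂ))

theorem tendsto_mul_inv_sub (z : ℂ) :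
    Tendsto (fun w : ℂ => w * (w - z)⁻¹) (Bornology.cobounded ℂ) (𝓝 1) := by
  have h1 : Tendsto (fun w : ℂ => w - z) (Bornology.cobounded ℂ) (Bornology.cobounded ℂ) :=
    tendsto_sub_const_cobounded z
  have h2 : Tendsto (fun w : ℂ => 1 + z * (w - z)⁻¹) (Bornology.cobounded ℂ) (𝓝 (1 + z * 0)) :=
    ((tendsto_inv₀_cobounded.comp h1).const_mul z).const_add 1
  rw [mul_zero, add_zero] at h2
  refine h2.congr' ?_
  filter_upwards [eventually_cobounded_ne z] with w hw
  have := sub_ne_zero.2 hw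
  field_simp
  ring

theorem tendsto_id_mul_inv_sub_mul {f : ℂ → ℂ} {c : ℂ}
    (hf : Tendsto f (Bornology.cobounded ℂ) (𝓝 c)) (z : ℂ) :
    Tendsto (fun w : ℂ => w • ((w - z)⁻¹ * f w)) (Bornology.cobounded ℂ) (𝓝 c) := by
  have := (tendsto_mul_inv_sub z).mul hf
  rw [one_mul] at this
  refine this.congr fun w => ?_
  rw [smul_eq_mul, mul_assoc]

theorem cauchy_formula {κ : ℂ} {D : Set ℂ} {f : ℂ → ℂ} {c : ℂ} (hf : Hol κ D f c) {Γ : Cycle}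
    (hs : Γ.supp ⊆ D) (hind : ∀ z ∉ D, Γ.ind z = -κ) {z : ℂ} (hz : z ∈ D) (hzs : z ∉ Γ.supp) :
    Γ.integ (fun w => (w - z)⁻¹ * f w) =
      2 * Real.pi * Complex.I * ((κ + Γ.ind z) * f z - κ * c) := by
  obtain ⟨hD, hfd, hinf⟩ := hf
  have hd : DifferentiableOn ℂ (dslope f z) D :=
    (Complex.differentiableOn_dslope (hD.mem_nhds hz)).2 hfd
  have h1 : Γ.integ (dslope f z) = (2 * Real.pi * Complex.I * -κ) • (c - f z) := by
    refine integ_eq_of_tendsto Γ hD hs hind hd ?_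
    rcases hinf with h | ⟨h1, h2⟩
    · left; rw [h, neg_zero]
    · refine Or.inr ⟨h1, (tendsto_id_mul_inv_sub_mul (h2.sub_const (f z)) z).congr' ?_⟩
      filter_upwards [eventually_cobounded_ne z] with w hw
      rw [dslope_of_ne _ hw, slope_def_field, div_eq_inv_mul]
  have hc : ∀ {g : ℂ → ℂ}, ContinuousOn g D → ContinuousOn (fun w => (w - z)⁻¹ * g w) Γ.supp :=
    fun hg => (Grid.differentiableOn_inv_sub hzs).continuousOn.mul (hg.mono hs)
  have h2 : EqOn (dslope f z) (fun w => (w - z)⁻¹ * f w - (w - z)⁻¹ * f z) Γ.supp := by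
    intro w hw
    have hzw : w ≠ z := fun e => hzs (e ▸ hw)
    rw [dslope_of_ne _ hzw, slope_def_field]
    field_simp
  rw [Γ.integ_congr h2, Γ.integ_sub (hc hfd.continuousOn) (hc continuousOn_const)] at h1
  have h3 : Γ.integ (fun w => (w - z)⁻¹ * f z) = Γ.integ (fun w => (w - z)⁻¹) * f z :=
    Γ.integ_smul_const (Grid.differentiableOn_inv_sub hzs).continuousOn (f z)
  have h4 : Γ.integ (fun w => (w - z)⁻¹) = 2 * Real.pi * Complex.I * Γ.ind z := by
    rw [Path.ind, mul_inv_cancel_left₀ Complex.two_pi_I_ne_zero]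
  rw [h3, h4, smul_eq_mul] at h1
  linear_combination h1

/-! ### Domains between a closed set and an open set -/

/-- `W` is an open neighbourhood of `K` with closure in `D` and boundary `Γ`. -/
structure Nbhd (κ : ℂ) (K D W : Set ℂ) (Γ : Cycle) : Prop where
  isOpen : IsOpen W
  subset : K ⊆ W
  closure_subset : closure W ⊆ D
  supp_eq : Γ.supp = frontier W
  ind_in : ∀ z ∈ W, Γ.ind z = 1 - κ
  ind_out : ∀ z ∉ closure W, Γ.ind z = -κ
  bounded : κ = 0 → Bornology.IsBounded W

theorem nbhd_boundaryCycle {κ : ℂ} {K D W : Set ℂ} {n : ℕ} {γ : Fin n → ℝ → ℂ}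
    (hW : IsOpen W) (hγ : IsOrientedBoundary W γ) (hκ : κ = 0 ∨ κ = 1)
    (hb : κ = 0 ↔ Bornology.IsBounded W) (h1 : K ⊆ W) (h2 : closure W ⊆ D) :
    Nbhd κ K D W (boundaryCycle hW hγ) := by
  obtain ⟨κ', hκ', hb', hin, hout⟩ := boundaryCycle_ind hW hγ
  have : κ = κ' := by
    have := hb.trans hb'.symm
    rcases hκ with rfl | rfl <;> rcases hκ' with rfl | rfl <;> simp_all
  subst this
  exact ⟨hW, h1, h2, boundaryCycle_supp hW hγ, hin, hout, hb.1⟩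

theorem exists_nbhd {κ : ℂ} {K D : Set ℂ} (hK : IsClosed K) (hD : IsOpen D) (hKD : K ⊆ D)
    (hκ : κ = 0 ∧ Bornology.IsBounded K ∨ κ = 1 ∧ D ∈ Bornology.cobounded ℂ) :
    ∃ W Γ, Nbhd κ K D W Γ := by
  rcases hκ with ⟨rfl, hb⟩ | ⟨rfl, hc⟩
  · obtain ⟨W, n, γ, hW, h1, h2, h3, hγ, -, -⟩ :=
      Grid.exists_bounded_cauchyDomain (Metric.isCompact_of_isClosed_isBounded hK hb) hD hKD
    exact ⟨W, boundaryCycle hW.1 hγ,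
      nbhd_boundaryCycle hW.1 hγ (Or.inl rfl) (by simp [h3]) h1 h2⟩
  · have hDc : IsCompact Dᶜ := by
      refine Metric.isCompact_of_isClosed_isBounded hD.isClosed_compl ?_
      rwa [Bornology.isBounded_def, compl_compl]
    obtain ⟨W, n, γ, hW, h1, h2, h3, hγ, -⟩ :=
      Grid.exists_unbounded_cauchyDomain hDc hK.isOpen_compl (compl_subset_compl.2 hKD)
    rw [compl_compl] at h1 h2
    exact ⟨W, boundaryCycle hW.1 hγ,
      nbhd_boundaryCycle hW.1 hγ (Or.inr rfl) (by simp [h3]) h1 h2⟩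

theorem Nbhd.sep {κ : ℂ} {K D W : Set ℂ} {Γ : Cycle} (h : Nbhd κ K D W Γ) : Sep κ K D Γ := by
  refine ⟨fun z hz => ?_, fun z hz => h.ind_in z (h.subset hz),
    fun z hz => h.ind_out z fun h' => hz (h.closure_subset h')⟩
  rw [h.supp_eq, h.isOpen.frontier_eq] at hz
  exact ⟨h.closure_subset hz.1, fun h' => hz.2 (h.subset h')⟩

/-! ### The functional calculus of a closed linear relation -/

/-- The value of the Cauchy integral. -/
noncomputable def val (G : Submodule ℂ (X × X)) (κ c : ℂ) (Γ : Path) (f : ℂ → ℂ) : X →L[ℂ] X :=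
  (κ * c) • 1 + (2 * Real.pi * Complex.I : ℂ)⁻¹ • Γ.integ (fun z => f z • res G z)

/-- `A = f(G)`, where `c` is the value of `f` at infinity in the unbounded case `κ = 1`. -/
def IsCalc (G : Submodule ℂ (X × X)) (κ : ℂ) (f : ℂ → ℂ) (c : ℂ) (A : X →L[ℂ] X) : Prop :=
  ∃ D, Hol κ D f c ∧ (rho G)ᶜ ⊆ D ∧ ∃ Γ, Sep κ (rho G)ᶜ D Γ ∧ A = val G κ c Γ.toPath f

/-- For `κ = 0`, the relation behaves like a bounded operator near infinity. -/
def Kind (κ : ℂ) (G : Submodule ℂ (X × X)) : Prop :=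
  κ = 0 ∧ rho G ∈ Bornology.cobounded ℂ ∧
    Tendsto (fun z => z • res G z) (Bornology.cobounded ℂ) (𝓝 1) ∨ κ = 1

theorem Sep.subset_rho {κ : ℂ} {D : Set ℂ} {Γ : Cycle} (h : Sep κ (rho G)ᶜ D Γ) :
    Γ.supp ⊆ rho G := fun z hz => not_notMem.1 (h.1 hz).2

theorem Sep.subset {κ : ℂ} {K D : Set ℂ} {Γ : Cycle} (h : Sep κ K D Γ) : Γ.supp ⊆ D :=
  fun _ hz => (h.1 hz).1

theorem val_eq {κ c : ℂ} {f : ℂ → ℂ} {D D' : Set ℂ} {Γ Γ' : Cycle} (hf : Hol κ D f c)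
    (hf' : Hol κ D' f c) (hΓ : Sep κ (rho G)ᶜ D Γ) (hΓ' : Sep κ (rho G)ᶜ D' Γ') :
    val G κ c Γ.toPath f = val G κ c Γ'.toPath f := by
  unfold val
  congr 2
  refine integ_eq_of_ind_eq Γ Γ' ((hf.1.union hf'.1).inter (isOpen_rho G))
    (fun z hz => ⟨Or.inl (hΓ.subset hz), hΓ.subset_rho hz⟩)
    (fun z hz => ⟨Or.inr (hΓ'.subset hz), hΓ'.subset_rho hz⟩) ?_ ?_
  · intro z hz
    by_cases hr : z ∈ rho G
    · have hzD : z ∉ D ∪ D' := fun h => hz ⟨h, hr⟩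
      rw [mem_union, not_or] at hzD
      rw [hΓ.2.2 z hzD.1, hΓ'.2.2 z hzD.2]
    · rw [hΓ.2.1 z hr, hΓ'.2.1 z hr]
  · have hu : DifferentiableOn ℂ f (D ∪ D') := by
      rintro z (hz | hz)
      · exact (hf.2.1.differentiableAt (hf.1.mem_nhds hz)).differentiableWithinAt
      · exact (hf'.2.1.differentiableAt (hf'.1.mem_nhds hz)).differentiableWithinAt
    exact (hu.mono inter_subset_left).smul ((differentiableOn_res G).mono inter_subset_right)

theorem IsCalc.eq_val {κ c : ℂ} {f : ℂ → ℂ} {A : X →L[ℂ] X} (h : IsCalc G κ f c A) {D : Set ℂ}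
    {Γ : Cycle} (hf : Hol κ D f c) (hΓ : Sep κ (rho G)ᶜ D Γ) : A = val G κ c Γ.toPath f := by
  obtain ⟨D', hf', -, Γ', hΓ', rfl⟩ := h
  exact val_eq hf' hf hΓ' hΓ

theorem IsCalc.unique {κ c : ℂ} {f : ℂ → ℂ} {A B : X →L[ℂ] X} (h : IsCalc G κ f c A)
    (h' : IsCalc G κ f c B) : A = B := by
  obtain ⟨D', hf', -, Γ', hΓ', rfl⟩ := h'
  exact h.eq_val hf' hΓ'

theorem Hol.mono {κ c : ℂ} {f : ℂ → ℂ} {D D' : Set ℂ} (h : Hol κ D f c) (hD' : IsOpen D')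
    (hsub : D' ⊆ D) (hc : κ = 0 ∨ D' ∈ Bornology.cobounded ℂ) : Hol κ D' f c := by
  refine ⟨hD', h.2.1.mono hsub, ?_⟩
  rcases h.2.2 with h1 | ⟨-, h2⟩
  · exact Or.inl h1
  · exact hc.imp_right fun h3 => ⟨h3, h2⟩

theorem Hol.cobounded {κ c : ℂ} {f : ℂ → ℂ} {D : Set ℂ} (h : Hol κ D f c) :
    κ = 0 ∨ D ∈ Bornology.cobounded ℂ := h.2.2.imp_right fun h => h.1

theorem Kind.exists_nbhd {κ : ℂ} (hG : Kind κ G) {D : Set ℂ} (hD : IsOpen D)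
    (hGD : (rho G)ᶜ ⊆ D) (hc : κ = 0 ∨ D ∈ Bornology.cobounded ℂ) :
    ∃ W Γ, Nbhd κ (rho G)ᶜ D W Γ := by
  refine RieszDunford.exists_nbhd (isOpen_rho G).isClosed_compl hD hGD ?_
  rcases hG with ⟨h1, h2, -⟩ | h1
  · left
    refine ⟨h1, ?_⟩
    rwa [Bornology.isBounded_def, compl_compl]
  · right
    refine ⟨h1, hc.resolve_left ?_⟩
    rw [h1]; exact one_ne_zero

theorem exists_isCalc {κ : ℂ} (hG : Kind κ G) {D : Set ℂ} {f : ℂ → ℂ} {c : ℂ} (hf : Hol κ D f c)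
    (hD : (rho G)ᶜ ⊆ D) : ∃ A, IsCalc G κ f c A := by
  obtain ⟨W, Γ, h⟩ := hG.exists_nbhd hf.1 hD hf.cobounded
  exact ⟨_, D, hf, hD, Γ, h.sep, rfl⟩

theorem Kind.mul_self {κ : ℂ} (hG : Kind κ G) : κ * κ = κ := by
  rcases hG with ⟨rfl, -⟩ | rfl <;> simp

theorem cobounded_inter {κ : ℂ} {D D' : Set ℂ} (h : κ = 0 ∨ D ∈ Bornology.cobounded ℂ)
    (h' : κ = 0 ∨ D' ∈ Bornology.cobounded ℂ) : κ = 0 ∨ D ∩ D' ∈ Bornology.cobounded ℂ := by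
  rcases h with h | h
  · exact Or.inl h
  · exact h'.imp_right fun h' => inter_mem h h'

theorem continuousOn_smul_res {f : ℂ → ℂ} {D s : Set ℂ} (hf : DifferentiableOn ℂ f D)
    (h1 : s ⊆ D) (h2 : s ⊆ rho G) : ContinuousOn (fun z => f z • res G z) s :=
  (hf.continuousOn.mono h1).smul ((continuousOn_res G).mono h2)

theorem Hol.add_smul {κ c d a : ℂ} {f g : ℂ → ℂ} {D : Set ℂ} (hf : Hol κ D f c) (hg : Hol κ D g d) :
    Hol κ D (fun z => a * f z + g z) (a * c + d) := by
  refine ⟨hf.1, (hf.2.1.const_mul a).add hg.2.1, ?_⟩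
  rcases hf.2.2 with h | h
  · exact Or.inl h
  · exact hg.2.2.imp_right fun h' => ⟨h.1, (h.2.const_mul a).add h'.2⟩

theorem Hol.mul {κ c d : ℂ} {f g : ℂ → ℂ} {D : Set ℂ} (hf : Hol κ D f c) (hg : Hol κ D g d) :
    Hol κ D (fun z => f z * g z) (c * d) := by
  refine ⟨hf.1, hf.2.1.mul hg.2.1, ?_⟩
  rcases hf.2.2 with h | h
  · exact Or.inl h
  · exact hg.2.2.imp_right fun h' => ⟨h.1, h.2.mul h'.2⟩

theorem Hol.const {κ : ℂ} {D : Set ℂ} (hD : IsOpen D) (hc : κ = 0 ∨ D ∈ Bornology.cobounded ℂ)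
    (c : ℂ) : Hol κ D (fun _ => c) c :=
  ⟨hD, differentiableOn_const c, hc.imp_right fun h => ⟨h, tendsto_const_nhds⟩⟩

/-- Two functions have a common domain and a common cycle. -/
theorem Kind.common {κ c d : ℂ} {f g : ℂ → ℂ} {A B : X →L[ℂ] X} (hG : Kind κ G)
    (hA : IsCalc G κ f c A) (hB : IsCalc G κ g d B) :
    ∃ D, Hol κ D f c ∧ Hol κ D g d ∧ (rho G)ᶜ ⊆ D ∧ ∃ W Γ, Nbhd κ (rho G)ᶜ D W Γ ∧
      A = val G κ c Γ.toPath f ∧ B = val G κ d Γ.toPath g := by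
  obtain ⟨D, hf, hD, -⟩ := id hA
  obtain ⟨D', hg, hD', -⟩ := id hB
  have hc := cobounded_inter hf.cobounded hg.cobounded
  have hf' := hf.mono (hf.1.inter hg.1) inter_subset_left hc
  have hg' := hg.mono (hf.1.inter hg.1) inter_subset_right hc
  obtain ⟨W, Γ, h⟩ := hG.exists_nbhd hf'.1 (subset_inter hD hD') hc
  exact ⟨D ∩ D', hf', hg', subset_inter hD hD', W, Γ, h, hA.eq_val hf' h.sep, hB.eq_val hg' h.sep⟩

theorem IsCalc.add_smul {κ c d : ℂ} {f g : ℂ → ℂ} {A B : X →L[ℂ] X} (hG : Kind κ G)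
    (hA : IsCalc G κ f c A) (hB : IsCalc G κ g d B) (a : ℂ) :
    IsCalc G κ (fun z => a * f z + g z) (a * c + d) (a • A + B) := by
  obtain ⟨D, hf, hg, hD, W, Γ, hΓ, rfl, rfl⟩ := hG.common hA hB
  refine ⟨D, hf.add_smul hg, hD, Γ, hΓ.sep, ?_⟩
  have hs := hΓ.sep
  unfold val
  have : EqOn (fun z => (a * f z + g z) • res G z)
      (fun z => a • (f z • res G z) + g z • res G z) Γ.supp := by
    intro z _
    simp only
    rw [_root_.add_smul, mul_smul]
  rw [Γ.integ_congr this, Γ.integ_add, Γ.integ_smul]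
  · module
  · exact (continuousOn_smul_res hf.2.1 hs.subset hs.subset_rho).const_smul a
  · exact continuousOn_smul_res hg.2.1 hs.subset hs.subset_rho

theorem IsCalc.mul {κ c d : ℂ} {f g : ℂ → ℂ} {A B : X →L[ℂ] X} (hG : Kind κ G)
    (hA : IsCalc G κ f c A) (hB : IsCalc G κ g d B) :
    IsCalc G κ (fun z => f z * g z) (c * d) (A * B) := by
  obtain ⟨D, hf, hg, hD, W, Γ, hΓ, hAv, -⟩ := hG.common hA hB
  obtain ⟨W', Γ', hΓ'⟩ : ∃ W' Γ', Nbhd κ (closure W) D W' Γ' := by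
    refine exists_nbhd isClosed_closure hf.1 hΓ.closure_subset ?_
    rcases hG with ⟨h1, -⟩ | h1
    · exact Or.inl ⟨h1, (hΓ.bounded h1).closure⟩
    · exact Or.inr ⟨h1, hf.cobounded.resolve_left (by rw [h1]; exact one_ne_zero)⟩
  have hs := hΓ.sep
  have hs' : Sep κ (rho G)ᶜ D Γ' := by
    have := hΓ'.sep
    have hsub : (rho G)ᶜ ⊆ closure W := hΓ.subset.trans subset_closure
    exact ⟨fun z hz => ⟨(this.1 hz).1, fun h => (this.1 hz).2 (hsub h)⟩,
      fun z hz => this.2.1 z (hsub hz), this.2.2⟩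
  have hBv : B = val G κ d Γ'.toPath g := hB.eq_val hg hs'
  refine ⟨D, hf.mul hg, hD, Γ, hs, ?_⟩
  rw [hAv, hBv]
  have hcl : ∀ z ∈ Γ.supp, z ∈ closure W := by
    intro z hz
    rw [hΓ.supp_eq] at hz
    exact frontier_subset_closure hz
  have hne : ∀ z ∈ Γ.supp, ∀ w ∈ Γ'.supp, w ≠ z := by
    rintro z hz w hw rfl
    exact (hΓ'.sep.1 hw).2 (hcl w hz)
  set P := Γ.integ (fun z => f z • res G z) with hP
  set Q := Γ'.integ (fun w => g w • res G w) with hQ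
  set p : ℂ := 2 * Real.pi * Complex.I with hp
  have hp0 : p ≠ 0 := Complex.two_pi_I_ne_zero
  have cf := continuousOn_smul_res hf.2.1 hs.subset hs.subset_rho
  have cg := continuousOn_smul_res hg.2.1 hs'.subset hs'.subset_rho
  have hinner : ∀ z ∈ Γ.supp, Γ'.integ (fun w => (w - z)⁻¹ * g w) = p * (g z - κ * d) := by
    intro z hz
    rw [cauchy_formula hg hs'.subset hs'.2.2 (hs.subset hz) fun h => hne z hz z h rfl,
      hΓ'.ind_in z (hΓ'.subset (hcl z hz))]
    ring
  have houter : ∀ w ∈ Γ'.supp, Γ.integ (fun z => (z - w)⁻¹ * f z) = -(p * (κ * c)) := by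
    intro w hw
    rw [cauchy_formula hf hs.subset hs.2.2 (hs'.subset hw) fun h => hne w h w hw rfl,
      hΓ.ind_out w (hΓ'.sep.1 hw).2]
    ring
  have hmain : P * Q = Γ.integ (fun z => p • ((f z * g z) • res G z)) - (p * (κ * d)) • P
      - (p * (κ * c)) • Q := by
    have e0 : EqOn (fun z => (f z • res G z) * Q) (fun z => Γ'.integ fun w =>
        (((w - z)⁻¹ * g w) • (f z • res G z) + ((z - w)⁻¹ * f z) • (g w • res G w))) Γ.supp := by
      intro z hz
      have h2 := Γ'.integ_clm (ContinuousLinearMap.mul ℂ (X →L[ℂ] X) (f z • res G z)) cg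
      rw [← hQ] at h2
      simp only [ContinuousLinearMap.mul_apply'] at h2
      refine h2.symm.trans ?_
      refine Γ'.integ_congr fun w hw => ?_
      rw [smul_mul_smul_comm, res_mul_res (hs.subset_rho hz) (hs'.subset_rho hw) (hne z hz w hw),
        ← neg_sub w z, inv_neg]
      module
    have cinv : ContinuousOn (fun q : ℂ × ℂ => (q.2 - q.1)⁻¹) (Γ.supp ×ˢ Γ'.supp) := by
      refine ContinuousOn.inv₀ (by fun_prop) ?_
      rintro ⟨z, w⟩ ⟨hz, hw⟩
      exact sub_ne_zero.2 (hne z hz w hw)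
    have cinv' : ContinuousOn (fun q : ℂ × ℂ => (q.1 - q.2)⁻¹) (Γ.supp ×ˢ Γ'.supp) := by
      refine ContinuousOn.inv₀ (by fun_prop) ?_
      rintro ⟨z, w⟩ ⟨hz, hw⟩
      exact sub_ne_zero.2 (hne z hz w hw).symm
    have c1 : ContinuousOn (fun q : ℂ × ℂ => ((q.2 - q.1)⁻¹ * g q.2) • (f q.1 • res G q.1))
        (Γ.supp ×ˢ Γ'.supp) := by
      refine ContinuousOn.smul (cinv.mul ?_) ?_
      · exact hg.2.1.continuousOn.comp continuousOn_snd fun q hq => hs'.subset hq.2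
      · exact cf.comp continuousOn_fst fun q hq => hq.1
    have c2 : ContinuousOn (fun q : ℂ × ℂ => ((q.1 - q.2)⁻¹ * f q.1) • (g q.2 • res G q.2))
        (Γ.supp ×ˢ Γ'.supp) := by
      refine ContinuousOn.smul (cinv'.mul ?_) ?_
      · exact hf.2.1.continuousOn.comp continuousOn_fst fun q hq => hs.subset hq.1
      · exact cg.comp continuousOn_snd fun q hq => hq.2
    have slice : ∀ {F : ℂ × ℂ → X →L[ℂ] X}, ContinuousOn F (Γ.supp ×ˢ Γ'.supp) → ∀ z ∈ Γ.supp,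
        ContinuousOn (fun w => F (z, w)) Γ'.supp := fun hF z hz =>
      hF.comp (by fun_prop) fun w hw => ⟨hz, hw⟩
    have slice' : ∀ {F : ℂ × ℂ → X →L[ℂ] X}, ContinuousOn F (Γ.supp ×ˢ Γ'.supp) → ∀ w ∈ Γ'.supp,
        ContinuousOn (fun z => F (z, w)) Γ.supp := fun hF w hw =>
      hF.comp (by fun_prop) fun z hz => ⟨hz, hw⟩
    have i1 : ∀ z ∈ Γ.supp, Γ'.integ (fun w => ((w - z)⁻¹ * g w) • (f z • res G z)) =
        (p * (g z - κ * d)) • (f z • res G z) := by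
      intro z hz
      rw [Γ'.integ_smul_const (f := fun w => (w - z)⁻¹ * g w), hinner z hz]
      exact (Grid.differentiableOn_inv_sub fun h => hne z hz z h rfl).continuousOn.mul
        (hg.2.1.continuousOn.mono hs'.subset)
    have i2 : ∀ w ∈ Γ'.supp, Γ.integ (fun z => ((z - w)⁻¹ * f z) • (g w • res G w)) =
        -(p * (κ * c)) • (g w • res G w) := by
      intro w hw
      rw [Γ.integ_smul_const (f := fun z => (z - w)⁻¹ * f z), houter w hw]
      exact (Grid.differentiableOn_inv_sub fun h => hne w h w hw rfl).continuousOn.mul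
        (hf.2.1.continuousOn.mono hs.subset)
    have e2 : EqOn (fun z => Γ'.integ fun w =>
        (((w - z)⁻¹ * g w) • (f z • res G z) + ((z - w)⁻¹ * f z) • (g w • res G w)))
        (fun z => (p * (g z - κ * d)) • (f z • res G z) +
          Γ'.integ fun w => ((z - w)⁻¹ * f z) • (g w • res G w)) Γ.supp := by
      intro z hz
      simp only
      rw [Γ'.integ_add (slice c1 z hz) (slice c2 z hz), i1 z hz]
    have cc : ContinuousOn (fun z => (p * (g z - κ * d)) • (f z • res G z)) Γ.supp :=
      (continuousOn_const.mul ((hg.2.1.continuousOn.mono hs.subset).sub continuousOn_const)).smul cf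
    have e1 : P * Q = Γ.integ (fun z => Γ'.integ fun w =>
        (((w - z)⁻¹ * g w) • (f z • res G z) + ((z - w)⁻¹ * f z) • (g w • res G w))) := by
      have := Γ.integ_clm ((ContinuousLinearMap.mul ℂ (X →L[ℂ] X)).flip Q) cf
      rw [← hP] at this
      simp only [ContinuousLinearMap.flip_apply, ContinuousLinearMap.mul_apply'] at this
      rw [← this]
      exact Γ.integ_congr e0
    have cd : ContinuousOn (fun z => Γ'.integ fun w => ((z - w)⁻¹ * f z) • (g w • res G w))
        Γ.supp := by
      refine ((cf.mul continuousOn_const).sub cc).congr (f := fun z => (f z • res G z) * Q -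
        (p * (g z - κ * d)) • (f z • res G z)) fun z hz => ?_
      exact eq_sub_of_add_eq' ((e0 hz).trans (e2 hz)).symm
    rw [e1, Γ.integ_congr e2, Γ.integ_add cc cd, Γ.integ_comm Γ'.toPath c2, Γ'.integ_congr i2,
      Γ'.integ_smul, ← hQ]
    have e3 : EqOn (fun z => (p * (g z - κ * d)) • (f z • res G z))
        (fun z => p • ((f z * g z) • res G z) - (p * (κ * d)) • (f z • res G z)) Γ.supp := by
      intro z _
      simp only
      module
    rw [Γ.integ_congr e3, Γ.integ_sub, Γ.integ_smul (p * (κ * d)), ← hP]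
    · module
    · exact (continuousOn_smul_res (hf.mul hg).2.1 hs.subset hs.subset_rho).const_smul p
    · exact cf.const_smul (p * (κ * d))
  unfold val
  rw [← hP, ← hQ]
  rw [Γ.integ_smul] at hmain
  have hk := hG.mul_self
  have hexp : ∀ (a b q : ℂ) (P Q : X →L[ℂ] X), (a • 1 + q • P) * (b • 1 + q • Q) =
      (a * b) • 1 + (a * q) • Q + (b * q) • P + (q * q) • (P * Q) := by
    intro a b q P Q
    simp only [add_mul, mul_add, smul_mul_smul_comm, one_mul, mul_one]
    module
  rw [hexp, hmain]
  have : (κ * c * (κ * d)) = κ * (c * d) := by linear_combination c * d * hk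
  rw [this]
  simp only [smul_sub, smul_smul]
  have q1 : p⁻¹ * p⁻¹ * p = p⁻¹ := by field_simp
  have q2 : p⁻¹ * p⁻¹ * (p * (κ * d)) = κ * d * p⁻¹ := by field_simp
  have q3 : p⁻¹ * p⁻¹ * (p * (κ * c)) = κ * c * p⁻¹ := by field_simp
  rw [q1, q2, q3]
  module

end RieszDunford

namespace RieszDunford

variable {X : Type*} [NormedAddCommGroup X] [NormedSpace ℂ X]

/-! ### Bounded operators -/

/-- The graph of a bounded operator. -/
abbrev gr (A : X →L[ℂ] X) : Submodule ℂ (X × X) := (A : X →ₗ[ℂ] X).graph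

theorem mem_gr {A : X →L[ℂ] X} {p : X × X} : p ∈ gr A ↔ p.2 = A p.1 := by
  rw [gr, LinearMap.mem_graph_iff]; rfl

theorem isRes_gr {A R : X →L[ℂ] X} {z : ℂ} (h1 : (z • 1 - A) * R = 1) (h2 : R * (z • 1 - A) = 1) :
    IsRes (gr A) z R := by
  constructor
  · intro x
    rw [mem_gr]
    have := congrArg (fun L : X →L[ℂ] X => L x) h1
    simp only [mul_apply_eq_comp, _root_.sub_apply, _root_.smul_apply, one_apply_eq_self] at this
    simp only
    linear_combination (norm := module) this
  · intro p hp
    rw [mem_gr] at hp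
    have := congrArg (fun L : X →L[ℂ] X => L p.1) h2
    simp only [mul_apply_eq_comp, _root_.sub_apply, _root_.smul_apply, one_apply_eq_self] at this
    rw [hp]
    exact this

theorem IsRes.gr_left {A R : X →L[ℂ] X} {z : ℂ} (h : IsRes (gr A) z R) :
    (z • 1 - A) * R = 1 := by
  ext x
  have := h.1 x
  rw [mem_gr] at this
  simp only [mul_apply_eq_comp, _root_.sub_apply, _root_.smul_apply, one_apply_eq_self]
  simp only at this
  linear_combination (norm := module) this

theorem IsRes.gr_right {A R : X →L[ℂ] X} {z : ℂ} (h : IsRes (gr A) z R) :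
    R * (z • 1 - A) = 1 := by
  ext x
  exact h.2 (x, A x) (mem_gr.2 rfl)

variable [CompleteSpace X]

theorem isRes_gr_resolvent {A : X →L[ℂ] X} {z : ℂ} (hz : z ∈ resolventSet ℂ A) :
    IsRes (gr A) z (resolvent A z) := by
  have hz' : IsUnit (algebraMap ℂ (X →L[ℂ] X) z - A) := hz
  rw [Algebra.algebraMap_eq_smul_one] at hz'
  refine isRes_gr ?_ ?_ <;> rw [resolvent, Algebra.algebraMap_eq_smul_one]
  · exact Ring.mul_inverse_cancel _ hz'
  · exact Ring.inverse_mul_cancel _ hz'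

theorem kind_gr (A : X →L[ℂ] X) : Kind 0 (gr A) := by
  have hc : resolventSet ℂ A ∈ Bornology.cobounded ℂ := by
    have := (spectrum.isCompact (𝕜 := ℂ) A).isBounded
    rwa [Bornology.isBounded_def, spectrum, compl_compl] at this
  refine Or.inl ⟨rfl, mem_of_superset hc fun z hz => (isRes_gr_resolvent hz).mem_rho, ?_⟩
  have h1 : Tendsto (fun z => 1 + A * resolvent A z) (Bornology.cobounded ℂ) (𝓝 (1 + A * 0)) :=
    ((spectrum.resolvent_tendsto_cobounded (𝕜 := ℂ) A).const_mul A).const_add 1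
  rw [mul_zero, add_zero] at h1
  refine h1.congr' ?_
  filter_upwards [hc] with z hz
  have h2 := isRes_gr_resolvent hz
  rw [h2.res_eq]
  have := h2.gr_left
  rw [sub_mul, smul_mul_assoc, one_mul] at this
  rw [← this, sub_add_cancel]

theorem continuousOn_smul_fun {s : Set ℂ} {E : Type*} [NormedAddCommGroup E] [NormedSpace ℂ E] {f : ℂ → ℂ} {g : ℂ → E}
    (hf : ContinuousOn f s) (hg : ContinuousOn g s) : ContinuousOn (fun z => f z • g z) s := hf.smul hg

theorem continuousOn_smul_sub_const {s : Set ℂ} {E : Type*} [NormedAddCommGroup E] [NormedSpace ℂ E] {g : ℂ → E}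
    (hg : ContinuousOn g s) (x : E) : ContinuousOn (fun z => z • g z - x) s :=
  (continuousOn_id.smul hg).sub continuousOn_const

/-! ### Integrals in closed subspaces -/

variable {E : Type*} [NormedAddCommGroup E] [NormedSpace ℂ E] [CompleteSpace E]

theorem Path.integ_mem (Γ : Path) {S : Submodule ℂ E} (hS : IsClosed (S : Set E)) {f : ℂ → E}
    (hf : ContinuousOn f Γ.supp) (hm : ∀ z ∈ Γ.supp, f z ∈ S) : Γ.integ f ∈ S := by
  classical
  have : CompleteSpace S := hS.completeSpace_coe
  let g : ℂ → S := fun z => if h : z ∈ Γ.supp then ⟨f z, hm z h⟩ else 0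
  have hg : EqOn (fun z => S.subtypeL (g z)) f Γ.supp := by
    intro z hz
    simp [g, hz]
  have hgc : ContinuousOn g Γ.supp :=
    Topology.IsInducing.subtypeVal.continuousOn_iff.2 (hf.congr hg)
  rw [← Γ.integ_congr hg, Γ.integ_clm S.subtypeL hgc]
  exact Subtype.prop _

theorem Path.integ_pair_mem (Γ : Path) {G : Submodule ℂ (X × X)} (hG : IsClosed (G : Set (X × X)))
    {f g : ℂ → X} (hf : ContinuousOn f Γ.supp) (hg : ContinuousOn g Γ.supp)
    (hm : ∀ z ∈ Γ.supp, (f z, g z) ∈ G) : (Γ.integ f, Γ.integ g) ∈ G := by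
  have hfg : ContinuousOn (fun z => (f z, g z)) Γ.supp := hf.prodMk hg
  have h := Γ.integ_mem hG hfg hm
  have h1 := Γ.integ_clm (ContinuousLinearMap.fst ℂ X X) hfg
  have h2 := Γ.integ_clm (ContinuousLinearMap.snd ℂ X X) hfg
  simp only [ContinuousLinearMap.coe_fst', ContinuousLinearMap.coe_snd'] at h1 h2
  rwa [h1, h2]

variable {G : Submodule ℂ (X × X)}

theorem continuousOn_res_apply {s : Set ℂ} (h : s ⊆ rho G) (x : X) :
    ContinuousOn (fun z => res G z x) s :=
  ((continuousOn_res G).mono h).clm_apply continuousOn_const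

theorem val_apply {κ c : ℂ} {Γ : Path} {f : ℂ → ℂ} (hf : ContinuousOn f Γ.supp)
    (hs : Γ.supp ⊆ rho G) (x : X) : val G κ c Γ f x =
      (κ * c) • x + (2 * Real.pi * Complex.I : ℂ)⁻¹ • Γ.integ (fun z => f z • res G z x) := by
  have := Γ.integ_clm (ContinuousLinearMap.apply ℂ X x)
    (continuousOn_smul_fun hf ((continuousOn_res G).mono hs))
  simp only [ContinuousLinearMap.apply_apply, _root_.smul_apply] at this
  simp only [val, _root_.add_apply, _root_.smul_apply, one_apply_eq_self]
  rw [this]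

/-- The resolvent commutes with the relation. -/
theorem IsRes.apply_snd {z : ℂ} {R : X →L[ℂ] X} (h : IsRes G z R) {p : X × X} (hp : p ∈ G) :
    R p.2 = z • R p.1 - p.1 := by
  have := h.2 p hp
  rw [map_sub, map_smul] at this
  linear_combination (norm := module) -this

/-- `f(G)` commutes with `G`. -/
theorem IsCalc.mem_of_mem {κ c : ℂ} {f : ℂ → ℂ} {A : X →L[ℂ] X} (h : IsCalc G κ f c A)
    (hG : IsClosed (G : Set (X × X))) {p : X × X} (hp : p ∈ G) : (A p.1, A p.2) ∈ G := by
  obtain ⟨D, hf, -, Γ, hΓ, rfl⟩ := h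
  have hfc := hf.2.1.continuousOn.mono hΓ.subset
  rw [val_apply hfc hΓ.subset_rho, val_apply hfc hΓ.subset_rho]
  have h1 := Γ.integ_pair_mem hG (continuousOn_smul_fun hfc (continuousOn_res_apply hΓ.subset_rho p.1))
    (continuousOn_smul_fun hfc (continuousOn_res_apply hΓ.subset_rho p.2)) (fun z hz => by
      have hR := isRes_res (hΓ.subset_rho hz)
      have := G.smul_mem (f z) (hR.1 p.1)
      rw [← hR.apply_snd hp] at this
      exact this)
  exact G.add_mem (G.smul_mem (κ * c) hp) (G.smul_mem (2 * Real.pi * Complex.I : ℂ)⁻¹ h1)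

/-- The range of `f(G) - f(∞)` is contained in the domain. -/
theorem IsCalc.sub_mem_dom {κ c : ℂ} {f : ℂ → ℂ} {A : X →L[ℂ] X} (h : IsCalc G κ f c A)
    (hG : IsClosed (G : Set (X × X))) (x : X) : ∃ y, (A x - (κ * c) • x, y) ∈ G := by
  obtain ⟨D, hf, -, Γ, hΓ, rfl⟩ := h
  have hfc := hf.2.1.continuousOn.mono hΓ.subset
  have hR := continuousOn_res_apply hΓ.subset_rho x
  have h1 := Γ.integ_pair_mem hG (continuousOn_smul_fun hfc hR) (continuousOn_smul_fun hfc (continuousOn_smul_sub_const hR x)) fun z hz => G.smul_mem (f z) ((isRes_res (hΓ.subset_rho hz)).1 x)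
  refine ⟨(2 * Real.pi * Complex.I : ℂ)⁻¹ • Γ.integ (fun z => f z • (z • res G z x - x)), ?_⟩
  rw [val_apply hfc hΓ.subset_rho, add_sub_cancel_left]
  exact G.smul_mem (2 * Real.pi * Complex.I : ℂ)⁻¹ h1

theorem tendsto_zero_of_tendsto_smul {f : ℂ → ℂ} {a : ℂ}
    (h : Tendsto (fun z => z * f z) (Bornology.cobounded ℂ) (𝓝 a)) :
    Tendsto f (Bornology.cobounded ℂ) (𝓝 0) := by
  have := (tendsto_inv₀_cobounded (α := ℂ)).mul h
  rw [zero_mul] at this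
  refine this.congr' ?_
  filter_upwards [eventually_cobounded_ne 0] with z hz
  rw [inv_mul_cancel_left₀ hz]

/-- If `h(∞) = 0` and `z h` has a value at infinity, then `(z h)(G) = G h(G)`. -/
theorem IsCalc.id_mul {κ c : ℂ} {h : ℂ → ℂ} {A A' : X →L[ℂ] X} (hA : IsCalc G κ h 0 A)
    (hA' : IsCalc G κ (fun z => z * h z) c A') (hk : Kind κ G) (hG : IsClosed (G : Set (X × X))) :
    (∀ x, (A x, A' x) ∈ G) ∧ ∀ p ∈ G, A p.2 = A' p.1 := by
  obtain ⟨D, hf, hf', hD, W, Γ, hΓ, rfl, rfl⟩ := hk.common hA hA'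
  have hs := hΓ.sep
  have hfc := hf.2.1.continuousOn.mono hs.subset
  have hfc' := hf'.2.1.continuousOn.mono hs.subset
  have hi : Γ.integ h = (2 * Real.pi * Complex.I * -κ) • c :=
    integ_eq_of_tendsto Γ hf.1 hs.subset hs.2.2 hf.2.1 (by
      rcases hf'.2.2 with h0 | h0
      · left; rw [h0, neg_zero]
      · exact Or.inr h0)
  have hp0 : (2 * Real.pi * Complex.I : ℂ) ≠ 0 := Complex.two_pi_I_ne_zero
  have key : ∀ x, (2 * Real.pi * Complex.I : ℂ)⁻¹ • Γ.integ (fun z => h z • (z • res G z x - x)) =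
      val G κ c Γ.toPath (fun z => z * h z) x := by
    intro x
    have hR := continuousOn_res_apply hs.subset_rho x
    have e : EqOn (fun z => h z • (z • res G z x - x))
        (fun z => (z * h z) • res G z x - h z • x) Γ.supp := by
      intro z _
      simp only
      module
    rw [val_apply hfc' hs.subset_rho, Γ.integ_congr e, Γ.integ_sub (continuousOn_smul_fun hfc' hR)
      (continuousOn_smul_fun hfc continuousOn_const (g := fun _ => x)), Γ.integ_smul_const hfc, hi, smul_sub, smul_smul, smul_eq_mul]
    have : (2 * Real.pi * Complex.I : ℂ)⁻¹ * (2 * Real.pi * Complex.I * -κ * c) = -(κ * c) := by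
      field_simp
    rw [this]
    module
  constructor
  · intro x
    have hR := continuousOn_res_apply hs.subset_rho x
    have h1 := Γ.integ_pair_mem hG (continuousOn_smul_fun hfc hR) (continuousOn_smul_fun hfc (continuousOn_smul_sub_const hR x)) fun z hz => G.smul_mem (h z) ((isRes_res (hs.subset_rho hz)).1 x)
    have h2 := G.smul_mem (2 * Real.pi * Complex.I : ℂ)⁻¹ h1
    rw [Prod.smul_mk] at h2
    rw [val_apply hfc hs.subset_rho, ← key, mul_zero, zero_smul, zero_add]
    exact h2
  · intro p hp
    rw [val_apply hfc hs.subset_rho, ← key, mul_zero, zero_smul, zero_add]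
    congr 1
    refine Γ.integ_congr fun z hz => ?_
    rw [(isRes_res (hs.subset_rho hz)).apply_snd hp]

/-! ### The unit -/

theorem isCalc_one {κ : ℂ} (hk : Kind κ G) : IsCalc G κ (fun _ => 1) 1 1 := by
  have hc : κ = 0 ∨ (univ : Set ℂ) ∈ Bornology.cobounded ℂ := Or.inr univ_mem
  obtain ⟨W, Γ, hΓ⟩ := hk.exists_nbhd isOpen_univ (subset_univ _) hc
  refine ⟨univ, Hol.const isOpen_univ hc 1, subset_univ _, Γ, hΓ.sep, ?_⟩
  have hs := hΓ.sep
  have h1 : Γ.integ (res G) = (2 * Real.pi * Complex.I * (1 - κ)) • 1 := by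
    refine integ_eq_of_tendsto Γ (isOpen_rho G) hs.subset_rho hs.2.1 (differentiableOn_res G) ?_
    rcases hk with ⟨-, h⟩ | h
    · exact Or.inr h
    · left; rw [h, sub_self]
  have hp0 : (2 * Real.pi * Complex.I : ℂ) ≠ 0 := Complex.two_pi_I_ne_zero
  simp only [val, one_smul]
  rw [h1, smul_smul, inv_mul_cancel_left₀ hp0]
  module

/-! ### Intertwining operators -/

variable {Y : Type*} [NormedAddCommGroup Y] [NormedSpace ℂ Y] [CompleteSpace Y]

omit [CompleteSpace X] [CompleteSpace Y] in
theorem res_intertwine {G' : Submodule ℂ (Y × Y)} {L : X →L[ℂ] Y}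
    (hL : ∀ p ∈ G, (L p.1, L p.2) ∈ G') {z : ℂ} (hz : z ∈ rho G) (hz' : z ∈ rho G') (x : X) :
    L (res G z x) = res G' z (L x) := by
  have h1 := (isRes_res hz').2 _ (hL _ ((isRes_res hz).1 x))
  simp only [map_sub, map_smul] at h1
  rw [← h1]
  simp only [map_sub, map_smul, sub_sub_cancel]

theorem IsCalc.intertwine {G' : Submodule ℂ (Y × Y)} {L : X →L[ℂ] Y}
    (hL : ∀ p ∈ G, (L p.1, L p.2) ∈ G') (hσ : rho G' ⊆ rho G) {κ κ' c : ℂ} (hk : Kind κ G)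
    (hκ : κ = κ' ∨ κ = 0) {f : ℂ → ℂ} {A : X →L[ℂ] X} {A' : Y →L[ℂ] Y}
    (hA : IsCalc G κ f c A) (hA' : IsCalc G' κ' f c A') (x : X) : L (A x) = A' (L x) := by
  obtain ⟨D, hf, hD, Γ', hΓ', rfl⟩ := hA'
  have hf' : Hol κ D f c := by
    rcases hκ with rfl | rfl
    · exact hf
    · exact ⟨hf.1, hf.2.1, Or.inl rfl⟩
  obtain ⟨W, Γ, hΓ⟩ := hk.exists_nbhd hf.1 ((compl_subset_compl.2 hσ).trans hD) hf'.cobounded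
  have hs := hΓ.sep
  rw [hA.eq_val hf' hs]
  have hd : DifferentiableOn ℂ (fun z => f z • L (res G z x)) (D ∩ rho G) := by
    refine (hf.2.1.mono inter_subset_left).smul ?_
    have h1 := ((differentiableOn_res G).mono inter_subset_right : DifferentiableOn ℂ _ (D ∩ rho G))
    exact L.differentiable.comp_differentiableOn (h1.clm_apply (differentiableOn_const x))
  have key := sum_integ_eq_of_tendsto ![Γ, Γ'] ![1, -1] (Ω := D ∩ rho G) (m := κ' - κ)
    (hf.1.inter (isOpen_rho G))
    (by
      simp only [Fin.forall_fin_two, Matrix.cons_val_zero, Matrix.cons_val_one]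
      exact ⟨subset_inter hs.subset hs.subset_rho,
        subset_inter hΓ'.subset (hΓ'.subset_rho.trans hσ)⟩)
    (by
      intro z hz
      simp only [Fin.sum_univ_two, Matrix.cons_val_zero, Matrix.cons_val_one]
      by_cases hzD : z ∈ D
      · have hzr : z ∉ rho G := fun h => hz ⟨hzD, h⟩
        rw [hs.2.1 z hzr, hΓ'.2.1 z fun h => hzr (hσ h)]
        ring
      · rw [hs.2.2 z hzD, hΓ'.2.2 z hzD]
        ring) hd (a := c • L x) (by
      rcases hκ with rfl | rfl
      · left; ring
      rcases hf.2.2 with h | ⟨h1, h2⟩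
      · left; rw [h, sub_zero]
      · right
        rcases hk with ⟨-, h3, h4⟩ | h3
        · refine ⟨inter_mem h1 h3, ?_⟩
          have h5 : Tendsto (fun z => f z • L ((z • res G z) x)) (Bornology.cobounded ℂ)
              (𝓝 (c • L ((1 : X →L[ℂ] X) x))) :=
            h2.smul ((L.continuous.tendsto _).comp
              (((ContinuousLinearMap.apply ℂ X x).continuous.tendsto _).comp h4))
          refine h5.congr fun z => ?_
          rw [_root_.smul_apply, map_smul, smul_comm]
        · exact absurd h3 zero_ne_one)
  simp only [Fin.sum_univ_two, Matrix.cons_val_zero, Matrix.cons_val_one] at key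
  have hfc := hf.2.1.continuousOn.mono hs.subset
  have hfc' := hf.2.1.continuousOn.mono hΓ'.subset
  rw [val_apply hfc hs.subset_rho, val_apply hfc' hΓ'.subset_rho, map_add, map_smul, map_smul,
    ← Γ.integ_clm L (continuousOn_smul_fun hfc (continuousOn_res_apply hs.subset_rho x))]
  have e : EqOn (fun z => f z • res G' z (L x)) (fun z => f z • L (res G z x)) Γ'.supp := by
    intro z hz
    simp only
    rw [res_intertwine hL (hσ (hΓ'.subset_rho hz)) (hΓ'.subset_rho hz)]
  rw [Γ'.integ_congr e]
  simp only [map_smul]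
  have hp0 : (2 * Real.pi * Complex.I : ℂ) ≠ 0 := Complex.two_pi_I_ne_zero
  have key2 : (2 * Real.pi * Complex.I : ℂ)⁻¹ • Γ.integ (fun z => f z • L (res G z x)) =
      (2 * Real.pi * Complex.I : ℂ)⁻¹ • Γ'.integ (fun z => f z • L (res G z x)) +
        (κ' - κ) • c • L x := by
    have : Γ.integ (fun z => f z • L (res G z x)) = Γ'.integ (fun z => f z • L (res G z x)) +
        (2 * Real.pi * Complex.I * (κ' - κ)) • c • L x := by
      rw [← key]; module
    rw [this, smul_add, smul_smul _ (_ * _), inv_mul_cancel_left₀ hp0]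
  rw [key2]
  module

end RieszDunford

namespace RieszDunford

variable {X : Type*} [NormedAddCommGroup X] [NormedSpace ℂ X] [CompleteSpace X]
  {G : Submodule ℂ (X × X)} {κ c : ℂ} {f : ℂ → ℂ} {A : X →L[ℂ] X}

theorem IsCalc.congr (hk : Kind κ G) (hA : IsCalc G κ f c A) {g : ℂ → ℂ} {D : Set ℂ}
    (hD : IsOpen D) (hσ : (rho G)ᶜ ⊆ D) (hc : κ = 0 ∨ D ∈ Bornology.cobounded ℂ)
    (h : EqOn f g D) : IsCalc G κ g c A := by
  obtain ⟨D', hf, hD', -⟩ := id hA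
  have hc' := cobounded_inter hf.cobounded hc
  have hf' := hf.mono (hf.1.inter hD) inter_subset_left hc'
  obtain ⟨W, Γ, hΓ⟩ := hk.exists_nbhd hf'.1 (subset_inter hD' hσ) hc'
  have heq : EqOn f g (D' ∩ D) := h.mono inter_subset_right
  refine ⟨D' ∩ D, ⟨hf'.1, hf'.2.1.congr heq.symm, ?_⟩, subset_inter hD' hσ, Γ, hΓ.sep, ?_⟩
  · refine hf'.2.2.imp_right fun h1 => ⟨h1.1, h1.2.congr' ?_⟩
    filter_upwards [h1.1] with z hz using heq hz
  · rw [hA.eq_val hf' hΓ.sep, val, val]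
    congr 2
    exact Γ.integ_congr fun z hz => by simp only [heq (hΓ.sep.subset hz)]

theorem IsCalc.const_sub (hk : Kind κ G) (hA : IsCalc G κ f c A) (w : ℂ) :
    IsCalc G κ (fun z => w - f z) (w - c) (w • 1 - A) := by
  have := (isCalc_one hk).add_smul hk (hA.add_smul hk hA (-2)) w
  convert this using 1
  · funext z; ring
  · ring
  · module

theorem IsCalc.comm (hk : Kind κ G) (hA : IsCalc G κ f c A) {g : ℂ → ℂ} {d : ℂ} {B : X →L[ℂ] X}
    (hB : IsCalc G κ g d B) : A * B = B * A := by
  have h1 := hA.mul hk hB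
  have h2 := hB.mul hk hA
  rw [mul_comm d c] at h2
  simp only [mul_comm (g _)] at h2
  exact h1.unique h2

/-! ### The spectral mapping theorem -/

theorem Hol.inv {D : Set ℂ} (hf : Hol κ D f c) {w : ℂ} (h0 : ∀ z ∈ D, f z ≠ w)
    (hc : κ = 0 ∨ c ≠ w) : Hol κ D (fun z => (w - f z)⁻¹) (w - c)⁻¹ := by
  refine ⟨hf.1, (hf.2.1.const_sub w).inv fun z hz => sub_ne_zero.2 (h0 z hz).symm, ?_⟩
  rcases hc with h | h
  · exact Or.inl h
  · exact hf.2.2.imp_right fun h1 => ⟨h1.1, (h1.2.const_sub w).inv₀ (sub_ne_zero.2 h.symm)⟩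

theorem IsCalc.inv (hk : Kind κ G) (hA : IsCalc G κ f c A) {D : Set ℂ} (hf : Hol κ D f c)
    (hD : (rho G)ᶜ ⊆ D) {w : ℂ} (h0 : ∀ z ∈ D, f z ≠ w) (hc : κ = 0 ∨ c ≠ w) :
    w ∈ rho (gr A) ∧ IsCalc G κ (fun z => (w - f z)⁻¹) (w - c)⁻¹ (res (gr A) w) := by
  obtain ⟨R, hR⟩ := exists_isCalc hk (hf.inv h0 hc) hD
  have h1 := hA.const_sub hk w
  have h2 : (w • 1 - A) * R = 1 := by
    have h3 := (h1.mul hk hR).congr hk (g := fun _ => 1) hf.1 hD hf.cobounded fun z hz =>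
      mul_inv_cancel₀ (sub_ne_zero.2 (h0 z hz).symm)
    rcases hc with h | h
    · obtain ⟨D', hf', hD', Γ, hΓ, h4⟩ := h3
      rw [h4, (isCalc_one hk).eq_val (D := D') (Γ := Γ) (Hol.const hf'.1 hf'.cobounded 1) hΓ]
      simp [val, h]
    · rw [mul_inv_cancel₀ (sub_ne_zero.2 h.symm)] at h3
      exact h3.unique (isCalc_one hk)
  have h5 : IsRes (gr A) w R := isRes_gr h2 ((h1.comm hk hR).symm.trans h2)
  exact ⟨h5.mem_rho, h5.res_eq ▸ hR⟩

theorem IsCalc.mem_rho_gr (hk : Kind κ G) (hA : IsCalc G κ f c A) {w : ℂ}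
    (h0 : ∀ z ∉ rho G, f z ≠ w) (hc : κ = 0 ∨ c ≠ w) : w ∈ rho (gr A) := by
  obtain ⟨D, hf, hD, -⟩ := id hA
  have ho : IsOpen (D ∩ f ⁻¹' {w}ᶜ) :=
    hf.2.1.continuousOn.isOpen_inter_preimage hf.1 isOpen_compl_singleton
  have hcb : κ = 0 ∨ D ∩ f ⁻¹' {w}ᶜ ∈ Bornology.cobounded ℂ := by
    rcases hc with h | h
    · exact Or.inl h
    · exact hf.2.2.imp_right fun h1 =>
        inter_mem h1.1 (h1.2.eventually (isOpen_compl_singleton.mem_nhds h))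
  exact (hA.inv hk (hf.mono ho inter_subset_left hcb) (fun z hz => ⟨hD hz, h0 z hz⟩)
    (fun z hz => hz.2) hc).1

theorem IsCalc.apply_notMem_rho_gr (hk : Kind κ G) (hG : IsClosed (G : Set (X × X)))
    (hA : IsCalc G κ f c A) {a : ℂ} (ha : a ∉ rho G) : f a ∉ rho (gr A) := by
  rintro ⟨B, hB⟩
  apply ha
  obtain ⟨D, hf, hD, -⟩ := id hA
  have haD : a ∈ D := hD ha
  have hd : DifferentiableOn ℂ (dslope f a) D :=
    (Complex.differentiableOn_dslope (hf.1.mem_nhds haD)).2 hf.2.1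
  have hz : ∀ z, z * dslope f a z = -1 * (f a - f z) + ((a - 1) * dslope f a z + dslope f a z) := by
    intro z
    have := sub_smul_dslope f a z
    rw [smul_eq_mul] at this
    linear_combination this
  have hh : Hol κ D (dslope f a) 0 := by
    refine ⟨hf.1, hd, hf.2.2.imp_right fun h1 => ⟨h1.1, ?_⟩⟩
    refine tendsto_zero_of_tendsto_smul (a := c - f a)
      ((tendsto_id_mul_inv_sub_mul (h1.2.sub_const (f a)) a).congr' ?_)
    filter_upwards [eventually_cobounded_ne a] with z hz
    rw [dslope_of_ne _ hz, slope_def_field, div_eq_inv_mul, smul_eq_mul]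
  obtain ⟨H, hH⟩ := exists_isCalc hk hh hD
  have hH' := (hA.const_sub hk (f a)).add_smul hk (hH.add_smul hk hH (a - 1)) (-1)
  rw [← funext hz] at hH'
  obtain ⟨m1, m2⟩ := hH.id_mul hH' hk hG
  have hAH := (hA.const_sub hk (f a)).comm hk hH
  have hBH : H * B = B * H := by
    calc H * B = (B * (f a • 1 - A)) * H * B := by rw [hB.gr_right, one_mul]
      _ = B * H * ((f a • 1 - A) * B) := by rw [mul_assoc B, hAH]; simp only [mul_assoc]
      _ = B * H := by rw [hB.gr_left, mul_one]
  refine ⟨H * B, fun x => ?_, fun p hp => ?_⟩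
  · have h1 := m1 (B x)
    have h2 := congrArg (fun L : X →L[ℂ] X => L x) hB.gr_left
    simp only [mul_apply_eq_comp, one_apply_eq_self] at h2
    rw [mul_apply_eq_comp]
    convert h1 using 2
    simp only [_root_.add_apply, _root_.smul_apply, h2]
    module
  · have h2 := congrArg (fun L : X →L[ℂ] X => L p.1) hB.gr_right
    simp only [mul_apply_eq_comp, one_apply_eq_self] at h2
    rw [hBH, mul_apply_eq_comp, map_sub, map_smul, m2 p hp]
    conv_rhs => rw [← h2]
    congr 1
    simp only [_root_.add_apply, _root_.smul_apply]
    module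

theorem IsCalc.infty_notMem_rho_gr (hG : IsClosed (G : Set (X × X))) (hA : IsCalc G 1 f c A)
    {x : X} (hx : ∀ y, (x, y) ∉ G) : c ∉ rho (gr A) := by
  rintro ⟨B, hB⟩
  obtain ⟨y, hy⟩ := hA.sub_mem_dom hG (B x)
  have h2 := congrArg (fun L : X →L[ℂ] X => L x) hB.gr_left
  simp only [mul_apply_eq_comp, one_apply_eq_self, _root_.sub_apply, _root_.smul_apply] at h2
  rw [one_mul] at hy
  refine hx (-y) ?_
  have := G.neg_mem hy
  rwa [Prod.neg_mk, neg_sub, h2] at this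

/-! ### Composition -/

theorem IsCalc.comp (hk : Kind κ G) (hA : IsCalc G κ f c A) {g : ℂ → ℂ} {d : ℂ} {B : X →L[ℂ] X}
    (hB : IsCalc (gr A) 0 g d B) (hσ : ∀ a ∉ rho G, f a ∉ rho (gr A))
    (hc : κ = 0 ∨ c ∉ rho (gr A)) : IsCalc G κ (fun z => g (f z)) (g c) B := by
  obtain ⟨D, hf, hD, -⟩ := id hA
  obtain ⟨Dg, hg, hDg, -⟩ := id hB
  obtain ⟨Wg, Γg, hΓg⟩ := (kind_gr A).exists_nbhd hg.1 hDg (Or.inl rfl)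
  have hsg := hΓg.sep
  have hBv := hB.eq_val hg hsg
  have ho : IsOpen (D ∩ f ⁻¹' Wg) := hf.2.1.continuousOn.isOpen_inter_preimage hf.1 hΓg.isOpen
  have hcW : κ = 0 ∨ c ∈ Wg := hc.imp_right fun h => hΓg.subset h
  have hWD : Wg ⊆ Dg := subset_closure.trans hΓg.closure_subset
  have hcb : κ = 0 ∨ D ∩ f ⁻¹' Wg ∈ Bornology.cobounded ℂ := by
    rcases hcW with h | h
    · exact Or.inl h
    · exact hf.2.2.imp_right fun h1 =>
        inter_mem h1.1 (h1.2.eventually (hΓg.isOpen.mem_nhds h))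
  have hf' := hf.mono ho inter_subset_left hcb
  have hσ' : (rho G)ᶜ ⊆ D ∩ f ⁻¹' Wg := fun a ha => ⟨hD ha, hΓg.subset (hσ a ha)⟩
  obtain ⟨W, Γ, hΓ⟩ := hk.exists_nbhd ho hσ' hcb
  have hs := hΓ.sep
  have hgf : Hol κ (D ∩ f ⁻¹' Wg) (fun z => g (f z)) (g c) := by
    refine ⟨ho, hg.2.1.comp hf'.2.1 fun z hz => hWD hz.2, ?_⟩
    rcases hcW with h | h
    · exact Or.inl h
    · refine hf'.2.2.imp_right fun h1 => ⟨h1.1, ?_⟩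
      exact ((hg.2.1.differentiableAt (hg.1.mem_nhds (hWD h))).continuousAt.tendsto).comp h1.2
  refine ⟨_, hgf, hσ', Γ, hs, ?_⟩
  set p : ℂ := 2 * Real.pi * Complex.I with hp
  have hp0 : p ≠ 0 := Complex.two_pi_I_ne_zero
  have hdis : ∀ w ∈ Γg.supp, w ∉ Wg := fun w hw h =>
    (disjoint_frontier_iff_isOpen.2 hΓg.isOpen).le_bot ⟨hΓg.supp_eq ▸ hw, h⟩
  have hne : ∀ z ∈ Γ.supp, ∀ w ∈ Γg.supp, w - f z ≠ 0 := fun z hz w hw h =>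
    hdis w hw (sub_eq_zero.1 h ▸ (hs.subset hz).2)
  have hres : ∀ w ∈ Γg.supp, res (gr A) w = (κ * (w - c)⁻¹) • 1 +
      p⁻¹ • Γ.integ (fun z => (w - f z)⁻¹ • res G z) := by
    intro w hw
    have h0 : ∀ z ∈ D ∩ f ⁻¹' Wg, f z ≠ w := fun z hz h => hdis w hw (h ▸ hz.2)
    have h1 : κ = 0 ∨ c ≠ w := hcW.imp_right fun h h' => hdis w hw (h' ▸ h)
    exact (hA.inv hk hf' hσ' h0 h1).2.eq_val (hf'.inv h0 h1) hs
  have hgc : ContinuousOn g Γg.supp := hg.2.1.continuousOn.mono hsg.subset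
  have hcf : ContinuousOn f Γ.supp := hf'.2.1.continuousOn.mono hs.subset
  have c1 : ContinuousOn (fun w => (κ * ((w - c)⁻¹ * g w)) • (1 : X →L[ℂ] X)) Γg.supp := by
    rcases hcW with h | h
    · simp only [h, zero_mul, zero_smul]
      exact continuousOn_const
    · exact ((continuousOn_const.mul ((Grid.differentiableOn_inv_sub
        fun h' => hdis c h' h).continuousOn.mul hgc))).smul continuousOn_const
  have hsplit : EqOn (fun w => g w • res (gr A) w) (fun w => (κ * ((w - c)⁻¹ * g w)) • 1 +
      p⁻¹ • Γ.integ (fun z => ((w - f z)⁻¹ * g w) • res G z)) Γg.supp := by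
    intro w hw
    simp only
    rw [hres w hw, smul_add, smul_comm (g w) p⁻¹, ← Γ.integ_smul]
    congr 1
    · rw [smul_smul]; congr 1; ring
    · congr 2
      funext z
      rw [smul_smul]; congr 1; ring
  have cr : ContinuousOn (fun w => g w • res (gr A) w) Γg.supp :=
    continuousOn_smul_fun hgc ((continuousOn_res _).mono hsg.subset_rho)
  have c2 : ContinuousOn (fun w => p⁻¹ • Γ.integ (fun z => ((w - f z)⁻¹ * g w) • res G z))
      Γg.supp :=
    (cr.sub c1).congr fun w hw => eq_sub_of_add_eq' (hsplit hw).symm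
  have hcomm := Γg.integ_comm Γ.toPath (f := fun w z => ((w - f z)⁻¹ * g w) • res G z) (by
    have e1 : ContinuousOn (fun q : ℂ × ℂ => q.1 - f q.2) (Γg.supp ×ˢ Γ.supp) :=
      continuousOn_fst.sub (hcf.comp continuousOn_snd fun q hq => hq.2)
    have e2 : ContinuousOn (fun q : ℂ × ℂ => g q.1) (Γg.supp ×ˢ Γ.supp) :=
      hgc.comp continuousOn_fst fun q hq => hq.1
    have e3 : ContinuousOn (fun q : ℂ × ℂ => res G q.2) (Γg.supp ×ˢ Γ.supp) :=
      ((continuousOn_res G).mono hs.subset_rho).comp continuousOn_snd fun q hq => hq.2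
    exact ((e1.inv₀ fun q hq => hne q.2 hq.2 q.1 hq.1).mul e2).smul e3)
  have hin : ∀ a ∈ Wg, Γg.integ (fun w => (w - a)⁻¹ * g w) = p * g a := by
    intro a ha
    rw [cauchy_formula hg hsg.subset hsg.2.2 (hWD ha) (fun h => hdis a h ha), hΓg.ind_in a ha]
    ring
  have hinner : EqOn (fun z => Γg.integ (fun w => ((w - f z)⁻¹ * g w) • res G z))
      (fun z => p • (g (f z) • res G z)) Γ.supp := by
    intro z hz
    have hzW := (hs.subset hz).2
    simp only
    rw [Γg.integ_smul_const (f := fun w => (w - f z)⁻¹ * g w), hin _ hzW, smul_smul]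
    exact (Grid.differentiableOn_inv_sub fun h => hdis _ h hzW).continuousOn.mul hgc
  have h1 : Γg.integ (fun w => (κ * ((w - c)⁻¹ * g w)) • (1 : X →L[ℂ] X)) =
      (p * (κ * g c)) • 1 := by
    rcases hcW with h | h
    · simp only [h, zero_mul, zero_smul, mul_zero]
      exact Γg.integ_zero
    · have hc1 : ContinuousOn (fun w => (w - c)⁻¹ * g w) Γg.supp :=
        (Grid.differentiableOn_inv_sub fun h' => hdis c h' h).continuousOn.mul hgc
      simp only [mul_smul κ]
      rw [Γg.integ_smul, Γg.integ_smul_const hc1, hin c h, smul_smul]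
      congr 1
      ring
  rw [hBv, val, val, zero_mul, zero_smul, zero_add, ← hp, Γg.integ_congr hsplit,
    Γg.integ_add c1 c2, h1, Γg.integ_smul, hcomm, Γ.integ_congr hinner, Γ.integ_smul,
    inv_smul_smul₀ hp0, smul_add, smul_smul, inv_mul_cancel_left₀ hp0]

/-! ### Spectral projections -/

/-- A resolvent on the part of the spectrum on which `f` does not vanish. -/
theorem IsCalc.exists_local_res (hk : Kind κ G) (hG : IsClosed (G : Set (X × X)))
    (hA : IsCalc G κ f c A) {a : ℂ} (ha : a ∈ rho G ∨ ∀ᶠ z in 𝓝 a, f z = 0) :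
    ∃ H : X →L[ℂ] X, H * A = A * H ∧ (∀ x, (H x, a • H x - A x) ∈ G) ∧
      ∀ p ∈ G, H (a • p.1 - p.2) = A p.1 := by
  obtain ⟨D₀, hf, hD₀, -⟩ := id hA
  obtain ⟨D, hDo, hDs, hσ, hcb, hd, heq⟩ : ∃ D, IsOpen D ∧ D ⊆ D₀ ∧ (rho G)ᶜ ⊆ D ∧
      (κ = 0 ∨ D ∈ Bornology.cobounded ℂ) ∧
      DifferentiableOn ℂ (fun z => (z - a)⁻¹ * f z) D ∧ ∀ z ∈ D, (z - a) * ((z - a)⁻¹ * f z) = f z := by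
    have hd : ∀ z ∈ D₀, z ≠ a → DifferentiableAt ℂ (fun z => (z - a)⁻¹ * f z) z := fun z hz hza =>
      ((differentiableAt_id.sub_const a).inv (sub_ne_zero.2 hza)).mul
        (hf.2.1.differentiableAt (hf.1.mem_nhds hz))
    rcases ha with ha | ha
    · refine ⟨D₀ ∩ {a}ᶜ, hf.1.inter isOpen_compl_singleton, inter_subset_left,
        subset_inter hD₀ fun z hz h => hz (h ▸ ha),
        cobounded_inter hf.cobounded (Or.inr (eventually_cobounded_ne a)),
        fun z hz => (hd z hz.1 hz.2).differentiableWithinAt, fun z hz => ?_⟩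
      exact mul_inv_cancel_left₀ (sub_ne_zero.2 hz.2) _
    · refine ⟨D₀, hf.1, subset_rfl, hD₀, hf.cobounded, fun z hz => ?_, fun z hz => ?_⟩
      · rcases eq_or_ne z a with rfl | hza
        · refine DifferentiableAt.differentiableWithinAt ?_
          refine (differentiableAt_const (0 : ℂ)).congr_of_eventuallyEq ?_
          filter_upwards [ha] with w hw
          rw [hw, mul_zero]
        · exact (hd z hz hza).differentiableWithinAt
      · rcases eq_or_ne z a with rfl | hza
        · rw [ha.self_of_nhds, mul_zero, mul_zero]
        · exact mul_inv_cancel_left₀ (sub_ne_zero.2 hza) _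
  have hh : Hol κ D (fun z => (z - a)⁻¹ * f z) 0 := by
    refine ⟨hDo, hd, ?_⟩
    rcases hf.2.2 with h | h
    · exact Or.inl h
    · exact hcb.imp_right fun h1 =>
        ⟨h1, tendsto_zero_of_tendsto_smul (tendsto_id_mul_inv_sub_mul h.2 a)⟩
  obtain ⟨H, hH⟩ := exists_isCalc hk hh hσ
  have hH' := (hA.add_smul hk (hH.add_smul hk hH (a - 1)) 1).congr hk
    (g := fun z => z * ((z - a)⁻¹ * f z)) hDo hσ hcb fun z hz => by
      have := heq z hz
      simp only
      linear_combination -this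
  obtain ⟨m1, m2⟩ := hH.id_mul hH' hk hG
  refine ⟨-H, by rw [neg_mul, mul_neg, hH.comm hk hA], fun x => ?_, fun p hp => ?_⟩
  · have := G.neg_mem (m1 x)
    rw [Prod.neg_mk] at this
    convert this using 1
    refine Prod.ext rfl ?_
    simp only [_root_.add_apply, _root_.smul_apply, _root_.neg_apply]
    module
  · rw [_root_.neg_apply, map_sub, map_smul, m2 p hp]
    simp only [_root_.add_apply, _root_.smul_apply]
    module

variable {Y : Type*} [NormedAddCommGroup Y] [NormedSpace ℂ Y]

/-- The part of `G` in the range of the projection `f(G) = ι π`. -/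
theorem IsCalc.mem_rho_of_retract (hk : Kind κ G) (hG : IsClosed (G : Set (X × X)))
    (hA : IsCalc G κ f c A) {ι : Y →L[ℂ] X} {π : X →L[ℂ] Y} (h1 : ∀ y, π (ι y) = y)
    (h2 : ∀ x, ι (π x) = A x) {G' : Submodule ℂ (Y × Y)} (hG' : ∀ q, q ∈ G' ↔ (ι q.1, ι q.2) ∈ G)
    {a : ℂ} (ha : a ∈ rho G ∨ ∀ᶠ z in 𝓝 a, f z = 0) : a ∈ rho G' := by
  obtain ⟨H, hc, m1, m2⟩ := hA.exists_local_res hk hG ha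
  have hAι : ∀ y, A (ι y) = ι y := fun y => by rw [← h2, h1]
  refine ⟨π.comp (H.comp ι), fun y => ?_, fun q hq => ?_⟩
  · rw [hG']
    have h3 : A (H (ι y)) = H (ι y) := by
      have := congrArg (fun L : X →L[ℂ] X => L (ι y)) hc
      simp only [mul_apply_eq_comp, hAι] at this
      exact this.symm
    have := m1 (ι y)
    rw [hAι] at this
    simpa only [ContinuousLinearMap.comp_apply, map_sub, map_smul, h2, h3] using this
  · have := m2 _ ((hG' q).1 hq)
    rw [hAι, ← map_smul, ← map_sub] at this
    rw [ContinuousLinearMap.comp_apply, ContinuousLinearMap.comp_apply, this, h1]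

theorem IsCalc.mem_rho_of_mem_retract (hk : Kind κ G) (hG : IsClosed (G : Set (X × X)))
    (hA : IsCalc G κ f c A) {ι : Y →L[ℂ] X} {π : X →L[ℂ] Y} (h1 : ∀ y, π (ι y) = y)
    (h2 : ∀ x, ι (π x) = A x) {G' : Submodule ℂ (Y × Y)} (hG' : ∀ q, q ∈ G' ↔ (ι q.1, ι q.2) ∈ G)
    {a : ℂ} (ha : ∀ᶠ z in 𝓝 a, f z = 1) (ha' : a ∈ rho G') : a ∈ rho G := by
  obtain ⟨H, -, m1, m2⟩ := (hA.const_sub hk 1).exists_local_res hk hG (a := a)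
    (Or.inr (ha.mono fun z hz => by rw [hz, sub_self]))
  obtain ⟨R, hR⟩ := ha'
  refine ⟨ι.comp (R.comp π) + H, fun x => ?_, fun p hp => ?_⟩
  · have h3 := G.add_mem ((hG' _).1 (hR.1 (π x))) (m1 x)
    rw [Prod.mk_add_mk] at h3
    convert h3 using 1
    refine Prod.ext rfl ?_
    simp only [_root_.add_apply, ContinuousLinearMap.comp_apply, map_sub, map_smul, h2,
      _root_.sub_apply, _root_.smul_apply, one_apply_eq_self]
    module
  · have h3 : (π p.1, π p.2) ∈ G' := by
      rw [hG']
      simp only [h2]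
      exact hA.mem_of_mem hG hp
    have h4 := hR.2 _ h3
    have h5 := m2 p hp
    simp only [_root_.add_apply, ContinuousLinearMap.comp_apply, map_sub, map_smul, h2,
      _root_.sub_apply, _root_.smul_apply, one_apply_eq_self] at h4 h5 ⊢
    have h6 := congrArg ι h4
    simp only [map_sub, map_smul, h2] at h6
    linear_combination (norm := module) h6 + h5

end RieszDunford

namespace RieszDunford

variable {X : Type*} [NormedAddCommGroup X] [NormedSpace ℂ X] [CompleteSpace X]
  {G : Submodule ℂ (X × X)} {κ c : ℂ} {f : ℂ → ℂ} {A : X →L[ℂ] X}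

/-! ### Powers and bounds -/

theorem IsCalc.pow (hk : Kind κ G) (hA : IsCalc G κ f c A) (n : ℕ) :
    IsCalc G κ (fun z => f z ^ n) (c ^ n) (A ^ n) := by
  induction n with
  | zero => simpa using isCalc_one hk
  | succ n ih => simpa only [pow_succ] using ih.mul hk hA

theorem Hol.zero_kind {D : Set ℂ} {d : ℂ} (h : Hol 0 D f c) : Hol 0 D f d :=
  ⟨h.1, h.2.1, Or.inl rfl⟩

theorem IsCalc.zero_kind {d : ℂ} (h : IsCalc G 0 f c A) : IsCalc G 0 f d A := by
  obtain ⟨D, hf, hD, Γ, hΓ, rfl⟩ := h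
  exact ⟨D, hf.zero_kind, hD, Γ, hΓ, by simp only [val, zero_mul]⟩

theorem isCalc_id (A : X →L[ℂ] X) : IsCalc (gr A) 0 (fun z => z) c A := by
  have hk := kind_gr A
  have h1 : IsCalc (gr A) 0 (fun _ => 1) 0 1 := (isCalc_one hk).zero_kind
  obtain ⟨A', hA'⟩ := exists_isCalc (c := c) (f := fun z => z * 1) hk
    ⟨isOpen_univ, differentiable_id.mul_const 1 |>.differentiableOn, Or.inl rfl⟩ (subset_univ _)
  have hG : IsClosed (gr A : Set (X × X)) := by
    have : (gr A : Set (X × X)) = {p | p.2 = A p.1} := by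
      ext p; exact mem_gr
    rw [this]
    exact isClosed_eq continuous_snd (A.continuous.comp continuous_fst)
  have h2 := (h1.id_mul hA' hk hG).1
  have h3 : A' = A := by
    ext x
    simpa [mem_gr] using h2 x
  simpa [h3] using hA'

theorem exists_norm_val_le {Γ : Path} (hs : Γ.supp ⊆ rho G) :
    ∃ M, 0 ≤ M ∧ ∀ (f : ℂ → ℂ) (c : ℂ) (C : ℝ), 0 ≤ C → (∀ z ∈ Γ.supp, ‖f z‖ ≤ C) →
      ‖val G 0 c Γ f‖ ≤ M * C := by
  obtain ⟨M₀, hM₀⟩ := Γ.compact.exists_bound_of_continuousOn ((continuousOn_res G).mono hs)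
  set I := ∫ s, ‖Γ.d s‖ ∂Γ.μ
  have hI : 0 ≤ I := integral_nonneg fun _ => norm_nonneg _
  refine ⟨‖(2 * Real.pi * Complex.I : ℂ)⁻¹‖ * (I * max M₀ 0), by positivity,
    fun f c C hC hf => ?_⟩
  rw [val, zero_mul, zero_smul, zero_add, norm_smul, mul_assoc _ _ C, mul_assoc I]
  refine mul_le_mul_of_nonneg_left ?_ (norm_nonneg _)
  refine Γ.norm_integ_le (f := fun z => f z • res G z) fun z hz => ?_
  rw [norm_smul, mul_comm ‖f z‖]
  exact mul_le_mul ((hM₀ z hz).trans (le_max_left _ _)) (hf z hz) (norm_nonneg _) (le_max_right _ _)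

theorem exists_norm_pow_le {N : X →L[ℂ] X} {ε r : ℝ} (hN : ∀ z ∉ rho (gr N), ‖z‖ ≤ ε) (hr : ε < r)
    (hr0 : 0 ≤ r) : ∃ M, 0 ≤ M ∧ ∀ n : ℕ, ‖N ^ n‖ ≤ M * r ^ n := by
  have hσ : (rho (gr N))ᶜ ⊆ Metric.ball 0 r := fun z hz =>
    mem_ball_zero_iff.2 ((hN z hz).trans_lt hr)
  obtain ⟨W, Γ, hΓ⟩ := (kind_gr N).exists_nbhd Metric.isOpen_ball hσ (Or.inl rfl)
  obtain ⟨M, hM0, hM⟩ := exists_norm_val_le hΓ.sep.subset_rho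
  refine ⟨M, hM0, fun n => ?_⟩
  rw [((isCalc_id (c := 0) N).pow (kind_gr N) n).eq_val (D := Metric.ball 0 r) (Γ := Γ)
    ⟨Metric.isOpen_ball, (differentiable_id.pow n).differentiableOn, Or.inl rfl⟩ hΓ.sep]
  have := hM (fun z => z ^ n) ((0 : ℂ) ^ n) (r ^ n) (by positivity) fun z hz => by
    rw [norm_pow]
    exact pow_le_pow_left₀ (norm_nonneg _)
      (mem_ball_zero_iff.1 (hΓ.sep.subset hz)).le n
  simpa using this

theorem exists_norm_res_pow_le {B : X →L[ℂ] X} {K : Set ℂ} {r r' : ℝ} (hr : r < r') (hr0 : 0 < r)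
    (hK : ∀ z ∈ K, ∀ a ∉ rho (gr B), r' ≤ dist z a) :
    ∃ M, 0 ≤ M ∧ ∀ z ∈ K, ∀ n : ℕ, ‖res (gr B) z ^ n‖ ≤ M * r⁻¹ ^ n := by
  have hk := kind_gr B
  obtain ⟨W, Γ, hΓ⟩ := hk.exists_nbhd Metric.isOpen_thickening
    (Metric.self_subset_thickening (sub_pos.2 hr) (rho (gr B))ᶜ) (Or.inl rfl)
  obtain ⟨M, hM0, hM⟩ := exists_norm_val_le hΓ.sep.subset_rho
  refine ⟨M, hM0, fun z hz n => ?_⟩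
  have hd : ∀ w ∈ Metric.thickening (r' - r) (rho (gr B))ᶜ, r < dist z w := by
    intro w hw
    obtain ⟨a, ha, haw⟩ := Metric.mem_thickening_iff.1 hw
    have h1 := hK z hz a ha
    have h2 := dist_triangle z w a
    linarith
  have hne : ∀ w ∈ Metric.thickening (r' - r) (rho (gr B))ᶜ, w ≠ z := by
    rintro w hw rfl
    have := hd w hw
    rw [dist_self] at this
    linarith
  have hid : Hol 0 (Metric.thickening (r' - r) (rho (gr B))ᶜ) (fun w => w) 0 :=
    ⟨Metric.isOpen_thickening, differentiableOn_id, Or.inl rfl⟩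
  have h1 := ((isCalc_id (c := 0) B).inv hk hid (Metric.self_subset_thickening (sub_pos.2 hr) _)
    hne (Or.inl rfl)).2
  rw [(h1.pow hk n).eq_val (D := Metric.thickening (r' - r) (rho (gr B))ᶜ) (Γ := Γ)
    ⟨hid.1, ((hid.inv hne (Or.inl rfl)).2.1).pow n, Or.inl rfl⟩ hΓ.sep]
  have := hM (fun w => (z - w)⁻¹ ^ n) 0 (r⁻¹ ^ n) (by positivity) fun w hw => by
    rw [norm_pow, norm_inv, ← dist_eq_norm]
    exact pow_le_pow_left₀ (by positivity)
      (inv_anti₀ hr0 (hd w (hΓ.sep.subset hw)).le) n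
  simpa only [val, zero_mul, zero_smul] using this

/-! ### Termwise integration -/

theorem Path.hasSum_integ {E : Type*} [NormedAddCommGroup E] [NormedSpace ℂ E] [CompleteSpace E]
    (Γ : Path) {F : ℕ → ℂ → E} {f : ℂ → E} {b : ℕ → ℝ} (hF : ∀ n, ContinuousOn (F n) Γ.supp)
    (hb : Summable b) (hFb : ∀ n, ∀ z ∈ Γ.supp, ‖F n z‖ ≤ b n)
    (hsum : ∀ z ∈ Γ.supp, HasSum (fun n => F n z) (f z)) :
    HasSum (fun n => Γ.integ (F n)) (Γ.integ f) := by
  have h1 := hasSum_integral_of_summable_integral_norm (μ := Γ.μ)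
    (F := fun n s => Γ.d s • F n (Γ.p s)) (fun n => Γ.integrable (hF n)) (by
      refine Summable.of_nonneg_of_le (fun n => integral_nonneg fun _ => norm_nonneg _)
        (fun n => ?_) (hb.mul_left (∫ s, ‖Γ.d s‖ ∂Γ.μ))
      rw [← integral_mul_const]
      refine integral_mono (Γ.integrable (hF n)).norm (Γ.int.norm.mul_const _) fun s => ?_
      simp only [norm_smul]
      exact mul_le_mul_of_nonneg_left (hFb n _ (Γ.mem s)) (norm_nonneg _))
  have h2 : ∀ s, ∑' n, Γ.d s • F n (Γ.p s) = Γ.d s • f (Γ.p s) := fun s =>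
    ((hsum _ (Γ.mem s)).const_smul (Γ.d s)).tsum_eq
  simp only [h2] at h1
  exact h1

/-! ### Cauchy's formula for the derivatives -/

theorem cauchy_formula_deriv {D : Set ℂ} (hD : IsOpen D) (hf : DifferentiableOn ℂ f D) {Γ : Cycle}
    (hs : Γ.supp ⊆ D) (hind : ∀ z ∉ D, Γ.ind z = 0) {w : ℂ} (hw : w ∈ D) (hw1 : Γ.ind w = 1)
    (hws : w ∉ Γ.supp) (n : ℕ) : Γ.integ (fun z => (z - w)⁻¹ ^ (n + 1) * f z) =
      2 * Real.pi * Complex.I * ((n.factorial : ℂ)⁻¹ * deriv^[n] f w) := by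
  obtain ⟨R, hR, hRD⟩ := Metric.nhds_basis_closedBall.mem_iff.1 (hD.mem_nhds hw)
  have hd : DifferentiableOn ℂ (fun z => (z - w)⁻¹ ^ (n + 1) * f z) (D \ {w}) :=
    ((Grid.differentiableOn_inv_sub (by simp)).pow (n + 1)).mul (hf.mono sdiff_subset)
  have hsp : Metric.sphere w |R| ⊆ D \ {w} := by
    intro z hz
    rw [abs_of_pos hR] at hz
    refine ⟨hRD (Metric.sphere_subset_closedBall hz), ?_⟩
    rintro rfl
    simp at hz
    exact hR.ne hz
  rw [integ_eq_of_ind_eq Γ (circleCycle w hR) (hD.sdiff isClosed_singleton)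
    (fun z hz => ⟨hs hz, fun h => hws ((show z = w from h) ▸ hz)⟩) hsp ?_ hd]
  · have h1 : (circleCycle w hR).integ (fun z => (z - w)⁻¹ ^ (n + 1) * f z) =
        ∮ z in C(w, R), (z - w)⁻¹ ^ (n + 1) * f z := integ_circlePath w R _
    have h2 := DiffContOnCl.circleIntegral_one_div_sub_center_pow_smul hR n
      (hf.diffContOnCl_ball hRD)
    simp only [one_div, ← inv_pow, smul_eq_mul] at h2
    rw [h1, h2, iteratedDeriv_eq_iterate]
    ring
  · intro z hz
    by_cases hzw : z = w
    · subst hzw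
      rw [hw1]
      exact (ind_circlePath_inside (Metric.mem_ball_self hR)).symm
    · have hzD : z ∉ D := fun h => hz ⟨h, hzw⟩
      rw [hind z hzD]
      exact (ind_circlePath_outside hR fun h => hzD (hRD h)).symm

/-! ### Perturbation by a commuting operator -/

theorem hasSum_res_add {B N : X →L[ℂ] X} (hc : B * N = N * B) {z : ℂ} (hz : z ∈ rho (gr B))
    (hs : Summable fun n : ℕ => (N * res (gr B) z) ^ n) :
    z ∈ rho (gr (B + N)) ∧
      HasSum (fun n : ℕ => N ^ n * res (gr B) z ^ (n + 1)) (res (gr (B + N)) z) := by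
  set R := res (gr B) z with hR
  have hRes := isRes_res hz
  have h1 := hRes.gr_left
  have h2 := hRes.gr_right
  rw [← hR] at h1 h2
  have hN : (z • 1 - B) * N = N * (z • 1 - B) := by
    rw [sub_mul, mul_sub, hc]; simp
  have hNR : N * R = R * N := by
    calc N * R = R * (z • 1 - B) * N * R := by rw [h2, one_mul]
      _ = R * N * ((z • 1 - B) * R) := by rw [mul_assoc R, hN]; simp only [mul_assoc]
      _ = R * N := by rw [h1, mul_one]
  have hcomm : Commute N R := hNR
  set S := ∑' n : ℕ, (N * R) ^ n
  have h3 : S * (1 - N * R) = 1 := hs.tsum_pow_mul_one_sub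
  have h4 : (1 - N * R) * S = 1 := hs.one_sub_mul_tsum_pow
  have h5 : z • 1 - (B + N) = (1 - N * R) * (z • 1 - B) := by
    rw [sub_mul, one_mul, mul_assoc, h2, mul_one]; abel
  have h6 : z • 1 - (B + N) = (z • 1 - B) * (1 - N * R) := by
    rw [mul_sub, hNR, ← mul_assoc, h1, one_mul, mul_one]; abel
  have hSR : S * R = R * S := by
    calc S * R = S * R * ((1 - N * R) * S) := by rw [h4, mul_one]
      _ = S * ((1 - N * R) * R) * S := by
        have : R * (1 - N * R) = (1 - N * R) * R := by
          rw [mul_sub, sub_mul, ← mul_assoc, ← hNR]; simp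
        rw [← this]; simp only [mul_assoc]
      _ = S * (1 - N * R) * R * S := by simp only [mul_assoc]
      _ = R * S := by rw [h3, one_mul]
  have hres : IsRes (gr (B + N)) z (R * S) := by
    refine isRes_gr ?_ ?_
    · rw [h5, mul_assoc, ← mul_assoc _ R, h1, one_mul, h4]
    · rw [h6, ← hSR, mul_assoc, ← mul_assoc R, h2, one_mul, h3]
  refine ⟨hres.mem_rho, ?_⟩
  rw [hres.res_eq]
  have := hs.hasSum.mul_left R
  have e : ∀ n : ℕ, R * (N * R) ^ n = N ^ n * R ^ (n + 1) := fun n => by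
    rw [hcomm.mul_pow, ← mul_assoc, (hcomm.symm.pow_right n).eq, mul_assoc, ← pow_succ']
  simp only [e] at this
  exact this

theorem hasSum_perturbation {B N : X →L[ℂ] X} (hc : B * N = N * B) {ε : ℝ} (hε : 0 < ε)
    (hN : ∀ z ∉ rho (gr N), ‖z‖ ≤ ε) {K : Set ℂ} (hK : IsCompact K)
    (hKd : ∀ z ∈ K, z ∉ Metric.cthickening ε (rho (gr B))ᶜ) :
    ∃ b : ℕ → ℝ, Summable b ∧ ∀ z ∈ K,
      (∀ n, ‖N ^ n * res (gr B) z ^ (n + 1)‖ ≤ b n) ∧ z ∈ rho (gr (B + N)) ∧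
      HasSum (fun n : ℕ => N ^ n * res (gr B) z ^ (n + 1)) (res (gr (B + N)) z) := by
  have hS : IsCompact (rho (gr B))ᶜ := by
    refine Metric.isCompact_of_isClosed_isBounded (isOpen_rho _).isClosed_compl ?_
    rcases kind_gr B with ⟨-, h, -⟩ | h
    · rwa [Bornology.isBounded_def, compl_compl]
    · exact absurd h zero_ne_one
  obtain ⟨δ, hδ, hδK⟩ := (hS.cthickening (r := ε)).exists_cthickening_subset_open
    hK.isClosed.isOpen_compl (fun z hz hzK => hKd z hzK hz)
  rw [cthickening_cthickening hδ.le hε.le] at hδK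
  have hd : ∀ z ∈ K, ∀ a ∉ rho (gr B), ε + δ ≤ dist z a := by
    intro z hz a ha
    by_contra! h
    exact hδK (Metric.mem_cthickening_of_dist_le z a (δ + ε) _ ha (by linarith)) hz
  obtain ⟨M, hM0, hM⟩ := exists_norm_pow_le (r := ε + δ / 3) hN (by linarith) (by linarith)
  obtain ⟨M', hM0', hM'⟩ := exists_norm_res_pow_le (r := ε + 2 * δ / 3) (r' := ε + δ) (B := B) (K := K)
    (by linarith) (by linarith) hd
  set r := ε + δ / 3
  set r' := ε + 2 * δ / 3
  have hr : 0 < r := by positivity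
  have hr' : 0 < r' := by positivity
  have hq : r * r'⁻¹ < 1 := by
    rw [← div_eq_mul_inv, div_lt_one hr']
    simp only [r, r']
    linarith
  have hgeo : Summable fun n : ℕ => (r * r'⁻¹) ^ n :=
    summable_geometric_of_lt_one (by positivity) hq
  refine ⟨fun n => M * M' * r'⁻¹ * (r * r'⁻¹) ^ n, hgeo.mul_left _, fun z hz => ?_⟩
  have hzr : z ∈ rho (gr B) := by
    by_contra h
    have := hd z hz z h
    rw [dist_self] at this
    linarith
  refine ⟨fun n => ?_, hasSum_res_add hc hzr ?_⟩
  · calc _ ≤ ‖N ^ n‖ * ‖res (gr B) z ^ (n + 1)‖ := norm_mul_le _ _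
      _ ≤ (M * r ^ n) * (M' * r'⁻¹ ^ (n + 1)) :=
        mul_le_mul (hM n) (hM' z hz (n + 1)) (norm_nonneg _) (by positivity)
      _ = _ := by simp only [mul_pow]; ring
  · have hcomm : Commute N (res (gr B) z) := by
      have h1 := (isRes_res hzr).gr_left
      have h2 := (isRes_res hzr).gr_right
      have hN : (z • 1 - B) * N = N * (z • 1 - B) := by
        rw [sub_mul, mul_sub, hc]; simp
      calc N * res (gr B) z = res (gr B) z * (z • 1 - B) * N * res (gr B) z := by rw [h2, one_mul]
        _ = res (gr B) z * N * ((z • 1 - B) * res (gr B) z) := by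
          rw [mul_assoc (res (gr B) z), hN]; simp only [mul_assoc]
        _ = _ := by rw [h1, mul_one]
    refine Summable.of_norm_bounded (hgeo.mul_left (M * M')) fun n => ?_
    rw [hcomm.mul_pow]
    calc _ ≤ ‖N ^ n‖ * ‖res (gr B) z ^ n‖ := norm_mul_le _ _
      _ ≤ (M * r ^ n) * (M' * r'⁻¹ ^ n) :=
        mul_le_mul (hM n) (hM' z hz n) (norm_nonneg _) (by positivity)
      _ = _ := by simp only [mul_pow]; ring

/-- The Taylor expansion of `f(B + N)`. -/
theorem IsCalc.hasSum_taylor {B N : X →L[ℂ] X} (hc : B * N = N * B) {ε : ℝ} (hε : 0 < ε)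
    (hN : ∀ z ∉ rho (gr N), ‖z‖ ≤ ε) {D : Set ℂ} (hD : IsOpen D)
    (hCD : Metric.cthickening ε (rho (gr B))ᶜ ⊆ D) (hf : DifferentiableOn ℂ f D)
    (hA : IsCalc (gr (B + N)) 0 f c A) {A' : ℕ → X →L[ℂ] X}
    (hA' : ∀ n, IsCalc (gr B) 0 (fun z => (n.factorial : ℂ)⁻¹ * deriv^[n] f z) 0 (A' n)) :
    HasSum (fun n => N ^ n * A' n) A := by
  have hk := kind_gr B
  have hSC : (rho (gr B))ᶜ ⊆ Metric.cthickening ε (rho (gr B))ᶜ := Metric.self_subset_cthickening _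
  have hCb : Bornology.IsBounded (Metric.cthickening ε (rho (gr B))ᶜ) := by
    refine Bornology.IsBounded.cthickening ?_
    rcases kind_gr B with ⟨-, h, -⟩ | h
    · rwa [Bornology.isBounded_def, compl_compl]
    · exact absurd h zero_ne_one
  obtain ⟨W, Γ, hΓ⟩ := exists_nbhd (κ := 0) Metric.isClosed_cthickening hD hCD (Or.inl ⟨rfl, hCb⟩)
  have hdis : ∀ w ∈ W, w ∉ Γ.supp := fun w hw h =>
    (disjoint_frontier_iff_isOpen.2 hΓ.isOpen).le_bot ⟨hΓ.supp_eq ▸ h, hw⟩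
  have hsD := hΓ.sep.subset
  obtain ⟨b, hb, hKb⟩ := hasSum_perturbation hc hε hN Γ.compact fun z hz h => hdis z (hΓ.subset h) hz
  have hWD : W ⊆ D := subset_closure.trans hΓ.closure_subset
  have hρ : Γ.supp ⊆ rho (gr B) := fun z hz => by
    by_contra h
    exact hdis z (hΓ.subset (hSC h)) hz
  obtain ⟨W', Γ', hΓ'⟩ := hk.exists_nbhd hΓ.isOpen (hSC.trans hΓ.subset) (Or.inl rfl)
  have hs' := hΓ'.sep
  set p : ℂ := 2 * Real.pi * Complex.I with hp
  have hp0 : p ≠ 0 := Complex.two_pi_I_ne_zero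
  have hfc := hf.continuousOn.mono hsD
  have hdn : ∀ n, DifferentiableOn ℂ (deriv^[n] f) D := fun n =>
    ((hf.analyticOnNhd hD).iterated_deriv n).differentiableOn
  have hne : ∀ z ∈ Γ.supp, ∀ w ∈ W, w ≠ z := by
    rintro z hz w hw rfl
    exact hdis w hw hz
  -- the powers of the resolvent
  have hpow : ∀ z ∈ Γ.supp, ∀ n : ℕ, res (gr B) z ^ n =
      p⁻¹ • Γ'.integ (fun w => (z - w)⁻¹ ^ n • res (gr B) w) := by
    intro z hz n
    have hid : Hol 0 W (fun w => w) 0 := ⟨hΓ.isOpen, differentiableOn_id, Or.inl rfl⟩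
    have h1 := ((isCalc_id (c := 0) B).inv hk hid (hSC.trans hΓ.subset) (hne z hz) (Or.inl rfl)).2
    rw [(h1.pow hk n).eq_val (D := W) (Γ := Γ')
      ⟨hid.1, ((hid.inv (hne z hz) (Or.inl rfl)).2.1).pow n, Or.inl rfl⟩ hs', val, zero_mul,
      zero_smul, zero_add]
  have hcoef : ∀ n, p⁻¹ • Γ.integ (fun z => f z • res (gr B) z ^ (n + 1)) = A' n := by
    intro n
    have e1 : EqOn (fun z => f z • res (gr B) z ^ (n + 1)) (fun z => p⁻¹ • Γ'.integ fun w =>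
        ((z - w)⁻¹ ^ (n + 1) * f z) • res (gr B) w) Γ.supp := by
      intro z hz
      simp only
      rw [hpow z hz, smul_comm, ← Γ'.integ_smul]
      congr 2
      funext w
      rw [smul_smul, mul_comm]
    have hcomm := Γ.integ_comm Γ'.toPath
      (f := fun z w => ((z - w)⁻¹ ^ (n + 1) * f z) • res (gr B) w) (by
        have c1 : ContinuousOn (fun q : ℂ × ℂ => q.1 - q.2) (Γ.supp ×ˢ Γ'.supp) := by fun_prop
        have c2 : ContinuousOn (fun q : ℂ × ℂ => f q.1) (Γ.supp ×ˢ Γ'.supp) :=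
          hfc.comp continuousOn_fst fun q hq => hq.1
        have c3 : ContinuousOn (fun q : ℂ × ℂ => res (gr B) q.2) (Γ.supp ×ˢ Γ'.supp) :=
          ((continuousOn_res _).mono hs'.subset_rho).comp continuousOn_snd fun q hq => hq.2
        exact (((c1.inv₀ fun q hq => sub_ne_zero.2
          (hne q.1 hq.1 q.2 (hs'.subset hq.2)).symm).pow (n + 1)).mul c2).smul c3)
    have e2 : EqOn (fun w => Γ.integ fun z => ((z - w)⁻¹ ^ (n + 1) * f z) • res (gr B) w)
        (fun w => p • (((n.factorial : ℂ)⁻¹ * deriv^[n] f w) • res (gr B) w)) Γ'.supp := by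
      intro w hw
      have hwW := hs'.subset hw
      simp only
      have hcz : ContinuousOn (fun z => (z - w)⁻¹ ^ (n + 1) * f z) Γ.supp :=
        ((Grid.differentiableOn_inv_sub (hdis w hwW)).continuousOn.pow (n + 1)).mul hfc
      rw [Γ.integ_smul_const hcz, cauchy_formula_deriv hD hf hsD
        (fun z hz => by rw [hΓ.sep.2.2 z hz, neg_zero]) (hWD hwW)
        (by rw [hΓ.ind_in w hwW, sub_zero]) (hdis w hwW), smul_smul]
    rw [(hA' n).eq_val (D := W) (Γ := Γ')
      ⟨hΓ.isOpen, ((hdn n).mono hWD).const_mul _, Or.inl rfl⟩ hs', Γ.integ_congr e1,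
      Γ.integ_smul, hcomm, Γ'.integ_congr e2, Γ'.integ_smul, inv_smul_smul₀ hp0, val, zero_mul,
      zero_smul, zero_add]
  have hσ : (rho (gr (B + N)))ᶜ ⊆ Metric.cthickening ε (rho (gr B))ᶜ := by
    intro z hz
    by_contra h
    obtain ⟨b', -, h0⟩ := hasSum_perturbation hc hε hN (isCompact_singleton (x := z))
      (by rintro w rfl; exact h)
    have h1 := (h0 z rfl).2.1
    exact hz h1
  have hsep : Sep 0 (rho (gr (B + N)))ᶜ D Γ :=
    ⟨fun z hz => ⟨hsD hz, fun h => (hΓ.sep.1 hz).2 (hσ h)⟩, fun z hz => hΓ.sep.2.1 z (hσ hz),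
      hΓ.sep.2.2⟩
  rw [hA.eq_val (D := D) ⟨hD, hf, Or.inl rfl⟩ hsep, val, zero_mul, zero_smul, zero_add]
  obtain ⟨C, hC⟩ := Γ.compact.exists_bound_of_continuousOn hfc
  have hcR : ∀ n : ℕ, ContinuousOn (fun z => res (gr B) z ^ (n + 1)) Γ.supp := fun n =>
    ((continuousOn_res _).mono hρ).pow (n + 1)
  have key := Γ.hasSum_integ (F := fun n z => f z • (N ^ n * res (gr B) z ^ (n + 1)))
    (f := fun z => f z • res (gr (B + N)) z) (b := fun n => C * b n)
    (fun n => continuousOn_smul_fun hfc (continuousOn_const.mul (hcR n))) (hb.mul_left C)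
    (fun n z hz => by
      rw [norm_smul]
      exact mul_le_mul (hC z hz) ((hKb z hz).1 n) (norm_nonneg _)
        ((norm_nonneg _).trans (hC z hz)))
    (fun z hz => (hKb z hz).2.2.const_smul (f z))
  have e : ∀ n, N ^ n * A' n = p⁻¹ • Γ.integ (fun z => f z • (N ^ n * res (gr B) z ^ (n + 1))) := by
    intro n
    have h1 := Γ.integ_clm (ContinuousLinearMap.mul ℂ (X →L[ℂ] X) (N ^ n)) (continuousOn_smul_fun hfc (hcR n))
    simp only [ContinuousLinearMap.mul_apply'] at h1
    rw [← hcoef n, mul_smul_comm, ← h1]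
    simp only [mul_smul_comm]
  simp only [e]
  exact key.const_smul p⁻¹

end RieszDunford

namespace SliceCalc

open RieszDunford

/-! ### Slices -/

theorem mul_self_of_mem {i : ℍ[ℝ]} (hi : i ∈ unitSphere) : i * i = -1 := by
  have h1 : star i = -i := by
    ext <;> simp [hi.1]
  have h2 := Quaternion.self_mul_star i
  rw [h1, mul_neg, Quaternion.normSq_eq_norm_mul_self, hi.2] at h2
  rw [← neg_eq_iff_eq_neg, h2]
  simp

/-- The identification of `ℂ` with a slice, as a homomorphism. -/
noncomputable def sliceHom {i : ℍ[ℝ]} (hi : i ∈ unitSphere) : ℂ →ₐ[ℝ] ℍ[ℝ] :=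
  Complex.liftAux i (mul_self_of_mem hi)

variable {i : ℍ[ℝ]}

theorem slicePt_mul (hi : i ∈ unitSphere) (z w : ℂ) :
    slicePt i (z * w) = slicePt i z * slicePt i w := map_mul (sliceHom hi) z w

theorem slicePt_inv (hi : i ∈ unitSphere) (z : ℂ) :
    slicePt i z⁻¹ = (slicePt i z)⁻¹ := map_inv₀ (sliceHom hi) z

theorem slicePt_add (i : ℍ[ℝ]) (z w : ℂ) : slicePt i (z + w) = slicePt i z + slicePt i w := by
  simp [slicePt, add_smul]; abel

theorem slicePt_sub (i : ℍ[ℝ]) (z w : ℂ) : slicePt i (z - w) = slicePt i z - slicePt i w := by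
  simp [slicePt, sub_smul]; abel

@[simp] theorem slicePt_ofReal (i : ℍ[ℝ]) (r : ℝ) : slicePt i (r : ℂ) = (r : ℍ[ℝ]) := by
  simp [slicePt]

theorem slicePt_real_smul (i : ℍ[ℝ]) (r : ℝ) (z : ℂ) : slicePt i (r * z) = r • slicePt i z := by
  simp [slicePt, smul_smul, Quaternion.coe_mul_eq_smul]

@[simp] theorem slicePt_re (hi : i ∈ unitSphere) (z : ℂ) : (slicePt i z).re = z.re := by
  simp [slicePt, hi.1]

theorem slicePt_im (hi : i ∈ unitSphere) (z : ℂ) : (slicePt i z).im = z.im • i := by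
  ext <;> simp [slicePt, hi.1]

@[simp] theorem norm_slicePt (hi : i ∈ unitSphere) (z : ℂ) : ‖slicePt i z‖ = ‖z‖ := by
  have h1 : ‖slicePt i z‖ ^ 2 = ‖z‖ ^ 2 := by
    have h2 : ‖i‖ ^ 2 = i.imI ^ 2 + i.imJ ^ 2 + i.imK ^ 2 := by
      rw [sq, ← Quaternion.normSq_eq_norm_mul_self, Quaternion.normSq_def', hi.1]; ring
    rw [hi.2] at h2
    rw [sq, ← Quaternion.normSq_eq_norm_mul_self, Quaternion.normSq_def', Complex.sq_norm,
      Complex.normSq_apply]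
    simp [slicePt, hi.1]
    linear_combination (-z.im ^ 2) * h2
  exact (sq_eq_sq₀ (norm_nonneg _) (norm_nonneg _)).1 h1

theorem star_slicePt (hi : i ∈ unitSphere) (z : ℂ) :
    star (slicePt i z) = slicePt i (starRingEnd ℂ z) := by
  ext <;> simp [slicePt, hi.1]

theorem slicePt_neg (i : ℍ[ℝ]) (z : ℂ) : slicePt (-i) z = slicePt i (starRingEnd ℂ z) := by
  simp [slicePt]

theorem neg_mem_unitSphere (hi : i ∈ unitSphere) : -i ∈ unitSphere := by
  simpa [unitSphere] using hi

theorem isometry_slicePt (hi : i ∈ unitSphere) : Isometry (slicePt i) := by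
  refine Isometry.of_dist_eq fun z w => ?_
  rw [dist_eq_norm, ← slicePt_sub, norm_slicePt hi, dist_eq_norm]

/-- The imaginary unit that is fixed as a reference. -/
def unitI : ℍ[ℝ] := ⟨0, 1, 0, 0⟩

@[simp] theorem unitI_re : unitI.re = 0 := rfl
@[simp] theorem unitI_imI : unitI.imI = 1 := rfl
@[simp] theorem unitI_imJ : unitI.imJ = 0 := rfl
@[simp] theorem unitI_imK : unitI.imK = 0 := rfl

theorem unitI_mem : unitI ∈ unitSphere := by
  refine ⟨rfl, ?_⟩
  have : ‖unitI‖ ^ 2 = 1 := by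
    rw [sq, ← Quaternion.normSq_eq_norm_mul_self, Quaternion.normSq_def']
    simp
  nlinarith [norm_nonneg unitI]

/-- An imaginary unit orthogonal to the reference. -/
def unitJ : ℍ[ℝ] := ⟨0, 0, 1, 0⟩

@[simp] theorem unitJ_re : unitJ.re = 0 := rfl
@[simp] theorem unitJ_imI : unitJ.imI = 0 := rfl
@[simp] theorem unitJ_imJ : unitJ.imJ = 1 := rfl
@[simp] theorem unitJ_imK : unitJ.imK = 0 := rfl

theorem unitJ_mem : unitJ ∈ unitSphere := by
  refine ⟨rfl, ?_⟩
  have : ‖unitJ‖ ^ 2 = 1 := by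
    rw [sq, ← Quaternion.normSq_eq_norm_mul_self, Quaternion.normSq_def']
    simp
  nlinarith [norm_nonneg unitJ]

theorem unitJ_mul_self : unitJ * unitJ = -1 := mul_self_of_mem unitJ_mem

theorem slicePt_mul_unitJ (z : ℂ) :
    slicePt unitI z * unitJ = unitJ * slicePt unitI (starRingEnd ℂ z) := by
  ext <;> simp [slicePt]

/-- Every quaternion is `z + w j` with `z`, `w` in the reference slice. -/
theorem eq_slicePt_add (q : ℍ[ℝ]) :
    q = slicePt unitI ⟨q.re, q.imI⟩ + slicePt unitI ⟨q.imJ, q.imK⟩ * unitJ := by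
  ext <;> simp [slicePt]

theorem exists_conj (hi : i ∈ unitSphere) : ∃ q : ℍ[ℝ], q ≠ 0 ∧ ∀ z, slicePt unitI z * q = q * slicePt i z := by
  obtain ⟨q, hq, h⟩ : ∃ q : ℍ[ℝ], q ≠ 0 ∧ unitI * q = q * i := by
    by_cases h : unitI + i = 0
    · refine ⟨unitJ, fun h0 => ?_, ?_⟩
      · have := unitJ_mem.2
        rw [h0, norm_zero] at this
        exact zero_ne_one this
      · rw [← neg_eq_of_add_eq_zero_right h]
        ext <;> simp
    · refine ⟨unitI + i, h, ?_⟩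
      rw [mul_add, add_mul, mul_self_of_mem hi, mul_self_of_mem unitI_mem, add_comm]
  refine ⟨q, hq, fun z => ?_⟩
  rw [slicePt, slicePt, add_mul, mul_add, smul_mul_assoc, mul_smul_comm, h,
    Quaternion.coe_commutes]

/-- The point of the closed upper half plane that represents the sphere of `x`. -/
noncomputable def proj (x : ℍ[ℝ]) : ℂ := ⟨x.re, ‖x.im‖⟩

theorem sliceUnit_of_im_eq_zero {x : ℍ[ℝ]} (h : x.im = 0) : sliceUnit x = unitI := if_pos h

theorem sliceUnit_of_im_ne_zero {x : ℍ[ℝ]} (h : x.im ≠ 0) : sliceUnit x = ‖x.im‖⁻¹ • x.im :=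
  if_neg h

theorem sliceUnit_mem (x : ℍ[ℝ]) : sliceUnit x ∈ unitSphere := by
  by_cases h : x.im = 0
  · rw [sliceUnit_of_im_eq_zero h]
    exact unitI_mem
  · rw [sliceUnit_of_im_ne_zero h]
    refine ⟨by simp, ?_⟩
    rw [norm_smul, norm_inv, norm_norm, inv_mul_cancel₀ (norm_ne_zero_iff.2 h)]

theorem slicePt_sliceUnit (x : ℍ[ℝ]) : slicePt (sliceUnit x) (proj x) = x := by
  unfold slicePt proj
  by_cases h : x.im = 0
  · simp only [h, norm_zero, zero_smul, add_zero]
    conv_rhs => rw [← Quaternion.re_add_im x, h, add_zero]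
  · simp only [sliceUnit_of_im_ne_zero h, smul_smul]
    rw [mul_inv_cancel₀ (norm_ne_zero_iff.2 h), one_smul, Quaternion.re_add_im]

theorem exists_slicePt (x : ℍ[ℝ]) : ∃ i ∈ unitSphere, slicePt i (proj x) = x :=
  ⟨_, sliceUnit_mem x, slicePt_sliceUnit x⟩

theorem proj_slicePt (hi : i ∈ unitSphere) (z : ℂ) : proj (slicePt i z) = ⟨z.re, |z.im|⟩ := by
  rw [proj, slicePt_re hi, slicePt_im hi, norm_smul, hi.2, mul_one, Real.norm_eq_abs]

theorem proj_slicePt_eq (hi : i ∈ unitSphere) (z : ℂ) :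
    proj (slicePt i z) = z ∨ proj (slicePt i z) = starRingEnd ℂ z := by
  rw [proj_slicePt hi]
  rcases abs_choice z.im with h | h
  · left; rw [h]
  · right; rw [h]; rfl

theorem norm_proj (x : ℍ[ℝ]) : ‖proj x‖ = ‖x‖ := by
  conv_rhs => rw [← slicePt_sliceUnit x]
  rw [norm_slicePt (sliceUnit_mem x)]

theorem continuous_proj : Continuous proj := by
  have : proj = fun x : ℍ[ℝ] => (x.re : ℂ) + (‖x.im‖ : ℝ) * Complex.I := by
    funext x
    apply Complex.ext <;> simp [proj]
  rw [this]
  have h1 : Continuous fun x : ℍ[ℝ] => x.re := Quaternion.continuous_re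
  have h2 : Continuous fun x : ℍ[ℝ] => x.im := Quaternion.continuous_im
  fun_prop

theorem tendsto_proj : Tendsto proj (Bornology.cobounded ℍ[ℝ]) (Bornology.cobounded ℂ) := by
  rw [← tendsto_norm_atTop_iff_cobounded]
  simp only [norm_proj]
  exact tendsto_norm_cobounded_atTop

theorem tendsto_slicePt (hi : i ∈ unitSphere) :
    Tendsto (slicePt i) (Bornology.cobounded ℂ) (Bornology.cobounded ℍ[ℝ]) := by
  rw [← tendsto_norm_atTop_iff_cobounded]
  simp only [norm_slicePt hi]
  exact tendsto_norm_cobounded_atTop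

/-- Conjugation symmetric sets. -/
def ConjSymm (E : Set ℂ) : Prop := ∀ z ∈ E, starRingEnd ℂ z ∈ E

theorem ConjSymm.mem_iff {E : Set ℂ} (h : ConjSymm E) {z : ℂ} : starRingEnd ℂ z ∈ E ↔ z ∈ E :=
  ⟨fun hz => by simpa using h _ hz, h z⟩

theorem ConjSymm.proj_mem {E : Set ℂ} (h : ConjSymm E) (hi : i ∈ unitSphere) {z : ℂ} :
    proj (slicePt i z) ∈ E ↔ z ∈ E := by
  rcases proj_slicePt_eq hi z with h1 | h1 <;> rw [h1]
  exact h.mem_iff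

theorem ConjSymm.preimage_proj {E : Set ℂ} (h : ConjSymm E) (hi : i ∈ unitSphere) :
    slicePt i ⁻¹' (proj ⁻¹' E) = E := by
  ext z; exact h.proj_mem hi

theorem axiallySymmetric_preimage_proj (E : Set ℂ) : AxiallySymmetric (proj ⁻¹' E) := by
  rintro x hx y ⟨i, hi, rfl⟩
  rw [mem_preimage, proj_slicePt hi, abs_of_nonneg (norm_nonneg _)]
  exact hx

theorem axiallySymmetric_mem_iff {D : Set ℍ[ℝ]} (h : AxiallySymmetric D) {i' : ℍ[ℝ]}
    (hi : i ∈ unitSphere) (hi' : i' ∈ unitSphere) {z : ℂ} :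
    slicePt i z ∈ D ↔ slicePt i' z ∈ D := by
  have key : ∀ {i i' : ℍ[ℝ]}, i ∈ unitSphere → i' ∈ unitSphere → slicePt i z ∈ D →
      slicePt i' z ∈ D := by
    intro i i' hi hi' hz
    have h1 : ∀ i'' ∈ unitSphere, slicePt i'' (proj (slicePt i z)) ∈ D := fun i'' hi'' =>
      h _ hz ⟨i'', hi'', rfl⟩
    rcases proj_slicePt_eq hi z with h2 | h2
    · exact h2 ▸ h1 i' hi'
    · have := h1 (-i') (neg_mem_unitSphere hi')
      rwa [slicePt_neg, h2, Complex.conj_conj] at this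
  exact ⟨key hi hi', key hi' hi⟩

theorem conjSymm_preimage {D : Set ℍ[ℝ]} (h : AxiallySymmetric D) (hi : i ∈ unitSphere) :
    ConjSymm (slicePt i ⁻¹' D) := by
  intro z hz
  rw [mem_preimage, ← slicePt_neg]
  exact (axiallySymmetric_mem_iff h hi (neg_mem_unitSphere hi)).1 hz

theorem mem_iff_proj_mem {D : Set ℍ[ℝ]} (h : AxiallySymmetric D) {x : ℍ[ℝ]} :
    slicePt unitI (proj x) ∈ D ↔ x ∈ D := by
  obtain ⟨i, hi, hx⟩ := exists_slicePt x
  rw [axiallySymmetric_mem_iff h unitI_mem hi, hx]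

/-! ### Slice functions and their complex representatives -/

/-- The function on `ℂ` that represents an intrinsic slice function. -/
noncomputable def cpl (f : ℍ[ℝ] → ℍ[ℝ]) (z : ℂ) : ℂ :=
  ⟨(f (slicePt unitI z)).re, (f (slicePt unitI z)).imI⟩

/-- `f` is intrinsic slice hyperholomorphic on the axially symmetric set represented by `E`. -/
structure SliceHol (f : ℍ[ℝ] → ℍ[ℝ]) (E : Set ℂ) : Prop where
  isOpen : IsOpen E
  symm : ConjSymm E
  diff : DifferentiableOn ℂ (cpl f) E
  conj : ∀ z ∈ E, cpl f (starRingEnd ℂ z) = starRingEnd ℂ (cpl f z)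
  eq : ∀ i ∈ unitSphere, ∀ z ∈ E, f (slicePt i z) = slicePt i (cpl f z)

theorem cpl_of_eq {f : ℍ[ℝ] → ℍ[ℝ]} {z w : ℂ} (h : f (slicePt unitI z) = slicePt unitI w) :
    cpl f z = w := by
  rw [cpl, h]
  apply Complex.ext <;> simp [slicePt]

theorem hasFDerivAt_complex_iff {α β : ℂ → ℝ} {z : ℂ} :
    DifferentiableAt ℂ (fun w => (⟨α w, β w⟩ : ℂ)) z ↔
      DifferentiableAt ℝ α z ∧ DifferentiableAt ℝ β z ∧
      fderiv ℝ α z 1 = fderiv ℝ β z Complex.I ∧ fderiv ℝ α z Complex.I = -fderiv ℝ β z 1 := by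
  have hF : (fun w => (⟨α w, β w⟩ : ℂ)) = fun w => (α w : ℂ) + (β w : ℂ) * Complex.I := by
    funext w
    apply Complex.ext <;> simp
  have hr : ∀ {F : ℂ → ℂ}, DifferentiableAt ℝ F z → DifferentiableAt ℝ (fun w => (F w).re) z ∧
      fderiv ℝ (fun w => (F w).re) z = Complex.reCLM.comp (fderiv ℝ F z) := fun h =>
    ⟨Complex.reCLM.differentiableAt.comp z h, (Complex.reCLM.hasFDerivAt.comp z h.hasFDerivAt).fderiv⟩
  have hi : ∀ {F : ℂ → ℂ}, DifferentiableAt ℝ F z → DifferentiableAt ℝ (fun w => (F w).im) z ∧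
      fderiv ℝ (fun w => (F w).im) z = Complex.imCLM.comp (fderiv ℝ F z) := fun h =>
    ⟨Complex.imCLM.differentiableAt.comp z h, (Complex.imCLM.hasFDerivAt.comp z h.hasFDerivAt).fderiv⟩
  rw [differentiableAt_complex_iff_differentiableAt_real]
  constructor
  · rintro ⟨h1, h2⟩
    obtain ⟨h3, h4⟩ := hr h1
    obtain ⟨h5, h6⟩ := hi h1
    simp only at h3 h4 h5 h6
    refine ⟨h3, h5, ?_, ?_⟩ <;> rw [h4, h6] <;> simp [h2]
  · rintro ⟨h1, h2, h3, h4⟩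
    have hd : DifferentiableAt ℝ (fun w => (⟨α w, β w⟩ : ℂ)) z := by
      rw [hF]
      exact (Complex.ofRealCLM.differentiableAt.comp z h1).add
        ((Complex.ofRealCLM.differentiableAt.comp z h2).mul_const _)
    refine ⟨hd, ?_⟩
    have h5 := (hr hd).2
    have h6 := (hi hd).2
    simp only at h5 h6
    rw [h5, h6] at h3 h4
    simp only [ContinuousLinearMap.comp_apply, Complex.reCLM_apply, Complex.imCLM_apply] at h3 h4
    apply Complex.ext
    · simp [h4]
    · simp [h3]

theorem IntrinsicSHOn.sliceHol {f : ℍ[ℝ] → ℍ[ℝ]} {D : Set ℍ[ℝ]} (h : IntrinsicSHOn f D) :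
    SliceHol f (slicePt unitI ⁻¹' D) := by
  obtain ⟨hD, hax, α, β, hαβ⟩ := h
  have hc : ∀ z, slicePt unitI z ∈ D → cpl f z = ⟨α z, β z⟩ := fun z hz =>
    cpl_of_eq ((hαβ unitI unitI_mem z hz).1)
  have hopen : IsOpen (slicePt unitI ⁻¹' D) := hD.preimage (isometry_slicePt unitI_mem).continuous
  have hs := conjSymm_preimage hax unitI_mem
  refine ⟨hopen, hs, fun z hz => ?_, fun z hz => ?_, fun i hi z hz => ?_⟩
  · refine DifferentiableAt.differentiableWithinAt ?_
    have h1 := (hαβ unitI unitI_mem z hz).2.2.2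
    refine (hasFDerivAt_complex_iff.2 h1).congr_of_eventuallyEq ?_
    filter_upwards [hopen.mem_nhds hz] with w hw using hc w hw
  · obtain ⟨-, h1, h2, -⟩ := hαβ unitI unitI_mem z hz
    rw [hc _ (hs z hz), hc z hz, h1, h2]
    rfl
  · rw [hc z hz]
    exact (hαβ i hi z ((axiallySymmetric_mem_iff hax unitI_mem hi).1 hz)).1

theorem SliceHol.intrinsicSHOn {f : ℍ[ℝ] → ℍ[ℝ]} {E : Set ℂ} (h : SliceHol f E) :
    IntrinsicSHOn f (proj ⁻¹' E) := by
  refine ⟨h.isOpen.preimage continuous_proj, axiallySymmetric_preimage_proj E,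
    fun z => (cpl f z).re, fun z => (cpl f z).im, fun i hi z hz => ?_⟩
  rw [mem_preimage, h.symm.proj_mem hi] at hz
  refine ⟨h.eq i hi z hz, by simp only [h.conj z hz, Complex.conj_re],
    by simp only [h.conj z hz, Complex.conj_im], ?_⟩
  rw [← hasFDerivAt_complex_iff]
  exact h.diff.differentiableAt (h.isOpen.mem_nhds hz)

theorem SliceHol.apply {f : ℍ[ℝ] → ℍ[ℝ]} {E : Set ℂ} (h : SliceHol f E) {x : ℍ[ℝ]}
    (hx : proj x ∈ E) : f x = slicePt (sliceUnit x) (cpl f (proj x)) := by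
  rw [← h.eq _ (sliceUnit_mem x) _ hx, slicePt_sliceUnit]

theorem SliceHol.conj_real {f : ℍ[ℝ] → ℍ[ℝ]} {E : Set ℂ} (h : SliceHol f E)
    (hE : E ∈ Bornology.cobounded ℂ) {c : ℂ} (hc : Tendsto (cpl f) (Bornology.cobounded ℂ) (𝓝 c)) :
    c = (c.re : ℂ) := by
  have h1 : Tendsto (fun z => cpl f (starRingEnd ℂ z)) (Bornology.cobounded ℂ) (𝓝 c) := by
    refine hc.comp ?_
    rw [← tendsto_norm_atTop_iff_cobounded]
    simpa using tendsto_norm_cobounded_atTop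
  have h2 : Tendsto (fun z => cpl f (starRingEnd ℂ z)) (Bornology.cobounded ℂ)
      (𝓝 (starRingEnd ℂ c)) := by
    refine ((Complex.continuous_conj.tendsto c).comp hc).congr' ?_
    filter_upwards [hE] with z hz using (h.conj z hz).symm
  exact (Complex.conj_eq_iff_re.1 (tendsto_nhds_unique h2 h1)).symm

theorem SliceHol.tendsto_iff {f : ℍ[ℝ] → ℍ[ℝ]} {E : Set ℂ} (h : SliceHol f E)
    (hE : E ∈ Bornology.cobounded ℂ) {c : ℍ[ℝ]} :
    Tendsto f (Bornology.cobounded ℍ[ℝ]) (𝓝 c) ↔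
      ∃ r : ℝ, c = r ∧ Tendsto (cpl f) (Bornology.cobounded ℂ) (𝓝 (r : ℂ)) := by
  have key : ∀ r : ℝ, Tendsto (cpl f) (Bornology.cobounded ℂ) (𝓝 (r : ℂ)) →
      Tendsto f (Bornology.cobounded ℍ[ℝ]) (𝓝 (r : ℍ[ℝ])) := by
    intro r hr
    rw [tendsto_iff_norm_sub_tendsto_zero] at hr ⊢
    refine (hr.comp tendsto_proj).congr' ?_
    filter_upwards [tendsto_proj.eventually hE] with x hx
    rw [h.apply hx, ← slicePt_ofReal (sliceUnit x), ← slicePt_sub, norm_slicePt (sliceUnit_mem x)]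
    rfl
  constructor
  · intro hc
    have h1 : Tendsto (cpl f) (Bornology.cobounded ℂ) (𝓝 ⟨c.re, c.imI⟩) := by
      have h2 := hc.comp (tendsto_slicePt unitI_mem)
      have h3 : Continuous fun q : ℍ[ℝ] => (⟨q.re, q.imI⟩ : ℂ) := by
        have : (fun q : ℍ[ℝ] => (⟨q.re, q.imI⟩ : ℂ)) =
            fun q : ℍ[ℝ] => (q.re : ℂ) + (q.imI : ℂ) * Complex.I := by
          funext q
          apply Complex.ext <;> simp
        rw [this]
        have h1 : Continuous fun x : ℍ[ℝ] => x.re := Quaternion.continuous_re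
        have h2 : Continuous fun x : ℍ[ℝ] => x.imI := Quaternion.continuous_imI
        fun_prop
      exact (h3.tendsto c).comp h2
    have h2 := h.conj_real hE h1
    rw [h2] at h1
    exact ⟨_, tendsto_nhds_unique hc (key _ h1), h1⟩
  · rintro ⟨r, rfl, hr⟩
    exact key r hr

theorem memSH_iff {f : ℍ[ℝ] → ℍ[ℝ]} {K : Set (OnePoint ℍ[ℝ])} :
    MemSH f K ↔ ∃ E, SliceHol f E ∧ (∀ x : ℍ[ℝ], (x : OnePoint ℍ[ℝ]) ∈ K → proj x ∈ E) ∧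
      (OnePoint.infty ∈ K → E ∈ Bornology.cobounded ℂ ∧
        Tendsto (cpl f) (Bornology.cobounded ℂ) (𝓝 ((valInfty f).re : ℂ))) := by
  constructor
  · rintro ⟨D, hD, h1, h2⟩
    have hs := IntrinsicSHOn.sliceHol hD
    refine ⟨_, hs, fun x hx => (mem_iff_proj_mem hD.2.1).2 (h1 x hx), fun hK => ?_⟩
    obtain ⟨⟨r, -, hr⟩, c, hc⟩ := h2 hK
    have hE : slicePt unitI ⁻¹' D ∈ Bornology.cobounded ℂ := by
      refine tendsto_slicePt unitI_mem ?_
      refine mem_of_superset ?_ hr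
      exact Bornology.isBounded_def.1 Metric.isBounded_ball
    obtain ⟨r, rfl, hr⟩ := (hs.tendsto_iff hE).1 hc
    refine ⟨hE, ?_⟩
    rw [valInfty, hc.limUnder_eq]
    simpa using hr
  · rintro ⟨E, hs, h1, h2⟩
    refine ⟨_, hs.intrinsicSHOn, h1, fun hK => ?_⟩
    obtain ⟨hE, hc⟩ := h2 hK
    constructor
    · obtain ⟨r, -, hr⟩ := (Metric.hasBasis_cobounded_compl_ball (0 : ℂ)).mem_iff.1 hE
      refine ⟨max r 1, by positivity, fun x hx => hr ?_⟩
      rw [mem_compl_iff, mem_ball_zero_iff, not_lt] at hx ⊢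
      rw [norm_proj]
      exact (le_max_left _ _).trans hx
    · exact ⟨_, (hs.tendsto_iff hE).2 ⟨_, rfl, hc⟩⟩

theorem SliceHol.valInfty_eq {f : ℍ[ℝ] → ℍ[ℝ]} {E : Set ℂ} (h : SliceHol f E)
    (hE : E ∈ Bornology.cobounded ℂ) {r : ℝ}
    (hr : Tendsto (cpl f) (Bornology.cobounded ℂ) (𝓝 (r : ℂ))) : valInfty f = r :=
  ((h.tendsto_iff hE).2 ⟨r, rfl, hr⟩).limUnder_eq

end SliceCalc

namespace SliceCalc

open RieszDunford

/-! ### The complex space of a quaternionic right Banach space -/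

/-- The space `V` with the complex structure of a slice. -/
def Cx (V : Type*) := V

variable {V : Type*} [NormedAddCommGroup V]

noncomputable instance : NormedAddCommGroup (Cx V) := inferInstanceAs (NormedAddCommGroup V)

instance [CompleteSpace V] : CompleteSpace (Cx V) := inferInstanceAs (CompleteSpace V)

/-- The scalars of the reference slice as right multiplications. -/
noncomputable def slOp : ℂ →+* HOp where
  toFun z := MulOpposite.op (slicePt unitI z)
  map_one' := by
    rw [← Complex.ofReal_one, slicePt_ofReal]; rfl
  map_mul' z w := by rw [mul_comm, slicePt_mul unitI_mem, MulOpposite.op_mul]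
  map_zero' := by
    rw [← Complex.ofReal_zero, slicePt_ofReal]; simp
  map_add' z w := by rw [slicePt_add, MulOpposite.op_add]

theorem slOp_apply (z : ℂ) : slOp z = MulOpposite.op (slicePt unitI z) := rfl

variable [Module HOp V]

noncomputable instance : Module ℂ (Cx V) := Module.compHom V slOp

variable [NormSMulClass HOp V]

noncomputable instance : NormedSpace ℂ (Cx V) where
  norm_smul_le z v := by
    have h : ∀ v : V, ‖slOp z • v‖ ≤ ‖z‖ * ‖v‖ := fun v => by
      rw [norm_smul, slOp_apply, MulOpposite.norm_op, norm_slicePt unitI_mem]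
    exact h v

variable [NormedSpace ℝ V] [IsScalarTower ℝ HOp V]

omit [NormSMulClass HOp V] in
theorem op_coe_smul (r : ℝ) (v : V) : MulOpposite.op (r : ℍ[ℝ]) • v = r • v := by
  have : MulOpposite.op (r : ℍ[ℝ]) = r • (1 : HOp) := by
    rw [← MulOpposite.op_one, ← MulOpposite.op_smul]
    congr 1
    ext <;> simp
  rw [this, smul_assoc, one_smul]

/-- The identity as a real linear isometry. -/
noncomputable def toCx : V ≃L[ℝ] Cx V where
  toFun v := v
  invFun v := v
  map_add' _ _ := rfl
  map_smul' r v := by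
    have h : (slOp (r : ℂ)) • v = r • v := by
      rw [slOp_apply, slicePt_ofReal, op_coe_smul]
    exact h.symm
  continuous_toFun := continuous_id
  continuous_invFun := continuous_id

theorem smul_toCx (z : ℂ) (v : V) : z • toCx v = toCx (MulOpposite.op (slicePt unitI z) • v) := rfl

theorem toCx_surj (x : Cx V) : ∃ v, toCx v = x := ⟨x, rfl⟩

/-- Bounded operators are complex linear. -/
noncomputable def cxOp (A : V →L[HOp] V) : Cx V →L[ℂ] Cx V where
  toFun x := toCx (A (toCx.symm x))
  map_add' x y := by rw [map_add, map_add, map_add]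
  map_smul' z x := by
    obtain ⟨v, rfl⟩ := toCx_surj x
    rw [smul_toCx, ContinuousLinearEquiv.symm_apply_apply, ContinuousLinearEquiv.symm_apply_apply,
      map_smul]
    rfl
  cont := toCx.continuous.comp (A.continuous.comp toCx.symm.continuous)

@[simp] theorem cxOp_toCx (A : V →L[HOp] V) (v : V) : cxOp A (toCx v) = toCx (A v) := rfl

theorem cxOp_injective : Function.Injective (cxOp : (V →L[HOp] V) → _) := by
  intro A B h
  ext v
  exact toCx.injective (congrArg (fun L : Cx V →L[ℂ] Cx V => L (toCx v)) h)

theorem cxOp_mul (A B : V →L[HOp] V) : cxOp (A * B) = cxOp A * cxOp B := rfl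

theorem cxOp_add (A B : V →L[HOp] V) : cxOp (A + B) = cxOp A + cxOp B := rfl

theorem cxOp_one : cxOp (1 : V →L[HOp] V) = 1 := rfl

/-- Right multiplication by a quaternion, on the complex space. -/
noncomputable def rmul (q : ℍ[ℝ]) : Cx V →L[ℝ] Cx V :=
  LinearMap.mkContinuous
    { toFun := fun x => toCx (MulOpposite.op q • toCx.symm x)
      map_add' := fun x y => by rw [map_add, smul_add, map_add]
      map_smul' := fun r x => by
        have h : ∀ v : V, MulOpposite.op q • r • v = r • MulOpposite.op q • v := fun v => by
          rw [← op_coe_smul, ← op_coe_smul, smul_smul, smul_smul, ← MulOpposite.op_mul,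
            ← MulOpposite.op_mul, Quaternion.coe_commutes]
        change toCx (MulOpposite.op q • toCx.symm (r • x)) = r • toCx (MulOpposite.op q • toCx.symm x)
        rw [(toCx (V := V)).symm.map_smul, h, (toCx (V := V)).map_smul] } ‖q‖ (fun x => by
        change ‖MulOpposite.op q • toCx.symm x‖ ≤ _
        rw [norm_smul, MulOpposite.norm_op]
        rfl)

@[simp] theorem rmul_toCx (q : ℍ[ℝ]) (v : V) :
    rmul q (toCx v) = toCx (MulOpposite.op q • v) := rfl

theorem rmul_rmul (p q : ℍ[ℝ]) (x : Cx V) : rmul q (rmul p x) = rmul (p * q) x := by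
  obtain ⟨v, rfl⟩ := toCx_surj x
  rw [rmul_toCx, rmul_toCx, rmul_toCx, smul_smul, ← MulOpposite.op_mul]

theorem rmul_slicePt (z : ℂ) (x : Cx V) : rmul (slicePt unitI z) x = z • x := rfl

theorem rmul_add (p q : ℍ[ℝ]) (x : Cx V) : rmul (p + q) x = rmul p x + rmul q x := by
  obtain ⟨v, rfl⟩ := toCx_surj x
  rw [rmul_toCx, rmul_toCx, rmul_toCx, MulOpposite.op_add, add_smul, map_add]

theorem rmul_one (x : Cx V) : rmul 1 x = x := by
  obtain ⟨v, rfl⟩ := toCx_surj x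
  rw [rmul_toCx, MulOpposite.op_one, one_smul]

theorem rmul_unitJ_smul (z : ℂ) (x : Cx V) :
    rmul unitJ (z • x) = starRingEnd ℂ z • rmul unitJ x := by
  rw [← rmul_slicePt, ← rmul_slicePt, rmul_rmul, rmul_rmul, slicePt_mul_unitJ]

theorem rmul_unitJ_rmul (x : Cx V) : rmul unitJ (rmul unitJ x) = -x := by
  rw [rmul_rmul, unitJ_mul_self]
  obtain ⟨v, rfl⟩ := toCx_surj x
  rw [rmul_toCx, MulOpposite.op_neg, MulOpposite.op_one, neg_smul, one_smul, map_neg]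

theorem exists_cxOp {B : Cx V →L[ℂ] Cx V} (hB : ∀ x, B (rmul unitJ x) = rmul unitJ (B x)) :
    ∃ A : V →L[HOp] V, cxOp A = B := by
  have h : ∀ (q : ℍ[ℝ]) (x : Cx V), B (rmul q x) = rmul q (B x) := by
    intro q x
    rw [eq_slicePt_add q, rmul_add, rmul_add, map_add, ← rmul_rmul, ← rmul_rmul, hB, rmul_slicePt,
      rmul_slicePt, rmul_slicePt, rmul_slicePt, map_smul, map_smul]
  refine ⟨{ toFun := fun v => toCx.symm (B (toCx v))
            map_add' := fun v w => by rw [map_add, map_add, map_add]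
            map_smul' := fun q v => ?_
            cont := toCx.symm.continuous.comp (B.continuous.comp toCx.continuous) }, rfl⟩
  have := h q.unop (toCx v)
  rw [rmul_toCx, MulOpposite.op_unop] at this
  rw [this]
  rfl

/-! ### The graph as a complex linear relation -/

variable (T : V →ₗ.[HOp] V)

/-- The graph of `T` as a complex linear relation. -/
noncomputable def cxGraph : Submodule ℂ (Cx V × Cx V) where
  carrier := {p | (toCx.symm p.1, toCx.symm p.2) ∈ T.graph}
  add_mem' := fun {p q} hp hq => by
    have := T.graph.add_mem hp hq
    exact this
  zero_mem' := T.graph.zero_mem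
  smul_mem' := fun z p hp => by
    have := T.graph.smul_mem (slOp z) hp
    exact this

variable {T}

theorem mem_cxGraph {v w : V} :
    (toCx v, toCx w) ∈ cxGraph T ↔ v ∈ T.domain ∧ app T v = w := by
  have : (toCx v, toCx w) ∈ cxGraph T ↔ (v, w) ∈ T.graph := Iff.rfl
  rw [this, LinearPMap.mem_graph_iff]
  constructor
  · rintro ⟨y, h1, h2⟩
    simp only at h1 h2
    subst h1
    exact ⟨y.2, (app_of_mem T y.2).trans h2⟩
  · rintro ⟨h1, h2⟩
    exact ⟨⟨v, h1⟩, rfl, (app_of_mem T h1).symm.trans h2⟩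

theorem mem_cxGraph_app {v : V} (hv : v ∈ T.domain) : (toCx v, toCx (app T v)) ∈ cxGraph T :=
  mem_cxGraph.2 ⟨hv, rfl⟩

theorem isClosed_cxGraph (hT : IsClosed (T.graph : Set (V × V))) :
    IsClosed (cxGraph T : Set (Cx V × Cx V)) :=
  hT.preimage ((toCx.symm.continuous.comp continuous_fst).prodMk
    (toCx.symm.continuous.comp continuous_snd))

theorem rmul_mem_cxGraph (q : ℍ[ℝ]) {p : Cx V × Cx V} (hp : p ∈ cxGraph T) :
    (rmul q p.1, rmul q p.2) ∈ cxGraph T := T.graph.smul_mem (MulOpposite.op q) hp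

theorem cxGraph_ofBdd (A : V →L[HOp] V) : cxGraph (ofBdd A) = gr (cxOp A) := by
  ext ⟨x, y⟩
  obtain ⟨v, rfl⟩ := toCx_surj x
  obtain ⟨w, rfl⟩ := toCx_surj y
  rw [mem_cxGraph, mem_gr]
  have h : v ∈ (ofBdd A).domain := Submodule.mem_top
  have h2 : app (ofBdd A) v = A v := by
    rw [app_of_mem _ h]; rfl
  simp only [h, true_and, h2, cxOp_toCx]
  exact ⟨fun e => by rw [e], fun e => (toCx.injective e).symm⟩

variable [CompleteSpace V]

/-- An everywhere defined closed operator is bounded. -/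
theorem exists_ofBdd (hT : IsClosed (T.graph : Set (V × V))) (hd : T.domain = ⊤) :
    ∃ B : V →L[HOp] V, ofBdd B = T := by
  have hm : ∀ v, v ∈ T.domain := fun v => hd ▸ Submodule.mem_top
  let L : V →ₗ[HOp] V :=
    { toFun := app T
      map_add' := fun v w => app_add T (hm v) (hm w)
      map_smul' := fun q v => app_smul T q (hm v) }
  let L' : V →ₗ[ℝ] V :=
    { toFun := app T
      map_add' := fun v w => app_add T (hm v) (hm w)
      map_smul' := fun r v => by
        rw [← op_coe_smul, app_smul T _ (hm v), op_coe_smul]; rfl }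
  have hg : IsClosed (L'.graph : Set (V × V)) := by
    convert hT using 1
    ext ⟨v, w⟩
    have h1 : (v, w) ∈ (L'.graph : Set (V × V)) ↔ w = app T v := LinearMap.mem_graph_iff _ _
    have h2 : (v, w) ∈ (T.graph : Set (V × V)) ↔ v ∈ T.domain ∧ app T v = w := mem_cxGraph
    rw [h1, h2]
    exact ⟨fun h => ⟨hm v, h.symm⟩, fun h => h.2.symm⟩
  refine ⟨⟨L, L'.continuous_of_isClosed_graph hg⟩, ?_⟩
  refine LinearPMap.ext (by rw [hd]; rfl) fun x y hxy => ?_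
  rw [← app_of_mem T]
  rfl

/-- The kind of the calculus. -/
noncomputable def kap (T : V →ₗ.[HOp] V) : ℂ :=
  open Classical in if T.domain = ⊤ then 0 else 1

omit [NormSMulClass HOp V] [NormedSpace ℝ V] [IsScalarTower ℝ HOp V] [CompleteSpace V] in
theorem kap_of_eq (h : T.domain = ⊤) : kap T = 0 := if_pos h

omit [NormSMulClass HOp V] [NormedSpace ℝ V] [IsScalarTower ℝ HOp V] [CompleteSpace V] in
theorem kap_of_ne (h : T.domain ≠ ⊤) : kap T = 1 := if_neg h

theorem kind_cxGraph (hT : IsClosed (T.graph : Set (V × V))) : Kind (kap T) (cxGraph T) := by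
  by_cases h : T.domain = ⊤
  · rw [kap_of_eq h]
    obtain ⟨B, rfl⟩ := exists_ofBdd hT h
    rw [cxGraph_ofBdd]
    exact kind_gr _
  · exact Or.inr (kap_of_ne h)

/-! ### The pseudo-resolvent and the complex resolvent -/

omit [NormSMulClass HOp V] [CompleteSpace V] in
theorem real_smul_mem {v : V} (r : ℝ) (hv : v ∈ T.domain) : r • v ∈ T.domain := by
  rw [← op_coe_smul]; exact T.domain.smul_mem _ hv

omit [NormSMulClass HOp V] [CompleteSpace V] in
theorem app_real_smul {v : V} (r : ℝ) (hv : v ∈ T.domain) : app T (r • v) = r • app T v := by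
  rw [← op_coe_smul, app_smul T _ hv, op_coe_smul]

omit [NormSMulClass HOp V] [CompleteSpace V] in
theorem app_sub {v w : V} (hv : v ∈ T.domain) (hw : w ∈ T.domain) :
    app T (v - w) = app T v - app T w := by
  have h1 := app_real_smul (-1) hw
  have h2 := app_add T hv (real_smul_mem (-1) hw)
  rw [h1, neg_one_smul, neg_one_smul, ← sub_eq_add_neg, ← sub_eq_add_neg] at h2
  exact h2

omit [NormSMulClass HOp V] [CompleteSpace V] in
theorem IsPseudoResolvent.unique {s : ℍ[ℝ]} {B B' : V →L[HOp] V} (h : IsPseudoResolvent T s B)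
    (h' : IsPseudoResolvent T s B') : B = B' := by
  ext v
  have := h.2 _ (h'.1 v).1
  rwa [(h'.1 v).2] at this

omit [NormSMulClass HOp V] [CompleteSpace V] in
theorem IsPseudoResolvent.eq {s : ℍ[ℝ]} {B : V →L[HOp] V} (h : IsPseudoResolvent T s B) :
    pseudoResolvent T s = B := by
  have h' : ∃ B, IsPseudoResolvent T s B := ⟨B, h⟩
  rw [pseudoResolvent, dif_pos h']
  exact IsPseudoResolvent.unique h'.choose_spec h

omit [NormSMulClass HOp V] [CompleteSpace V] in
theorem isPseudoResolvent_slicePt {i i' : ℍ[ℝ]} (hi : i ∈ unitSphere) (hi' : i' ∈ unitSphere)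
    {z : ℂ} {B : V →L[HOp] V} (h : IsPseudoResolvent T (slicePt i z) B) :
    IsPseudoResolvent T (slicePt i' z) B := by
  have hq : ∀ v, qOp T (slicePt i' z) v = qOp T (slicePt i z) v := fun v => by
    rw [qOp, qOp, slicePt_re hi, slicePt_re hi', norm_slicePt hi, norm_slicePt hi']
  simpa only [IsPseudoResolvent, hq] using h

omit [NormSMulClass HOp V] [CompleteSpace V] in
/-- The pseudo-resolvent commutes with `T`. -/
theorem IsPseudoResolvent.comm {s : ℍ[ℝ]} {B : V →L[HOp] V} (h : IsPseudoResolvent T s B) {v : V}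
    (hv : v ∈ T.domain) : app T (B v) ∈ T.domain ∧ app T (app T (B v)) ∈ T.domain ∧
      B (app T v) = app T (B v) := by
  obtain ⟨⟨h1, h2⟩, h3⟩ := h.1 v
  have h4 : app T (app T (B v)) = v + (2 * s.re) • app T (B v) - (‖s‖ ^ 2) • B v := by
    have h4 := h3
    rw [qOp] at h4
    linear_combination (norm := module) h4
  have h6 : v + (2 * s.re) • app T (B v) ∈ T.domain := T.domain.add_mem hv (real_smul_mem _ h2)
  have h5 : app T (app T (B v)) ∈ T.domain := by
    rw [h4]
    exact T.domain.sub_mem h6 (real_smul_mem _ h1)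
  refine ⟨h2, h5, ?_⟩
  have h7 : qOp T s (app T (B v)) = app T v := by
    rw [qOp, h4, app_sub h6 (real_smul_mem _ h1), app_add T hv (real_smul_mem _ h2),
      app_real_smul _ h2, app_real_smul _ h1]
    rw [h4]
    abel
  have := h.2 _ ⟨h2, h5⟩
  rwa [h7] at this

/-- The complex resolvent in terms of the pseudo-resolvent. -/
theorem IsPseudoResolvent.exists_isRes (hT : IsClosed (T.graph : Set (V × V))) {z : ℂ}
    {B : V →L[HOp] V} (h : IsPseudoResolvent T (slicePt unitI z) B) :
    ∃ R, IsRes (cxGraph T) z R ∧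
      ∀ v, R (toCx v) = starRingEnd ℂ z • toCx (B v) - toCx (app T (B v)) := by
  have hre : ∀ v : V, ((2 * (slicePt unitI z).re) • v) = (2 * z.re) • v := fun v => by
    rw [slicePt_re unitI_mem]
  have hB1 : ∀ v, B v ∈ T.domain := fun v => (h.1 v).1.1
  have hB2 : ∀ v, app T (B v) ∈ T.domain := fun v => (h.1 v).1.2
  let L : Cx V →ₗ[ℂ] Cx V :=
    { toFun := fun x => toCx (app T (B (toCx.symm x)))
      map_add' := fun x y => by
        rw [map_add, map_add, app_add T (hB1 _) (hB1 _), map_add]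
      map_smul' := fun a x => by
        obtain ⟨v, rfl⟩ := toCx_surj x
        rw [smul_toCx, ContinuousLinearEquiv.symm_apply_apply,
          ContinuousLinearEquiv.symm_apply_apply, map_smul, app_smul T _ (hB1 v)]
        rfl }
  have hLg : IsClosed (L.graph : Set (Cx V × Cx V)) := by
    have : (L.graph : Set (Cx V × Cx V)) =
        (fun p => (cxOp B p.1, p.2)) ⁻¹' (cxGraph T : Set (Cx V × Cx V)) := by
      ext ⟨x, y⟩
      obtain ⟨v, rfl⟩ := toCx_surj x
      obtain ⟨w, rfl⟩ := toCx_surj y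
      have h1 : (toCx v, toCx w) ∈ (L.graph : Set (Cx V × Cx V)) ↔ toCx w = L (toCx v) :=
        LinearMap.mem_graph_iff _ _
      have h2 : (toCx v, toCx w) ∈ (fun p => (cxOp B p.1, p.2)) ⁻¹' (cxGraph T : Set (Cx V × Cx V)) ↔
        B v ∈ T.domain ∧ app T (B v) = w := mem_cxGraph
      rw [h1, h2]
      exact ⟨fun e => ⟨hB1 v, (toCx.injective e).symm⟩, fun e => by rw [← e.2]; rfl⟩
    rw [this]
    exact (isClosed_cxGraph hT).preimage
      (((cxOp B).continuous.comp continuous_fst).prodMk continuous_snd)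
  let TB : Cx V →L[ℂ] Cx V := ⟨L, L.continuous_of_isClosed_graph hLg⟩
  have hTB : ∀ v, TB (toCx v) = toCx (app T (B v)) := fun v => rfl
  have hq : ∀ v, toCx (app T (app T v)) = toCx (qOp T (slicePt unitI z) v) +
      (z + starRingEnd ℂ z) • toCx (app T v) - (z * starRingEnd ℂ z) • toCx v := by
    intro v
    rw [qOp, hre, norm_slicePt unitI_mem, map_add, map_sub, map_smul, map_smul, Complex.add_conj,
      Complex.mul_conj, Complex.normSq_eq_norm_sq, Complex.coe_smul, Complex.coe_smul]
    abel
  refine ⟨starRingEnd ℂ z • cxOp B - TB, ⟨fun x => ?_, fun p hp => ?_⟩, fun v => rfl⟩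
  · obtain ⟨v, rfl⟩ := toCx_surj x
    have h1 := (cxGraph T).smul_mem (starRingEnd ℂ z) (mem_cxGraph_app (hB1 v))
    have h2 := mem_cxGraph_app (hB2 v)
    have h3 := (cxGraph T).sub_mem h1 h2
    convert h3 using 1
    refine Prod.ext rfl ?_
    simp only [_root_.sub_apply, _root_.smul_apply, hTB, cxOp_toCx, Prod.snd_sub, Prod.smul_snd]
    rw [hq, (h.1 v).2]
    module
  · obtain ⟨x, y⟩ := p
    obtain ⟨v, rfl⟩ := toCx_surj x
    obtain ⟨w, rfl⟩ := toCx_surj y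
    obtain ⟨h1, rfl⟩ := mem_cxGraph.1 hp
    obtain ⟨h2, h3, h4⟩ := IsPseudoResolvent.comm h h1
    simp only [_root_.sub_apply, _root_.smul_apply, map_sub, map_smul, hTB, cxOp_toCx, h4]
    rw [hq, (h.1 v).2]
    module

omit [CompleteSpace V] in
theorem IsRes.conj {z : ℂ} {R : Cx V →L[ℂ] Cx V} (h : IsRes (cxGraph T) z R) :
    ∃ R', IsRes (cxGraph T) (starRingEnd ℂ z) R' ∧ ∀ x, R' (rmul unitJ x) = rmul unitJ (R x) := by
  have hc : Continuous fun x => -rmul unitJ (R (rmul unitJ x)) :=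
    ((rmul unitJ).continuous.comp (R.continuous.comp (rmul unitJ).continuous)).neg
  let R' : Cx V →L[ℂ] Cx V :=
    { toFun := fun x => -rmul unitJ (R (rmul unitJ x))
      map_add' := fun x y => by rw [map_add, map_add, map_add, neg_add]
      map_smul' := fun a x => by
        rw [rmul_unitJ_smul, map_smul, rmul_unitJ_smul, Complex.conj_conj, smul_neg]; rfl
      cont := hc }
  have hR' : ∀ x, R' x = -rmul unitJ (R (rmul unitJ x)) := fun x => rfl
  refine ⟨R', ⟨fun x => ?_, fun p hp => ?_⟩, fun x => ?_⟩
  · have h1 := (cxGraph T).neg_mem (rmul_mem_cxGraph unitJ (h.1 (rmul unitJ x)))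
    convert h1 using 1
    refine Prod.ext rfl ?_
    simp only [hR', Prod.snd_neg, map_sub, rmul_unitJ_smul, rmul_unitJ_rmul, smul_neg]
    abel
  · have h1 := h.2 _ (rmul_mem_cxGraph unitJ hp)
    rw [hR', map_sub, rmul_unitJ_smul, Complex.conj_conj, h1, rmul_unitJ_rmul, neg_neg]
  · rw [hR', rmul_unitJ_rmul, map_neg, map_neg, neg_neg]

omit [CompleteSpace V] in
theorem conj_mem_rho {z : ℂ} (hz : z ∈ rho (cxGraph T)) : starRingEnd ℂ z ∈ rho (cxGraph T) := by
  obtain ⟨R, hR⟩ := hz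
  obtain ⟨R', hR', -⟩ := IsRes.conj hR
  exact hR'.mem_rho

omit [CompleteSpace V] in
theorem res_conj {z : ℂ} (hz : z ∈ rho (cxGraph T)) (x : Cx V) :
    res (cxGraph T) (starRingEnd ℂ z) (rmul unitJ x) = rmul unitJ (res (cxGraph T) z x) := by
  obtain ⟨R', hR', h⟩ := IsRes.conj (isRes_res hz)
  rw [hR'.res_eq, h]

omit [CompleteSpace V] in
theorem exists_isPseudoResolvent {z : ℂ} (hz : z ∈ rho (cxGraph T)) :
    ∃ B, IsPseudoResolvent T (slicePt unitI z) B := by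
  have hz' := conj_mem_rho hz
  set R := res (cxGraph T) z with hR
  set R' := res (cxGraph T) (starRingEnd ℂ z) with hR'
  have h1 := isRes_res hz
  have h2 := isRes_res hz'
  rw [← hR] at h1
  rw [← hR'] at h2
  obtain ⟨B, hB⟩ := exists_cxOp (B := R * R') (fun x => by
    have h3 := res_conj hz x
    have h4 := res_conj hz' (R x)
    rw [Complex.conj_conj] at h4
    rw [mul_apply_eq_comp, h3, ← hR, h4, res_comm hz hz', mul_apply_eq_comp])
  have hBv : ∀ v, toCx (B v) = R (R' (toCx v)) := fun v => by
    rw [← cxOp_toCx, hB]; rfl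
  have hqC : ∀ v, toCx (qOp T (slicePt unitI z) v) = toCx (app T (app T v)) -
      (z + starRingEnd ℂ z) • toCx (app T v) + (z * starRingEnd ℂ z) • toCx v := by
    intro v
    rw [qOp, slicePt_re unitI_mem, norm_slicePt unitI_mem, map_add, map_sub, map_smul, map_smul,
      Complex.add_conj, Complex.mul_conj, Complex.normSq_eq_norm_sq, Complex.coe_smul,
      Complex.coe_smul]
  refine ⟨B, fun v => ?_, fun v hv => ?_⟩
  · have m1 := h1.1 (R' (toCx v))
    have m2 := h2.1 (toCx v)
    obtain ⟨y, hy⟩ := toCx_surj (z • R (R' (toCx v)) - R' (toCx v))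
    obtain ⟨u, hu⟩ := toCx_surj (R' (toCx v))
    obtain ⟨t, ht⟩ := toCx_surj (starRingEnd ℂ z • R' (toCx v) - toCx v)
    rw [← hy, ← hBv] at m1
    rw [← hu] at m2
    rw [hu, ← ht, ← hu] at m2
    obtain ⟨d1, e1⟩ := mem_cxGraph.1 m1
    obtain ⟨d2, e2⟩ := mem_cxGraph.1 m2
    have m3 := (cxGraph T).sub_mem ((cxGraph T).smul_mem z m1) m2
    obtain ⟨r, hr⟩ := toCx_surj (z • toCx y - toCx t)
    have m4 : (toCx y, toCx r) ∈ cxGraph T := by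
      convert m3 using 1
      refine Prod.ext ?_ ?_
      · simp only [Prod.fst_sub, Prod.smul_fst]
        rw [hy, hBv, hu]
      · simp only [Prod.snd_sub, Prod.smul_snd]
        rw [hr]
    obtain ⟨d3, e3⟩ := mem_cxGraph.1 m4
    refine ⟨⟨d1, e1 ▸ d3⟩, toCx.injective ?_⟩
    rw [hqC, e1, e3, hr, hy, ht, hBv]
    module
  · obtain ⟨hv1, hv2⟩ := hv
    apply toCx.injective
    rw [hBv]
    have m1 := mem_cxGraph_app hv1
    have m2 := mem_cxGraph_app hv2
    have m3 := (cxGraph T).sub_mem ((cxGraph T).smul_mem z m1) m2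
    have e1 := h2.2 _ m3
    have e2 := h1.2 _ m1
    simp only [Prod.fst_sub, Prod.smul_fst, Prod.snd_sub, Prod.smul_snd] at e1 e2
    rw [← e2, ← e1, hqC]
    congr 2
    module

theorem mem_sResolventSet_iff (hT : IsClosed (T.graph : Set (V × V))) {i : ℍ[ℝ]}
    (hi : i ∈ unitSphere) {z : ℂ} : slicePt i z ∈ sResolventSet T ↔ z ∈ rho (cxGraph T) := by
  constructor
  · rintro ⟨B, hB⟩
    obtain ⟨R, hR, -⟩ := IsPseudoResolvent.exists_isRes hT (isPseudoResolvent_slicePt hi unitI_mem hB)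
    exact hR.mem_rho
  · intro hz
    obtain ⟨B, hB⟩ := exists_isPseudoResolvent hz
    exact ⟨B, isPseudoResolvent_slicePt unitI_mem hi hB⟩

theorem mem_sSpectrum_iff (hT : IsClosed (T.graph : Set (V × V))) {i : ℍ[ℝ]}
    (hi : i ∈ unitSphere) {z : ℂ} : slicePt i z ∈ sSpectrum T ↔ z ∉ rho (cxGraph T) :=
  (mem_sResolventSet_iff hT hi).not

theorem mem_sSpectrum_iff_proj (hT : IsClosed (T.graph : Set (V × V))) {x : ℍ[ℝ]} :
    x ∈ sSpectrum T ↔ proj x ∉ rho (cxGraph T) := by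
  obtain ⟨i, hi, hx⟩ := exists_slicePt x
  rw [← mem_sSpectrum_iff hT hi, hx]

omit [NormedSpace ℝ V] [IsScalarTower ℝ HOp V] [CompleteSpace V] in
theorem conjSymm_compl_rho [NormedSpace ℝ V] [IsScalarTower ℝ HOp V] :
    ConjSymm (rho (cxGraph T))ᶜ := fun z hz h => by
  have := conj_mem_rho h
  rw [Complex.conj_conj] at this
  exact hz this

theorem toCx_sliceResolvent (hT : IsClosed (T.graph : Set (V × V))) {z : ℂ}
    (hz : z ∈ rho (cxGraph T)) (v : V) :
    toCx (sliceResolvent T (slicePt unitI z) v) = res (cxGraph T) z (toCx v) := by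
  obtain ⟨B, hB⟩ := exists_isPseudoResolvent hz
  obtain ⟨R, hR, h⟩ := IsPseudoResolvent.exists_isRes hT hB
  rw [hR.res_eq, h, sliceResolvent, IsPseudoResolvent.eq hB, map_sub, star_slicePt unitI_mem]
  rfl

omit [CompleteSpace V] in
theorem sliceResolvent_conj {i q : ℍ[ℝ]} (hi : i ∈ unitSphere)
    (hq : ∀ z, slicePt unitI z * q = q * slicePt i z) {z : ℂ} (hz : z ∈ rho (cxGraph T)) (v : V) :
    sliceResolvent T (slicePt i z) (v <• q) = (sliceResolvent T (slicePt unitI z) v) <• q := by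
  obtain ⟨B, hB⟩ := exists_isPseudoResolvent hz
  have hB' := isPseudoResolvent_slicePt unitI_mem hi hB
  rw [sliceResolvent, sliceResolvent, IsPseudoResolvent.eq hB, IsPseudoResolvent.eq hB', map_smul,
    app_smul T _ (hB.1 v).1.1, smul_sub, smul_smul, smul_smul, star_slicePt hi,
    star_slicePt unitI_mem, ← MulOpposite.op_mul, ← MulOpposite.op_mul, hq]

end SliceCalc

namespace RieszDunford

/-! ### Conjugate cycles -/

/-- The complex conjugate of a path, with the opposite orientation. -/
noncomputable def Path.conj (Γ : Path) : Path where
  S := Γ.S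
  mS := Γ.mS
  μ := Γ.μ
  sf := Γ.sf
  p s := starRingEnd ℂ (Γ.p s)
  d s := -starRingEnd ℂ (Γ.d s)
  supp := starRingEnd ℂ '' Γ.supp
  compact := Γ.compact.image Complex.continuous_conj
  meas := Complex.continuous_conj.measurable.comp Γ.meas
  mem s := mem_image_of_mem _ (Γ.mem s)
  int := (Complex.conjCLE.toContinuousLinearMap.integrable_comp Γ.int).neg

theorem Path.integ_conj {E F : Type*} [NormedAddCommGroup E] [NormedSpace ℂ E] [CompleteSpace E]
    [NormedAddCommGroup F] [NormedSpace ℂ F] [CompleteSpace F] (Γ : Path) (L : E →L[ℝ] F)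
    (hL : ∀ (a : ℂ) x, L (a • x) = starRingEnd ℂ a • L x) {f : ℂ → E} {g : ℂ → F}
    (hf : ContinuousOn f Γ.supp) (h : ∀ z ∈ Γ.supp, g (starRingEnd ℂ z) = L (f z)) :
    Γ.conj.integ g = -L (Γ.integ f) := by
  have h1 : Γ.conj.integ g = ∫ s, -L (Γ.d s • f (Γ.p s)) ∂Γ.μ := by
    refine integral_congr_ae (Eventually.of_forall fun s => ?_)
    change (-starRingEnd ℂ (Γ.d s)) • g (starRingEnd ℂ (Γ.p s)) = _
    simp only [h _ (Γ.mem s), hL, neg_smul]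
  rw [h1, integral_neg, L.integral_comp_comm (Γ.integrable hf)]
  rfl

theorem Path.ind_conj (Γ : Path) {z : ℂ} (hz : starRingEnd ℂ z ∉ Γ.supp) :
    Γ.conj.ind z = starRingEnd ℂ (Γ.ind (starRingEnd ℂ z)) := by
  have h := Γ.integ_conj (f := fun w => (w - starRingEnd ℂ z)⁻¹) (g := fun w => (w - z)⁻¹)
    Complex.conjCLE.toContinuousLinearMap (fun a x => map_mul (starRingEnd ℂ) a x)
    (Grid.differentiableOn_inv_sub hz).continuousOn (fun w _ => by simp)
  rw [Path.ind, Path.ind, h]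
  simp only [map_mul, map_inv₀, Complex.conj_ofReal, Complex.conj_I, map_ofNat]
  rw [mul_neg, mul_neg, inv_neg, neg_mul]
  rfl

/-- The complex conjugate of a cycle, with the opposite orientation. -/
noncomputable def Cycle.conj (Γ : Cycle) : Cycle where
  toPath := Γ.toPath.conj
  ind_loc := by
    intro z hz
    have hz' : starRingEnd ℂ z ∉ Γ.supp := fun h => hz ⟨_, h, by simp⟩
    have h1 := (Complex.continuous_conj.tendsto z).eventually (Γ.ind_loc _ hz')
    have h2 := (Complex.continuous_conj.tendsto z).eventually
      (Γ.compact.isClosed.isOpen_compl.mem_nhds hz')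
    filter_upwards [h1, h2] with w hw hw'
    rw [Γ.ind_conj hz', Γ.ind_conj hw', hw]
  ind_far := by
    have hc : Tendsto (starRingEnd ℂ) (Bornology.cobounded ℂ) (Bornology.cobounded ℂ) := by
      rw [← tendsto_norm_atTop_iff_cobounded]
      simpa using tendsto_norm_cobounded_atTop
    filter_upwards [hc.eventually Γ.ind_far,
      hc.eventually (Bornology.isBounded_def.1 Γ.compact.isBounded)] with w hw hw'
    rw [Γ.ind_conj hw', hw, map_zero]

theorem Sep.conj {κ : ℂ} {K D : Set ℂ} {Γ : Cycle} (h : Sep κ K D Γ)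
    (hκ : starRingEnd ℂ κ = κ) (hK : ∀ z ∈ K, starRingEnd ℂ z ∈ K)
    (hD : ∀ z ∈ D, starRingEnd ℂ z ∈ D) : Sep κ K D Γ.conj := by
  have hK' : ∀ z, starRingEnd ℂ z ∈ K → z ∈ K := fun z hz => by simpa using hK _ hz
  have hD' : ∀ z, starRingEnd ℂ z ∈ D → z ∈ D := fun z hz => by simpa using hD _ hz
  refine ⟨?_, fun z hz => ?_, fun z hz => ?_⟩
  · rintro _ ⟨z, hz, rfl⟩
    exact ⟨hD _ (h.1 hz).1, fun h' => (h.1 hz).2 (hK' _ h')⟩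
  · refine (Γ.ind_conj fun h' => (h.1 h').2 (hK z hz)).trans ?_
    rw [h.2.1 _ (hK z hz), map_sub, map_one, hκ]
  · have hz' : starRingEnd ℂ z ∉ D := fun h' => hz (hD' _ h')
    refine (Γ.ind_conj fun h' => hz' (h.1 h').1).trans ?_
    rw [h.2.2 _ hz', map_neg, hκ]

end RieszDunford

namespace SliceCalc

open RieszDunford

variable {V : Type*} [NormedAddCommGroup V] [Module HOp V] [NormSMulClass HOp V] [NormedSpace ℝ V]
  [IsScalarTower ℝ HOp V] [CompleteSpace V] {T : V →ₗ.[HOp] V}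

/-! ### The complex and the quaternionic calculus -/

theorem conj_kap : starRingEnd ℂ (kap T) = kap T := by
  unfold kap
  split_ifs <;> simp

theorem exists_cxOp_of_isCalc (hT : IsClosed (T.graph : Set (V × V))) {f : ℂ → ℂ} {E : Set ℂ}
    {c : ℝ} (hs : ConjSymm E) (hconj : ∀ z ∈ E, f (starRingEnd ℂ z) = starRingEnd ℂ (f z))
    (hf : Hol (kap T) E f c) (hE : (rho (cxGraph T))ᶜ ⊆ E) :
    ∃ A : V →L[HOp] V, IsCalc (cxGraph T) (kap T) f c (cxOp A) := by
  obtain ⟨W, Γ, hΓ⟩ := (kind_cxGraph hT).exists_nbhd hf.1 hE hf.cobounded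
  have h1 := hΓ.sep
  have h2 := h1.conj conj_kap conjSymm_compl_rho hs
  have hB : IsCalc (cxGraph T) (kap T) f c (val (cxGraph T) (kap T) c Γ.toPath f) :=
    ⟨E, hf, hE, Γ, h1, rfl⟩
  obtain ⟨A, hA⟩ := exists_cxOp (B := val (cxGraph T) (kap T) c Γ.toPath f) fun x => by
    have hfc := hf.2.1.continuousOn.mono h1.subset
    have hfc' := hf.2.1.continuousOn.mono h2.subset
    have h3 := Γ.integ_conj (rmul unitJ) (f := fun z => f z • res (cxGraph T) z x)
      (g := fun z => f z • res (cxGraph T) z (rmul unitJ x)) rmul_unitJ_smul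
      (continuousOn_smul_fun hfc (continuousOn_res_apply h1.subset_rho x)) fun z hz => by
        rw [hconj z (h1.subset hz), res_conj (h1.subset_rho hz), rmul_unitJ_smul]
    rw [hB.eq_val hf h2, val_apply hfc' h2.subset_rho]
    refine (congrArg (fun y => _ + (2 * Real.pi * Complex.I : ℂ)⁻¹ • y) h3).trans ?_
    rw [← hB.eq_val hf h2, val_apply hfc h1.subset_rho, map_add, rmul_unitJ_smul, rmul_unitJ_smul]
    simp only [map_mul, map_inv₀, conj_kap, Complex.conj_ofReal, Complex.conj_I, map_ofNat]
    rw [mul_neg, inv_neg, neg_smul, smul_neg]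
  exact ⟨A, hA ▸ hB⟩

omit [CompleteSpace V] [NormSMulClass HOp V] [NormedSpace ℝ V] [IsScalarTower ℝ HOp V] in
theorem cauchyFactor_eq {i : ℍ[ℝ]} :
    ((2 * Real.pi)⁻¹ • (-i) : ℍ[ℝ]) = slicePt i (2 * Real.pi * Complex.I : ℂ)⁻¹ := by
  have : (2 * Real.pi * Complex.I : ℂ)⁻¹ = ⟨0, -(2 * Real.pi)⁻¹⟩ := by
    rw [mul_inv, Complex.inv_I]
    apply Complex.ext <;> simp [← Complex.ofReal_ofNat, ← Complex.ofReal_mul, ← Complex.ofReal_inv]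
  rw [this, slicePt]
  simp

theorem toCx_cauchyIntegral (hT : IsClosed (T.graph : Set (V × V))) {f : ℍ[ℝ] → ℍ[ℝ]} {E W : Set ℂ}
    (hf : SliceHol f E) (hW : IsOpen W) {n : ℕ} {γ : Fin n → ℝ → ℂ} (hγ : IsOrientedBoundary W γ)
    (h1 : frontier W ⊆ E) (h2 : frontier W ⊆ rho (cxGraph T)) (v : V) :
    toCx (cauchyIntegral T f unitI γ v) = (2 * Real.pi * Complex.I : ℂ)⁻¹ •
      (boundaryCycle hW hγ).integ (fun z => cpl f z • res (cxGraph T) z (toCx v)) := by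
  have hfr : ∀ k, ∀ t ∈ Ioc (0 : ℝ) 1, γ k t ∈ frontier W := fun k t ht => by
    rw [hγ.2.1]
    exact mem_iUnion.2 ⟨k, mem_image_of_mem _ ⟨ht.1.le, ht.2⟩⟩
  rw [integ_boundaryCycle hW hγ (continuousOn_smul_fun (hf.diff.continuousOn.mono h1)
    (continuousOn_res_apply h2 _)), cauchyIntegral, cauchyFactor_eq, ← smul_toCx, map_sum]
  congr 2
  funext k
  rw [intervalIntegral.integral_of_le zero_le_one, intervalIntegral.integral_of_le zero_le_one,
    ← ContinuousLinearEquiv.integral_comp_comm]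
  refine setIntegral_congr_fun measurableSet_Ioc fun t ht => ?_
  have hm := hfr k t ht
  change toCx (_ <• _) = _
  rw [hf.eq _ unitI_mem _ (h1 hm), ← slicePt_mul unitI_mem, ← smul_toCx,
    toCx_sliceResolvent hT (h2 hm), mul_comm, mul_smul]

/-- Right multiplication by a nonzero quaternion. -/
noncomputable def rmulEquiv {q : ℍ[ℝ]} (hq : q ≠ 0) : Cx V ≃L[ℝ] Cx V :=
  ContinuousLinearEquiv.equivOfInverse (rmul q) (rmul q⁻¹)
    (fun x => by rw [rmul_rmul, mul_inv_cancel₀ hq, rmul_one])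
    (fun x => by rw [rmul_rmul, inv_mul_cancel₀ hq, rmul_one])

theorem cauchyIntegral_conj {f : ℍ[ℝ] → ℍ[ℝ]} {E : Set ℂ}
    (hf : SliceHol f E) {n : ℕ} {γ : Fin n → ℝ → ℂ} {i q : ℍ[ℝ]} (hi : i ∈ unitSphere)
    (hq0 : q ≠ 0) (hq : ∀ z, slicePt unitI z * q = q * slicePt i z)
    (h1 : ∀ k, ∀ t ∈ Ioc (0 : ℝ) 1, γ k t ∈ E)
    (h2 : ∀ k, ∀ t ∈ Ioc (0 : ℝ) 1, γ k t ∈ rho (cxGraph T)) (v : V) :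
    cauchyIntegral T f i γ (v <• q) = (cauchyIntegral T f unitI γ v) <• q := by
  have key : ∀ k, ∫ t in (0 : ℝ)..1, sliceResolvent T (slicePt i (γ k t)) (v <• q) <•
      (f (slicePt i (γ k t)) * slicePt i (deriv (γ k) t)) =
      (∫ t in (0 : ℝ)..1, sliceResolvent T (slicePt unitI (γ k t)) v <•
        (f (slicePt unitI (γ k t)) * slicePt unitI (deriv (γ k) t))) <• q := by
    intro k
    have h3 := ContinuousLinearEquiv.integral_comp_comm (μ := volume.restrict (Ioc (0 : ℝ) 1))
      (toCx.trans ((rmulEquiv hq0).trans toCx.symm) : V ≃L[ℝ] V)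
      (fun t => sliceResolvent T (slicePt unitI (γ k t)) v <•
        (f (slicePt unitI (γ k t)) * slicePt unitI (deriv (γ k) t)))
    rw [intervalIntegral.integral_of_le zero_le_one, intervalIntegral.integral_of_le zero_le_one]
    refine Eq.trans ?_ h3
    refine setIntegral_congr_fun measurableSet_Ioc fun t ht => ?_
    change _ = MulOpposite.op q • (sliceResolvent T (slicePt unitI (γ k t)) v <•
        (f (slicePt unitI (γ k t)) * slicePt unitI (deriv (γ k) t)))
    rw [sliceResolvent_conj hi hq (h2 k t ht), hf.eq _ unitI_mem _ (h1 k t ht),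
      hf.eq _ hi _ (h1 k t ht), ← slicePt_mul hi, ← slicePt_mul unitI_mem, smul_smul, smul_smul,
      ← MulOpposite.op_mul, ← MulOpposite.op_mul, hq]
  rw [cauchyIntegral, cauchyIntegral, Finset.sum_congr rfl fun k _ => key k, ← Finset.smul_sum,
    cauchyFactor_eq, cauchyFactor_eq, smul_smul, smul_smul, ← MulOpposite.op_mul,
    ← MulOpposite.op_mul, hq]

end SliceCalc

namespace RieszDunford

variable {X : Type*} [NormedAddCommGroup X] [NormedSpace ℂ X] [CompleteSpace X]
  {G : Submodule ℂ (X × X)}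

theorem Nbhd.closure_mem_cobounded {K D W : Set ℂ} {Γ : Cycle} (h : Nbhd 1 K D W Γ) :
    closure W ∈ Bornology.cobounded ℂ := by
  filter_upwards [Γ.ind_far] with z hz
  by_contra hz'
  rw [h.ind_out z hz'] at hz
  simp at hz

theorem IsCalc.tendsto {f : ℂ → ℂ} {c : ℂ} {A : X →L[ℂ] X} (h : IsCalc G 1 f c A) :
    Tendsto f (Bornology.cobounded ℂ) (𝓝 c) := by
  obtain ⟨D, hf, -⟩ := h
  exact (hf.2.2.resolve_left one_ne_zero).2

theorem IsCalc.unique_of_kind {κ : ℂ} (hk : Kind κ G) {f : ℂ → ℂ} {c d : ℂ} {A B : X →L[ℂ] X}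
    (hA : IsCalc G κ f c A) (hB : IsCalc G κ f d B) : A = B := by
  rcases hk with ⟨rfl, -⟩ | rfl
  · exact hA.zero_kind.unique hB
  · rw [tendsto_nhds_unique hB.tendsto hA.tendsto] at hB
    exact hA.unique hB

end RieszDunford

namespace SliceCalc

open RieszDunford

variable {V : Type*} [NormedAddCommGroup V] [Module HOp V] [NormSMulClass HOp V] [NormedSpace ℝ V]
  [IsScalarTower ℝ HOp V] [CompleteSpace V] {T : V →ₗ.[HOp] V} {f : ℍ[ℝ] → ℍ[ℝ]}

/-! ### Well-definedness -/

theorem infty_mem_sSpectrumX : OnePoint.infty ∈ sSpectrumX T ↔ T.domain ≠ ⊤ := by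
  simp [sSpectrumX]

theorem coe_mem_sSpectrumX {x : ℍ[ℝ]} : (x : OnePoint ℍ[ℝ]) ∈ sSpectrumX T ↔ x ∈ sSpectrum T := by
  simp [sSpectrumX]

theorem kap_eq_zero_iff : kap T = 0 ↔ T.domain = ⊤ := by
  by_cases h : T.domain = ⊤ <;> simp [kap, h]

theorem kap_eq : kap T = 0 ∨ kap T = 1 := by
  by_cases h : T.domain = ⊤ <;> simp [kap, h]

theorem memSH_sSpectrumX_iff (hT : IsClosed (T.graph : Set (V × V))) :
    MemSH f (sSpectrumX T) ↔ ∃ E, SliceHol f E ∧ (rho (cxGraph T))ᶜ ⊆ E ∧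
      Hol (kap T) E (cpl f) ((valInfty f).re : ℂ) := by
  rw [memSH_iff]
  refine exists_congr fun E => and_congr_right fun hE => ?_
  constructor
  · rintro ⟨h1, h2⟩
    refine ⟨fun z hz => ?_, hE.isOpen, hE.diff, ?_⟩
    · have := h1 (slicePt unitI z) (coe_mem_sSpectrumX.2 ((mem_sSpectrum_iff hT unitI_mem).2 hz))
      rwa [hE.symm.proj_mem unitI_mem] at this
    · by_cases hd : T.domain = ⊤
      · exact Or.inl (kap_of_eq hd)
      · exact Or.inr (h2 (infty_mem_sSpectrumX.2 hd))
  · rintro ⟨h1, h2⟩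
    refine ⟨fun x hx => h1 ((mem_sSpectrum_iff_proj hT).1 (coe_mem_sSpectrumX.1 hx)), fun hx => ?_⟩
    refine h2.2.2.resolve_left ?_
    rw [kap_of_ne (infty_mem_sSpectrumX.1 hx)]
    exact one_ne_zero

theorem isBounded_preimage_proj {W : Set ℂ} (hW : ConjSymm W) :
    Bornology.IsBounded (proj ⁻¹' W) ↔ Bornology.IsBounded W := by
  rw [isBounded_iff_forall_norm_le, isBounded_iff_forall_norm_le]
  refine exists_congr fun C => ⟨fun h z hz => ?_, fun h x hx => ?_⟩
  · rw [← norm_slicePt unitI_mem]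
    exact h _ ((hW.proj_mem unitI_mem).2 hz)
  · rw [← norm_proj]
    exact h _ hx

theorem exists_admissible (hT : IsClosed (T.graph : Set (V × V))) {E : Set ℂ} (hf : SliceHol f E)
    (hE : (rho (cxGraph T))ᶜ ⊆ E) (hc : kap T = 0 ∨ E ∈ Bornology.cobounded ℂ) :
    ∃ (i : ℍ[ℝ]) (U : Set ℍ[ℝ]) (n : ℕ) (γ : Fin n → ℝ → ℂ), Admissible T f i U γ := by
  have key : ∀ (W : Set ℂ) (n : ℕ) (γ : Fin n → ℝ → ℂ), IsCauchyDomain W → ConjSymm W →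
      (rho (cxGraph T))ᶜ ⊆ W → closure W ⊆ E → (Bornology.IsBounded W ↔ T.domain = ⊤) →
      IsOrientedBoundary W γ → Admissible T f unitI (proj ⁻¹' W) γ := by
    intro W n γ hW hs h1 h2 h3 hγ
    refine ⟨unitI_mem, ⟨hW.1.preimage continuous_proj, axiallySymmetric_preimage_proj W,
      fun i hi => ?_⟩, ?_, fun x hx => h1 ((mem_sSpectrum_iff_proj hT).1 hx),
      ⟨_, hf.intrinsicSHOn, ?_⟩, ?_⟩
    · rwa [hs.preimage_proj hi]
    · rwa [isBounded_preimage_proj hs]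
    · exact (continuous_proj.closure_preimage_subset W).trans (preimage_mono h2)
    · rwa [hs.preimage_proj unitI_mem]
  have hcl : IsClosed (rho (cxGraph T))ᶜ := (isOpen_rho _).isClosed_compl
  by_cases hd : T.domain = ⊤
  · have hb : Bornology.IsBounded (rho (cxGraph T))ᶜ := by
      rcases kind_cxGraph hT with ⟨-, h, -⟩ | h
      · rwa [Bornology.isBounded_def, compl_compl]
      · rw [kap_of_eq hd] at h
        exact absurd h zero_ne_one
    obtain ⟨W, n, γ, hW, h1, h2, h3, hγ, -, hs⟩ := Grid.exists_bounded_cauchyDomain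
      (Metric.isCompact_of_isClosed_isBounded hcl hb) hf.isOpen hE
    exact ⟨_, _, n, γ, key W n γ hW (hs conjSymm_compl_rho) h1 h2 (iff_of_true h3 hd) hγ⟩
  · have hc' : E ∈ Bornology.cobounded ℂ := hc.resolve_left (by rwa [kap_eq_zero_iff])
    have hEc : IsCompact Eᶜ := by
      refine Metric.isCompact_of_isClosed_isBounded hf.isOpen.isClosed_compl ?_
      rwa [Bornology.isBounded_def, compl_compl]
    obtain ⟨W, n, γ, hW, h1, h2, h3, hγ, hs⟩ :=
      Grid.exists_unbounded_cauchyDomain hEc hcl.isOpen_compl (compl_subset_compl.2 hE)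
    rw [compl_compl] at h1 h2
    refine ⟨_, _, n, γ, key W n γ hW (hs fun z hz h => hz ?_) h1 h2 (iff_of_false h3 hd) hγ⟩
    exact hf.symm.mem_iff.1 h

theorem cxOp_apply_of_admissible (hT : IsClosed (T.graph : Set (V × V))) {A : V →L[HOp] V}
    {r : ℝ} (hA : IsCalc (cxGraph T) (kap T) (cpl f) r (cxOp A)) {i : ℍ[ℝ]} {U : Set ℍ[ℝ]} {n : ℕ}
    {γ : Fin n → ℝ → ℂ} (h : Admissible T f i U γ) (v : V) :
    toCx (A v) = (kap T * r) • toCx v + toCx (cauchyIntegral T f i γ v) := by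
  obtain ⟨hi, ⟨hU, hax, hC⟩, hb, hsp, ⟨D, hD, hUD⟩, hγ⟩ := h
  obtain ⟨q, hq0, hq⟩ := exists_conj hi
  have hW : slicePt i ⁻¹' U = slicePt unitI ⁻¹' U := by
    ext z
    exact axiallySymmetric_mem_iff hax hi unitI_mem
  rw [hW] at hγ
  set W := slicePt unitI ⁻¹' U with hWdef
  have hs := conjSymm_preimage hax unitI_mem
  have hUW : U = proj ⁻¹' W := by
    ext x
    exact (mem_iff_proj_mem hax).symm
  have hE := IntrinsicSHOn.sliceHol hD
  have hWo : IsOpen W := (hC unitI unitI_mem).1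
  have hcl : closure W ⊆ slicePt unitI ⁻¹' D :=
    ((isometry_slicePt unitI_mem).continuous.closure_preimage_subset U).trans (preimage_mono hUD)
  have hN : Nbhd (kap T) (rho (cxGraph T))ᶜ (slicePt unitI ⁻¹' D) W (boundaryCycle hWo hγ) := by
    refine nbhd_boundaryCycle hWo hγ kap_eq ?_ (fun z hz => ?_) hcl
    · rw [kap_eq_zero_iff, ← hb, hUW, isBounded_preimage_proj hs]
    · exact hsp ((mem_sSpectrum_iff hT unitI_mem).2 hz)
  have hH : Hol (kap T) (slicePt unitI ⁻¹' D) (cpl f) r := by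
    refine ⟨hE.isOpen, hE.diff, ?_⟩
    rcases kap_eq (T := T) with h | h
    · exact Or.inl h
    · right
      rw [h] at hN hA
      exact ⟨mem_of_superset hN.closure_mem_cobounded hcl, hA.tendsto⟩
  have hsub := hN.sep.subset
  have hsub' := hN.sep.subset_rho
  have h0 : ∀ u, toCx (A u) = (kap T * r) • toCx u + toCx (cauchyIntegral T f unitI γ u) := by
    intro u
    have h1 := hsub
    have h2 := hsub'
    rw [boundaryCycle_supp] at h1 h2
    rw [toCx_cauchyIntegral hT hE hWo hγ h1 h2, ← cxOp_toCx, hA.eq_val hH hN.sep,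
      val_apply (hE.diff.continuousOn.mono hsub) hsub']
  have hfr : ∀ k, ∀ t ∈ Ioc (0 : ℝ) 1, γ k t ∈ frontier W := fun k t ht => by
    rw [hγ.2.1]
    exact mem_iUnion.2 ⟨k, mem_image_of_mem _ ⟨ht.1.le, ht.2⟩⟩
  rw [boundaryCycle_supp] at hsub hsub'
  have hv : v = (v <• q⁻¹) <• q := by
    rw [smul_smul, ← MulOpposite.op_mul, inv_mul_cancel₀ hq0, MulOpposite.op_one, one_smul]
  rw [hv, cauchyIntegral_conj hE hi hq0 hq (fun k t ht => hsub (hfr k t ht))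
    (fun k t ht => hsub' (hfr k t ht)), map_smul, ← rmul_toCx, h0, map_add, rmul_toCx]
  congr 1
  obtain ⟨s, hs⟩ : ∃ s : ℝ, kap T * r = s := by
    rcases kap_eq (T := T) with h | h <;> rw [h]
    · exact ⟨0, by simp⟩
    · exact ⟨r, by simp⟩
  rw [hs, Complex.coe_smul, Complex.coe_smul, map_smul, rmul_toCx]

theorem isSCalc_iff (hT : IsClosed (T.graph : Set (V × V))) (hf : MemSH f (sSpectrumX T))
    {A : V →L[HOp] V} :
    IsSCalc T f A ↔ IsCalc (cxGraph T) (kap T) (cpl f) ((valInfty f).re : ℂ) (cxOp A) := by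
  obtain ⟨E, hE, hσ, hH⟩ := (memSH_sSpectrumX_iff hT).1 hf
  have hadm := exists_admissible hT hE hσ hH.cobounded
  have key : ∀ {A : V →L[HOp] V}, IsCalc (cxGraph T) (kap T) (cpl f) ((valInfty f).re : ℂ) (cxOp A) →
      IsSCalc T f A := by
    intro A hA
    refine ⟨hadm, fun i U n γ h => ⟨fun hd v => toCx.injective ?_, fun hd v => toCx.injective ?_⟩⟩
    · rw [cxOp_apply_of_admissible hT hA h, kap_of_eq hd, zero_mul, zero_smul, zero_add]
    · have h1 := hH.2.2.resolve_left (by rwa [kap_eq_zero_iff])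
      rw [cxOp_apply_of_admissible hT hA h, kap_of_ne hd, one_mul, Complex.coe_smul, map_add,
        hE.valInfty_eq h1.1 h1.2, op_coe_smul, map_smul, Quaternion.re_coe]
  refine ⟨fun h => ?_, key⟩
  obtain ⟨A', hA'⟩ := exists_cxOp_of_isCalc hT hE.symm hE.conj hH hσ
  have : A = A' := by
    obtain ⟨i, U, n, γ, hγ⟩ := hadm
    have h1 := h.2 i U n γ hγ
    have h2 := (key hA').2 i U n γ hγ
    ext v
    by_cases hd : T.domain = ⊤
    · rw [h1.1 hd, h2.1 hd]
    · rw [h1.2 hd, h2.2 hd]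
  rw [this]
  exact hA'

theorem isSCalc_sCalc (hT : IsClosed (T.graph : Set (V × V))) (hf : MemSH f (sSpectrumX T)) :
    IsSCalc T f (sCalc T f) := by
  obtain ⟨E, hE, hσ, hH⟩ := (memSH_sSpectrumX_iff hT).1 hf
  obtain ⟨A, hA⟩ := exists_cxOp_of_isCalc hT hE.symm hE.conj hH hσ
  have h : ∃ A, IsSCalc T f A := ⟨A, (isSCalc_iff hT hf).2 hA⟩
  rw [sCalc, dif_pos h]
  exact h.choose_spec

theorem isCalc_sCalc (hT : IsClosed (T.graph : Set (V × V))) (hf : MemSH f (sSpectrumX T)) :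
    IsCalc (cxGraph T) (kap T) (cpl f) ((valInfty f).re : ℂ) (cxOp (sCalc T f)) :=
  (isSCalc_iff hT hf).1 (isSCalc_sCalc hT hf)

/-- A function that agrees near the spectrum with a function whose calculus is known. -/
theorem memSH_and_sCalc_eq (hT : IsClosed (T.graph : Set (V × V))) {E : Set ℂ} (hf : SliceHol f E)
    (hE : (rho (cxGraph T))ᶜ ⊆ E) (hc : kap T = 0 ∨ E ∈ Bornology.cobounded ℂ) {g : ℂ → ℂ} {c : ℂ}
    {A : V →L[HOp] V} (hA : IsCalc (cxGraph T) (kap T) g c (cxOp A)) (hg : EqOn g (cpl f) E) :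
    MemSH f (sSpectrumX T) ∧ sCalc T f = A := by
  have h1 := hA.congr (kind_cxGraph hT) hf.isOpen hE hc hg
  have h2 : MemSH f (sSpectrumX T) := by
    refine (memSH_sSpectrumX_iff hT).2 ⟨E, hf, hE, hf.isOpen, hf.diff, ?_⟩
    rcases kap_eq (T := T) with h | h
    · exact Or.inl h
    · right
      have hE' := hc.resolve_left (by rw [h]; exact one_ne_zero)
      rw [h] at h1
      have h3 := hf.conj_real hE' h1.tendsto
      refine ⟨hE', ?_⟩
      rw [hf.valInfty_eq hE' (h3 ▸ h1.tendsto), Quaternion.re_coe, ← h3]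
      exact h1.tendsto
  exact ⟨h2, cxOp_injective ((isCalc_sCalc hT h2).unique_of_kind (kind_cxGraph hT) h1)⟩

end SliceCalc

namespace SliceCalc

open RieszDunford

/-! ### Operations on slice functions -/

variable {f g : ℍ[ℝ] → ℍ[ℝ]} {E E' : Set ℂ}

theorem SliceHol.of_eq {F : ℂ → ℂ} (hE : IsOpen E) (hs : ConjSymm E)
    (hF : DifferentiableOn ℂ F E) (hc : ∀ z ∈ E, F (starRingEnd ℂ z) = starRingEnd ℂ (F z))
    (h : ∀ i ∈ unitSphere, ∀ z ∈ E, f (slicePt i z) = slicePt i (F z)) :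
    SliceHol f E ∧ EqOn F (cpl f) E := by
  have he : EqOn F (cpl f) E := fun z hz => (cpl_of_eq (h unitI unitI_mem z hz)).symm
  refine ⟨⟨hE, hs, hF.congr fun z hz => (he hz).symm, fun z hz => ?_, fun i hi z hz => ?_⟩, he⟩
  · rw [← he hz, ← he (hs z hz), hc z hz]
  · rw [← he hz, h i hi z hz]

theorem SliceHol.mono (hf : SliceHol f E) (ho : IsOpen E') (hs : ConjSymm E') (h : E' ⊆ E) :
    SliceHol f E' :=
  ⟨ho, hs, hf.diff.mono h, fun z hz => hf.conj z (h hz), fun i hi z hz => hf.eq i hi z (h hz)⟩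

theorem ConjSymm.inter (h : ConjSymm E) (h' : ConjSymm E') : ConjSymm (E ∩ E') :=
  fun z hz => ⟨h z hz.1, h' z hz.2⟩

theorem sliceHol_real_const (r : ℝ) : SliceHol (fun _ => (r : ℍ[ℝ])) univ ∧
    EqOn (fun _ => (r : ℂ)) (cpl fun _ => (r : ℍ[ℝ])) univ :=
  SliceHol.of_eq isOpen_univ (fun _ _ => mem_univ _) (differentiableOn_const _)
    (fun _ _ => (Complex.conj_ofReal r).symm) fun i _ _ _ => (slicePt_ofReal i r).symm

theorem SliceHol.smul_add (hf : SliceHol f E) (hg : SliceHol g E) (a : ℝ) :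
    SliceHol (a • f + g) E ∧ EqOn (fun z => a * cpl f z + cpl g z) (cpl (a • f + g)) E := by
  refine SliceHol.of_eq hf.isOpen hf.symm ((hf.diff.const_mul _).add hg.diff) (fun z hz => ?_)
    fun i hi z hz => ?_
  · rw [hf.conj z hz, hg.conj z hz, map_add, map_mul, Complex.conj_ofReal]
  · rw [Pi.add_apply, Pi.smul_apply, hf.eq i hi z hz, hg.eq i hi z hz, slicePt_add,
      slicePt_real_smul]

theorem SliceHol.mul (hf : SliceHol f E) (hg : SliceHol g E) :
    SliceHol (f * g) E ∧ EqOn (fun z => cpl f z * cpl g z) (cpl (f * g)) E := by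
  refine SliceHol.of_eq hf.isOpen hf.symm (hf.diff.mul hg.diff) (fun z hz => ?_) fun i hi z hz => ?_
  · rw [hf.conj z hz, hg.conj z hz, map_mul]
  · rw [Pi.mul_apply, hf.eq i hi z hz, hg.eq i hi z hz, slicePt_mul hi]

theorem SliceHol.comp (hg : SliceHol g E') (hf : SliceHol f E) :
    SliceHol (g ∘ f) (E ∩ cpl f ⁻¹' E') ∧
      EqOn (fun z => cpl g (cpl f z)) (cpl (g ∘ f)) (E ∩ cpl f ⁻¹' E') := by
  refine SliceHol.of_eq (hf.diff.continuousOn.isOpen_inter_preimage hf.isOpen hg.isOpen)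
    (fun z hz => ⟨hf.symm z hz.1, ?_⟩)
    (hg.diff.comp (hf.diff.mono inter_subset_left) fun z hz => hz.2) (fun z hz => ?_)
    fun i hi z hz => ?_
  · rw [mem_preimage, hf.conj z hz.1]
    exact hg.symm _ hz.2
  · rw [hf.conj z hz.1, hg.conj _ hz.2]
  · rw [Function.comp_apply, hf.eq i hi z hz.1, hg.eq i hi _ hz.2]

/-! ### The slice derivative -/

theorem slicePt_apply_eq {F : ℂ → ℂ} (hc : ∀ z ∈ E, F (starRingEnd ℂ z) = starRingEnd ℂ (F z))
    {i j : ℍ[ℝ]} (hi : i ∈ unitSphere) (hj : j ∈ unitSphere) {z w : ℂ} (hz : z ∈ E)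
    (h : slicePt i z = slicePt j w) : slicePt i (F z) = slicePt j (F w) := by
  have h1 := congrArg (fun q : ℍ[ℝ] => q.re) h
  have h2 := congrArg (fun q : ℍ[ℝ] => q.im) h
  simp only [slicePt_re hi, slicePt_re hj, slicePt_im hi, slicePt_im hj] at h1 h2
  have h3 : |z.im| = |w.im| := by
    have := congrArg norm h2
    rwa [norm_smul, norm_smul, hi.2, hj.2, mul_one, mul_one] at this
  by_cases h0 : z.im = 0
  · have hw0 : w.im = 0 := by rwa [h0, abs_zero, eq_comm, abs_eq_zero] at h3
    have hzw : z = w := Complex.ext h1 (h0.trans hw0.symm)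
    have hr := hc z hz
    rw [Complex.conj_eq_iff_im.2 h0] at hr
    rw [← hzw, ← Complex.conj_eq_iff_re.1 hr.symm, slicePt_ofReal, slicePt_ofReal]
  · rcases abs_eq_abs.1 h3 with h4 | h4
    · rw [← h4] at h2
      rw [smul_right_injective _ h0 h2, Complex.ext h1 h4]
    · have hw : w = starRingEnd ℂ z := Complex.ext h1.symm (by rw [Complex.conj_im, h4, neg_neg])
      have hij : i = -j := by
        refine smul_right_injective _ h0 ?_
        simp only
        rw [h2, h4, neg_smul_neg]
      rw [hw, hc z hz, hij, slicePt_neg]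

theorem SliceHol.sliceDeriv_eq (hf : SliceHol f E) {j : ℍ[ℝ]} (hj : j ∈ unitSphere) {w : ℂ}
    (hw : w ∈ E) (hx : sliceUnit (slicePt j w) = j) :
    sliceDeriv f (slicePt j w) = slicePt j (deriv (cpl f) w) := by
  have hemb := (isometry_slicePt hj).isEmbedding
  have hfil : 𝓝[slicePlane j \ {slicePt j w}] (slicePt j w) = map (slicePt j) (𝓝[≠] w) := by
    rw [hemb.map_nhdsWithin_eq, image_compl_eq_range_sdiff_image hemb.injective, image_singleton]
    rfl
  rw [sliceDeriv, hx, hfil]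
  refine Tendsto.limUnder_eq ?_
  rw [tendsto_map'_iff]
  have hd := (hf.diff.differentiableAt (hf.isOpen.mem_nhds hw)).hasDerivAt
  have h1 := ((isometry_slicePt hj).continuous.tendsto _).comp (hasDerivAt_iff_tendsto_slope.1 hd)
  refine h1.congr' ?_
  filter_upwards [mem_nhdsWithin_of_mem_nhds (hf.isOpen.mem_nhds hw)] with y hy
  rw [Function.comp_apply, Function.comp_apply, hf.eq j hj y hy, hf.eq j hj w hw, ← slicePt_sub,
    ← slicePt_sub, ← slicePt_inv hj, ← slicePt_mul hj, slope_def_module, smul_eq_mul]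

theorem SliceHol.deriv_conj (hf : SliceHol f E) {z : ℂ} (hz : z ∈ E) :
    deriv (cpl f) (starRingEnd ℂ z) = starRingEnd ℂ (deriv (cpl f) z) := by
  have h1 : cpl f =ᶠ[𝓝 (starRingEnd ℂ z)] fun w => starRingEnd ℂ (cpl f (starRingEnd ℂ w)) := by
    filter_upwards [hf.isOpen.mem_nhds (hf.symm z hz)] with w hw
    rw [hf.conj w hw, Complex.conj_conj]
  rw [h1.deriv_eq]
  have := (hf.diff.differentiableAt (hf.isOpen.mem_nhds hz)).hasDerivAt
  rw [← Complex.conj_conj z] at this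
  have h2 := this.conj_conj
  rw [Complex.conj_conj] at h2
  rw [← Complex.conj_conj z]
  simp only [Complex.conj_conj]
  exact h2.deriv

theorem SliceHol.sliceDeriv (hf : SliceHol f E) :
    SliceHol (sliceDeriv f) E ∧ EqOn (deriv (cpl f)) (cpl (QuatS.sliceDeriv f)) E := by
  refine SliceHol.of_eq hf.isOpen hf.symm (hf.diff.deriv hf.isOpen) (fun z hz => hf.deriv_conj hz)
    fun i hi z hz => ?_
  have hw : proj (slicePt i z) ∈ E := (hf.symm.proj_mem hi).2 hz
  have h1 := slicePt_sliceUnit (slicePt i z)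
  have h2 := hf.sliceDeriv_eq (sliceUnit_mem (slicePt i z)) hw (by rw [h1])
  rw [h1] at h2
  rw [h2]
  exact (slicePt_apply_eq (fun z hz => hf.deriv_conj hz) hi (sliceUnit_mem _) hz h1.symm).symm

theorem SliceHol.iterate_sliceDeriv (hf : SliceHol f E) (n : ℕ) :
    SliceHol (QuatS.sliceDeriv^[n] f) E ∧
      EqOn (deriv^[n] (cpl f)) (cpl (QuatS.sliceDeriv^[n] f)) E := by
  induction n with
  | zero => exact ⟨hf, fun _ _ => rfl⟩
  | succ n ih =>
    rw [Function.iterate_succ_apply', Function.iterate_succ_apply']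
    refine ⟨ih.1.sliceDeriv.1, fun z hz => ?_⟩
    rw [← ih.1.sliceDeriv.2 hz]
    exact (ih.2.eventuallyEq_of_mem (hf.isOpen.mem_nhds hz)).deriv_eq

end SliceCalc

namespace SliceCalc

open RieszDunford

variable {V : Type*} [NormedAddCommGroup V] [Module HOp V] [NormSMulClass HOp V] [NormedSpace ℝ V]
  [IsScalarTower ℝ HOp V]

theorem cxOp_real_smul (a : ℝ) (A : V →L[HOp] V) : cxOp (a • A) = (a : ℂ) • cxOp A := by
  ext x
  obtain ⟨v, rfl⟩ := toCx_surj x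
  rw [cxOp_toCx, _root_.smul_apply, _root_.smul_apply, map_smul, cxOp_toCx, Complex.coe_smul]

theorem isClosed_graph_ofBdd (A : V →L[HOp] V) :
    IsClosed ((ofBdd A).graph : Set (V × V)) := by
  have : ((ofBdd A).graph : Set (V × V)) = {p | p.2 = A p.1} := by
    ext ⟨v, w⟩
    have h1 : (v, w) ∈ (ofBdd A).graph ↔ (toCx v, toCx w) ∈ cxGraph (ofBdd A) := Iff.rfl
    rw [SetLike.mem_coe, h1, cxGraph_ofBdd, mem_gr]
    exact ⟨fun h => toCx.injective h, fun h => congrArg toCx h⟩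
  rw [this]
  exact isClosed_eq continuous_snd (A.continuous.comp continuous_fst)

theorem mem_cxGraph_of_commutesWith {T : V →ₗ.[HOp] V} {A : V →L[HOp] V} (hA : CommutesWith A T)
    {p : Cx V × Cx V} (hp : p ∈ cxGraph T) : (cxOp A p.1, cxOp A p.2) ∈ cxGraph T := by
  obtain ⟨x, y⟩ := p
  obtain ⟨v, rfl⟩ := toCx_surj x
  obtain ⟨w, rfl⟩ := toCx_surj y
  obtain ⟨hv, rfl⟩ := mem_cxGraph.1 hp
  exact mem_cxGraph.2 (hA v hv)

variable [CompleteSpace V] {T : V →ₗ.[HOp] V} {f g : ℍ[ℝ] → ℍ[ℝ]}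

/-! ### The algebra homomorphism property -/

theorem sCalc_one (hT : IsClosed (T.graph : Set (V × V))) :
    MemSH (fun _ => 1) (sSpectrumX T) ∧ sCalc T (fun _ => 1) = 1 := by
  obtain ⟨h1, h2⟩ := sliceHol_real_const 1
  have h3 := isCalc_one (kind_cxGraph hT)
  rw [← cxOp_one] at h3
  simp only [Complex.ofReal_one, Quaternion.coe_one] at h1 h2
  exact memSH_and_sCalc_eq hT h1 (subset_univ _) (Or.inr univ_mem) h3 h2

theorem exists_common (hT : IsClosed (T.graph : Set (V × V))) (hf : MemSH f (sSpectrumX T))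
    (hg : MemSH g (sSpectrumX T)) : ∃ E, SliceHol f E ∧ SliceHol g E ∧ (rho (cxGraph T))ᶜ ⊆ E ∧
      (kap T = 0 ∨ E ∈ Bornology.cobounded ℂ) := by
  obtain ⟨E, hE, h1, h2⟩ := (memSH_sSpectrumX_iff hT).1 hf
  obtain ⟨E', hE', h1', h2'⟩ := (memSH_sSpectrumX_iff hT).1 hg
  have ho := hE.isOpen.inter hE'.isOpen
  have hs := hE.symm.inter hE'.symm
  exact ⟨E ∩ E', hE.mono ho hs inter_subset_left, hE'.mono ho hs inter_subset_right,
    subset_inter h1 h1', cobounded_inter h2.cobounded h2'.cobounded⟩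

theorem sCalc_smul_add (hT : IsClosed (T.graph : Set (V × V))) (hf : MemSH f (sSpectrumX T))
    (hg : MemSH g (sSpectrumX T)) (a : ℝ) :
    MemSH (a • f + g) (sSpectrumX T) ∧ sCalc T (a • f + g) = a • sCalc T f + sCalc T g := by
  obtain ⟨E, hfE, hgE, hE, hc⟩ := exists_common hT hf hg
  obtain ⟨h1, h2⟩ := hfE.smul_add hgE a
  have h3 := (isCalc_sCalc hT hf).add_smul (kind_cxGraph hT) (isCalc_sCalc hT hg) a
  rw [← cxOp_real_smul, ← cxOp_add] at h3
  exact memSH_and_sCalc_eq hT h1 hE hc h3 h2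

theorem sCalc_mul (hT : IsClosed (T.graph : Set (V × V))) (hf : MemSH f (sSpectrumX T))
    (hg : MemSH g (sSpectrumX T)) :
    MemSH (f * g) (sSpectrumX T) ∧ sCalc T (f * g) = sCalc T f * sCalc T g := by
  obtain ⟨E, hfE, hgE, hE, hc⟩ := exists_common hT hf hg
  obtain ⟨h1, h2⟩ := hfE.mul hgE
  have h3 := (isCalc_sCalc hT hf).mul (kind_cxGraph hT) (isCalc_sCalc hT hg)
  rw [← cxOp_mul] at h3
  exact memSH_and_sCalc_eq hT h1 hE hc h3 h2

/-! ### Commutation -/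

theorem commutesWith_sCalc (hT : IsClosed (T.graph : Set (V × V))) (hf : MemSH f (sSpectrumX T)) :
    CommutesWith (sCalc T f) T := by
  intro v hv
  have := (isCalc_sCalc hT hf).mem_of_mem (isClosed_cxGraph hT) (mem_cxGraph_app hv)
  exact mem_cxGraph.1 this

theorem sCalc_comm (hT : IsClosed (T.graph : Set (V × V))) (hf : MemSH f (sSpectrumX T))
    {A : V →L[HOp] V} (hA : CommutesWith A T) : A * sCalc T f = sCalc T f * A := by
  ext v
  have h := isCalc_sCalc hT hf
  exact toCx.injective (h.intertwine (L := cxOp A) (fun p hp => mem_cxGraph_of_commutesWith hA hp)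
    Subset.rfl (kind_cxGraph hT) (Or.inl rfl) h (toCx v))

/-! ### The spectral mapping theorem -/

theorem mem_sSpectrum_ofBdd_iff {A : V →L[HOp] V} {i : ℍ[ℝ]} (hi : i ∈ unitSphere) {z : ℂ} :
    slicePt i z ∈ sSpectrum (ofBdd A) ↔ z ∉ rho (gr (cxOp A)) := by
  rw [mem_sSpectrum_iff (isClosed_graph_ofBdd A) hi, cxGraph_ofBdd]

theorem sSpectrumX_ofBdd (A : V →L[HOp] V) :
    (fun x : ℍ[ℝ] => (x : OnePoint ℍ[ℝ])) '' sSpectrum (ofBdd A) = sSpectrumX (ofBdd A) := by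
  have : (ofBdd A).domain = ⊤ := rfl
  simp [sSpectrumX, this]

theorem spectral_mapping (hT : IsClosed (T.graph : Set (V × V))) (hf : MemSH f (sSpectrumX T)) :
    extendInfty f '' sSpectrumX T = sSpectrum (ofBdd (sCalc T f)) := by
  have hA := isCalc_sCalc hT hf
  have hk := kind_cxGraph hT
  obtain ⟨E, hE, hσ, hH⟩ := (memSH_sSpectrumX_iff hT).1 hf
  have hinf : T.domain ≠ ⊤ → valInfty f = slicePt unitI ((valInfty f).re : ℂ) := by
    intro hd
    have h1 := hH.2.2.resolve_left (by rwa [kap_eq_zero_iff])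
    rw [slicePt_ofReal, hE.valInfty_eq h1.1 h1.2, Quaternion.re_coe]
  apply Subset.antisymm
  · rintro _ ⟨p, hp, rfl⟩
    induction p using OnePoint.rec with
    | infty =>
      have hd := infty_mem_sSpectrumX.1 hp
      change valInfty f ∈ _
      rw [hinf hd, mem_sSpectrum_ofBdd_iff unitI_mem]
      obtain ⟨v, hv⟩ : ∃ v, v ∉ T.domain := by
        by_contra! h
        exact hd (eq_top_iff.2 fun v _ => h v)
      rw [kap_of_ne hd] at hA
      refine hA.infty_notMem_rho_gr (isClosed_cxGraph hT) (x := toCx v) fun y hy => hv ?_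
      obtain ⟨w, rfl⟩ := toCx_surj y
      exact (mem_cxGraph.1 hy).1
    | coe x =>
      have hx := (mem_sSpectrum_iff_proj hT).1 (coe_mem_sSpectrumX.1 hp)
      change f x ∈ _
      rw [hE.apply (hσ hx), mem_sSpectrum_ofBdd_iff (sliceUnit_mem x)]
      exact hA.apply_notMem_rho_gr hk (isClosed_cxGraph hT) hx
  · intro y hy
    obtain ⟨j, hj, hjy⟩ := exists_slicePt y
    rw [← hjy, mem_sSpectrum_ofBdd_iff hj] at hy
    by_cases h0 : ∃ z ∉ rho (cxGraph T), cpl f z = proj y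
    · obtain ⟨z, hz, hzy⟩ := h0
      refine ⟨(slicePt j z : ℍ[ℝ]), coe_mem_sSpectrumX.2 ((mem_sSpectrum_iff hT hj).2 hz), ?_⟩
      change f (slicePt j z) = y
      rw [hE.eq j hj z (hσ hz), hzy, hjy]
    · push Not at h0
      by_cases hd : T.domain = ⊤
      · exact absurd (hA.mem_rho_gr hk h0 (Or.inl (kap_of_eq hd))) hy
      · refine ⟨OnePoint.infty, infty_mem_sSpectrumX.2 hd, ?_⟩
        by_contra hne
        refine hy (hA.mem_rho_gr hk h0 (Or.inr fun h => hne ?_))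
        change valInfty f = y
        rw [hinf hd, ← hjy, ← h, slicePt_ofReal, slicePt_ofReal]

theorem sCalc_comp (hT : IsClosed (T.graph : Set (V × V))) (hf : MemSH f (sSpectrumX T))
    (hg : MemSH g (sSpectrumX (ofBdd (sCalc T f)))) :
    MemSH (g ∘ f) (sSpectrumX T) ∧ sCalc T (g ∘ f) = sCalc (ofBdd (sCalc T f)) g := by
  have hA := isCalc_sCalc hT hf
  have hk := kind_cxGraph hT
  have hT' := isClosed_graph_ofBdd (sCalc T f)
  have hB := isCalc_sCalc hT' hg
  obtain ⟨E, hE, hσ, hH⟩ := (memSH_sSpectrumX_iff hT).1 hf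
  obtain ⟨E', hE', hσ', hH'⟩ := (memSH_sSpectrumX_iff hT').1 hg
  rw [cxGraph_ofBdd] at hσ' hB
  rw [kap_of_eq (T := ofBdd (sCalc T f)) rfl] at hB
  have h1 : ∀ a ∉ rho (cxGraph T), cpl f a ∉ rho (gr (cxOp (sCalc T f))) := fun a ha =>
    hA.apply_notMem_rho_gr hk (isClosed_cxGraph hT) ha
  have h2 : kap T = 0 ∨ ((valInfty f).re : ℂ) ∉ rho (gr (cxOp (sCalc T f))) := by
    by_cases hd : T.domain = ⊤
    · exact Or.inl (kap_of_eq hd)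
    · right
      have h3 := hH.2.2.resolve_left (by rwa [kap_eq_zero_iff])
      rw [← mem_sSpectrum_ofBdd_iff unitI_mem, slicePt_ofReal, ← spectral_mapping hT hf]
      refine ⟨OnePoint.infty, infty_mem_sSpectrumX.2 hd, ?_⟩
      change valInfty f = _
      rw [hE.valInfty_eq h3.1 h3.2, Quaternion.re_coe]
  obtain ⟨h3, h4⟩ := hE'.comp hE
  refine memSH_and_sCalc_eq hT h3 (fun z hz => ⟨hσ hz, hσ' (h1 z hz)⟩) ?_ (hA.comp hk hB h1 h2) h4
  rcases hH.2.2 with h5 | ⟨h5, h6⟩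
  · exact Or.inl h5
  · exact h2.imp_right fun h7 => inter_mem h5 (h6 (hE'.isOpen.mem_nhds (hσ' h7)))

end SliceCalc

namespace SliceCalc

open RieszDunford

variable {V : Type*} [NormedAddCommGroup V] [Module HOp V] [NormSMulClass HOp V] [NormedSpace ℝ V]
  [IsScalarTower ℝ HOp V]

/-! ### Perturbation by a commuting operator -/

theorem cxOp_pow (A : V →L[HOp] V) (n : ℕ) : cxOp (A ^ n) = cxOp A ^ n := by
  induction n with
  | zero => rfl
  | succ n ih => rw [pow_succ, pow_succ, cxOp_mul, ih]

/-- Complex linear operators as real linear operators on the original space. -/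
noncomputable def toReal : (Cx V →L[ℂ] Cx V) →+ (V →L[ℝ] V) where
  toFun L := (toCx (V := V)).symm.toContinuousLinearMap.comp
    ((L.restrictScalars ℝ).comp (toCx (V := V)).toContinuousLinearMap)
  map_zero' := by ext; rfl
  map_add' _ _ := by ext; rfl

theorem continuous_toReal : Continuous (toReal : (Cx V →L[ℂ] Cx V) →+ (V →L[ℝ] V)) := by
  refine AddMonoidHomClass.continuous_of_bound _ 1 fun L => ?_
  rw [one_mul]
  exact ContinuousLinearMap.opNorm_le_bound _ (norm_nonneg _) fun v => L.le_opNorm (toCx v)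

theorem toReal_cxOp (A : V →L[HOp] V) : toReal (cxOp A) = A.restrictScalars ℝ := by
  ext; rfl

theorem commutesWith_ofBdd {A B : V →L[HOp] V} (h : B * A = A * B) : CommutesWith A (ofBdd B) := by
  have h0 : ∀ v, app (ofBdd B) v = B v := fun v => by
    rw [app_of_mem _ (show v ∈ (ofBdd B).domain from Submodule.mem_top)]; rfl
  intro v _
  refine ⟨Submodule.mem_top, ?_⟩
  rw [h0, h0]
  exact congrArg (fun L : V →L[HOp] V => L v) h

variable [CompleteSpace V]

theorem slicePt_mem_closure_thickening {B : V →L[HOp] V} {ε : ℝ} (hε : 0 < ε) {i : ℍ[ℝ]}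
    (hi : i ∈ unitSphere) {z : ℂ} (hz : z ∈ Metric.cthickening ε (rho (gr (cxOp B)))ᶜ) :
    slicePt i z ∈ closure (Metric.thickening ε (sSpectrum (ofBdd B))) := by
  have hiso := isometry_slicePt hi
  rw [← closure_thickening hε] at hz
  refine closure_mono ?_ (image_closure_subset_closure_image hiso.continuous
    (mem_image_of_mem (slicePt i) hz))
  rintro _ ⟨w, hw, rfl⟩
  obtain ⟨a, ha, hwa⟩ := Metric.mem_thickening_iff.1 hw
  refine Metric.mem_thickening_iff.2 ⟨slicePt i a, (mem_sSpectrum_ofBdd_iff hi).2 ha, ?_⟩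
  rwa [hiso.dist_eq]

theorem norm_le_of_sSpectrum_subset {N : V →L[HOp] V} {ε : ℝ}
    (hN : sSpectrum (ofBdd N) ⊆ Metric.closedBall 0 ε) : ∀ z ∉ rho (gr (cxOp N)), ‖z‖ ≤ ε := by
  intro z hz
  have := hN ((mem_sSpectrum_ofBdd_iff unitI_mem).2 hz)
  rwa [mem_closedBall_zero_iff, norm_slicePt unitI_mem] at this

theorem rho_add_compl_subset {B N : V →L[HOp] V} (hc : B * N = N * B) {ε : ℝ} (hε : 0 < ε)
    (hN : sSpectrum (ofBdd N) ⊆ Metric.closedBall 0 ε) :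
    (rho (gr (cxOp (B + N))))ᶜ ⊆ Metric.cthickening ε (rho (gr (cxOp B)))ᶜ := by
  intro z hz
  by_contra hz'
  have hc' : cxOp B * cxOp N = cxOp N * cxOp B := by rw [← cxOp_mul, hc, cxOp_mul]
  obtain ⟨b, -, h⟩ := hasSum_perturbation hc' hε (norm_le_of_sSpectrum_subset hN)
    (isCompact_singleton (x := z)) fun w hw => by rwa [mem_singleton_iff.1 hw]
  exact hz (h z rfl).2.1

theorem sSpectrum_add_subset {B N : V →L[HOp] V} (hc : B * N = N * B) {ε : ℝ} (hε : 0 < ε)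
    (hN : sSpectrum (ofBdd N) ⊆ Metric.closedBall 0 ε) :
    sSpectrum (ofBdd (B + N)) ⊆ closure (Metric.thickening ε (sSpectrum (ofBdd B))) := by
  intro x hx
  obtain ⟨j, hj, hjx⟩ := exists_slicePt x
  rw [← hjx] at hx ⊢
  exact slicePt_mem_closure_thickening hε hj
    (rho_add_compl_subset hc hε hN ((mem_sSpectrum_ofBdd_iff hj).1 hx))

theorem hasSum_taylor {B N : V →L[HOp] V} (hc : B * N = N * B) {ε : ℝ} (hε : 0 < ε)
    (hN : sSpectrum (ofBdd N) ⊆ Metric.closedBall 0 ε) {f : ℍ[ℝ] → ℍ[ℝ]}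
    (hf : MemSH f ((fun x : ℍ[ℝ] => (x : OnePoint ℍ[ℝ])) ''
      closure (Metric.thickening ε (sSpectrum (ofBdd B))))) :
    HasSum (fun n : ℕ => (N ^ n * ((n.factorial : ℝ)⁻¹ • sCalc (ofBdd B) (sliceDeriv^[n] f))
        ).restrictScalars ℝ) ((sCalc (ofBdd (B + N)) f).restrictScalars ℝ) ∧
      HasSum (fun n : ℕ => (((n.factorial : ℝ)⁻¹ • sCalc (ofBdd B) (sliceDeriv^[n] f)) * N ^ n
        ).restrictScalars ℝ) ((sCalc (ofBdd (B + N)) f).restrictScalars ℝ) := by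
  obtain ⟨E, hE, h1, -⟩ := memSH_iff.1 hf
  have hCE : Metric.cthickening ε (rho (gr (cxOp B)))ᶜ ⊆ E := fun z hz =>
    (hE.symm.proj_mem unitI_mem).1
      (h1 _ (mem_image_of_mem _ (slicePt_mem_closure_thickening hε unitI_mem hz)))
  have hmem : ∀ (A : V →L[HOp] V) (g : ℍ[ℝ] → ℍ[ℝ]), SliceHol g E → (rho (gr (cxOp A)))ᶜ ⊆ E →
      MemSH g (sSpectrumX (ofBdd A)) ∧
      IsCalc (gr (cxOp A)) 0 (cpl g) ((valInfty g).re : ℂ) (cxOp (sCalc (ofBdd A) g)) := by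
    intro A g hg hA
    have h2 : MemSH g (sSpectrumX (ofBdd A)) := by
      refine (memSH_sSpectrumX_iff (isClosed_graph_ofBdd A)).2 ⟨E, hg, ?_, hg.isOpen, hg.diff,
        Or.inl (kap_of_eq rfl)⟩
      rwa [cxGraph_ofBdd]
    have h3 := isCalc_sCalc (isClosed_graph_ofBdd A) h2
    rw [cxGraph_ofBdd, kap_of_eq (T := ofBdd A) rfl] at h3
    exact ⟨h2, h3⟩
  have hσ : (rho (gr (cxOp B)))ᶜ ⊆ E := (Metric.self_subset_cthickening _).trans hCE
  have hc' : cxOp B * cxOp N = cxOp N * cxOp B := by rw [← cxOp_mul, hc, cxOp_mul]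
  have hd := fun n => (hmem B _ (hE.iterate_sliceDeriv n).1 hσ)
  have key := IsCalc.hasSum_taylor hc' hε (norm_le_of_sSpectrum_subset hN) hE.isOpen hCE hE.diff
    (hmem (B + N) f hE ((rho_add_compl_subset hc hε hN).trans hCE)).2
    (A' := fun n => cxOp ((n.factorial : ℝ)⁻¹ • sCalc (ofBdd B) (sliceDeriv^[n] f))) fun n => by
      have h4 := ((hd n).2.add_smul (kind_gr _) (hd n).2 ((n.factorial : ℂ)⁻¹ - 1)).congr
        (kind_gr _) hE.isOpen hσ (Or.inl rfl)
        (g := fun z => (n.factorial : ℂ)⁻¹ * deriv^[n] (cpl f) z) fun z hz => by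
          simp only
          rw [(hE.iterate_sliceDeriv n).2 hz]
          ring
      convert h4.zero_kind using 1
      rw [cxOp_real_smul]
      push_cast
      module
  have h5 := key.map toReal continuous_toReal
  have h6 : HasSum (fun n : ℕ => (N ^ n * ((n.factorial : ℝ)⁻¹ • sCalc (ofBdd B) (sliceDeriv^[n] f))
        ).restrictScalars ℝ) ((sCalc (ofBdd (B + N)) f).restrictScalars ℝ) := by
    rw [← toReal_cxOp]
    convert h5 using 1
    funext n
    rw [Function.comp_apply, ← cxOp_pow, ← cxOp_mul, toReal_cxOp]
  refine ⟨h6, ?_⟩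
  convert h6 using 2 with n
  have h7 := sCalc_comm (isClosed_graph_ofBdd B) (hd n).1
    (commutesWith_ofBdd ((show Commute B N from hc).pow_right n).eq)
  ext v
  have h8 := congrArg (fun L : V →L[HOp] V => L v) h7
  change (n.factorial : ℝ)⁻¹ • _ = (N ^ n) ((n.factorial : ℝ)⁻¹ • _)
  rw [← op_coe_smul, ← op_coe_smul, map_smul]
  exact congrArg (fun w => MulOpposite.op (((n.factorial : ℝ)⁻¹ : ℝ) : ℍ[ℝ]) • w) h8.symm

end SliceCalc

namespace SliceCalc

open RieszDunford

/-! ### Characteristic functions of spectral sets -/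

theorem isPreconnected_unitSphere : IsPreconnected unitSphere := by
  have hS : IsPreconnected (Metric.sphere (0 : EuclideanSpace ℝ (Fin 3)) 1) := by
    refine isPreconnected_sphere ?_ 0 1
    rw [← Module.finrank_eq_rank, finrank_euclideanSpace_fin]
    norm_num
  let φ : EuclideanSpace ℝ (Fin 3) → ℍ[ℝ] := fun v =>
    v 0 • unitI + v 1 • unitJ + v 2 • (unitI * unitJ)
  have hφ : Continuous φ := by fun_prop
  have hn : ∀ v, ‖φ v‖ ^ 2 = ‖v‖ ^ 2 := by
    intro v
    rw [sq, ← Quaternion.normSq_eq_norm_mul_self, Quaternion.normSq_def', EuclideanSpace.norm_sq_eq,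
      Fin.sum_univ_three]
    simp [φ]
  have himg : unitSphere = φ '' Metric.sphere 0 1 := by
    ext q
    constructor
    · rintro ⟨h1, h2⟩
      have hq : φ !₂[q.imI, q.imJ, q.imK] = q := by
        ext <;> simp [φ, h1]
      refine ⟨_, ?_, hq⟩
      rw [mem_sphere_zero_iff_norm, ← sq_eq_sq₀ (norm_nonneg _) zero_le_one, ← hn, hq, h2]
    · rintro ⟨v, hv, rfl⟩
      rw [mem_sphere_zero_iff_norm] at hv
      refine ⟨by simp [φ], ?_⟩
      rw [← sq_eq_sq₀ (norm_nonneg _) zero_le_one, hn, hv]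
  rw [himg]
  exact hS.image _ hφ.continuousOn

theorem ConjSymm.thickening {K : Set ℂ} (hK : ConjSymm K) (δ : ℝ) :
    ConjSymm (Metric.thickening δ K) := by
  intro z hz
  obtain ⟨a, ha, h⟩ := Metric.mem_thickening_iff.1 hz
  exact Metric.mem_thickening_iff.2 ⟨_, hK a ha, by rwa [Complex.isometry_conj.dist_eq]⟩

theorem exists_separation {K K' : Set ℂ} (hK : IsClosed K) (hK' : IsCompact K')
    (hd : Disjoint K K') (hs : ConjSymm K) (hs' : ConjSymm K') :
    ∃ E E' : Set ℂ, IsOpen E ∧ IsOpen E' ∧ ConjSymm E ∧ ConjSymm E' ∧ Disjoint E E' ∧ K ⊆ E ∧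
      K' ⊆ E' ∧ E ∈ Bornology.cobounded ℂ := by
  obtain ⟨δ, hδ, h⟩ := hd.symm.exists_thickenings hK' hK
  obtain ⟨R, hR⟩ := hK'.isBounded.thickening (δ := δ) |>.exists_norm_le
  refine ⟨Metric.thickening δ K ∪ (Metric.closedBall 0 R)ᶜ, Metric.thickening δ K',
    Metric.isOpen_thickening.union Metric.isClosed_closedBall.isOpen_compl,
    Metric.isOpen_thickening, ?_, hs'.thickening δ, ?_,
    (Metric.self_subset_thickening hδ K).trans subset_union_left,
    Metric.self_subset_thickening hδ K', ?_⟩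
  · rintro z (hz | hz)
    · exact Or.inl (hs.thickening δ z hz)
    · right
      simpa using hz
  · rw [disjoint_union_left]
    refine ⟨h.symm, ?_⟩
    rw [disjoint_compl_left_iff_subset]
    exact fun z hz => mem_closedBall_zero_iff.2 (hR z hz)
  · exact mem_of_superset (Bornology.isBounded_def.1 Metric.isBounded_closedBall) subset_union_right

/-- The characteristic function of an axially symmetric set. -/
noncomputable def charFun (E : Set ℂ) (x : ℍ[ℝ]) : ℍ[ℝ] :=
  open Classical in if proj x ∈ E then 1 else 0

theorem charFun_of_mem {E : Set ℂ} {x : ℍ[ℝ]} (h : proj x ∈ E) : charFun E x = 1 := if_pos h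

theorem charFun_of_notMem {E : Set ℂ} {x : ℍ[ℝ]} (h : proj x ∉ E) : charFun E x = 0 := if_neg h

open Classical in
theorem sliceHol_charFun {E E' : Set ℂ} (hE : IsOpen E) (hE' : IsOpen E') (hs : ConjSymm E)
    (hs' : ConjSymm E') (hd : Disjoint E E') :
    SliceHol (charFun E) (E ∪ E') ∧
      EqOn (fun z => if z ∈ E then 1 else 0) (cpl (charFun E)) (E ∪ E') := by
  refine SliceHol.of_eq (hE.union hE') ?_ ?_ (fun z _ => ?_) fun i hi z _ => ?_
  · rintro z (hz | hz)
    · exact Or.inl (hs z hz)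
    · exact Or.inr (hs' z hz)
  · rintro z (hz | hz)
    · refine DifferentiableAt.differentiableWithinAt ?_
      refine (differentiableAt_const (1 : ℂ)).congr_of_eventuallyEq ?_
      filter_upwards [hE.mem_nhds hz] with w hw using if_pos hw
    · refine DifferentiableAt.differentiableWithinAt ?_
      refine (differentiableAt_const (0 : ℂ)).congr_of_eventuallyEq ?_
      filter_upwards [hE'.mem_nhds hz] with w hw using if_neg fun h => hd.le_bot ⟨h, hw⟩
  · by_cases h : z ∈ E
    · simp [h, hs.mem_iff]
    · simp [h, hs.mem_iff]
  · by_cases h : z ∈ E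
    · rw [charFun_of_mem ((hs.proj_mem hi).2 h), if_pos h, ← Complex.ofReal_one, slicePt_ofReal]
      rfl
    · rw [charFun_of_notMem fun h' => h ((hs.proj_mem hi).1 h'), if_neg h, ← Complex.ofReal_zero,
        slicePt_ofReal]
      rfl

theorem eventually_nhds_infty {p : OnePoint ℍ[ℝ] → Prop} :
    (∀ᶠ q in 𝓝 OnePoint.infty, p q) ↔
      (∀ᶠ x : ℍ[ℝ] in Bornology.cobounded ℍ[ℝ], p x) ∧ p OnePoint.infty := by
  rw [OnePoint.nhds_infty_eq, eventually_sup, eventually_map, eventually_pure,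
    coclosedCompact_eq_cocompact, Metric.cobounded_eq_cocompact]

theorem eventually_nhds_coe {p : OnePoint ℍ[ℝ] → Prop} {x : ℍ[ℝ]} :
    (∀ᶠ q in 𝓝 (x : OnePoint ℍ[ℝ]), p q) ↔ ∀ᶠ y : ℍ[ℝ] in 𝓝 x, p (y : OnePoint ℍ[ℝ]) := by
  rw [OnePoint.nhds_coe_eq, eventually_map]

variable {V : Type*} [NormedAddCommGroup V] [Module HOp V] [NormSMulClass HOp V] [NormedSpace ℝ V]
  [IsScalarTower ℝ HOp V] [CompleteSpace V] {T : V →ₗ.[HOp] V}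

/-- Clopen parts of the spectrum are axially symmetric. -/
theorem mem_iff_of_isClopen (hT : IsClosed (T.graph : Set (V × V))) {Δ : Set (OnePoint ℍ[ℝ])}
    (hc : IsClopen ((↑) ⁻¹' Δ : Set (sSpectrumX T))) {z : ℂ} (hz : z ∉ rho (cxGraph T))
    {i j : ℍ[ℝ]} (hi : i ∈ unitSphere) (hj : j ∈ unitSphere) :
    (slicePt i z : OnePoint ℍ[ℝ]) ∈ Δ ↔ (slicePt j z : OnePoint ℍ[ℝ]) ∈ Δ := by
  have key : ∀ {i j : ℍ[ℝ]}, i ∈ unitSphere → j ∈ unitSphere → (slicePt i z : OnePoint ℍ[ℝ]) ∈ Δ →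
      (slicePt j z : OnePoint ℍ[ℝ]) ∈ Δ := by
    intro i j hi hj h
    let φ : unitSphere → sSpectrumX T := fun i =>
      ⟨slicePt i z, coe_mem_sSpectrumX.2 ((mem_sSpectrum_iff hT i.2).2 hz)⟩
    have hφ : Continuous φ := by
      refine Continuous.subtype_mk (OnePoint.continuous_coe.comp ?_) _
      unfold slicePt
      fun_prop
    have hpre : PreconnectedSpace unitSphere :=
      isPreconnected_iff_preconnectedSpace.1 isPreconnected_unitSphere
    have h1 := isPreconnected_univ.subset_isClopen (hc.preimage hφ) ⟨⟨i, hi⟩, mem_univ _, h⟩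
    exact h1 (mem_univ (⟨j, hj⟩ : unitSphere))
  exact ⟨key hi hj, key hj hi⟩

/-- The complex representatives of the finite points of a part of the spectrum. -/
def specPart (T : V →ₗ.[HOp] V) (Δ : Set (OnePoint ℍ[ℝ])) : Set ℂ :=
  {z | z ∉ rho (cxGraph T) ∧ (slicePt unitI z : OnePoint ℍ[ℝ]) ∈ Δ}

theorem isClosed_specPart (hT : IsClosed (T.graph : Set (V × V))) {Δ : Set (OnePoint ℍ[ℝ])}
    (hc : IsClosed ((↑) ⁻¹' Δ : Set (sSpectrumX T))) : IsClosed (specPart T Δ) := by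
  let φ : ↥(rho (cxGraph T))ᶜ → sSpectrumX T := fun z =>
    ⟨slicePt unitI z, coe_mem_sSpectrumX.2 ((mem_sSpectrum_iff hT unitI_mem).2 z.2)⟩
  have hφ : Continuous φ := by
    refine Continuous.subtype_mk (OnePoint.continuous_coe.comp ?_) _
    exact (isometry_slicePt unitI_mem).continuous.comp continuous_subtype_val
  have h1 := (hc.preimage hφ).trans (isOpen_rho (cxGraph T)).isClosed_compl
  convert h1 using 1
  ext z
  simp [specPart, φ, and_comm]

theorem conjSymm_specPart (hT : IsClosed (T.graph : Set (V × V))) {Δ : Set (OnePoint ℍ[ℝ])}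
    (hc : IsClopen ((↑) ⁻¹' Δ : Set (sSpectrumX T))) : ConjSymm (specPart T Δ) := by
  rintro z ⟨h1, h2⟩
  refine ⟨conjSymm_compl_rho z h1, ?_⟩
  rw [← slicePt_neg]
  exact (mem_iff_of_isClopen hT hc h1 unitI_mem (neg_mem_unitSphere unitI_mem)).1 h2

theorem isBounded_specPart (hT : IsClosed (T.graph : Set (V × V))) {Δ : Set (OnePoint ℍ[ℝ])}
    (hc : IsClosed ((↑) ⁻¹' Δ : Set (sSpectrumX T)))
    (hi : OnePoint.infty ∉ Δ) : Bornology.IsBounded (specPart T Δ) := by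
  by_cases hd : T.domain = ⊤
  · rcases kind_cxGraph hT with ⟨-, h, -⟩ | h
    · refine Bornology.IsBounded.subset (t := (rho (cxGraph T))ᶜ) ?_ fun z hz => hz.1
      rwa [Bornology.isBounded_def, compl_compl]
    · rw [kap_of_eq hd] at h
      exact absurd h zero_ne_one
  · obtain ⟨O, hO, hO'⟩ := isOpen_induced_iff.1 hc.isOpen_compl
    have hiO : OnePoint.infty ∈ O := by
      have : (⟨OnePoint.infty, infty_mem_sSpectrumX.2 hd⟩ : sSpectrumX T) ∈
        ((↑) ⁻¹' Δ : Set (sSpectrumX T))ᶜ := hi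
      rwa [← hO'] at this
    have h1 := (eventually_nhds_infty.1 (hO.mem_nhds hiO)).1
    rw [Bornology.isBounded_def]
    filter_upwards [(tendsto_slicePt unitI_mem).eventually h1] with z hz hz'
    have : (⟨slicePt unitI z, coe_mem_sSpectrumX.2 ((mem_sSpectrum_iff hT unitI_mem).2 hz'.1)⟩ :
        sSpectrumX T) ∈ ((↑) ⁻¹' O : Set (sSpectrumX T)) := hz
    rw [hO'] at this
    exact this hz'.2

theorem exists_charFun (hT : IsClosed (T.graph : Set (V × V))) {Δ : Set (OnePoint ℍ[ℝ])}
    (hΔ : Δ ⊆ sSpectrumX T) (hc : IsClopen ((↑) ⁻¹' Δ : Set (sSpectrumX T))) :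
    ∃ χ, MemSH χ (sSpectrumX T) ∧ (∀ᶠ p in 𝓝ˢ Δ, extendInfty χ p = 1) ∧
      ∀ᶠ p in 𝓝ˢ (sSpectrumX T \ Δ), extendInfty χ p = 0 := by
  have hc' : IsClopen ((↑) ⁻¹' (sSpectrumX T \ Δ) : Set (sSpectrumX T)) := by
    convert hc.compl using 1
    ext p
    simp
  set K := specPart T Δ with hK
  set K' := specPart T (sSpectrumX T \ Δ) with hK'
  have hcl := isClosed_specPart hT hc.1
  have hcl' := isClosed_specPart hT hc'.1
  have hs := conjSymm_specPart hT hc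
  have hs' := conjSymm_specPart hT hc'
  have hd : Disjoint K K' := Set.disjoint_left.2 fun z hz hz' => hz'.2.2 hz.2
  obtain ⟨E, E', hE, hE', hsE, hsE', hdE, hKE, hKE', hi, hi'⟩ : ∃ E E' : Set ℂ, IsOpen E ∧
      IsOpen E' ∧ ConjSymm E ∧ ConjSymm E' ∧ Disjoint E E' ∧ K ⊆ E ∧ K' ⊆ E' ∧
      (OnePoint.infty ∈ Δ → E ∈ Bornology.cobounded ℂ) ∧
      (OnePoint.infty ∈ sSpectrumX T \ Δ → E' ∈ Bornology.cobounded ℂ) := by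
    by_cases h : OnePoint.infty ∈ Δ
    · obtain ⟨E, E', h1, h2, h3, h4, h5, h6, h7, h8⟩ := exists_separation hcl
        (Metric.isCompact_of_isClosed_isBounded hcl' (isBounded_specPart hT hc'.1 fun h' => h'.2 h))
        hd hs hs'
      exact ⟨E, E', h1, h2, h3, h4, h5, h6, h7, fun _ => h8, fun h' => absurd h h'.2⟩
    · obtain ⟨E, E', h1, h2, h3, h4, h5, h6, h7, h8⟩ := exists_separation hcl'
        (Metric.isCompact_of_isClosed_isBounded hcl (isBounded_specPart hT hc.1 h))
        hd.symm hs' hs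
      exact ⟨E', E, h2, h1, h4, h3, h5.symm, h7, h6, fun h' => absurd h' h, fun _ => h8⟩
  obtain ⟨hχ, hcpl⟩ := sliceHol_charFun hE hE' hsE hsE' hdE
  have hpart : ∀ {Δ' : Set (OnePoint ℍ[ℝ])},
      IsClopen ((↑) ⁻¹' Δ' : Set (sSpectrumX T)) → ∀ x : ℍ[ℝ], (x : OnePoint ℍ[ℝ]) ∈ sSpectrumX T →
      (x : OnePoint ℍ[ℝ]) ∈ Δ' → proj x ∈ specPart T Δ' := by
    intro Δ' hc' x hx hx'
    obtain ⟨j, hj, hjx⟩ := exists_slicePt x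
    have h1 := (mem_sSpectrum_iff_proj hT).1 (coe_mem_sSpectrumX.1 hx)
    refine ⟨h1, ?_⟩
    rwa [mem_iff_of_isClopen hT hc' h1 unitI_mem hj, hjx]
  have hone : E ∈ Bornology.cobounded ℂ →
      Tendsto (cpl (charFun E)) (Bornology.cobounded ℂ) (𝓝 ((1 : ℝ) : ℂ)) := by
    intro h
    refine tendsto_const_nhds.congr' ?_
    filter_upwards [h] with z hz
    rw [← hcpl (Or.inl hz), Complex.ofReal_one]
    exact (if_pos hz).symm
  have hzero : E' ∈ Bornology.cobounded ℂ →
      Tendsto (cpl (charFun E)) (Bornology.cobounded ℂ) (𝓝 ((0 : ℝ) : ℂ)) := by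
    intro h
    refine tendsto_const_nhds.congr' ?_
    filter_upwards [h] with z hz
    rw [← hcpl (Or.inr hz), Complex.ofReal_zero]
    exact (if_neg fun h' => hdE.le_bot ⟨h', hz⟩).symm
  have hv1 : OnePoint.infty ∈ Δ → valInfty (charFun E) = ((1 : ℝ) : ℍ[ℝ]) := fun h =>
    hχ.valInfty_eq (mem_of_superset (hi h) subset_union_left) (hone (hi h))
  have hv0 : OnePoint.infty ∈ sSpectrumX T \ Δ → valInfty (charFun E) = ((0 : ℝ) : ℍ[ℝ]) := fun h =>
    hχ.valInfty_eq (mem_of_superset (hi' h) subset_union_right) (hzero (hi' h))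
  refine ⟨charFun E, memSH_iff.2 ⟨_, hχ, fun x hx => ?_, fun hx => ?_⟩, ?_, ?_⟩
  · by_cases h : (x : OnePoint ℍ[ℝ]) ∈ Δ
    · exact Or.inl (hKE (hpart hc x hx h))
    · exact Or.inr (hKE' (hpart hc' x hx ⟨hx, h⟩))
  · by_cases h : OnePoint.infty ∈ Δ
    · rw [hv1 h, Quaternion.re_coe]
      exact ⟨mem_of_superset (hi h) subset_union_left, hone (hi h)⟩
    · rw [hv0 ⟨hx, h⟩, Quaternion.re_coe]
      exact ⟨mem_of_superset (hi' ⟨hx, h⟩) subset_union_right, hzero (hi' ⟨hx, h⟩)⟩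
  · rw [eventually_nhdsSet_iff_forall]
    intro p hp
    induction p using OnePoint.rec with
    | infty =>
      refine eventually_nhds_infty.2 ⟨?_, hv1 hp⟩
      filter_upwards [tendsto_proj.eventually (hi hp)] with x hx using charFun_of_mem hx
    | coe x =>
      rw [eventually_nhds_coe]
      filter_upwards [(hE.preimage continuous_proj).mem_nhds (hKE (hpart hc x (hΔ hp) hp))]
        with y hy using charFun_of_mem hy
  · rw [eventually_nhdsSet_iff_forall]
    intro p hp
    induction p using OnePoint.rec with
    | infty =>
      refine eventually_nhds_infty.2 ⟨?_, hv0 hp⟩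
      filter_upwards [tendsto_proj.eventually (hi' hp)] with x hx
        using charFun_of_notMem fun h => hdE.le_bot ⟨h, hx⟩
    | coe x =>
      rw [eventually_nhds_coe]
      filter_upwards [(hE'.preimage continuous_proj).mem_nhds (hKE' (hpart hc' x hp.1 hp))]
        with y hy using charFun_of_notMem fun h => hdE.le_bot ⟨h, hy⟩

end SliceCalc

namespace SliceCalc

open RieszDunford

variable {V : Type*} [NormedAddCommGroup V] [Module HOp V] [NormSMulClass HOp V] [NormedSpace ℝ V]
  [IsScalarTower ℝ HOp V]

/-! ### Riesz projections -/

instance (W : Submodule HOp V) : NormSMulClass HOp W :=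
  ⟨fun q w => norm_smul q (w : V)⟩

/-- The inclusion of a right linear subspace. -/
noncomputable def cxIncl (W : Submodule HOp V) : Cx W →L[ℂ] Cx V where
  toFun x := toCx ((toCx.symm x : W) : V)
  map_add' _ _ := rfl
  map_smul' _ _ := rfl
  cont := toCx.continuous.comp (continuous_subtype_val.comp toCx.symm.continuous)

@[simp] theorem cxIncl_toCx (W : Submodule HOp V) (w : W) : cxIncl W (toCx w) = toCx (w : V) := rfl

/-- A bounded operator as a map onto its range. -/
noncomputable def cxRestr (P : V →L[HOp] V) : Cx V →L[ℂ] Cx P.range where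
  toFun x := toCx (⟨P (toCx.symm x), LinearMap.mem_range_self _ _⟩ : P.range)
  map_add' x y := by
    rw [← map_add]
    congr 1
    refine Subtype.ext ((congrArg P (map_add _ x y)).trans (map_add P _ _))
  map_smul' z x := by
    obtain ⟨v, rfl⟩ := toCx_surj x
    rw [smul_toCx, RingHom.id_apply, smul_toCx]
    congr 1
    exact Subtype.ext (map_smul P _ v)
  cont := toCx.continuous.comp
    ((P.continuous.comp toCx.symm.continuous).subtype_mk fun _ => LinearMap.mem_range_self _ _)

@[simp] theorem cxIncl_cxRestr (P : V →L[HOp] V) (x : Cx V) : cxIncl P.range (cxRestr P x) = cxOp P x := rfl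

theorem app_restrictTo {T : V →ₗ.[HOp] V} {W : Submodule HOp V} {w : W}
    (hw : w ∈ (restrictTo T W).domain) : ((app (restrictTo T W) w : W) : V) = app T w := by
  rw [app_of_mem _ hw]; rfl

theorem mem_cxGraph_restrictTo {T : V →ₗ.[HOp] V} {W : Submodule HOp V} (q : Cx W × Cx W) :
    q ∈ cxGraph (restrictTo T W) ↔ (cxIncl W q.1, cxIncl W q.2) ∈ cxGraph T := by
  obtain ⟨x, y⟩ := q
  obtain ⟨v, rfl⟩ := toCx_surj x
  obtain ⟨w, rfl⟩ := toCx_surj y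
  rw [cxIncl_toCx, cxIncl_toCx, mem_cxGraph, mem_cxGraph]
  constructor
  · rintro ⟨h1, rfl⟩
    exact ⟨h1.1, (app_restrictTo h1).symm⟩
  · rintro ⟨h1, h2⟩
    have h3 : v ∈ (restrictTo T W).domain := ⟨h1, h2 ▸ w.2⟩
    exact ⟨h3, Subtype.ext ((app_restrictTo h3).trans h2)⟩

theorem isClosed_graph_restrictTo {T : V →ₗ.[HOp] V} (hT : IsClosed (T.graph : Set (V × V)))
    (W : Submodule HOp V) : IsClosed ((restrictTo T W).graph : Set (W × W)) := by
  have h := (isClosed_cxGraph hT).preimage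
    (((cxIncl W).continuous.comp continuous_fst).prodMk ((cxIncl W).continuous.comp continuous_snd))
  have h' := h.preimage ((toCx (V := W)).continuous.prodMap (toCx (V := W)).continuous)
  convert h' using 1
  ext ⟨v, w⟩
  exact mem_cxGraph_restrictTo (toCx v, toCx w)

theorem mem_range_iff {P : V →L[HOp] V} (hP : P * P = P) {v : V} : v ∈ P.range ↔ P v = v := by
  constructor
  · rintro ⟨w, rfl⟩
    exact congrArg (fun L : V →L[HOp] V => L w) hP
  · intro h
    exact ⟨v, h⟩

theorem isClosed_range {P : V →L[HOp] V} (hP : P * P = P) : IsClosed (P.range : Set V) := by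
  have : (P.range : Set V) = {v | P v = v} := by
    ext v
    exact mem_range_iff hP
  rw [this]
  exact isClosed_eq P.continuous continuous_id

variable [CompleteSpace V] {T : V →ₗ.[HOp] V} {χ : ℍ[ℝ] → ℍ[ℝ]}

theorem eventually_cpl_eq (hT : IsClosed (T.graph : Set (V × V))) (hχ : MemSH χ (sSpectrumX T))
    {Δ : Set (OnePoint ℍ[ℝ])} (hΔ : Δ ⊆ sSpectrumX T) {r : ℝ}
    (h : ∀ᶠ p in 𝓝ˢ Δ, extendInfty χ p = r) {i : ℍ[ℝ]} (hi : i ∈ unitSphere) {z : ℂ}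
    (hz : (slicePt i z : OnePoint ℍ[ℝ]) ∈ Δ) : ∀ᶠ w in 𝓝 z, cpl χ w = r := by
  obtain ⟨E, hE, hσ, -⟩ := (memSH_sSpectrumX_iff hT).1 hχ
  have hz' := (mem_sSpectrum_iff hT hi).1 (coe_mem_sSpectrumX.1 (hΔ hz))
  have h1 := eventually_nhds_coe.1 (eventually_nhdsSet_iff_forall.1 h _ hz)
  filter_upwards [(isometry_slicePt hi).continuous.continuousAt.eventually h1,
    hE.isOpen.mem_nhds (hσ hz')] with w hw hwE
  have h2 : χ (slicePt i w) = r := hw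
  rw [hE.eq i hi w hwE, ← slicePt_ofReal i] at h2
  exact (isometry_slicePt hi).injective h2

theorem eventually_cpl_eq_infty {Δ : Set (OnePoint ℍ[ℝ])} {r : ℝ}
    (h : ∀ᶠ p in 𝓝ˢ Δ, extendInfty χ p = r) (hi : OnePoint.infty ∈ Δ) :
    (∀ᶠ w in Bornology.cobounded ℂ, cpl χ w = r) ∧ valInfty χ = r := by
  have h1 := eventually_nhds_infty.1 (eventually_nhdsSet_iff_forall.1 h _ hi)
  refine ⟨?_, h1.2⟩
  filter_upwards [(tendsto_slicePt unitI_mem).eventually h1.1] with w hw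
  refine cpl_of_eq ?_
  rw [slicePt_ofReal]
  exact hw

variable {Δ : Set (OnePoint ℍ[ℝ])}

theorem sCalc_idempotent (hT : IsClosed (T.graph : Set (V × V))) (hΔ : Δ ⊆ sSpectrumX T)
    (hχ : MemSH χ (sSpectrumX T)) (h1 : ∀ᶠ p in 𝓝ˢ Δ, extendInfty χ p = (1 : ℝ))
    (h0 : ∀ᶠ p in 𝓝ˢ (sSpectrumX T \ Δ), extendInfty χ p = (0 : ℝ)) :
    sCalc T χ * sCalc T χ = sCalc T χ := by
  have hA := isCalc_sCalc hT hχ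
  have hk := kind_cxGraph hT
  obtain ⟨E, hE, hσ, hH⟩ := (memSH_sSpectrumX_iff hT).1 hχ
  have h2 := (hA.mul hk hA).congr hk (g := cpl χ)
    (D := interior {z | cpl χ z = (1 : ℝ) ∨ cpl χ z = (0 : ℝ)}) isOpen_interior (fun z hz => ?_) ?_
    fun z hz => ?_
  · rw [← cxOp_mul] at h2
    exact cxOp_injective (h2.unique_of_kind hk hA)
  · rw [mem_interior_iff_mem_nhds]
    have hz' := coe_mem_sSpectrumX.2 ((mem_sSpectrum_iff hT unitI_mem).2 hz)
    by_cases h : (slicePt unitI z : OnePoint ℍ[ℝ]) ∈ Δ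
    · exact (eventually_cpl_eq hT hχ hΔ h1 unitI_mem h).mono fun w hw => Or.inl hw
    · exact (eventually_cpl_eq hT hχ sdiff_subset h0 unitI_mem ⟨hz', h⟩).mono
        fun w hw => Or.inr hw
  · by_cases hd : T.domain = ⊤
    · exact Or.inl (kap_of_eq hd)
    · right
      have hi := infty_mem_sSpectrumX.2 hd
      have h3 : ∀ᶠ w in Bornology.cobounded ℂ, cpl χ w = (1 : ℝ) ∨ cpl χ w = (0 : ℝ) := by
        by_cases h : OnePoint.infty ∈ Δ
        · exact (eventually_cpl_eq_infty h1 h).1.mono fun w hw => Or.inl hw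
        · exact (eventually_cpl_eq_infty h0 ⟨hi, h⟩).1.mono fun w hw => Or.inr hw
      obtain ⟨R, -, hR⟩ := (Metric.hasBasis_cobounded_compl_closedBall (0 : ℂ)).mem_iff.1 h3
      refine mem_of_superset (Bornology.isBounded_def.1 Metric.isBounded_closedBall)
        (interior_maximal hR Metric.isClosed_closedBall.isOpen_compl)
  · rcases interior_subset hz with h | h <;> simp [h]

theorem app_mem_range (hT : IsClosed (T.graph : Set (V × V))) (hχ : MemSH χ (sSpectrumX T))
    (hP : sCalc T χ * sCalc T χ = sCalc T χ) {v : V} (hv : v ∈ (sCalc T χ).range)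
    (hd : v ∈ T.domain) : app T v ∈ (sCalc T χ).range := by
  rw [mem_range_iff hP] at hv ⊢
  have := (commutesWith_sCalc hT hχ v hd).2
  rw [← this, hv]

theorem infty_mem_sSpectrumX_restrictTo (hT : IsClosed (T.graph : Set (V × V)))
    (hΔ : Δ ⊆ sSpectrumX T)
    (hχ : MemSH χ (sSpectrumX T)) (h1 : ∀ᶠ p in 𝓝ˢ Δ, extendInfty χ p = (1 : ℝ))
    (h0 : ∀ᶠ p in 𝓝ˢ (sSpectrumX T \ Δ), extendInfty χ p = (0 : ℝ)) :
    OnePoint.infty ∈ sSpectrumX (restrictTo T (sCalc T χ).range) ↔ OnePoint.infty ∈ Δ := by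
  have hA := isCalc_sCalc hT hχ
  have hP := sCalc_idempotent hT hΔ hχ h1 h0
  have : CompleteSpace (sCalc T χ).range := (isClosed_range hP).completeSpace_coe
  have hdom : (∀ v ∈ (sCalc T χ).range, v ∈ T.domain) ↔
      (restrictTo T (sCalc T χ).range).domain = ⊤ := by
    rw [eq_top_iff]
    constructor
    · exact fun h w _ => ⟨h w w.2, app_mem_range hT hχ hP w.2 (h w w.2)⟩
    · exact fun h v hv => (h (Submodule.mem_top : (⟨v, hv⟩ : (sCalc T χ).range) ∈ ⊤)).1
  have hsub : ∀ v, sCalc T χ v - (valInfty χ).re • (if T.domain = ⊤ then 0 else v) ∈ T.domain := by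
    intro v
    by_cases hd : T.domain = ⊤
    · rw [hd]; exact Submodule.mem_top
    · obtain ⟨y, hy⟩ := hA.sub_mem_dom (isClosed_cxGraph hT) (toCx v)
      obtain ⟨w, rfl⟩ := toCx_surj y
      rw [kap_of_ne hd, one_mul, Complex.coe_smul, cxOp_toCx, ← map_smul, ← map_sub] at hy
      rw [if_neg hd]
      exact (mem_cxGraph.1 hy).1
  rw [infty_mem_sSpectrumX, Ne, ← hdom]
  constructor
  · intro h
    by_contra hi
    refine h fun v hv => ?_
    by_cases hd : T.domain = ⊤
    · rw [hd]; exact Submodule.mem_top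
    · have h3 := hsub v
      rw [(eventually_cpl_eq_infty h0 ⟨infty_mem_sSpectrumX.2 hd, hi⟩).2, Quaternion.re_coe,
        zero_smul, sub_zero, (mem_range_iff hP).1 hv] at h3
      exact h3
  · intro hi h
    have hd := infty_mem_sSpectrumX.1 (hΔ hi)
    refine hd (eq_top_iff.2 fun v _ => ?_)
    have h3 := hsub v
    rw [(eventually_cpl_eq_infty h1 hi).2, Quaternion.re_coe, one_smul, if_neg hd] at h3
    have h4 := T.domain.sub_mem (h _ (LinearMap.mem_range_self _ v)) h3
    have h5 : v = sCalc T χ v - (sCalc T χ v - v) := (sub_sub_cancel _ _).symm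
    rw [h5]
    exact h4

theorem mem_rho_restrictTo (hT : IsClosed (T.graph : Set (V × V))) (hΔ : Δ ⊆ sSpectrumX T)
    (hχ : MemSH χ (sSpectrumX T)) (h1 : ∀ᶠ p in 𝓝ˢ Δ, extendInfty χ p = (1 : ℝ))
    (h0 : ∀ᶠ p in 𝓝ˢ (sSpectrumX T \ Δ), extendInfty χ p = (0 : ℝ)) {i : ℍ[ℝ]}
    (hi : i ∈ unitSphere) {z : ℂ} :
    z ∉ rho (cxGraph (restrictTo T (sCalc T χ).range)) ↔ (slicePt i z : OnePoint ℍ[ℝ]) ∈ Δ := by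
  have hA := isCalc_sCalc hT hχ
  have hk := kind_cxGraph hT
  have hP := sCalc_idempotent hT hΔ hχ h1 h0
  have : CompleteSpace (sCalc T χ).range := (isClosed_range hP).completeSpace_coe
  have e1 : ∀ y : Cx (sCalc T χ).range, cxRestr (sCalc T χ) (cxIncl _ y) = y := by
    intro y
    obtain ⟨w, rfl⟩ := toCx_surj (V := (sCalc T χ).range) y
    exact congrArg (toCx (V := (sCalc T χ).range)) (Subtype.ext ((mem_range_iff hP).1 w.2))
  constructor
  · intro hz
    by_contra hn
    refine hz (hA.mem_rho_of_retract hk (isClosed_cxGraph hT) e1 (cxIncl_cxRestr _)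
      mem_cxGraph_restrictTo ?_)
    by_cases hr : z ∈ rho (cxGraph T)
    · exact Or.inl hr
    · right
      have := eventually_cpl_eq hT hχ sdiff_subset h0 hi
        ⟨coe_mem_sSpectrumX.2 ((mem_sSpectrum_iff hT hi).2 hr), hn⟩
      simpa using this
  · intro hz hr
    have h2 := eventually_cpl_eq hT hχ hΔ h1 hi hz
    refine (mem_sSpectrum_iff hT hi).1 (coe_mem_sSpectrumX.1 (hΔ hz))
      (hA.mem_rho_of_mem_retract hk (isClosed_cxGraph hT) e1 (cxIncl_cxRestr _)
      mem_cxGraph_restrictTo ?_ hr)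
    simpa using h2

theorem sSpectrumX_restrictTo (hT : IsClosed (T.graph : Set (V × V))) (hΔ : Δ ⊆ sSpectrumX T)
    (hχ : MemSH χ (sSpectrumX T)) (h1 : ∀ᶠ p in 𝓝ˢ Δ, extendInfty χ p = (1 : ℝ))
    (h0 : ∀ᶠ p in 𝓝ˢ (sSpectrumX T \ Δ), extendInfty χ p = (0 : ℝ)) :
    sSpectrumX (restrictTo T (sCalc T χ).range) = Δ := by
  have hP := sCalc_idempotent hT hΔ hχ h1 h0
  have : CompleteSpace (sCalc T χ).range := (isClosed_range hP).completeSpace_coe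
  ext p
  induction p using OnePoint.rec with
  | infty => exact infty_mem_sSpectrumX_restrictTo hT hΔ hχ h1 h0
  | coe x =>
    obtain ⟨j, hj, hjx⟩ := exists_slicePt x
    rw [coe_mem_sSpectrumX, ← hjx, mem_sSpectrum_iff (isClosed_graph_restrictTo hT _) hj,
      mem_rho_restrictTo hT hΔ hχ h1 h0 hj]

theorem sCalc_restrictTo (hT : IsClosed (T.graph : Set (V × V))) (hΔ : Δ ⊆ sSpectrumX T)
    (hχ : MemSH χ (sSpectrumX T)) (h1 : ∀ᶠ p in 𝓝ˢ Δ, extendInfty χ p = (1 : ℝ))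
    (h0 : ∀ᶠ p in 𝓝ˢ (sSpectrumX T \ Δ), extendInfty χ p = (0 : ℝ)) {f : ℍ[ℝ] → ℍ[ℝ]}
    (hf : MemSH f (sSpectrumX T)) (v : (sCalc T χ).range) :
    (sCalc (restrictTo T (sCalc T χ).range) f v : V) = sCalc T f v := by
  have hP := sCalc_idempotent hT hΔ hχ h1 h0
  have : CompleteSpace (sCalc T χ).range := (isClosed_range hP).completeSpace_coe
  have hT' := isClosed_graph_restrictTo hT (sCalc T χ).range
  have hf' : MemSH f (sSpectrumX (restrictTo T (sCalc T χ).range)) := by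
    rw [sSpectrumX_restrictTo hT hΔ hχ h1 h0]
    obtain ⟨D, hD, h2, h3⟩ := hf
    exact ⟨D, hD, fun x hx => h2 x (hΔ hx), fun h => h3 (hΔ h)⟩
  have key := (isCalc_sCalc hT' hf').intertwine (L := cxIncl (sCalc T χ).range)
    (fun p hp => (mem_cxGraph_restrictTo p).1 hp) (fun z hz => ?_) (kind_cxGraph hT') ?_
    (isCalc_sCalc hT hf) (toCx v)
  · exact toCx.injective key
  · by_contra h
    have h2 := hΔ ((mem_rho_restrictTo hT hΔ hχ h1 h0 unitI_mem).1 h)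
    exact (mem_sSpectrum_iff hT unitI_mem).1 (coe_mem_sSpectrumX.1 h2) hz
  · rcases kap_eq (T := restrictTo T (sCalc T χ).range) with h | h
    · exact Or.inr h
    · left
      have h2 : (restrictTo T (sCalc T χ).range).domain ≠ ⊤ := fun h' => by
        rw [kap_of_eq h'] at h
        exact zero_ne_one h
      rw [h, kap_of_ne]
      exact infty_mem_sSpectrumX.1 (hΔ ((infty_mem_sSpectrumX_restrictTo hT hΔ hχ h1 h0).1
        (infty_mem_sSpectrumX.2 h2)))

end SliceCalc

theorem mainTheorem10 {V : Type*} [NormedAddCommGroup V] [NormedSpace ℝ V] [Module HOp V]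
    [IsScalarTower ℝ HOp V] [NormSMulClass HOp V] [CompleteSpace V]
    (T : V →ₗ.[HOp] V) (hT : IsClosed (T.graph : Set (V × V))) :
    -- the calculus is well defined
    (∀ f, MemSH f (sSpectrumX T) → IsSCalc T f (sCalc T f)) ∧
    -- (i) algebra homomorphism
    (sCalc T (fun _ => 1) = 1 ∧
      ∀ f g, MemSH f (sSpectrumX T) → MemSH g (sSpectrumX T) →
        (∀ a : ℝ, sCalc T (a • f + g) = a • sCalc T f + sCalc T g) ∧
        sCalc T (f * g) = sCalc T f * sCalc T g) ∧
    -- (ii) commutation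
    (∀ f, MemSH f (sSpectrumX T) →
      CommutesWith (sCalc T f) T ∧
      ∀ A : V →L[HOp] V, CommutesWith A T → A * sCalc T f = sCalc T f * A) ∧
    -- (iii) spectral mapping theorem and composition rule
    (∀ f, MemSH f (sSpectrumX T) →
      extendInfty f '' sSpectrumX T = sSpectrum (ofBdd (sCalc T f)) ∧
      (fun x : ℍ[ℝ] => (x : OnePoint ℍ[ℝ])) '' sSpectrum (ofBdd (sCalc T f)) =
        sSpectrumX (ofBdd (sCalc T f)) ∧
      ∀ g, MemSH g ((fun x : ℍ[ℝ] => (x : OnePoint ℍ[ℝ])) '' (extendInfty f '' sSpectrumX T)) →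
        sCalc T (g ∘ f) = sCalc (ofBdd (sCalc T f)) g) ∧
    -- (iv) Riesz projections
    (∀ Δ : Set (OnePoint ℍ[ℝ]), Δ ⊆ sSpectrumX T →
      IsClopen ((↑) ⁻¹' Δ : Set (sSpectrumX T)) →
      (∃ χ, MemSH χ (sSpectrumX T) ∧ (∀ᶠ p in 𝓝ˢ Δ, extendInfty χ p = 1) ∧
        ∀ᶠ p in 𝓝ˢ (sSpectrumX T \ Δ), extendInfty χ p = 0) ∧
      ∀ χ, MemSH χ (sSpectrumX T) → (∀ᶠ p in 𝓝ˢ Δ, extendInfty χ p = 1) →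
        (∀ᶠ p in 𝓝ˢ (sSpectrumX T \ Δ), extendInfty χ p = 0) →
        sCalc T χ * sCalc T χ = sCalc T χ ∧
        CommutesWith (sCalc T χ) T ∧
        (∀ v ∈ (sCalc T χ).range, v ∈ T.domain → app T v ∈ (sCalc T χ).range) ∧
        sSpectrumX (restrictTo T (sCalc T χ).range) = Δ ∧
        ∀ f, MemSH f (sSpectrumX T) → ∀ v : (sCalc T χ).range,
          (sCalc (restrictTo T (sCalc T χ).range) f v : V) = sCalc T f v) ∧
    -- (v) perturbation by a commuting operator and Taylor series
    (∀ B N : V →L[HOp] V, ofBdd B = T → B * N = N * B →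
      ∀ ε : ℝ, 0 < ε → sSpectrum (ofBdd N) ⊆ Metric.closedBall 0 ε →
      sSpectrum (ofBdd (B + N)) ⊆ closure (Metric.thickening ε (sSpectrum T)) ∧
      ∀ f, MemSH f ((fun x : ℍ[ℝ] => (x : OnePoint ℍ[ℝ])) ''
          closure (Metric.thickening ε (sSpectrum T))) →
        HasSum (fun n : ℕ => (N ^ n * ((n.factorial : ℝ)⁻¹ • sCalc T (sliceDeriv^[n] f))
            ).restrictScalars ℝ)
          ((sCalc (ofBdd (B + N)) f).restrictScalars ℝ) ∧
        HasSum (fun n : ℕ => (((n.factorial : ℝ)⁻¹ • sCalc T (sliceDeriv^[n] f)) * N ^ n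
            ).restrictScalars ℝ)
          ((sCalc (ofBdd (B + N)) f).restrictScalars ℝ)) := by
  refine ⟨fun f hf => SliceCalc.isSCalc_sCalc hT hf,
    ⟨(SliceCalc.sCalc_one hT).2, fun f g hf hg => ⟨fun a => (SliceCalc.sCalc_smul_add hT hf hg a).2,
      (SliceCalc.sCalc_mul hT hf hg).2⟩⟩,
    fun f hf => ⟨SliceCalc.commutesWith_sCalc hT hf, fun A hA => SliceCalc.sCalc_comm hT hf hA⟩,
    fun f hf => ⟨SliceCalc.spectral_mapping hT hf, SliceCalc.sSpectrumX_ofBdd _, fun g hg => ?_⟩,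
    fun Δ hΔ hc => ⟨SliceCalc.exists_charFun hT hΔ hc, fun χ hχ h1 h0 => ?_⟩, ?_⟩
  · rw [SliceCalc.spectral_mapping hT hf, SliceCalc.sSpectrumX_ofBdd] at hg
    exact (SliceCalc.sCalc_comp hT hf hg).2
  · rw [← Quaternion.coe_one] at h1
    rw [← Quaternion.coe_zero] at h0
    have hP := SliceCalc.sCalc_idempotent hT hΔ hχ h1 h0
    exact ⟨hP, SliceCalc.commutesWith_sCalc hT hχ,
      fun v hv hd => SliceCalc.app_mem_range hT hχ hP hv hd,
      SliceCalc.sSpectrumX_restrictTo hT hΔ hχ h1 h0,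
      fun f hf v => SliceCalc.sCalc_restrictTo hT hΔ hχ h1 h0 hf v⟩
  · rintro B N rfl hBN ε hε hN
    exact ⟨SliceCalc.sSpectrum_add_subset hBN hε hN,
      fun f hf => SliceCalc.hasSum_taylor hBN hε hN hf⟩
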